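/- **Theorem 2.** *Setting.* Fix $\Lambda>0$. Let $p=-i\nabla_x$ on $L^2(\mathbb R^3)$ and let $\mathcal F$ be the bosonic Fock space over $L^2(\mathbb R^3;\mathbb C^2)$, with creation and annihilation operators $a_\lambda^*(k),a_\lambda(k)$, $\lambda=1,2$. Let $\varepsilon_1(k),\varepsilon_2(k)\in\mathbb R^3$ $(k\neq0)$ be measurable orthonormal polarization vectors orthogonal to $k$, each either even or odd in $k$, and put $$G^\lambda(k)=\frac{\mathbf 1_{\{|k|\le\Lambda\}}}{2\pi|k|^{1/2}}\,\varepsilon_\lambda(k),\qquad A(x)=\sum_{\lambda=1,2}\int_{\mathbb R^3}G^\lambda(k)\big[a_\lambda(k)e^{ik\cdot x}+a^*_\lambda(k)e^{-ik\cdot x}\big]dk,$$ $B=\operatorname{curl}A$, $H_f=\sum_\lambda\int|k|\,a_\lambda^*(k)a_\lambda(k)\,dk$. On $L^2(\mathbb R^3;\mathbb C^2)\otimes\mathcal F$ let, with the Pauli matrices $\sigma$ and $\alpha>0$, $$T_\alpha=(p+\sqrt\alpha A(x))^2+\sqrt\alpha\,\sigma\cdot B(x)+H_f,\qquad H_\alpha=T_\alpha+V,\qquad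 \Sigma_\alpha=\inf\operatorname{spec}T_\alpha,\quad E_\alpha=\inf\operatorname{spec}H_\alpha .$$ All operators are defined through their quadratic forms. *Assumptions.* Let $V:\mathbb R^3\to\mathbb R$ be measurable and such that the form domain $\{u\in H^1(\mathbb R^3):\int V_+|u|^2<\infty\}$ of $p^2+V$ is dense in $L^2(\mathbb R^3)$, with (i) for every $\varepsilon>0$ there is $C_\varepsilon>0$ with $V_-\le-\varepsilon\Delta+C_\varepsilon$ in the sense of quadratic forms; (ii) $V_-(x)\to0$ as $|x|\to\infty$; (iii) $-e_0=\inf\operatorname{spec}(p^2+V)$ is a negative eigenvalue of $p^2+V$; let $\phi$, $\|\phi\|=1$, be a corresponding eigenfunction (ground state). *Conclusion.* Let $A_V=(p_x^2+V+e_0)\otimes 1+1\otimes(k^2+|k|)$ on $L^2(\mathbb R^3_x)\otimes L^2(\mathbb R^3_k;\mathbb C^2)$, and let $D^*p\phi$ be the vector $(D^*p\phi)(x,k,\lambda)=G^\lambda(k)\cdot(p\phi)(x)$ of this space. Then $D^*p\phi$ lies in the range of $A_V$, has exactly one preimage $A_V^{-1}D^*p\phi$, the number $$\mathcal E(V,\Lambda)=4\,\big(D^*p\phi,\,A_V^{-1}D^*p\phi\big)$$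 is real and strictly positive, and $$E_\alpha-\Sigma_\alpha\le-e_0-\alpha\,\mathcal E(V,\Lambda)+O(\alpha^2)\qquad(\alpha\downarrow0),$$ where the constant in $O(\alpha^2)$ does not depend on $\alpha$. Moreover, there is $\rho>0$ such that $E_\alpha-\Sigma_\alpha<-e_0$ for all $\alpha\in(0,\rho]$. -/

import Mathlib

open MeasureTheory Filter Topology
open scoped ENNReal ContDiff

noncomputable section

namespace PauliFierz

/-! ### Operators given by quadratic forms, and their spectrum -/

section Forms

variable {H : Type*} [NormedAddCommGroup H] [InnerProductSpace ℂ H]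

/-- `FormOp Q q u f`: the vector `u` lies in the domain of the operator associated with the
sesquilinear form `q` (conjugate-linear in its first argument) with form domain `Q`, and this
operator maps `u` to `f`. -/
def FormOp (Q : Set H) (q : H → H → ℂ) (u f : H) : Prop :=
  u ∈ Q ∧ ∀ v ∈ Q, q v u = inner ℂ v f

/-- `z` belongs to the resolvent set of the operator `S` associated with `(Q, q)`: there is an
everywhere defined bounded operator `R = (S - z)⁻¹`. -/
def IsResolventPoint (Q : Set H) (q : H → H → ℂ) (z : ℂ) : Prop :=
  ∃ R : H →L[ℂ] H, ∀ u f : H, FormOp Q q u (f + z • u) ↔ u = R f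

/-- The spectrum of the operator associated with `(Q, q)`. -/
def formSpectrum (Q : Set H) (q : H → H → ℂ) : Set ℂ :=
  {z | ¬ IsResolventPoint Q q z}

/-- The infimum of the (real) spectrum of the operator associated with `(Q, q)`. -/
def infSpec (Q : Set H) (q : H → H → ℂ) : ℝ :=
  sInf {r : ℝ | (r : ℂ) ∈ formSpectrum Q q}

end Forms

/-! ### Weak derivatives in the electron variable -/

/-- Three-dimensional Euclidean space. -/
abbrev E3 : Type := EuclideanSpace ℝ (Fin 3)

/-- `g` is the weak `j`-th partial derivative of `f` (used for square-integrable `f` and `g`). -/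
def IsWeakPartial {F : Type*} [NormedAddCommGroup F] [NormedSpace ℝ F]
    (j : Fin 3) (f g : E3 → F) : Prop :=
  ∀ θ : E3 → ℝ, ContDiff ℝ ∞ θ → HasCompactSupport θ →
    ∫ x, (fderiv ℝ θ x (EuclideanSpace.single j 1)) • f x = - ∫ x, θ x • g x

/-- The Hilbert space `L²(ℝ³)`. -/
abbrev L2x : Type := Lp ℂ 2 (volume : Measure E3)

/-- `g` is square-integrable and is the weak derivative `∂_j u`. -/
def HasPartial (j : Fin 3) (u : L2x) (g : E3 → ℂ) : Prop :=
  MemLp g 2 volume ∧ IsWeakPartial j u g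

open Classical in
/-- The weak derivative `∂_j u`, if it exists in `L²` (and `0` otherwise). -/
def partialX (j : Fin 3) (u : L2x) : E3 → ℂ :=
  if h : ∃ g, HasPartial j u g then h.choose else 0

/-- The Sobolev space `H¹(ℝ³)`. -/
def sobolev1 : Set L2x := {u | ∀ j, ∃ g, HasPartial j u g}

section Parameter

variable {Y F : Type*} [MeasurableSpace Y] [NormedAddCommGroup F] [NormedSpace ℝ F]

/-- For functions of `(x, y)`: `g` is square-integrable and is the weak derivative `∂_{x_j} u`. -/
def HasPartialParam (ν : Measure Y) (j : Fin 3)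
    (u : Lp F 2 ((volume : Measure E3).prod ν)) (g : E3 × Y → F) : Prop :=
  MemLp g 2 ((volume : Measure E3).prod ν) ∧
    ∀ᵐ y ∂ν, IsWeakPartial j (fun x => u (x, y)) (fun x => g (x, y))

open Classical in
/-- The weak derivative `∂_{x_j} u`, if it exists in `L²` (and `0` otherwise). -/
def partialParam (ν : Measure Y) (j : Fin 3)
    (u : Lp F 2 ((volume : Measure E3).prod ν)) : E3 × Y → F :=
  if h : ∃ g, HasPartialParam ν j u g then h.choose else 0

end Parameter

/-! ### The Schrödinger operator `p² + V` -/

/-- The form domain of `p² + V`: all `u ∈ H¹(ℝ³)` with `∫ V₊ |u|² < ∞`. -/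
def schrodingerDomain (V : E3 → ℝ) : Set L2x :=
  {u | u ∈ sobolev1 ∧ ∫⁻ x, ENNReal.ofReal (V x) * ‖u x‖ₑ ^ 2 ≠ ⊤}

/-- The sesquilinear form of `p² + V = -Δ + V`. -/
def schrodingerForm (V : E3 → ℝ) (v u : L2x) : ℂ :=
  (∑ j, ∫ x, inner ℂ (partialX j v x) (partialX j u x)) +
    ∫ x, (V x : ℂ) * inner ℂ (v x) (u x)

/-- `V₋ ≤ -ε Δ + C_ε` in the sense of quadratic forms, for every `ε > 0`. -/
def NegPartFormBounded (V : E3 → ℝ) : Prop :=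
  ∀ ε : ℝ, 0 < ε → ∃ C : ℝ, 0 < C ∧ ∀ u ∈ sobolev1,
    ∫⁻ x, ENNReal.ofReal (-(V x)) * ‖u x‖ₑ ^ 2 ≤
      ENNReal.ofReal ε * (∑ j, ∫⁻ x, ‖partialX j u x‖ₑ ^ 2) +
        ENNReal.ofReal C * ∫⁻ x, ‖u x‖ₑ ^ 2

/-- `φ` is a normalized ground state of `p² + V`, with energy `-e₀ = inf spec (p² + V)`. -/
def IsGroundState (V : E3 → ℝ) (φ : L2x) (e₀ : ℝ) : Prop :=
  ‖φ‖ = 1 ∧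
    FormOp (schrodingerDomain V) (schrodingerForm V) φ ((-e₀ : ℂ) • φ) ∧
    infSpec (schrodingerDomain V) (schrodingerForm V) = -e₀

/-! ### Photons -/

/-- One-photon variables: the momentum `k ∈ ℝ³` and the polarization `λ ∈ {1, 2}`. -/
abbrev Photon : Type := E3 × Fin 2

/-- `dk` times counting measure on the polarizations. -/
def photonMeasure : Measure Photon := (volume : Measure E3).prod Measure.count

/-- Photon configurations: a photon number `n` and `n` one-photon variables. -/
abbrev Config : Type := Σ n : ℕ, (Fin n → Photon)

/-- The measure on configurations whose `L²` space is `⨁ₙ L²((ℝ³ × {1,2})ⁿ)`. -/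
def configMeasure : Measure Config :=
  Measure.sum fun n => (Measure.pi fun _ : Fin n => photonMeasure).map (Sigma.mk n)

/-- The vector space `ℂ²` of the electron spin. -/
abbrev Spin : Type := EuclideanSpace ℂ (Fin 2)

/-- The measure `dx ⊗ configMeasure`. -/
abbrev stateMeasure : Measure (E3 × Config) := (volume : Measure E3).prod configMeasure

/-- The Hilbert space `L²(ℝ³; ℂ²) ⊗ F_b(L²(ℝ³; ℂ²))`: sequences `ψ_n(x, k₁, λ₁, …, k_n, λ_n)` of
spinor-valued square-integrable functions, symmetric in the photon variables. Here `x` is the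
position of the electron and the photons are in momentum representation. -/
def stateSpace : Submodule ℂ (Lp Spin 2 stateMeasure) where
  carrier := {Ψ | ∃ f : E3 × Config → Spin,
    (∀ (x : E3) (n : ℕ) (κ : Fin n → Photon) (π : Equiv.Perm (Fin n)),
      f (x, ⟨n, κ ∘ π⟩) = f (x, ⟨n, κ⟩)) ∧ Ψ =ᵐ[stateMeasure] f}
  zero_mem' := ⟨0, by simp, Lp.coeFn_zero _ _ _⟩
  add_mem' := by
    rintro Ψ Φ ⟨f, hf, hΨ⟩ ⟨g, hg, hΦ⟩
    exact ⟨f + g, fun x n κ π => by simp [hf, hg],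
      (Lp.coeFn_add _ _).trans (hΨ.add hΦ)⟩
  smul_mem' := by
    rintro c Ψ ⟨f, hf, hΨ⟩
    exact ⟨c • f, fun x n κ π => by simp [hf],
      (Lp.coeFn_smul _ _).trans (hΨ.const_smul c)⟩

/-- The annihilation operator `∑_λ ∫ conj (g_x(k, λ)) a_λ(k) dk`. -/
def annihilate (g : E3 → Photon → ℂ) (Ψ : E3 × Config → Spin) : E3 × Config → Spin :=
  fun z => (Real.sqrt (z.2.1 + 1) : ℂ) •
    ∫ k, (starRingEnd ℂ) (g z.1 k) • Ψ (z.1, ⟨z.2.1 + 1, Fin.cons k z.2.2⟩) ∂photonMeasure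

/-- The creation operator `∑_λ ∫ g_x(k, λ) a*_λ(k) dk`. -/
def create (g : E3 → Photon → ℂ) (Ψ : E3 × Config → Spin) : E3 × Config → Spin
  | (_, ⟨0, _⟩) => 0
  | (x, ⟨n + 1, κ⟩) => ((Real.sqrt (n + 1))⁻¹ : ℂ) •
      ∑ i : Fin (n + 1), g x (κ i) • Ψ (x, ⟨n, i.removeNth κ⟩)

/-- The field operator (annihilation plus creation). -/
def fieldOp (g : E3 → Photon → ℂ) (Ψ : E3 × Config → Spin) : E3 × Config → Spin :=
  annihilate g Ψ + create g Ψ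

/-- The photon field energy `|k₁| + … + |k_n|` of a configuration. -/
def fieldEnergy (γ : Config) : ℝ := ∑ i, ‖(γ.2 i).1‖

/-- Polarization vectors: for `k ≠ 0`, `ε₁(k), ε₂(k)` are orthonormal and orthogonal to `k`, and
each `ε_λ` is even or odd. -/
structure IsPolarization (ε : Fin 2 → E3 → E3) : Prop where
  measurable : ∀ l, Measurable (ε l)
  orthonormal : ∀ k, k ≠ 0 → Orthonormal ℝ (fun l => ε l k)
  transversal : ∀ l k, k ≠ 0 → inner ℝ k (ε l k) = 0
  parity : ∀ l, (∀ k, k ≠ 0 → ε l (-k) = ε l k) ∨ (∀ k, k ≠ 0 → ε l (-k) = -ε l k)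

/-- The cutoff factor `χ(|k|) / (2π |k|^{1/2})`, with `χ` the indicator function of `|k| ≤ Λ`. -/
def cutoffFactor (L : ℝ) (k : E3) : ℝ :=
  if ‖k‖ ≤ L then 1 / (2 * Real.pi * Real.sqrt ‖k‖) else 0

/-- `G_j^λ(k)`, the `j`-th component of `χ(|k|) / (2π |k|^{1/2}) ε_λ(k)`. -/
def couplingG (L : ℝ) (ε : Fin 2 → E3 → E3) (j : Fin 3) (k : Photon) : ℂ :=
  ((cutoffFactor L k.1 * ε k.2 k.1 j : ℝ) : ℂ)

/-- `H_j^λ(k)`, the `j`-th component of `-i χ(|k|) / (2π |k|^{1/2}) k ∧ ε_λ(k)`. -/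
def couplingH (L : ℝ) (ε : Fin 2 → E3 → E3) (j : Fin 3) (k : Photon) : ℂ :=
  -Complex.I * ((cutoffFactor L k.1 *
    crossProduct (WithLp.ofLp k.1) (WithLp.ofLp (ε k.2 k.1)) j : ℝ) : ℂ)

/-- The phase `exp (-i k · x)`. -/
def phase (x : E3) (k : Photon) : ℂ :=
  Complex.exp (-(Complex.I * ((inner ℝ k.1 x : ℝ) : ℂ)))

/-- The `j`-th component of the vector potential `A(x)`. -/
def vectorPotential (L : ℝ) (ε : Fin 2 → E3 → E3) (j : Fin 3) :
    (E3 × Config → Spin) → (E3 × Config → Spin) :=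
  fieldOp fun x k => couplingG L ε j k * phase x k

/-- The `j`-th component of the magnetic field `B(x) = curl A(x)`. -/
def magneticField (L : ℝ) (ε : Fin 2 → E3 → E3) (j : Fin 3) :
    (E3 × Config → Spin) → (E3 × Config → Spin) :=
  fieldOp fun x k => couplingH L ε j k * phase x k

/-! ### The Pauli–Fierz operator -/

/-- The Pauli matrices. -/
def pauli : Fin 3 → Matrix (Fin 2) (Fin 2) ℂ :=
  ![!![0, 1; 1, 0], !![0, -Complex.I; Complex.I, 0], !![1, 0; 0, -1]]

/-- The action of the `j`-th Pauli matrix on a spinor. -/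
def pauliAct (j : Fin 3) (s : Spin) : Spin := WithLp.toLp 2 (Matrix.mulVec (pauli j) (WithLp.ofLp s))

/-- `(p_j + √α A_j(x)) Ψ` with `p = -i∇_x`. -/
def kinetic (L : ℝ) (ε : Fin 2 → E3 → E3) (α : ℝ) (j : Fin 3) (Ψ : stateSpace) :
    E3 × Config → Spin :=
  fun z => (-Complex.I) • partialParam configMeasure j (Ψ : Lp Spin 2 stateMeasure) z +
    (Real.sqrt α : ℂ) • vectorPotential L ε j (Ψ : Lp Spin 2 stateMeasure) z

/-- The form domain of `H_α = T + V`: finite kinetic energy `⟨Ψ, p² Ψ⟩`, finite field energy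
`⟨Ψ, H_f Ψ⟩` and finite `⟨Ψ, V₊ Ψ⟩`. -/
def pauliFierzDomain (V : E3 → ℝ) : Set stateSpace :=
  {Ψ | (∀ j, ∃ g, HasPartialParam configMeasure j (Ψ : Lp Spin 2 stateMeasure) g) ∧
    ∫⁻ z, ENNReal.ofReal (fieldEnergy z.2) * ‖(Ψ : Lp Spin 2 stateMeasure) z‖ₑ ^ 2
      ∂stateMeasure ≠ ⊤ ∧
    ∫⁻ z, ENNReal.ofReal (V z.1) * ‖(Ψ : Lp Spin 2 stateMeasure) z‖ₑ ^ 2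
      ∂stateMeasure ≠ ⊤}

/-- The sesquilinear form of `H_α = (p + √α A(x))² + √α σ·B(x) + H_f + V`. -/
def pauliFierzForm (L : ℝ) (ε : Fin 2 → E3 → E3) (V : E3 → ℝ) (α : ℝ)
    (Φ Ψ : stateSpace) : ℂ :=
  (∑ j, ∫ z, inner ℂ (kinetic L ε α j Φ z) (kinetic L ε α j Ψ z) ∂stateMeasure) +
    (Real.sqrt α : ℂ) * (∑ j, ∫ z, inner ℂ ((Φ : Lp Spin 2 stateMeasure) z)
      (pauliAct j (magneticField L ε j (Ψ : Lp Spin 2 stateMeasure) z)) ∂stateMeasure) +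
    (∫ z, (fieldEnergy z.2 : ℂ) * inner ℂ ((Φ : Lp Spin 2 stateMeasure) z)
      ((Ψ : Lp Spin 2 stateMeasure) z) ∂stateMeasure) +
    ∫ z, (V z.1 : ℂ) * inner ℂ ((Φ : Lp Spin 2 stateMeasure) z)
      ((Ψ : Lp Spin 2 stateMeasure) z) ∂stateMeasure

/-- `E_α = inf spec H_α`. -/
def groundEnergy (L : ℝ) (ε : Fin 2 → E3 → E3) (V : E3 → ℝ) (α : ℝ) : ℝ :=
  infSpec (pauliFierzDomain V) (pauliFierzForm L ε V α)

/-- The self-energy `Σ_α = inf spec T`, where `T` is `H_α` without external potential. -/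
def selfEnergy (L : ℝ) (ε : Fin 2 → E3 → E3) (α : ℝ) : ℝ :=
  groundEnergy L ε 0 α

/-! ### The operator `A_V` and the vector `D* p φ` -/

/-- The measure `dx dk` on electron position and one-photon variable. -/
abbrev pairMeasure : Measure (E3 × Photon) := (volume : Measure E3).prod photonMeasure

/-- One-photon functions of `x` and of the momentum `k` conjugate to the relative coordinate
`η = ξ - x` of the photon (the spin of the electron is suppressed). -/
abbrev L2pair : Type := Lp ℂ 2 pairMeasure

/-- The form domain of `A_V`. -/
def avDomain (V : E3 → ℝ) : Set L2pair :=
  {u | (∀ j, ∃ g, HasPartialParam photonMeasure j u g) ∧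
    ∫⁻ z, ENNReal.ofReal (‖z.2.1‖ ^ 2 + ‖z.2.1‖) * ‖u z‖ₑ ^ 2 ∂pairMeasure ≠ ⊤ ∧
    ∫⁻ z, ENNReal.ofReal (V z.1) * ‖u z‖ₑ ^ 2 ∂pairMeasure ≠ ⊤}

/-- The sesquilinear form of
`A_V = (p_x² + V + e₀) ⊗ 1 + 1 ⊗ (p_η² + H_f)`; here `p_η = k` and `H_f = |k|`. -/
def avForm (V : E3 → ℝ) (e₀ : ℝ) (v u : L2pair) : ℂ :=
  (∑ j, ∫ z, inner ℂ (partialParam photonMeasure j v z) (partialParam photonMeasure j u z)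
      ∂pairMeasure) +
    ∫ z, ((V z.1 + e₀ + ‖z.2.1‖ ^ 2 + ‖z.2.1‖ : ℝ) : ℂ) * inner ℂ (v z) (u z) ∂pairMeasure

/-- `(D* p φ)(x, k, λ) = ∑_j G_j^λ(k) (p_j φ)(x)` with `p = -i∇`. -/
def dStarP (L : ℝ) (ε : Fin 2 → E3 → E3) (φ : L2x) (z : E3 × Photon) : ℂ :=
  ∑ j, couplingG L ε j z.2 * (-Complex.I * partialX j φ z.1)

end PauliFierz

end

open PauliFierz

/-! TODO -/

set_option linter.unusedSectionVars false

noncomputable section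

namespace PauliFierz

open Function (comp_def)
open Real (mul_self_sqrt norm_eq_abs norm_of_nonneg sq_sqrt sqrt_nonneg sqrt_pos)
open Complex (abs_re_le_norm add_re conj_ofReal continuous_ofReal measurable_ofReal I norm_I norm_real
  ofReal_ne_zero ofReal_one ofReal_re ofReal_sub ofReal_sum re_le_norm re_ofReal_mul re_sum sub_re
  zero_re)
open Submodule (coe_add coe_smul span)
open EuclideanSpace (norm_sq_eq proj single)
open Filter.Eventually (of_forall)
open PiLp (inner_apply norm_apply_le norm_single)
open ENNReal (mul_lt_top ofReal ofReal_add ofReal_add_le ofReal_le_ofReal ofReal_lt_top ofReal_mul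
  ofReal_natCast ofReal_ne_top ofReal_of_nonpos ofReal_pow ofReal_sum_of_nonneg ofReal_toReal
  rpow_mul rpow_natCast toReal_nonneg toReal_ofReal)
open Finset (mem_univ mul_sum single_le_sum sum_add_distrib sum_congr sum_le_sum sum_mul sum_nonneg
  sum_sub_distrib)
open MeasureTheory.Measure (map_apply quasiMeasurePreserving_fst)
open MeasureTheory.Lp (coeFn_add coeFn_smul coeFn_sub coeFn_zero memLp)
open ContinuousLinearMap (adjoint le_opNorm)

local notation "vol×" ν:max => Measure.prod (volume : Measure E3) ν
local notation "μₖ" => photonMeasure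
local notation "μₛₖ" => Measure.prod stateMeasure photonMeasure
local notation "𝓦" => E3 × Config → Spin
local notation "𝓧" => (E3 × Config) × Photon
local notation "𝓗" => Lp Spin 2 stateMeasure
local notation "μₛ" => stateMeasure
local notation "μₚ" => pairMeasure
local notation:max "⟪" x "," y "⟫" => inner ℂ x y

/-! ### Closed semibounded forms and the bottom of the spectrum -/

section AbstractForms

lemma tendsto_zero_of_norm_sq_le {ι E : Type*} [SeminormedAddCommGroup E] {l : Filter ι} {f : ι → E}
    {b : ι → ℝ} (hb : Tendsto b l (𝓝 0)) (h : ∀ i, ‖f i‖ ^ 2 ≤ b i) : Tendsto f l (𝓝 0) := by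
  refine squeeze_zero_norm (fun i => Real.le_sqrt_of_sq_le (h i)) ?_
  simpa [comp_def] using (Real.continuous_sqrt.tendsto 0).comp hb

lemma cauchySeq_iff_tendsto_sub {E : Type*} [SeminormedAddCommGroup E] {f : ℕ → E} :
    CauchySeq f ↔ Tendsto (fun p : ℕ × ℕ => f p.1 - f p.2) atTop (𝓝 0) := by
  simp_rw [cauchySeq_iff_tendsto_dist_atTop_0, dist_eq_norm, ← tendsto_zero_iff_norm_tendsto_zero]

lemma re_inner_self_eq {H : Type*} [NormedAddCommGroup H] [InnerProductSpace ℂ H] (u : H) :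
    ⟪u, u⟫.re = ‖u‖ ^ 2 := by
  rw [norm_sq_eq_re_inner (𝕜 := ℂ)]; rfl

/-- The Riesz representation theorem for a pre-Hilbert space `W` given only by its inner product
`c`, continuously mapped by `ι` into `H`, and sequentially complete. -/
lemma exists_riesz {W H : Type*} [AddCommGroup W] [Module ℂ W] [NormedAddCommGroup H]
    [InnerProductSpace ℂ H] (c : InnerProductSpace.Core ℂ W)
    (hc : ∀ u : ℕ → W,
      Tendsto (fun p : ℕ × ℕ => (c.inner (u p.1 - u p.2) (u p.1 - u p.2)).re) atTop (𝓝 0) →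
      ∃ x, Tendsto (fun n => (c.inner (u n - x) (u n - x)).re) atTop (𝓝 0))
    (ι : W →ₗ[ℂ] H) (C : ℝ) (hι : ∀ w, ‖ι w‖ ^ 2 ≤ C * (c.inner w w).re) (f : H) :
    ∃ w, ∀ v, c.inner v w = ⟪ι v, f⟫ := by
  let _ : NormedAddCommGroup W := c.toNormedAddCommGroup
  let _ : InnerProductSpace ℂ W := InnerProductSpace.ofCore c.toCore
  have hin : ∀ v w : W, c.inner v w = ⟪v, w⟫ := fun v w => rfl
  simp only [hin, re_inner_self_eq] at hc hι
  have hcomp : CompleteSpace W := by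
    refine Metric.complete_of_cauchySeq_tendsto fun u hu => ?_
    obtain ⟨x, hx⟩ := hc u (by simpa using (cauchySeq_iff_tendsto_sub.1 hu).norm.pow 2)
    exact ⟨x, tendsto_sub_nhds_zero_iff.1 (tendsto_zero_of_norm_sq_le hx fun _ => le_rfl)⟩
  let ιc : W →L[ℂ] H := ι.mkContinuous (√|C|) fun w => by
    refine le_of_sq_le_sq ?_ (by positivity)
    rw [mul_pow, sq_sqrt (abs_nonneg _)]
    exact (hι w).trans (by gcongr; exact le_abs_self C)
  refine ⟨(InnerProductSpace.toDual ℂ W).symm ((innerSL ℂ f).comp ιc), fun v => ?_⟩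
  rw [hin, ← inner_conj_symm]
  erw [InnerProductSpace.toDual_symm_apply]
  simp [ιc, inner_conj_symm]

variable {H K : Type*} [NormedAddCommGroup H] [InnerProductSpace ℂ H]
  [NormedAddCommGroup K] [Module ℂ K]

/-- A Hermitian form `q` with form domain `Q` whose form norm is equivalent to the graph norm of a
closed operator `J` defined on `Q`. -/
structure ClosedForm (Q : Submodule ℂ H) (q : H → H → ℂ) (J : Q →ₗ[ℂ] K) : Prop where
  add_right : ∀ v ∈ Q, ∀ u ∈ Q, ∀ u' ∈ Q, q v (u + u') = q v u + q v u'
  smul_right : ∀ v ∈ Q, ∀ u ∈ Q, ∀ a : ℂ, q v (a • u) = a * q v u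
  symm : ∀ v ∈ Q, ∀ u ∈ Q, starRingEnd ℂ (q u v) = q v u
  graph : ∀ (u : ℕ → Q) (x : H) (y : K), Tendsto (fun n => (u n : H)) atTop (𝓝 x) →
    Tendsto (fun n => J (u n)) atTop (𝓝 y) → ∃ h : x ∈ Q, J ⟨x, h⟩ = y
  lower : ∃ c δ : ℝ, 0 < δ ∧ ∀ u : Q, δ * ‖J u‖ ^ 2 ≤ (q u u).re + c * ‖(u : H)‖ ^ 2
  upper : ∃ C : ℝ, ∀ u : Q, (q u u).re ≤ C * (‖J u‖ ^ 2 + ‖(u : H)‖ ^ 2)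

namespace ClosedForm

variable {Q : Submodule ℂ H} {q : H → H → ℂ} {J : Q →ₗ[ℂ] K}

lemma add_left (h : ClosedForm Q q J) {v v' u : H} (hv : v ∈ Q) (hv' : v' ∈ Q) (hu : u ∈ Q) :
    q (v + v') u = q v u + q v' u := by
  rw [← h.symm _ (Q.add_mem hv hv') _ hu, h.add_right _ hu _ hv _ hv', map_add, h.symm _ hv _ hu,
    h.symm _ hv' _ hu]

lemma smul_left (h : ClosedForm Q q J) {v u : H} (hv : v ∈ Q) (hu : u ∈ Q) (a : ℂ) :
    q (a • v) u = starRingEnd ℂ a * q v u := by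
  rw [← h.symm _ (Q.smul_mem a hv) _ hu, h.smul_right _ hu _ hv, map_mul, h.symm _ hv _ hu]

lemma sub_right (h : ClosedForm Q q J) {v u u' : H} (hv : v ∈ Q) (hu : u ∈ Q) (hu' : u' ∈ Q) :
    q v (u - u') = q v u - q v u' := by
  rw [sub_eq_add_neg, ← neg_one_smul ℂ u', h.add_right _ hv _ hu _ (Q.smul_mem _ hu'),
    h.smul_right _ hv _ hu']
  ring

/-- The Cauchy-Schwarz inequality for a non-negative form. -/
lemma norm_sq_le (h : ClosedForm Q q J) (hpos : ∀ u ∈ Q, 0 ≤ (q u u).re) {u v : H} (hu : u ∈ Q)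
    (hv : v ∈ Q) : ‖q u v‖ ^ 2 ≤ (q u u).re * (q v v).re := by
  let c : PreInnerProductSpace.Core ℂ Q :=
    { inner := fun v u => q v u
      conj_inner_symm := fun x y => h.symm _ x.2 _ y.2
      re_inner_nonneg := fun x => hpos _ x.2
      add_left := fun x y z => h.add_left x.2 y.2 z.2
      smul_left := fun x y r => h.smul_left x.2 y.2 r }
  have := @InnerProductSpace.Core.inner_mul_inner_self_le ℂ Q _ _ _ c ⟨u, hu⟩ ⟨v, hv⟩
  have h1 : ‖q v u‖ = ‖q u v‖ := by rw [← h.symm u hu v hv, RCLike.norm_conj]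
  calc ‖q u v‖ ^ 2 = ‖q u v‖ * ‖q v u‖ := by rw [h1, sq]
    _ ≤ _ := this

lemma re_shift (m : ℝ) (u : H) :
    (q u u - m * ⟪u, u⟫).re = (q u u).re - m * ‖u‖ ^ 2 := by
  rw [sub_re, re_ofReal_mul, re_inner_self_eq]

lemma shift (h : ClosedForm Q q J) (m : ℝ) :
    ClosedForm Q (fun v u => q v u - m * ⟪v, u⟫) J where
  add_right v hv u hu u' hu' := by
    simp only [h.add_right v hv u hu u' hu', inner_add_right]; ring
  smul_right v hv u hu a := by
    simp only [h.smul_right v hv u hu a, inner_smul_right]; ring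
  symm v hv u hu := by
    simp only [map_sub, map_mul, h.symm v hv u hu, conj_ofReal, inner_conj_symm]
  graph := h.graph
  lower := by
    obtain ⟨c, δ, hδ, hl⟩ := h.lower
    refine ⟨c + m, δ, hδ, fun u => ?_⟩
    have := hl u
    rw [re_shift]; linarith
  upper := by
    obtain ⟨C, hC⟩ := h.upper
    refine ⟨C + |m|, fun u => ?_⟩
    have := hC u
    rw [re_shift]
    have h4 : -m * ‖(u : H)‖ ^ 2 ≤ |m| * (‖J u‖ ^ 2 + ‖(u : H)‖ ^ 2) := by
      refine (mul_le_mul_of_nonneg_right (neg_le_abs m) (sq_nonneg _)).trans ?_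
      gcongr
      nlinarith [sq_nonneg ‖J u‖]
    linarith

/-- A non-negative closed form is continuous for the graph norm of `J`. -/
lemma tendsto_right (h : ClosedForm Q q J) (hpos : ∀ u ∈ Q, 0 ≤ (q u u).re) {v : H} (hv : v ∈ Q)
    {u : ℕ → Q} {x : Q} (hu : Tendsto (fun n => (u n : H)) atTop (𝓝 x))
    (hJ : Tendsto (fun n => J (u n)) atTop (𝓝 (J x))) :
    Tendsto (fun n => q v (u n)) atTop (𝓝 (q v x)) := by
  obtain ⟨C, hC⟩ := h.upper
  have hq0 : Tendsto (fun n => q v (u n - x)) atTop (𝓝 0) := by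
    have h1 : Tendsto (fun n => (q v v).re * (|C| * (‖J (u n) - J x‖ ^ 2 +
        ‖(u n : H) - x‖ ^ 2))) atTop (𝓝 0) := by
      have a := (tendsto_iff_norm_sub_tendsto_zero.1 hu).pow 2
      have b := (tendsto_iff_norm_sub_tendsto_zero.1 hJ).pow 2
      simpa using ((b.add a).const_mul |C|).const_mul (q v v).re
    refine tendsto_zero_of_norm_sq_le h1 fun n => (h.norm_sq_le hpos hv (Q.sub_mem (u n).2 x.2)).trans
      (mul_le_mul_of_nonneg_left ?_ (hpos v hv))
    have := hC (u n - x)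
    rw [map_sub] at this
    exact this.trans (mul_le_mul_of_nonneg_right (le_abs_self C) (by positivity))
  have h2 : ∀ n, q v (u n) = q v (u n - x) + q v x := fun n => by
    rw [h.sub_right hv (u n).2 x.2]; ring
  simp only [h2]
  simpa using hq0.add_const (q v x)

lemma exists_lower (h : ClosedForm Q q J) : ∃ c : ℝ, ∀ u ∈ Q, c * ‖u‖ ^ 2 ≤ (q u u).re := by
  obtain ⟨c, δ, hδ, hlow⟩ := h.lower
  refine ⟨-c, fun u hu => ?_⟩
  have := hlow ⟨u, hu⟩
  have h2 : 0 ≤ δ * ‖J ⟨u, hu⟩‖ ^ 2 := by positivity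
  linarith

/-- The greatest lower bound of a closed form belongs to the spectrum: otherwise the bounded
inverse `R` at that point would give the strictly larger lower bound `m + 1 / ‖R‖`. -/
lemma mem_formSpectrum (h : ClosedForm Q q J) {m : ℝ}
    (hm : ∀ u ∈ Q, m * ‖u‖ ^ 2 ≤ (q u u).re)
    (hopt : ∀ m', (∀ u ∈ Q, m' * ‖u‖ ^ 2 ≤ (q u u).re) → m' ≤ m) :
    (m : ℂ) ∈ formSpectrum (Q : Set H) q := by
  rintro ⟨R, hR⟩
  have hRf : ∀ f, FormOp (Q : Set H) q (R f) (f + (m : ℂ) • R f) := fun f => (hR _ f).2 rfl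
  -- the shifted form
  let q' : H → H → ℂ := fun v u => q v u - m * ⟪v, u⟫
  have hq' : ∀ u, (q' u u).re = (q u u).re - m * ‖u‖ ^ 2 := re_shift m
  have h' : ClosedForm Q q' J := h.shift m
  have hpos : ∀ u ∈ Q, 0 ≤ (q' u u).re := fun u hu => by
    rw [hq']; linarith [hm u hu]
  have hq'R : ∀ v ∈ Q, ∀ f, q' v (R f) = ⟪v, f⟫ := fun v hv f => by
    have := (hRf f).2 v hv
    simp only [q']
    rw [this, inner_add_right, inner_smul_right]; ring
  set N := ‖R‖ + 1 with hN
  have hNpos : 0 < N := by positivity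
  have key : ∀ u ∈ Q, (m + N⁻¹) * ‖u‖ ^ 2 ≤ (q u u).re := by
    intro u hu
    have h1 := h'.norm_sq_le hpos hu (hRf u).1
    rw [hq'R u hu u, hq'R (R u) (hRf u).1 u] at h1
    have h2 : ⟪R u, u⟫.re ≤ N * ‖u‖ ^ 2 := by
      refine (re_le_norm _).trans ((norm_inner_le_norm _ _).trans ?_)
      have := R.le_opNorm u
      calc ‖R u‖ * ‖u‖ ≤ (‖R‖ * ‖u‖) * ‖u‖ := by gcongr
        _ ≤ N * ‖u‖ ^ 2 := by rw [hN]; nlinarith [sq_nonneg ‖u‖]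
    have h3 : ‖⟪u, u⟫‖ = ‖u‖ ^ 2 := by
      rw [inner_self_eq_norm_sq_to_K]; simp
    rw [h3] at h1
    have h4 : (‖u‖ ^ 2) ^ 2 ≤ (q' u u).re * (N * ‖u‖ ^ 2) :=
      h1.trans (mul_le_mul_of_nonneg_left h2 (hpos u hu))
    rcases (sq_nonneg ‖u‖).eq_or_lt with h0 | h0
    · have := hpos u hu
      rw [hq'] at this
      rw [← h0] at this ⊢; linarith
    · have h5 : ‖u‖ ^ 2 ≤ (q' u u).re * N := by
        refine le_of_mul_le_mul_right ?_ h0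
        linarith
      rw [hq'] at h5
      have h6 : N⁻¹ * ‖u‖ ^ 2 ≤ (q u u).re - m * ‖u‖ ^ 2 := by
        rw [inv_mul_eq_div, div_le_iff₀ hNpos]; exact h5
      linarith
  have := hopt _ key
  have : 0 < N⁻¹ := by positivity
  linarith

variable [CompleteSpace H] [CompleteSpace K]

/-- A sequence that converges in `H` and is Cauchy for the form converges for the graph norm. -/
lemma exists_tendsto (h : ClosedForm Q q J) {u : ℕ → Q} {x : H}
    (hu : Tendsto (fun n => (u n : H)) atTop (𝓝 x)) {b : ℕ × ℕ → ℝ} (hb : Tendsto b atTop (𝓝 0))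
    (hq : ∀ p, (q (u p.1 - u p.2) (u p.1 - u p.2)).re ≤ b p) :
    ∃ hx : x ∈ Q, Tendsto (fun n => J (u n)) atTop (𝓝 (J ⟨x, hx⟩)) := by
  obtain ⟨c, δ, hδ, hlow⟩ := h.lower
  have ht := (cauchySeq_iff_tendsto_sub.1 hu.cauchySeq).norm
  obtain ⟨y, hy⟩ := cauchySeq_tendsto_of_complete (u := fun n => J (u n))
    (cauchySeq_iff_tendsto_sub.2 (tendsto_zero_of_norm_sq_le
      (b := fun p => (b p + c * ‖(u p.1 : H) - u p.2‖ ^ 2) / δ)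
      (by simpa using (hb.add ((ht.pow 2).const_mul c)).div_const δ) fun p => by
        rw [← map_sub, le_div_iff₀ hδ, mul_comm]
        exact (hlow _).trans (add_le_add_left (hq p) _)))
  obtain ⟨hx, hJ⟩ := h.graph u x y hu hy
  exact ⟨hx, by rwa [hJ]⟩

/-- Below the bottom of a closed form the operator has an everywhere defined inverse. -/
lemma isResolventPoint (h : ClosedForm Q q J) {r η : ℝ} (hη : 0 < η)
    (hr : ∀ u ∈ Q, (r + η) * ‖u‖ ^ 2 ≤ (q u u).re) : IsResolventPoint (Q : Set H) q r := by
  let q' : H → H → ℂ := fun v u => q v u - r * ⟪v, u⟫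
  have h' : ClosedForm Q q' J := h.shift r
  have hlowη : ∀ x : Q, η * ‖(x : H)‖ ^ 2 ≤ (q' x x).re := fun x => by
    change _ ≤ (q x x - r * ⟪(x : H), (x : H)⟫).re
    rw [re_shift]; linarith [hr x x.2]
  obtain ⟨C, hup⟩ := h'.upper
  let core : InnerProductSpace.Core ℂ Q :=
    { inner := fun v u => q' v u
      conj_inner_symm := fun x y => h'.symm _ x.2 _ y.2
      re_inner_nonneg := fun x => (by positivity : 0 ≤ η * ‖(x : H)‖ ^ 2).trans (hlowη x)
      add_left := fun x y z => h'.add_left x.2 y.2 z.2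
      smul_left := fun x y a => h'.smul_left x.2 y.2 a
      definite := fun x hx => by
        have h1 := hlowη x
        rw [show q' x x = 0 from hx, zero_re] at h1
        by_contra h0
        have : 0 < ‖(x : H)‖ := norm_pos_iff.2 fun h2 => h0 (Subtype.ext h2)
        exact absurd h1 (by push Not; positivity) }
  have hsq : ∀ x : Q, ‖(x : H)‖ ^ 2 ≤ η⁻¹ * (q' x x).re := fun x => by
    rw [inv_mul_eq_div, le_div_iff₀ hη, mul_comm]; exact hlowη x
  have hcomplete : ∀ u : ℕ → Q,
      Tendsto (fun p : ℕ × ℕ => (core.inner (u p.1 - u p.2) (u p.1 - u p.2)).re) atTop (𝓝 0) →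
      ∃ x, Tendsto (fun n => (core.inner (u n - x) (u n - x)).re) atTop (𝓝 0) := fun u hu => by
    obtain ⟨x, hx⟩ := cauchySeq_tendsto_of_complete (u := fun n => (u n : H))
      (cauchySeq_iff_tendsto_sub.2 (tendsto_zero_of_norm_sq_le (mul_zero η⁻¹ ▸ hu.const_mul η⁻¹)
        fun p => hsq (u p.1 - u p.2)))
    obtain ⟨hxQ, hy⟩ := h'.exists_tendsto hx hu fun p => le_rfl
    refine ⟨⟨x, hxQ⟩, squeeze_zero (fun n => core.re_inner_nonneg _) (fun n => hup _)
      (g := fun n => C * (‖J (u n - ⟨x, hxQ⟩)‖ ^ 2 + ‖(u n : H) - x‖ ^ 2)) ?_⟩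
    have a := (tendsto_iff_norm_sub_tendsto_zero.1 hx).pow 2
    have b := (tendsto_iff_norm_sub_tendsto_zero.1 hy).pow 2
    simpa using (b.add a).const_mul C
  choose R hR using exists_riesz core hcomplete Q.subtype η⁻¹ hsq
  have hR' : ∀ f (v : Q), q' v (R f) = ⟪(v : H), f⟫ := hR
  have huniq : ∀ (f : H) (w : Q), (∀ v : Q, q' v w = ⟪(v : H), f⟫) → w = R f := fun f w hw => by
    refine sub_eq_zero.1 (core.definite _ ((h'.sub_right (w - R f).2 w.2 (R f).2).trans ?_))
    rw [hw, hR', sub_self]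
  let Rl : H →ₗ[ℂ] H :=
    { toFun := fun f => (R f : H)
      map_add' := fun f g => congrArg Subtype.val (huniq (f + g) (R f + R g) fun v => by
        rw [coe_add, h'.add_right _ v.2 _ (R f).2 _ (R g).2, hR', hR', inner_add_right]).symm
      map_smul' := fun a f => congrArg Subtype.val (huniq (a • f) (a • R f) fun v => by
        rw [coe_smul, h'.smul_right _ v.2 _ (R f).2, hR', inner_smul_right]).symm }
  refine ⟨Rl.mkContinuous η⁻¹ fun f => ?_, fun u f => ⟨fun hu => ?_, fun hu => ?_⟩⟩
  · have h1 := (hlowη (R f)).trans (re_le_norm _)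
    rw [hR'] at h1
    replace h1 := h1.trans (norm_inner_le_norm _ _)
    change ‖(R f : H)‖ ≤ _
    rw [inv_mul_eq_div, le_div_iff₀ hη]
    rcases (norm_nonneg (R f : H)).eq_or_lt with h0 | h0
    · rw [← h0]; simp
    · exact le_of_mul_le_mul_left (by linarith) h0
  · exact congrArg Subtype.val (huniq f ⟨u, hu.1⟩ fun v => by
      simp only [q', hu.2 v v.2, inner_add_right, inner_smul_right, add_sub_cancel_right])
  · change u = (R f : H) at hu
    subst hu
    refine ⟨(R f).2, fun v hv => ?_⟩
    rw [inner_add_right, inner_smul_right]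
    exact sub_eq_iff_eq_add.1 (hR' f ⟨v, hv⟩)

lemma le_of_mem_formSpectrum (h : ClosedForm Q q J) {m : ℝ}
    (hm : ∀ u ∈ Q, m * ‖u‖ ^ 2 ≤ (q u u).re) {r : ℝ} (hr : (r : ℂ) ∈ formSpectrum (Q : Set H) q) :
    m ≤ r := by
  by_contra hlt
  push Not at hlt
  exact hr (h.isResolventPoint (sub_pos.2 hlt) (by simpa using hm))

/-- The bottom of the spectrum of a closed form is its greatest lower bound. -/
lemma exists_isLeast (h : ClosedForm Q q J) (hne : ∃ u ∈ Q, u ≠ 0) :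
    (∀ u ∈ Q, infSpec (Q : Set H) q * ‖u‖ ^ 2 ≤ (q u u).re) ∧
      ∀ m, (∀ u ∈ Q, m * ‖u‖ ^ 2 ≤ (q u u).re) → m ≤ infSpec (Q : Set H) q := by
  obtain ⟨u₀, hu₀, hne⟩ := hne
  have hn : 0 < ‖u₀‖ ^ 2 := by positivity
  let M : Set ℝ := {m | ∀ u ∈ Q, m * ‖u‖ ^ 2 ≤ (q u u).re}
  have hMne : M.Nonempty := h.exists_lower
  have hMbdd : BddAbove M := ⟨(q u₀ u₀).re / ‖u₀‖ ^ 2, fun m hm => by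
    rw [le_div_iff₀ hn]; exact hm u₀ hu₀⟩
  have hmem : ∀ u ∈ Q, sSup M * ‖u‖ ^ 2 ≤ (q u u).re := by
    intro u hu
    rcases (sq_nonneg ‖u‖).eq_or_lt with h0 | h0
    · obtain ⟨m, hm⟩ := hMne
      have := hm u hu
      rw [← h0] at this ⊢; simpa using this
    · rw [← le_div_iff₀ h0]
      exact csSup_le hMne fun m hm => by rw [le_div_iff₀ h0]; exact hm u hu
  have hspec := h.mem_formSpectrum hmem fun m' hm' => le_csSup hMbdd hm'
  have heq : infSpec (Q : Set H) q = sSup M := by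
    apply le_antisymm
    · exact csInf_le ⟨sSup M, fun r hr => h.le_of_mem_formSpectrum hmem hr⟩ hspec
    · exact le_csInf ⟨_, hspec⟩ fun r hr => h.le_of_mem_formSpectrum hmem hr
  rw [heq]
  exact ⟨hmem, fun m hm => le_csSup hMbdd hm⟩

/-- If `A ≥ 0` is given by a closed form and the solutions of `(A + δ) χ_δ = f` stay bounded as
`δ ↓ 0`, then they converge, and the limit solves `A χ = f`. -/
lemma exists_formOp_of_bounded (h : ClosedForm Q q J) (hpos : ∀ u ∈ Q, 0 ≤ (q u u).re) (f : H)
    (B : ℝ) (hB : ∀ (δ : ℝ) (u : H), 0 < δ → FormOp (Q : Set H) q u (f - (δ : ℂ) • u) → ‖u‖ ≤ B) :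
    ∃ u, FormOp (Q : Set H) q u f := by
  let δ : ℕ → ℝ := fun n => 1 / ((n : ℝ) + 1)
  have hδpos : ∀ n, 0 < δ n := fun n => by positivity
  have hδanti : StrictAnti δ := fun m n hmn => one_div_lt_one_div_of_lt (by positivity)
    (by exact_mod_cast Nat.succ_lt_succ hmn)
  have hδ0 : Tendsto δ atTop (𝓝 0) := tendsto_one_div_add_atTop_nhds_zero_nat
  have hex : ∀ n, ∃ u, FormOp (Q : Set H) q u (f - (δ n : ℂ) • u) := fun n => by
    obtain ⟨R, hR⟩ := h.isResolventPoint (r := -δ n) (hδpos n) (by simpa using hpos)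
    exact ⟨R f, by simpa [sub_eq_add_neg] using (hR (R f) f).2 rfl⟩
  choose u hu using hex
  have hBn : ∀ n, ‖u n‖ ≤ B := fun n => hB _ _ (hδpos n) (hu n)
  have hre : ∀ m n, (q (u n - u m) (u n - u m)).re =
      (δ m - δ n) * ⟪u n - u m, u m⟫.re - δ n * ‖u n - u m‖ ^ 2 := fun m n => by
    have hd := Q.sub_mem (hu n).1 (hu m).1
    have e : q (u n - u m) (u n - u m) = (δ m - δ n : ℝ) * ⟪u n - u m, u m⟫ -
        δ n * ⟪u n - u m, u n - u m⟫ := by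
      rw [h.sub_right hd (hu n).1 (hu m).1, (hu n).2 _ hd, (hu m).2 _ hd]
      simp only [inner_sub_right, inner_smul_right]
      push_cast
      ring
    rw [e, sub_re, re_ofReal_mul, re_ofReal_mul, re_inner_self_eq]
  have hmono : ∀ m n, m ≤ n → ‖u n - u m‖ ^ 2 ≤ ‖u n‖ ^ 2 - ‖u m‖ ^ 2 := fun m n hmn => by
    rcases hmn.eq_or_lt with rfl | hmn
    · simp
    have h1 : 0 ≤ (δ m - δ n) * ⟪u n - u m, u m⟫.re := by
      have h2 := hpos _ (Q.sub_mem (hu n).1 (hu m).1)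
      rw [hre] at h2
      linarith [mul_nonneg (hδpos n).le (sq_nonneg ‖u n - u m‖)]
    have h2 := norm_add_sq (𝕜 := ℂ) (u n - u m) (u m)
    rw [sub_add_cancel] at h2
    change _ = _ + 2 * ⟪u n - u m, u m⟫.re + _ at h2
    linarith [nonneg_of_mul_nonneg_right h1 (sub_pos.2 (hδanti hmn))]
  have hconv : Tendsto (fun n => ‖u n‖ ^ 2) atTop (𝓝 (⨆ n, ‖u n‖ ^ 2)) := by
    refine tendsto_atTop_ciSup (fun m n hmn => ?_) ⟨B ^ 2, ?_⟩
    · linarith [hmono m n hmn, sq_nonneg ‖u n - u m‖]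
    · rintro _ ⟨n, rfl⟩
      exact pow_le_pow_left₀ (norm_nonneg _) (hBn n) 2
  have hcauchy : CauchySeq u := by
    refine cauchySeq_iff_tendsto_sub.2 (tendsto_zero_of_norm_sq_le
      (by simpa using (cauchySeq_iff_tendsto_sub.1 hconv.cauchySeq).abs) fun p => ?_)
    rcases le_total p.1 p.2 with hmn | hmn
    · rw [norm_sub_rev, abs_sub_comm]; exact (hmono _ _ hmn).trans (le_abs_self _)
    · exact (hmono _ _ hmn).trans (le_abs_self _)
  obtain ⟨x, hx⟩ := cauchySeq_tendsto_of_complete hcauchy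
  obtain ⟨hxQ, hJx⟩ := h.exists_tendsto (u := fun n => ⟨u n, (hu n).1⟩) hx
    (b := fun p => ‖u p.1 - u p.2‖ * B)
    (by simpa using (cauchySeq_iff_tendsto_sub.1 hcauchy).norm.mul_const B) fun p => by
    obtain ⟨n, m⟩ := p
    change (q (u n - u m) (u n - u m)).re ≤ ‖u n - u m‖ * B
    have h4 : |δ m - δ n| ≤ 1 := by
      have : ∀ n, δ n ≤ 1 := fun n => (div_le_one (by positivity)).2 (by simp)
      rw [abs_le]
      constructor <;> linarith [hδpos n, hδpos m, this n, this m]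
    have h5 : (δ m - δ n) * ⟪u n - u m, u m⟫.re ≤ 1 * (‖u n - u m‖ * B) := by
      refine (le_abs_self _).trans ?_
      rw [abs_mul]
      exact mul_le_mul h4 ((abs_re_le_norm _).trans ((norm_inner_le_norm _ _).trans
        (mul_le_mul_of_nonneg_left (hBn m) (norm_nonneg _)))) (abs_nonneg _) zero_le_one
    rw [hre]
    linarith [mul_nonneg (hδpos n).le (sq_nonneg ‖u n - u m‖)]
  refine ⟨x, hxQ, fun v hv => ?_⟩
  have h1 : Tendsto (fun n => q v (u n)) atTop (𝓝 (q v x)) :=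
    h.tendsto_right hpos hv (u := fun n => ⟨u n, (hu n).1⟩) (x := ⟨x, hxQ⟩) hx hJx
  have h2 : Tendsto (fun n => q v (u n)) atTop (𝓝 ⟪v, f⟫) := by
    have h3 : ∀ n, q v (u n) = ⟪v, f - (δ n : ℂ) • u n⟫ := fun n => (hu n).2 v hv
    simp only [h3]
    have h4 : Tendsto (fun n => f - (δ n : ℂ) • u n) atTop (𝓝 (f - (0 : ℂ) • x)) :=
      tendsto_const_nhds.sub (((continuous_ofReal.tendsto 0).comp hδ0).smul hx)
    have h5 := (tendsto_const_nhds (x := v)).inner (𝕜 := ℂ) h4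
    rwa [zero_smul, sub_zero] at h5
  exact tendsto_nhds_unique h1 h2

end ClosedForm

end AbstractForms

/-! ### Weak derivatives -/

section WeakDerivatives

/-- The `j`-th standard unit vector of `ℝ³`. -/
def unitVec (j : Fin 3) : E3 := single j 1

section Basic

variable {F : Type*} [NormedAddCommGroup F] [NormedSpace ℝ F] {j : Fin 3}

lemma integrable_test_smul {f : E3 → F} (hf : LocallyIntegrable f) {θ : E3 → ℝ}
    (hθ : ContDiff ℝ ∞ θ) (hc : HasCompactSupport θ) : Integrable fun x => θ x • f x :=
  hf.integrable_smul_left_of_hasCompactSupport hθ.continuous hc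

lemma contDiff_partial {θ : E3 → ℝ} (hθ : ContDiff ℝ ∞ θ) (e : E3) :
    ContDiff ℝ ∞ fun x => fderiv ℝ θ x e :=
  (hθ.fderiv_right (m := ∞) (by simp)).clm_apply contDiff_const

lemma hasCompactSupport_partial {θ : E3 → ℝ} (hc : HasCompactSupport θ) (e : E3) :
    HasCompactSupport fun x => fderiv ℝ θ x e :=
  (hc.fderiv (𝕜 := ℝ)).comp_left (g := fun T : E3 →L[ℝ] ℝ => T e) (by simp)

lemma integrable_partial_smul {f : E3 → F} (hf : LocallyIntegrable f) {θ : E3 → ℝ}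
    (hθ : ContDiff ℝ ∞ θ) (hc : HasCompactSupport θ) (e : E3) :
    Integrable fun x => fderiv ℝ θ x e • f x :=
  integrable_test_smul hf (contDiff_partial hθ e) (hasCompactSupport_partial hc e)

lemma _root_.MeasureTheory.MemLp.locInt {f : E3 → F} (hf : MemLp f 2 volume) : LocallyIntegrable f :=
  hf.locallyIntegrable one_le_two

lemma IsWeakPartial.congr {f f' g g' : E3 → F} (h : IsWeakPartial j f g)
    (hf : f =ᵐ[volume] f') (hg : g =ᵐ[volume] g') : IsWeakPartial j f' g' := by
  intro θ hθ hc
  have h1 : ∫ x, θ x • g' x = ∫ x, θ x • g x :=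
    integral_congr_ae (hg.mono fun x hx => by simp only [hx])
  have h2 : ∫ x, fderiv ℝ θ x (single j 1) • f' x =
      ∫ x, fderiv ℝ θ x (single j 1) • f x :=
    integral_congr_ae (hf.mono fun x hx => by simp only [hx])
  rw [h1, h2, h θ hθ hc]

lemma IsWeakPartial.unique [CompleteSpace F] {f g g' : E3 → F} (h : IsWeakPartial j f g)
    (h' : IsWeakPartial j f g') (hg : LocallyIntegrable g) (hg' : LocallyIntegrable g') :
    g =ᵐ[volume] g' := by
  have h0 := ae_eq_zero_of_integral_contDiff_smul_eq_zero (hg.sub hg') (fun θ hθ hc => by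
    have h1 := h θ hθ hc
    rw [h' θ hθ hc, neg_inj] at h1
    simp only [Pi.sub_apply, smul_sub]
    rw [integral_sub (integrable_test_smul hg hθ hc) (integrable_test_smul hg' hθ hc), h1, sub_self])
  filter_upwards [h0] with x hx
  exact sub_eq_zero.1 hx

lemma IsWeakPartial.add {f f' g g' : E3 → F} (h : IsWeakPartial j f g)
    (h' : IsWeakPartial j f' g') (hf : LocallyIntegrable f) (hf' : LocallyIntegrable f')
    (hg : LocallyIntegrable g) (hg' : LocallyIntegrable g') :
    IsWeakPartial j (fun x => f x + f' x) (fun x => g x + g' x) := by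
  intro θ hθ hc
  simp only [smul_add]
  rw [integral_add (integrable_partial_smul hf hθ hc _) (integrable_partial_smul hf' hθ hc _),
    integral_add (integrable_test_smul hg hθ hc) (integrable_test_smul hg' hθ hc), h θ hθ hc,
    h' θ hθ hc, neg_add]

lemma IsWeakPartial.clm {G : Type*} [NormedAddCommGroup G] [NormedSpace ℝ G] [CompleteSpace F]
    [CompleteSpace G] (T : F →L[ℝ] G)
    {f g : E3 → F} (h : IsWeakPartial j f g) (hf : LocallyIntegrable f)
    (hg : LocallyIntegrable g) : IsWeakPartial j (fun x => T (f x)) (fun x => T (g x)) := by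
  intro θ hθ hc
  have h1 : ∀ (a : ℝ) (v : F), a • T v = T (a • v) := fun a v => (map_smul T a v).symm
  simp only [h1]
  rw [T.integral_comp_comm (integrable_partial_smul hf hθ hc _),
    T.integral_comp_comm (integrable_test_smul hg hθ hc), h θ hθ hc, map_neg]

lemma IsWeakPartial.mul {f g : E3 → F} (h : IsWeakPartial j f g) (hf : LocallyIntegrable f)
    (hg : LocallyIntegrable g) {m : E3 → ℝ} (hm : ContDiff ℝ ∞ m) :
    IsWeakPartial j (fun x => m x • f x)
      (fun x => m x • g x + fderiv ℝ m x (single j 1) • f x) := by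
  intro θ hθ hc
  have h1 := h (fun x => θ x * m x) (hθ.mul hm) hc.mul_right
  have hd : ∀ x, fderiv ℝ (fun x => θ x * m x) x (single j 1) =
      θ x * fderiv ℝ m x (single j 1) +
        fderiv ℝ θ x (single j 1) * m x := by
    intro x
    rw [fderiv_fun_mul (hθ.differentiable (by simp) x) (hm.differentiable (by simp) x)]
    simp [mul_comm]
  have i1 : Integrable fun x => (θ x * fderiv ℝ m x (single j 1)) • f x :=
    integrable_test_smul hf (hθ.mul (contDiff_partial hm _)) hc.mul_right
  have i2 : Integrable fun x => (fderiv ℝ θ x (single j 1) * m x) • f x :=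
    integrable_test_smul hf ((contDiff_partial hθ _).mul hm)
      (hasCompactSupport_partial hc _).mul_right
  have i3 : Integrable fun x => (θ x * m x) • g x :=
    integrable_test_smul hg (hθ.mul hm) hc.mul_right
  simp only [hd, add_smul] at h1
  rw [integral_add i1 i2] at h1
  simp only [smul_add, smul_smul]
  rw [integral_add i3 i1]
  rw [neg_add, ← h1]
  abel

lemma IsWeakPartial.of_tendsto {f g : E3 → F} {fn gn : ℕ → E3 → F}
    (h : ∀ n, IsWeakPartial j (fn n) (gn n)) (hf : MemLp f 2 volume) (hg : MemLp g 2 volume)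
    (hfn : ∀ n, MemLp (fn n) 2 volume) (hgn : ∀ n, MemLp (gn n) 2 volume)
    (hft : Tendsto (fun n => eLpNorm (fn n - f) 2 volume) atTop (𝓝 0))
    (hgt : Tendsto (fun n => eLpNorm (gn n - g) 2 volume) atTop (𝓝 0)) : IsWeakPartial j f g := by
  have key : ∀ (θ : E3 → ℝ), ContDiff ℝ ∞ θ → HasCompactSupport θ → ∀ (a : E3 → F)
      (an : ℕ → E3 → F), MemLp a 2 volume → (∀ n, MemLp (an n) 2 volume) →
      Tendsto (fun n => eLpNorm (an n - a) 2 volume) atTop (𝓝 0) →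
      Tendsto (fun n => ∫ x, θ x • an n x) atTop (𝓝 (∫ x, θ x • a x)) := by
    intro θ hθ hc a an ha han ht
    have hθL : MemLp θ 2 volume := hθ.continuous.memLp_of_hasCompactSupport hc
    refine tendsto_integral_of_L1 _ (integrable_test_smul ha.locInt hθ hc).aestronglyMeasurable
      (of_forall fun n =>
        integrable_test_smul (han n).locInt hθ hc) ?_
    have hlim : Tendsto (fun n => eLpNorm θ 2 volume * eLpNorm (an n - a) 2 volume) atTop (𝓝 0) := by
      have := ENNReal.Tendsto.const_mul ht (a := eLpNorm θ 2 volume) (Or.inr hθL.2.ne)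
      simpa using this
    refine tendsto_of_tendsto_of_tendsto_of_le_of_le tendsto_const_nhds hlim (fun n => bot_le)
      fun n => ?_
    have h1 : ∫⁻ x, ‖θ x • an n x - θ x • a x‖ₑ = eLpNorm (θ • (an n - a)) 1 volume := by
      rw [eLpNorm_one_eq_lintegral_enorm]
      simp [smul_sub]
    rw [h1]
    exact eLpNorm_smul_le_mul_eLpNorm (p := 2) (q := 2) (r := 1) ((han n).1.sub ha.1) hθL.1
  intro θ hθ hc
  have h1 := key _ (contDiff_partial hθ (single j 1))
    (hasCompactSupport_partial hc _) f fn hf hfn hft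
  have h2 := (key θ hθ hc g gn hg hgn hgt).neg
  refine tendsto_nhds_unique h1 (h2.congr fun n => ?_)
  exact (h n θ hθ hc).symm

end Basic

section Hilbert

variable {F : Type*} [NormedAddCommGroup F] [InnerProductSpace ℂ F] [NormedSpace ℝ F]
  [IsScalarTower ℝ ℂ F] {j : Fin 3}

lemma real_smul_eq (a : ℝ) (v : F) : a • v = (a : ℂ) • v := (algebraMap_smul ℂ a v).symm

lemma inner_real_smul_right' (a : ℝ) (v w : F) : ⟪v, a • w⟫ = a * ⟪v, w⟫ := by
  rw [real_smul_eq, inner_smul_right]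

/-- The real continuous linear map `v ↦ a • v` of multiplication by a complex number. -/
def complexSMul (F : Type*) [NormedAddCommGroup F] [InnerProductSpace ℂ F] [NormedSpace ℝ F]
    [IsScalarTower ℝ ℂ F] (a : ℂ) : F →L[ℝ] F :=
  LinearMap.mkContinuous
    { toFun := fun v => a • v
      map_add' := smul_add a
      map_smul' := fun r v => by
        simp only [RingHom.id_apply]
        rw [real_smul_eq, real_smul_eq, smul_smul, smul_smul, mul_comm] } ‖a‖
    (fun v => (norm_smul a v).le)

lemma IsWeakPartial.const_smul [CompleteSpace F] {f g : E3 → F} (h : IsWeakPartial j f g)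
    (hf : LocallyIntegrable f) (hg : LocallyIntegrable g) (a : ℂ) :
    IsWeakPartial j (fun x => a • f x) (fun x => a • g x) :=
  h.clm (complexSMul F a) hf hg

/-- Translation by `s e_j` on `L²(ℝ³; F)`. -/
def translate (j : Fin 3) (s : ℝ) : Lp F 2 (volume : Measure E3) →ₗᵢ[ℂ] Lp F 2 (volume : Measure E3) :=
  Lp.compMeasurePreservingₗᵢ ℂ (fun x => x + s • unitVec j)
    (measurePreserving_add_right volume (s • unitVec j))

lemma coeFn_translate (s : ℝ) (u : Lp F 2 (volume : Measure E3)) :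
    translate j s u =ᵐ[volume] fun x => u (x + s • unitVec j) :=
  Lp.coeFn_compMeasurePreserving u (measurePreserving_add_right volume (s • unitVec j))

lemma inner_translate (s : ℝ) (u v : Lp F 2 (volume : Measure E3)) :
    ⟪translate j s u, v⟫ = ⟪u, translate j (-s) v⟫ := by
  rw [L2.inner_def, L2.inner_def]
  have h1 : ∫ x, ⟪translate j s u x, v x⟫ =
      ∫ x, ⟪u (x + s • unitVec j), v x⟫ :=
    integral_congr_ae ((coeFn_translate (j := j) s u).mono fun x hx => by simp only [hx])
  have h2 : ∫ x, ⟪u x, translate j (-s) v x⟫ =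
      ∫ x, ⟪u x, v (x + (-s) • unitVec j)⟫ :=
    integral_congr_ae ((coeFn_translate (j := j) (-s) v).mono fun x hx => by simp only [hx])
  rw [h1, h2, ← integral_add_right_eq_self (μ := volume) (fun x => ⟪u x, v (x + (-s) • unitVec j)⟫)
    (s • unitVec j)]
  simp [add_assoc]

/-- Differentiation under the integral sign for a shifted test function. -/
lemma hasDerivAt_integral_shift {h : E3 → ℂ} (hh : LocallyIntegrable h) {θ : E3 → ℝ}
    (hθ : ContDiff ℝ ∞ θ) (hc : HasCompactSupport θ) (s₀ : ℝ) :
    HasDerivAt (fun s : ℝ => ∫ x, (θ (x - s • unitVec j)) • h x)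
      (∫ x, (-fderiv ℝ θ (x - s₀ • unitVec j) (unitVec j)) • h x) s₀ := by
  obtain ⟨R, hR⟩ := hc.isCompact.isBounded.subset_closedBall 0
  obtain ⟨M, hM⟩ := (hasCompactSupport_partial hc (unitVec j)).exists_bound_of_continuous
    (contDiff_partial hθ (unitVec j)).continuous
  have hM0 : 0 ≤ M := (norm_nonneg _).trans (hM 0)
  set K := Metric.closedBall (0 : E3) (R + |s₀| + 1) with hK
  have hshift : ∀ s : ℝ, ContDiff ℝ ∞ fun x : E3 => θ (x - s • unitVec j) := fun s =>
    hθ.comp (contDiff_id.sub contDiff_const)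
  have hcs : ∀ s : ℝ, HasCompactSupport fun x : E3 => θ (x - s • unitVec j) := fun s =>
    hc.comp_homeomorph (Homeomorph.subRight (s • unitVec j))
  refine (hasDerivAt_integral_of_dominated_loc_of_deriv_le (𝕜 := ℝ)
    (s := Metric.ball s₀ 1) (bound := K.indicator fun x => M * ‖h x‖)
    (F' := fun s x => (-fderiv ℝ θ (x - s • unitVec j) (unitVec j)) • h x)
    (Metric.ball_mem_nhds _ one_pos) ?_ ?_ ?_ ?_ ?_ ?_).2
  · exact of_forall fun s => (integrable_test_smul hh (hshift s) (hcs s)).aestronglyMeasurable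
  · exact integrable_test_smul hh (hshift s₀) (hcs s₀)
  · refine AEStronglyMeasurable.smul (f := fun x : E3 =>
      -fderiv ℝ θ (x - s₀ • unitVec j) (unitVec j)) ?_ hh.aestronglyMeasurable
    refine Continuous.aestronglyMeasurable ?_
    exact ((contDiff_partial hθ (unitVec j)).continuous.comp
      (continuous_id.sub continuous_const)).neg
  · refine of_forall fun x s hs => ?_
    by_cases hx : x ∈ K
    · rw [Set.indicator_of_mem hx, norm_smul, norm_neg]
      exact mul_le_mul_of_nonneg_right (hM _) (norm_nonneg _)
    · rw [Set.indicator_of_notMem hx]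
      have h0 : fderiv ℝ θ (x - s • unitVec j) = 0 := by
        by_contra hne
        have h1 : x - s • unitVec j ∈ tsupport θ :=
          support_fderiv_subset ℝ (f := θ) (Function.mem_support.2 hne)
        have h2 := hR h1
        rw [mem_closedBall_zero_iff] at h2
        apply hx
        rw [hK, mem_closedBall_zero_iff]
        have h3 : ‖s • unitVec j‖ ≤ |s₀| + 1 := by
          rw [norm_smul, unitVec, norm_single, norm_one, mul_one, norm_eq_abs]
          have h4 := hs
          rw [Metric.mem_ball, Real.dist_eq] at h4
          have h5 := abs_sub_abs_le_abs_sub s s₀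
          linarith
        have h6 := norm_add_le (x - s • unitVec j) (s • unitVec j)
        rw [sub_add_cancel] at h6
        linarith
      simp [h0]
  · have h1 : IntegrableOn (fun x => M * ‖h x‖) K :=
      ((hh.integrableOn_isCompact (isCompact_closedBall _ _)).norm).const_mul M
    exact h1.integrable_indicator Metric.isClosed_closedBall.measurableSet
  · refine of_forall fun x s _ => ?_
    have h1 : HasDerivAt (fun s : ℝ => x - s • unitVec j) (-unitVec j) s := by
      simpa using ((hasDerivAt_id s).smul_const (unitVec j)).const_sub x
    have h2 := (hθ.differentiable (by simp) (x - s • unitVec j)).hasFDerivAt.comp_hasDerivAt s h1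
    rw [map_neg] at h2
    exact h2.smul_const (h x)

/-- The linear span of the functions `θ • c` with `θ` a test function. -/
def testSpan (F : Type*) [NormedAddCommGroup F] [InnerProductSpace ℂ F] [NormedSpace ℝ F] :
    Submodule ℂ (Lp F 2 (volume : Measure E3)) :=
  span ℂ {w | ∃ (θ : E3 → ℝ) (c : F), ContDiff ℝ ∞ θ ∧ HasCompactSupport θ ∧
    w =ᵐ[volume] fun x => θ x • c}

lemma inner_test [CompleteSpace F] {u : E3 → F} (hu : LocallyIntegrable u) {θ : E3 → ℝ}
    (hθ : ContDiff ℝ ∞ θ) (hc : HasCompactSupport θ) (c : F) :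
    ∫ x, ⟪u x, θ x • c⟫ = starRingEnd ℂ ⟪c, (∫ x, θ x • u x)⟫ := by
  rw [← integral_inner (integrable_test_smul hu hθ hc), ← integral_conj]
  refine integral_congr_ae (of_forall fun x => ?_)
  simp only [inner_real_smul_right', map_mul, conj_ofReal, inner_conj_symm]

lemma dense_testSpan [CompleteSpace F] : (testSpan F).topologicalClosure = ⊤ := by
  rw [Submodule.topologicalClosure_eq_top_iff, Submodule.eq_bot_iff]
  intro u hu
  have hl : LocallyIntegrable u := (memLp u).locInt
  have h0 := ae_eq_zero_of_integral_contDiff_smul_eq_zero hl (fun θ hθ hc => by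
    have key : ∀ c : F, ⟪c, (∫ x, θ x • u x)⟫ = 0 := by
      intro c
      have hm : MemLp (fun x => θ x • c) 2 (volume : Measure E3) := by
        refine Continuous.memLp_of_hasCompactSupport (hθ.continuous.smul continuous_const) ?_
        exact hc.smul_right
      have hw : hm.toLp _ ∈ testSpan F := Submodule.subset_span ⟨θ, c, hθ, hc, hm.coeFn_toLp⟩
      have h1 := (Submodule.mem_orthogonal' _ _).1 hu _ hw
      rw [L2.inner_def] at h1
      have h2 : ∫ x, ⟪u x, hm.toLp (fun x => θ x • c) x⟫ = ∫ x, ⟪u x, θ x • c⟫ :=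
        integral_congr_ae (hm.coeFn_toLp.mono fun x hx => by simp only [hx])
      rw [h2, inner_test hl hθ hc c] at h1
      exact (map_eq_zero _).1 h1
    have h3 := key (∫ x, θ x • u x)
    exact inner_self_eq_zero.1 h3)
  rw [Lp.eq_zero_iff_ae_eq_zero]
  exact h0

/-- Along translations the scalar product with a function having a weak derivative is
differentiable. -/
lemma hasDerivAt_inner_translate [CompleteSpace F] {u g : Lp F 2 (volume : Measure E3)}
    (h : IsWeakPartial j u g) (v : Lp F 2 (volume : Measure E3)) (s : ℝ) :
    HasDerivAt (fun s => ⟪translate j s u, v⟫) ⟪translate j s g, v⟫ s := by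
  have hlu : LocallyIntegrable u := (memLp u).locInt
  have hlg : LocallyIntegrable g := (memLp g).locInt
  have htest : ∀ w ∈ testSpan F, ∀ s, HasDerivAt (fun s => ⟪translate j s u, w⟫)
      ⟪translate j s g, w⟫ s := by
    intro w hw
    induction hw using Submodule.span_induction with
    | mem w hw =>
      obtain ⟨θ, c, hθ, hc, hwe⟩ := hw
      intro s₀
      have hshift : ∀ s : ℝ, ContDiff ℝ ∞ fun x : E3 => θ (x - s • unitVec j) := fun s =>
        hθ.comp (contDiff_id.sub contDiff_const)
      have hcs : ∀ s : ℝ, HasCompactSupport fun x : E3 => θ (x - s • unitVec j) := fun s =>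
        hc.comp_homeomorph (Homeomorph.subRight (s • unitVec j))
      have hshape : ∀ (f : Lp F 2 (volume : Measure E3)) (s : ℝ),
          ⟪translate j s f, w⟫ = ∫ x, ⟪f x, θ (x - s • unitVec j) • c⟫ := by
        intro f s
        rw [inner_translate, L2.inner_def]
        refine integral_congr_ae ?_
        have h2 := (measurePreserving_add_right (volume : Measure E3)
          ((-s) • unitVec j)).quasiMeasurePreserving.ae_eq_comp hwe
        filter_upwards [coeFn_translate (j := j) (-s) w, h2] with x hx hx2
        rw [hx]
        simp only [Function.comp_apply] at hx2
        rw [hx2, neg_smul, sub_eq_add_neg]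
      have hu' : ∀ s, ⟪translate j s u, w⟫ =
          ∫ x, θ (x - s • unitVec j) • ⟪u x, c⟫ := by
        intro s
        rw [hshape]
        refine integral_congr_ae (of_forall fun x => ?_)
        simp only [inner_real_smul_right', Complex.real_smul]
      have hli : LocallyIntegrable fun x => ⟪u x, c⟫ := by
        have : MemLp (fun x => ⟪u x, c⟫) 2 (volume : Measure E3) :=
          (memLp u).inner_const c
        exact this.locInt
      have hd := hasDerivAt_integral_shift (j := j) hli hθ hc s₀
      simp only [hu']
      convert hd using 1
      rw [hshape, inner_test hlg (hshift s₀) (hcs s₀)]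
      have h3 := h _ (hshift s₀) (hcs s₀)
      have h4 : ∀ x, fderiv ℝ (fun x => θ (x - s₀ • unitVec j)) x = fderiv ℝ θ (x - s₀ • unitVec j) :=
        fun x => by
          simpa only [sub_eq_add_neg] using fderiv_comp_add_right (𝕜 := ℝ) (f := θ) (x := x) (-(s₀ • unitVec j))
      have h5 : ∫ x, θ (x - s₀ • unitVec j) • g x =
          - ∫ x, fderiv ℝ (fun x => θ (x - s₀ • unitVec j)) x (unitVec j) • u x := by
        rw [show unitVec j = single j (1 : ℝ) from rfl] at h3 ⊢
        rw [h3, neg_neg]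
      rw [h5, inner_neg_right, map_neg, ← inner_test hlu (contDiff_partial (hshift s₀) _)
        (hasCompactSupport_partial (hcs s₀) _), ← integral_neg]
      refine integral_congr_ae (of_forall fun x => ?_)
      simp only [h4, inner_real_smul_right', Complex.real_smul]
      push_cast; ring
    | zero => intro s; simpa using hasDerivAt_const s (0 : ℂ)
    | add x y _ _ hx hy =>
      intro s
      simp only [inner_add_right]
      exact (hx s).add (hy s)
    | smul a x _ hx =>
      intro s
      simp only [inner_smul_right]
      exact (hx s).const_mul a
  have hv : v ∈ closure (testSpan F : Set (Lp F 2 (volume : Measure E3))) := by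
    have : v ∈ (testSpan F).topologicalClosure := by rw [dense_testSpan]; trivial
    exact this
  obtain ⟨w, hw, hwv⟩ := mem_closure_iff_seq_limit.1 hv
  refine hasDerivAt_of_tendstoUniformly (l := atTop)
    (f := fun n s => ⟪translate j s u, w n⟫)
    (f' := fun n s => ⟪translate j s g, w n⟫) (g' := fun s => ⟪translate j s g, v⟫)
    ?_ (of_forall fun n s => htest _ (hw n) s)
    (fun s => tendsto_const_nhds.inner hwv) s
  rw [Metric.tendstoUniformly_iff]
  intro ε hε
  have h1 := (tendsto_iff_norm_sub_tendsto_zero.1 hwv).const_mul ‖g‖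
  rw [mul_zero] at h1
  filter_upwards [h1.eventually (gt_mem_nhds hε)] with n hn s
  rw [dist_comm, dist_eq_norm, ← inner_sub_right]
  refine (norm_inner_le_norm _ _).trans_lt ?_
  rwa [LinearIsometry.norm_map]

/-- Integration by parts for two square-integrable functions with square-integrable weak
derivatives. -/
lemma IsWeakPartial.integral_inner [CompleteSpace F] {u g v k : E3 → F}
    (hu : IsWeakPartial j u g)
    (hv : IsWeakPartial j v k) (mu : MemLp u 2 volume) (mg : MemLp g 2 volume)
    (mv : MemLp v 2 volume) (mk : MemLp k 2 volume) :
    ∫ x, ⟪g x, v x⟫ = - ∫ x, ⟪u x, k x⟫ := by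
  have tr : ∀ {a b : E3 → F} (ma : MemLp a 2 volume) (mb : MemLp b 2 volume),
      ⟪ma.toLp a, mb.toLp b⟫ = ∫ x, ⟪a x, b x⟫ := by
    intro a b ma mb
    rw [L2.inner_def]
    refine integral_congr_ae ?_
    filter_upwards [ma.coeFn_toLp, mb.coeFn_toLp] with x h1 h2
    rw [h1, h2]
  have hu' : IsWeakPartial j (mu.toLp u) (mg.toLp g) := hu.congr mu.coeFn_toLp.symm mg.coeFn_toLp.symm
  have hv' : IsWeakPartial j (mv.toLp v) (mk.toLp k) := hv.congr mv.coeFn_toLp.symm mk.coeFn_toLp.symm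
  have d1 := hasDerivAt_inner_translate hu' (mv.toLp v) 0
  have d2 := hasDerivAt_inner_translate hv' (mu.toLp u) (-0)
  have d3 := (d2.scomp (0 : ℝ) (hasDerivAt_neg (0 : ℝ))).star
  have heq : (fun s : ℝ => star ((fun s => ⟪translate j s (mv.toLp v), mu.toLp u⟫) (-s))) =
      fun s => ⟪translate j s (mu.toLp u), mv.toLp v⟫ := by
    funext s
    rw [inner_translate]
    exact inner_conj_symm _ _
  have d4 : HasDerivAt (fun s => ⟪translate j s (mu.toLp u), mv.toLp v⟫) _ 0 := heq ▸ d3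
  have huniq := d1.unique d4
  have hz : ∀ w : Lp F 2 (volume : Measure E3), translate j 0 w = w := by
    intro w
    refine Lp.ext ((coeFn_translate 0 w).trans (of_forall fun x => ?_))
    simp
  rw [neg_zero, hz, hz, tr] at huniq
  rw [huniq]
  simp only [neg_smul, one_smul, star_neg]
  congr 1
  rw [← tr mu mk]
  exact inner_conj_symm _ _

end Hilbert

end WeakDerivatives

/-! ### Weak derivatives of functions depending on parameters -/

section ParamDerivatives

variable {Y : Type*} [MeasurableSpace Y] {ν : Measure Y} [SFinite ν]

lemma ae_fiber {p : E3 × Y → Prop} (h : ∀ᵐ z ∂(vol× ν), p z) :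
    ∀ᵐ y ∂ν, ∀ᵐ x : E3, p (x, y) := by
  have h1 : ∀ᵐ z ∂(ν.prod (volume : Measure E3)), p z.swap :=
    Measure.measurePreserving_swap.quasiMeasurePreserving.ae h
  exact Measure.ae_ae_of_ae_prod h1

lemma ae_prod_of_ae_fiber {F : Type*} [NormedAddCommGroup F] {f g : E3 × Y → F}
    (hf : AEStronglyMeasurable f (vol× ν))
    (hg : AEStronglyMeasurable g (vol× ν))
    (h : ∀ᵐ y ∂ν, ∀ᵐ x : E3, f (x, y) = g (x, y)) : f =ᵐ[vol× ν] g := by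
  have hm : AEMeasurable (fun z => ‖f z - g z‖ₑ) (vol× ν) :=
    (hf.sub hg).enorm
  have h1 : ∫⁻ z, ‖f z - g z‖ₑ ∂(vol× ν) = 0 := by
    rw [lintegral_prod_symm _ hm]
    have h2 : ∀ᵐ y ∂ν, ∫⁻ x, ‖f (x, y) - g (x, y)‖ₑ ∂volume = 0 := by
      filter_upwards [h] with y hy
      have : ∫⁻ x, ‖f (x, y) - g (x, y)‖ₑ ∂volume =
          ∫⁻ _, 0 ∂volume :=
        lintegral_congr_ae (hy.mono fun x hx => by simp [hx])
      rw [this, lintegral_zero]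
    rw [lintegral_congr_ae h2, lintegral_zero]
  rw [lintegral_eq_zero_iff' hm] at h1
  filter_upwards [h1] with z hz
  exact sub_eq_zero.1 (enorm_eq_zero.1 hz)

lemma eLpNorm_two_sq {X E : Type*} [MeasurableSpace X] {μ : Measure X} [NormedAddCommGroup E]
    (f : X → E) : eLpNorm f 2 μ ^ 2 = ∫⁻ x, ‖f x‖ₑ ^ 2 ∂μ := by
  rw [eLpNorm_eq_lintegral_rpow_enorm_toReal (by simp) (by simp)]
  rw [← rpow_natCast, ← rpow_mul]
  simp

lemma memLp_two_iff {X E : Type*} [MeasurableSpace X] {μ : Measure X} [NormedAddCommGroup E]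
    {f : X → E} (hf : AEStronglyMeasurable f μ) :
    MemLp f 2 μ ↔ ∫⁻ x, ‖f x‖ₑ ^ 2 ∂μ < ⊤ := by
  rw [← eLpNorm_two_sq]
  refine ⟨fun h => ENNReal.pow_lt_top h.2, fun h => ⟨hf, ?_⟩⟩
  by_contra hc
  rw [not_lt, top_le_iff] at hc
  simp [hc] at h

lemma norm_sq_eq_lintegral {X E : Type*} [MeasurableSpace X] {μ : Measure X}
    [NormedAddCommGroup E] (f : Lp E 2 μ) :
    ofReal (‖f‖ ^ 2) = ∫⁻ x, ‖f x‖ₑ ^ 2 ∂μ := by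
  rw [← eLpNorm_two_sq, Lp.norm_def, ofReal_pow toReal_nonneg,
    ofReal_toReal (Lp.eLpNorm_ne_top f)]

lemma ae_memLp_fiber {F : Type*} [NormedAddCommGroup F] {f : E3 × Y → F}
    (hf : MemLp f 2 (vol× ν)) :
    ∀ᵐ y ∂ν, MemLp (fun x => f (x, y)) 2 (volume : Measure E3) := by
  have hm : AEMeasurable (fun z => ‖f z‖ₑ ^ 2) (vol× ν) :=
    hf.1.enorm.pow_const 2
  have h1 := (memLp_two_iff hf.1).1 hf
  rw [lintegral_prod_symm _ hm] at h1
  have h2 := ae_lt_top' hm.prod_swap.lintegral_prod_right' h1.ne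
  have h3 := hf.1.prod_swap.prodMk_left
  filter_upwards [h2, h3] with y hy hy3
  exact (memLp_two_iff hy3).2 hy

/-- `g` is the weak derivative `∂_{x_j} f` for almost every value of the parameter. -/
def IsWeakPartialParam {F : Type*} [NormedAddCommGroup F] [NormedSpace ℝ F] (ν : Measure Y)
    (j : Fin 3) (f g : E3 × Y → F) : Prop :=
  ∀ᵐ y ∂ν, IsWeakPartial j (fun x => f (x, y)) (fun x => g (x, y))

section Banach

variable {F : Type*} [NormedAddCommGroup F] [NormedSpace ℝ F] [CompleteSpace F] {j : Fin 3}

lemma IsWeakPartialParam.congr {f f' g g' : E3 × Y → F} (h : IsWeakPartialParam ν j f g)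
    (hf : f =ᵐ[vol× ν] f') (hg : g =ᵐ[vol× ν] g') :
    IsWeakPartialParam ν j f' g' := by
  filter_upwards [h, ae_fiber hf, ae_fiber hg] with y h1 h2 h3
  exact h1.congr h2 h3

lemma IsWeakPartialParam.unique {f g g' : E3 × Y → F} (h : IsWeakPartialParam ν j f g)
    (h' : IsWeakPartialParam ν j f g') (hg : MemLp g 2 (vol× ν))
    (hg' : MemLp g' 2 (vol× ν)) : g =ᵐ[vol× ν] g' := by
  refine ae_prod_of_ae_fiber hg.1 hg'.1 ?_
  filter_upwards [h, h', ae_memLp_fiber hg, ae_memLp_fiber hg'] with y h1 h2 h3 h4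
  exact h1.unique h2 h3.locInt h4.locInt

lemma IsWeakPartialParam.add {f f' g g' : E3 × Y → F} (h : IsWeakPartialParam ν j f g)
    (h' : IsWeakPartialParam ν j f' g') (hf : MemLp f 2 (vol× ν))
    (hf' : MemLp f' 2 (vol× ν))
    (hg : MemLp g 2 (vol× ν))
    (hg' : MemLp g' 2 (vol× ν)) :
    IsWeakPartialParam ν j (fun z => f z + f' z) (fun z => g z + g' z) := by
  filter_upwards [h, h', ae_memLp_fiber hf, ae_memLp_fiber hf', ae_memLp_fiber hg,
    ae_memLp_fiber hg'] with y h1 h2 h3 h4 h5 h6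
  exact h1.add h2 h3.locInt h4.locInt
    h5.locInt h6.locInt

lemma IsWeakPartialParam.clm {G : Type*} [NormedAddCommGroup G] [NormedSpace ℝ G]
    [CompleteSpace G] (T : Y → F →L[ℝ] G) {f g : E3 × Y → F} (h : IsWeakPartialParam ν j f g)
    (hf : MemLp f 2 (vol× ν))
    (hg : MemLp g 2 (vol× ν)) :
    IsWeakPartialParam ν j (fun z => T z.2 (f z)) (fun z => T z.2 (g z)) := by
  filter_upwards [h, ae_memLp_fiber hf, ae_memLp_fiber hg] with y h1 h3 h5
  exact h1.clm (T y) h3.locInt h5.locInt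

lemma IsWeakPartialParam.of_tendsto {f g : E3 × Y → F} {fn gn : ℕ → E3 × Y → F}
    (h : ∀ n, IsWeakPartialParam ν j (fn n) (gn n)) (hf : MemLp f 2 (vol× ν))
    (hg : MemLp g 2 (vol× ν))
    (hfn : ∀ n, MemLp (fn n) 2 (vol× ν))
    (hgn : ∀ n, MemLp (gn n) 2 (vol× ν))
    (hft : Tendsto (fun n => eLpNorm (fn n - f) 2 (vol× ν)) atTop (𝓝 0))
    (hgt : Tendsto (fun n => eLpNorm (gn n - g) 2 (vol× ν)) atTop (𝓝 0)) :
    IsWeakPartialParam ν j f g := by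
  let μ := vol× ν
  let c : ℕ → E3 × Y → ℝ≥0∞ := fun n z => ‖fn n z - f z‖ₑ ^ 2 + ‖gn n z - g z‖ₑ ^ 2
  have hcm : ∀ n, AEMeasurable (c n) μ := fun n =>
    (((hfn n).1.sub hf.1).enorm.pow_const 2).add (((hgn n).1.sub hg.1).enorm.pow_const 2)
  have hct : Tendsto (fun n => ∫⁻ z, c n z ∂μ) atTop (𝓝 0) := by
    have h1 : ∀ n, ∫⁻ z, c n z ∂μ = eLpNorm (fn n - f) 2 μ ^ 2 + eLpNorm (gn n - g) 2 μ ^ 2 := by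
      intro n
      rw [eLpNorm_two_sq, eLpNorm_two_sq,
        ← lintegral_add_left' (((hfn n).1.sub hf.1).enorm.pow_const 2)]
      rfl
    simp only [h1]
    have h2 := (ENNReal.Tendsto.pow (n := 2) hft).add (ENNReal.Tendsto.pow (n := 2) hgt)
    simpa using h2
  -- along a subsequence the fibrewise distances are summable, hence tend to zero
  have hex : ∀ n : ℕ, ∃ N, ∫⁻ z, c N z ∂μ ≤ (1 / 2 : ℝ≥0∞) ^ n := by
    intro n
    have hpos : (0 : ℝ≥0∞) < (1 / 2) ^ n := by
      apply ENNReal.pow_pos; simp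
    exact ((hct.eventually (ge_mem_nhds hpos))).exists
  choose N hN using hex
  have hcm' : ∀ n, AEMeasurable (fun y => ∫⁻ x, c (N n) (x, y) ∂volume) ν :=
    fun n => (hcm (N n)).prod_swap.lintegral_prod_right'
  have hsum : ∫⁻ y, ∑' n, ∫⁻ x, c (N n) (x, y) ∂volume ∂ν ≠ ⊤ := by
    rw [lintegral_tsum hcm']
    have h1 : ∀ n, ∫⁻ y, ∫⁻ x, c (N n) (x, y) ∂volume ∂ν ≤ (1 / 2 : ℝ≥0∞) ^ n := by
      intro n
      rw [← lintegral_prod_symm _ (hcm (N n))]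
      exact hN n
    refine ne_top_of_le_ne_top ?_ (ENNReal.tsum_le_tsum h1)
    rw [ENNReal.tsum_geometric]
    simp
  have hfin := ae_lt_top' (AEMeasurable.tsum hcm') hsum
  have hall : ∀ᵐ y ∂ν, ∀ n, IsWeakPartial j (fun x => fn (N n) (x, y)) (fun x => gn (N n) (x, y)) ∧
      MemLp (fun x => fn (N n) (x, y)) 2 (volume : Measure E3) ∧
      MemLp (fun x => gn (N n) (x, y)) 2 (volume : Measure E3) :=
    ae_all_iff.2 fun n => (h (N n)).and ((ae_memLp_fiber (hfn _)).and (ae_memLp_fiber (hgn _)))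
  filter_upwards [hfin, hall, ae_memLp_fiber hf, ae_memLp_fiber hg] with y h1 h2 h3 h4
  have h5 := ENNReal.tendsto_atTop_zero_of_tsum_ne_top h1.ne
  have hsq : ∀ {a : ℕ → ℝ≥0∞}, Tendsto (fun n => a n ^ 2) atTop (𝓝 0) → Tendsto a atTop (𝓝 0) := by
    intro a ha
    have h6 := (ENNReal.continuous_rpow_const (y := (1 / 2 : ℝ))).tendsto 0 |>.comp ha
    simp only [comp_def] at h6
    have h7 : ∀ n, (a n ^ 2) ^ (1 / 2 : ℝ) = a n := fun n => by
      rw [← rpow_natCast, ← rpow_mul]; simp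
    simp only [h7] at h6
    simpa using h6
  refine IsWeakPartial.of_tendsto (fun n => (h2 n).1) h3 h4 (fun n => (h2 n).2.1)
    (fun n => (h2 n).2.2) (hsq ?_) (hsq ?_)
  · refine tendsto_of_tendsto_of_tendsto_of_le_of_le tendsto_const_nhds h5 (fun n => bot_le)
      fun n => ?_
    rw [eLpNorm_two_sq]
    exact lintegral_mono fun x => le_self_add
  · refine tendsto_of_tendsto_of_tendsto_of_le_of_le tendsto_const_nhds h5 (fun n => bot_le)
      fun n => ?_
    rw [eLpNorm_two_sq]
    exact lintegral_mono fun x => le_add_self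

end Banach

section Hilbert

variable {F : Type*} [NormedAddCommGroup F] [InnerProductSpace ℂ F] [NormedSpace ℝ F]
  [IsScalarTower ℝ ℂ F] [CompleteSpace F] {j : Fin 3}

lemma integrable_inner_of_memLp {X : Type*} [MeasurableSpace X] {μ : Measure X} {u v : X → F}
    (hu : MemLp u 2 μ) (hv : MemLp v 2 μ) : Integrable (fun x => ⟪u x, v x⟫) μ := by
  refine (hu.norm.integrable_mul hv.norm).mono' (hu.1.inner hv.1) (of_forall fun x => ?_)
  exact norm_inner_le_norm _ _

lemma IsWeakPartialParam.const_smul {f g : E3 × Y → F} (h : IsWeakPartialParam ν j f g)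
    (hf : MemLp f 2 (vol× ν))
    (hg : MemLp g 2 (vol× ν)) (a : Y → ℂ) :
    IsWeakPartialParam ν j (fun z => a z.2 • f z) (fun z => a z.2 • g z) :=
  h.clm (fun y => complexSMul F (a y)) hf hg

lemma HasPartialParam.ae_eq {u : Lp F 2 (vol× ν)} {g : E3 × Y → F}
    (h : HasPartialParam ν j u g) : partialParam ν j u =ᵐ[vol× ν] g := by
  have hex : ∃ g, HasPartialParam ν j u g := ⟨g, h⟩
  have h1 : HasPartialParam ν j u (partialParam ν j u) := by
    rw [partialParam, dif_pos hex]; exact hex.choose_spec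
  exact IsWeakPartialParam.unique h1.2 h.2 h1.1 h.1

end Hilbert

lemma HasPartial.ae_eq {j : Fin 3} {u : L2x} {g : E3 → ℂ} (h : HasPartial j u g) :
    partialX j u =ᵐ[volume] g := by
  have hex : ∃ g, HasPartial j u g := ⟨g, h⟩
  have h1 : HasPartial j u (partialX j u) := by
    rw [partialX, dif_pos hex]; exact hex.choose_spec
  exact IsWeakPartial.unique h1.2 h.2 h1.1.locInt
    h.1.locInt

end ParamDerivatives

/-! ### Families of closed operators -/

section ClosedOperators

variable {ι H K : Type*} [NormedAddCommGroup H] [InnerProductSpace ℂ H]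
  [NormedAddCommGroup K] [InnerProductSpace ℂ K]

/-- `D` is the graph of a closed operator. -/
structure IsClosedOp (D : Submodule ℂ (H × K)) : Prop where
  closed : IsClosed (D : Set (H × K))
  eq_zero : ∀ g, ((0, g) : H × K) ∈ D → g = 0

/-- The common domain of the operators with graphs `D i`. -/
def opDomain (D : ι → Submodule ℂ (H × K)) : Submodule ℂ H :=
  ⨅ i, (D i).map (LinearMap.fst ℂ H K)

lemma mem_opDomain {D : ι → Submodule ℂ (H × K)} {u : H} :
    u ∈ opDomain D ↔ ∀ i, ∃ g, (u, g) ∈ D i := by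
  simp [opDomain, Submodule.mem_iInf, Submodule.mem_map]

variable {D : ι → Submodule ℂ (H × K)}

lemma IsClosedOp.unique {D : Submodule ℂ (H × K)} (h : IsClosedOp D) {u : H} {g g' : K}
    (hg : (u, g) ∈ D) (hg' : (u, g') ∈ D) : g = g' := by
  have := h.eq_zero (g - g') (by simpa using D.sub_mem hg hg')
  exact sub_eq_zero.1 this

/-- The operators with graphs `D i` on their common domain. -/
def opVal (hD : ∀ i, IsClosedOp (D i)) : opDomain D →ₗ[ℂ] (ι → K) where
  toFun u i := (mem_opDomain.1 u.2 i).choose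
  map_add' u v := by
    funext i
    refine (hD i).unique (mem_opDomain.1 (u + v).2 i).choose_spec ?_
    exact (D i).add_mem (mem_opDomain.1 u.2 i).choose_spec (mem_opDomain.1 v.2 i).choose_spec
  map_smul' a u := by
    funext i
    refine (hD i).unique (mem_opDomain.1 (a • u).2 i).choose_spec ?_
    exact (D i).smul_mem a (mem_opDomain.1 u.2 i).choose_spec

lemma opVal_mem (hD : ∀ i, IsClosedOp (D i)) (u : opDomain D) (i : ι) :
    ((u : H), opVal hD u i) ∈ D i := (mem_opDomain.1 u.2 i).choose_spec

lemma opVal_eq (hD : ∀ i, IsClosedOp (D i)) (u : opDomain D) (i : ι) {g : K}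
    (hg : ((u : H), g) ∈ D i) : opVal hD u i = g :=
  (hD i).unique (opVal_mem hD u i) hg

lemma opVal_graph [Fintype ι] (hD : ∀ i, IsClosedOp (D i)) (u : ℕ → opDomain D) (x : H)
    (y : ι → K) (hu : Tendsto (fun n => (u n : H)) atTop (𝓝 x))
    (hy : Tendsto (fun n => opVal hD (u n)) atTop (𝓝 y)) :
    ∃ h : x ∈ opDomain D, opVal hD ⟨x, h⟩ = y := by
  have hmem : ∀ i, (x, y i) ∈ D i := fun i => by
    have h1 := hu.prodMk_nhds ((tendsto_pi_nhds.1 hy) i)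
    exact (hD i).closed.mem_of_tendsto h1 (of_forall fun n => opVal_mem hD (u n) i)
  exact ⟨mem_opDomain.2 fun i => ⟨_, hmem i⟩, funext fun i => opVal_eq hD _ i (hmem i)⟩

lemma norm_opVal_sq_le [Fintype ι] (g : ι → K) : ‖g‖ ^ 2 ≤ ∑ i, ‖g i‖ ^ 2 := by
  have h0 : 0 ≤ ∑ i, ‖g i‖ ^ 2 := sum_nonneg fun i _ => sq_nonneg _
  have h1 : ‖g‖ ≤ √(∑ i, ‖g i‖ ^ 2) := by
    refine (pi_norm_le_iff_of_nonneg (sqrt_nonneg _)).2 fun i => ?_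
    refine Real.le_sqrt_of_sq_le ?_
    exact single_le_sum (f := fun i => ‖g i‖ ^ 2) (fun i _ => sq_nonneg _)
      (mem_univ i)
  calc ‖g‖ ^ 2 ≤ √(∑ i, ‖g i‖ ^ 2) ^ 2 := by gcongr
    _ = _ := sq_sqrt h0

end ClosedOperators

section ConcreteOperators

variable {X F : Type*} [MeasurableSpace X] {μ : Measure X} [NormedAddCommGroup F]
  [InnerProductSpace ℂ F]

/-- The graph of multiplication by `√W`. -/
def weightGraph (F : Type*) [NormedAddCommGroup F] [InnerProductSpace ℂ F] (μ : Measure X)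
    (W : X → ℝ) : Submodule ℂ (Lp F 2 μ × Lp F 2 μ) where
  carrier := {z | z.2 =ᵐ[μ] fun x => ((√(W x) : ℝ) : ℂ) • z.1 x}
  zero_mem' := by
    filter_upwards [coeFn_zero F 2 μ] with x hx
    change (0 : Lp F 2 μ) x = ((√(W x) : ℝ) : ℂ) • (0 : Lp F 2 μ) x
    rw [hx]; simp
  add_mem' := by
    rintro ⟨u, g⟩ ⟨u', g'⟩ h h'
    filter_upwards [h, h', coeFn_add u u', coeFn_add g g'] with x h1 h2 h3 h4
    simp only [Prod.mk_add_mk] at *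
    rw [h3, h4, Pi.add_apply, Pi.add_apply, h1, h2, smul_add]
  smul_mem' := by
    rintro a ⟨u, g⟩ h
    filter_upwards [h, coeFn_smul a u, coeFn_smul a g] with x h1 h3 h4
    simp only [Prod.smul_mk] at *
    rw [h3, h4, Pi.smul_apply, Pi.smul_apply, h1, smul_comm]

lemma isClosedOp_weightGraph (W : X → ℝ) : IsClosedOp (weightGraph F μ W) where
  closed := by
    refine IsSeqClosed.isClosed fun z p hz hp => ?_
    have h1 : Tendsto (fun n => (z n).1) atTop (𝓝 p.1) := (continuous_fst.tendsto p).comp hp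
    have h2 : Tendsto (fun n => (z n).2) atTop (𝓝 p.2) := (continuous_snd.tendsto p).comp hp
    have t1 := tendstoInMeasure_of_tendsto_eLpNorm (two_ne_zero) (fun n => (memLp (z n).1).1)
      (memLp p.1).1 ((Lp.tendsto_Lp_iff_tendsto_eLpNorm' _ _).1 h1)
    obtain ⟨ns, hns, hae⟩ := t1.exists_seq_tendsto_ae
    have t2 := tendstoInMeasure_of_tendsto_eLpNorm (two_ne_zero)
      (fun n => (memLp (z (ns n)).2).1)
      (memLp p.2).1 ((Lp.tendsto_Lp_iff_tendsto_eLpNorm' _ _).1 (h2.comp hns.tendsto_atTop))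
    obtain ⟨ms, hms, hae2⟩ := t2.exists_seq_tendsto_ae
    have hall : ∀ᵐ x ∂μ, ∀ n, (z n).2 x = ((√(W x) : ℝ) : ℂ) • (z n).1 x :=
      ae_all_iff.2 fun n => hz n
    filter_upwards [hae, hae2, hall] with x a1 a2 a3
    have a4 := (a1.comp hms.tendsto_atTop).const_smul ((√(W x) : ℝ) : ℂ)
    refine tendsto_nhds_unique a2 (a4.congr fun n => ?_)
    exact (a3 _).symm
  eq_zero g hg := by
    rw [Lp.eq_zero_iff_ae_eq_zero]
    have h : g =ᵐ[μ] fun x => ((√(W x) : ℝ) : ℂ) • (0 : Lp F 2 μ) x := hg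
    filter_upwards [h, coeFn_zero F 2 μ] with x h1 h2
    rw [h1, h2]; simp

lemma enorm_sqrt_smul_sq (w : ℝ) (v : F) :
    ‖((√w : ℝ) : ℂ) • v‖ₑ ^ 2 = ofReal w * ‖v‖ₑ ^ 2 := by
  rw [enorm_smul, mul_pow]
  congr 1
  rw [← ofReal_norm, norm_real, norm_of_nonneg (sqrt_nonneg _),
    ← ofReal_pow (sqrt_nonneg _)]
  rcases le_total 0 w with h | h
  · rw [sq_sqrt h]
  · rw [Real.sqrt_eq_zero_of_nonpos h, ofReal_of_nonpos h]; simp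

lemma exists_mem_weightGraph {W : X → ℝ} (hW : AEMeasurable W μ) {u : Lp F 2 μ} :
    (∃ g, (u, g) ∈ weightGraph F μ W) ↔ ∫⁻ x, ofReal (W x) * ‖u x‖ₑ ^ 2 ∂μ ≠ ⊤ := by
  constructor
  · rintro ⟨g, hg⟩
    have h1 := (memLp_two_iff (memLp g).1).1 (memLp g)
    have h2 : ∫⁻ x, ‖g x‖ₑ ^ 2 ∂μ = ∫⁻ x, ofReal (W x) * ‖u x‖ₑ ^ 2 ∂μ := by
      refine lintegral_congr_ae ?_
      have hg' : g =ᵐ[μ] fun x => ((√(W x) : ℝ) : ℂ) • u x := hg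
      filter_upwards [hg'] with x hx
      rw [hx, enorm_sqrt_smul_sq]
    rw [← h2]; exact h1.ne
  · intro h
    have hm : AEStronglyMeasurable (fun x => ((√(W x) : ℝ) : ℂ) • u x) μ :=
      (measurable_ofReal.comp_aemeasurable hW.sqrt).aestronglyMeasurable.smul
        (memLp u).1
    have hL : MemLp (fun x => ((√(W x) : ℝ) : ℂ) • u x) 2 μ := by
      rw [memLp_two_iff hm]
      simp only [enorm_sqrt_smul_sq]
      exact h.lt_top
    exact ⟨hL.toLp _, hL.coeFn_toLp⟩

lemma norm_sq_of_mem_weightGraph {W : X → ℝ} {u g : Lp F 2 μ} (h : (u, g) ∈ weightGraph F μ W) :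
    ofReal (‖g‖ ^ 2) = ∫⁻ x, ofReal (W x) * ‖u x‖ₑ ^ 2 ∂μ := by
  rw [norm_sq_eq_lintegral]
  refine lintegral_congr_ae ?_
  have hg' : g =ᵐ[μ] fun x => ((√(W x) : ℝ) : ℂ) • u x := h
  filter_upwards [hg'] with x hx
  rw [hx, enorm_sqrt_smul_sq]

end ConcreteOperators

section GradientGraphs

variable {Y F : Type*} [MeasurableSpace Y] {ν : Measure Y} [SFinite ν] [NormedAddCommGroup F]
  [InnerProductSpace ℂ F] [NormedSpace ℝ F] [IsScalarTower ℝ ℂ F] [CompleteSpace F]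

/-- The graph of the weak derivative `∂_{x_j}` for functions depending on a parameter. -/
def gradGraphParam (F : Type*) [NormedAddCommGroup F] [InnerProductSpace ℂ F] [NormedSpace ℝ F]
    [IsScalarTower ℝ ℂ F] [CompleteSpace F] (ν : Measure Y) [SFinite ν] (j : Fin 3) :
    Submodule ℂ (Lp F 2 (vol× ν) × Lp F 2 (vol× ν)) where
  carrier := {z | HasPartialParam ν j z.1 z.2}
  zero_mem' := by
    refine ⟨memLp _, ?_⟩
    have h : IsWeakPartialParam ν j (0 : E3 × Y → F) 0 :=
      of_forall fun y θ _ _ => by simp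
    exact h.congr (coeFn_zero _ _ _).symm (coeFn_zero _ _ _).symm
  add_mem' := by
    rintro ⟨u, g⟩ ⟨u', g'⟩ h h'
    refine ⟨memLp _, ?_⟩
    exact (IsWeakPartialParam.add h.2 h'.2 (memLp u) (memLp u') (memLp g)
      (memLp g')).congr (coeFn_add _ _).symm (coeFn_add _ _).symm
  smul_mem' := by
    rintro a ⟨u, g⟩ h
    refine ⟨memLp _, ?_⟩
    exact (IsWeakPartialParam.const_smul h.2 (memLp u) (memLp g) (fun _ => a)).congr
      (coeFn_smul _ _).symm (coeFn_smul _ _).symm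

lemma isClosedOp_gradGraphParam (j : Fin 3) : IsClosedOp (gradGraphParam F ν j) where
  closed := by
    refine IsSeqClosed.isClosed fun z p hz hp => ?_
    have h1 : Tendsto (fun n => (z n).1) atTop (𝓝 p.1) := (continuous_fst.tendsto p).comp hp
    have h2 : Tendsto (fun n => (z n).2) atTop (𝓝 p.2) := (continuous_snd.tendsto p).comp hp
    exact ⟨memLp _, IsWeakPartialParam.of_tendsto (fun n => (hz n).2) (memLp _) (memLp _)
      (fun n => memLp _) (fun n => memLp _) ((Lp.tendsto_Lp_iff_tendsto_eLpNorm' _ _).1 h1)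
      ((Lp.tendsto_Lp_iff_tendsto_eLpNorm' _ _).1 h2)⟩
  eq_zero g hg := by
    rw [Lp.eq_zero_iff_ae_eq_zero]
    have h : IsWeakPartialParam ν j (0 : E3 × Y → F) 0 :=
      of_forall fun y θ _ _ => by simp
    have h' : IsWeakPartialParam ν j (0 : E3 × Y → F) g :=
      IsWeakPartialParam.congr hg.2 (coeFn_zero _ _ _) (ae_eq_refl _)
    exact h'.unique h (memLp g) MemLp.zero

lemma exists_mem_gradGraphParam {j : Fin 3} {u : Lp F 2 (vol× ν)} :
    (∃ g, (u, g) ∈ gradGraphParam F ν j) ↔ ∃ g, HasPartialParam ν j u g := by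
  constructor
  · rintro ⟨g, hg⟩; exact ⟨g, hg⟩
  · rintro ⟨g, hg⟩
    exact ⟨hg.1.toLp g, memLp _,
      IsWeakPartialParam.congr hg.2 (ae_eq_refl _) hg.1.coeFn_toLp.symm⟩

/-- The graph of the weak derivative `∂_j` on `L²(ℝ³)`. -/
def gradGraph (j : Fin 3) : Submodule ℂ (L2x × L2x) where
  carrier := {z | HasPartial j z.1 z.2}
  zero_mem' := by
    refine ⟨memLp _, ?_⟩
    have h : IsWeakPartial j (0 : E3 → ℂ) 0 := fun θ _ _ => by simp
    exact h.congr (coeFn_zero _ _ _).symm (coeFn_zero _ _ _).symm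
  add_mem' := by
    rintro ⟨u, g⟩ ⟨u', g'⟩ h h'
    refine ⟨memLp _, ?_⟩
    exact (IsWeakPartial.add h.2 h'.2 (memLp u).locInt
      (memLp u').locInt (memLp g).locInt
      (memLp g').locInt).congr (coeFn_add _ _).symm
      (coeFn_add _ _).symm
  smul_mem' := by
    rintro a ⟨u, g⟩ h
    refine ⟨memLp _, ?_⟩
    exact (IsWeakPartial.const_smul h.2 (memLp u).locInt
      (memLp g).locInt a).congr
      (coeFn_smul a u).symm (coeFn_smul a g).symm

lemma isClosedOp_gradGraph (j : Fin 3) : IsClosedOp (gradGraph j) where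
  closed := by
    refine IsSeqClosed.isClosed fun z p hz hp => ?_
    have h1 : Tendsto (fun n => (z n).1) atTop (𝓝 p.1) := (continuous_fst.tendsto p).comp hp
    have h2 : Tendsto (fun n => (z n).2) atTop (𝓝 p.2) := (continuous_snd.tendsto p).comp hp
    exact ⟨memLp _, IsWeakPartial.of_tendsto (fun n => (hz n).2) (memLp _) (memLp _)
      (fun n => memLp _) (fun n => memLp _) ((Lp.tendsto_Lp_iff_tendsto_eLpNorm' _ _).1 h1)
      ((Lp.tendsto_Lp_iff_tendsto_eLpNorm' _ _).1 h2)⟩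
  eq_zero g hg := by
    rw [Lp.eq_zero_iff_ae_eq_zero]
    have h : IsWeakPartial j (0 : E3 → ℂ) 0 := fun θ _ _ => by simp
    have h' : IsWeakPartial j (0 : E3 → ℂ) g :=
      IsWeakPartial.congr hg.2 (coeFn_zero _ _ _) (ae_eq_refl _)
    exact h'.unique h (memLp g).locInt locallyIntegrable_zero

lemma exists_mem_gradGraph {j : Fin 3} {u : L2x} :
    (∃ g, (u, g) ∈ gradGraph j) ↔ ∃ g, HasPartial j u g := by
  constructor
  · rintro ⟨g, hg⟩; exact ⟨g, hg⟩
  · rintro ⟨g, hg⟩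
    exact ⟨hg.1.toLp g, memLp _,
      IsWeakPartial.congr hg.2 (ae_eq_refl _) hg.1.coeFn_toLp.symm⟩

end GradientGraphs

/-! ### Forms given by a gradient and a potential -/

section GradientForms

variable {X F : Type*} [MeasurableSpace X] {μ : Measure X} [NormedAddCommGroup F]
  [InnerProductSpace ℂ F]

lemma lintegral_ofReal_mul_eq (W : X → ℝ) (u : X → F) :
    ∫⁻ x, ofReal (W x * ‖u x‖ ^ 2) ∂μ = ∫⁻ x, ofReal (W x) * ‖u x‖ₑ ^ 2 ∂μ := by
  refine lintegral_congr fun x => ?_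
  rw [ENNReal.ofReal_mul' (sq_nonneg _), ofReal_pow (norm_nonneg _), ofReal_norm]

lemma integrable_weight_sq {W : X → ℝ} (hW : AEMeasurable W μ) {u : X → F}
    (hu : AEStronglyMeasurable u μ) (h1 : ∫⁻ x, ofReal (W x) * ‖u x‖ₑ ^ 2 ∂μ ≠ ⊤)
    (h2 : ∫⁻ x, ofReal (-W x) * ‖u x‖ₑ ^ 2 ∂μ ≠ ⊤) :
    Integrable (fun x => W x * ‖u x‖ ^ 2) μ := by
  have hm : AEStronglyMeasurable (fun x => W x * ‖u x‖ ^ 2) μ :=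
    hW.aestronglyMeasurable.mul (hu.norm.pow 2)
  refine ⟨hm, ?_⟩
  rw [HasFiniteIntegral]
  have h3 : ∀ x, ‖W x * ‖u x‖ ^ 2‖ₑ = ofReal (W x) * ‖u x‖ₑ ^ 2 +
      ofReal (-W x) * ‖u x‖ₑ ^ 2 := by
    intro x
    rw [← add_mul, enorm_mul]
    congr 1
    · rw [Real.enorm_eq_ofReal_abs]
      rcases le_total 0 (W x) with h | h
      · rw [abs_of_nonneg h, ofReal_of_nonpos (neg_nonpos.2 h), add_zero]
      · rw [abs_of_nonpos h, ofReal_of_nonpos h, zero_add]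
    · rw [enorm_pow, enorm_norm]
  simp only [h3]
  have h4 : AEMeasurable (fun x => ofReal (W x) * ‖u x‖ₑ ^ 2) μ :=
    hW.ennreal_ofReal.mul (hu.enorm.pow_const 2)
  rw [lintegral_add_left' h4]
  exact ENNReal.add_lt_top.2 ⟨h1.lt_top, h2.lt_top⟩

lemma integrable_weight_inner {W : X → ℝ} (hW : AEMeasurable W μ) {u v : X → F}
    (hu : AEStronglyMeasurable u μ) (hv : AEStronglyMeasurable v μ)
    (iu : Integrable (fun x => W x * ‖u x‖ ^ 2) μ) (iv : Integrable (fun x => W x * ‖v x‖ ^ 2) μ) :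
    Integrable (fun x => (W x : ℂ) * ⟪v x, u x⟫) μ := by
  refine (iu.norm.add iv.norm).mono' ?_ (of_forall fun x => ?_)
  · exact (measurable_ofReal.comp_aemeasurable hW).aestronglyMeasurable.mul (hv.inner hu)
  · simp only [Pi.add_apply]
    rw [norm_mul, norm_mul, norm_mul, norm_real, ← mul_add]
    refine mul_le_mul_of_nonneg_left ?_ (norm_nonneg _)
    refine (norm_inner_le_norm _ _).trans ?_
    rw [norm_of_nonneg (sq_nonneg _), norm_of_nonneg (sq_nonneg _)]
    nlinarith [sq_nonneg (‖v x‖ - ‖u x‖), sq_nonneg ‖u x‖, sq_nonneg ‖v x‖]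

/-- The three derivatives together with multiplication by `√W`. -/
def gradWeightOps (D : Fin 3 → Submodule ℂ (Lp F 2 μ × Lp F 2 μ)) (W : X → ℝ) :
    Option (Fin 3) → Submodule ℂ (Lp F 2 μ × Lp F 2 μ)
  | none => weightGraph F μ W
  | some j => D j

lemma isClosedOp_gradWeightOps {D : Fin 3 → Submodule ℂ (Lp F 2 μ × Lp F 2 μ)}
    (hD : ∀ j, IsClosedOp (D j)) (W : X → ℝ) : ∀ i, IsClosedOp (gradWeightOps D W i)
  | none => isClosedOp_weightGraph W
  | some j => hD j

lemma inner_self_re (u : F) : ⟪u, u⟫ = ((‖u‖ ^ 2 : ℝ) : ℂ) := by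
  rw [inner_self_eq_norm_sq_to_K]; simp

lemma integral_mul_inner_self (W : X → ℝ) (u : X → F) :
    ∫ x, (W x : ℂ) * ⟪u x, u x⟫ ∂μ = ((∫ x, W x * ‖u x‖ ^ 2 ∂μ : ℝ) : ℂ) := by
  simp only [← integral_complex_ofReal, inner_self_re, Complex.ofReal_mul]

variable {D : Fin 3 → Submodule ℂ (Lp F 2 μ × Lp F 2 μ)} {W : X → ℝ}

/-- The negative part of `W` is relatively form bounded with respect to the gradients `D`, with
relative bound `ε`. -/
def NegFormBound (D : Fin 3 → Submodule ℂ (Lp F 2 μ × Lp F 2 μ)) (W : X → ℝ) (ε C : ℝ) : Prop :=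
  ∀ (u : Lp F 2 μ) (g : Fin 3 → Lp F 2 μ), (∀ j, (u, g j) ∈ D j) →
    ∫⁻ x, ofReal (-W x) * ‖u x‖ₑ ^ 2 ∂μ ≤
      ofReal (ε * ∑ j, ‖g j‖ ^ 2 + C * ‖u‖ ^ 2)

/-- The derivatives and the product with `√W` on the common domain. -/
abbrev gradWeightVal (hD : ∀ j, IsClosedOp (D j)) (W : X → ℝ) :=
  opVal (isClosedOp_gradWeightOps hD W)

lemma gradWeightVal_mem (hD : ∀ j, IsClosedOp (D j)) (u : opDomain (gradWeightOps D W))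
    (i : Option (Fin 3)) : (u.1, gradWeightVal hD W u i) ∈ gradWeightOps D W i := opVal_mem _ u i

lemma integrable_of_mem_opDomain (hD : ∀ j, IsClosedOp (D j)) (hW : AEMeasurable W μ) {ε C : ℝ}
    (hb : NegFormBound D W ε C) (u : opDomain (gradWeightOps D W)) :
    Integrable (fun x => W x * ‖u.1 x‖ ^ 2) μ := by
  refine integrable_weight_sq hW (memLp _).1
    ((exists_mem_weightGraph hW).1 (mem_opDomain.1 u.2 none)) ?_
  exact ((hb u _ (fun j => gradWeightVal_mem hD u (some j))).trans_lt
    ofReal_lt_top).ne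

/-- A form `∑_j ⟨∂_j v, ∂_j u⟩ + ∫ W ⟨v, u⟩` is closed on its natural domain if the negative part
of `W` has relative form bound less than one. -/
lemma closedForm_gradWeight (hD : ∀ j, IsClosedOp (D j)) (hW : AEMeasurable W μ) {ε C : ℝ}
    (hε : ε < 1) (hε0 : 0 ≤ ε) (hC : 0 ≤ C) (hb : NegFormBound D W ε C)
    (q : Lp F 2 μ → Lp F 2 μ → ℂ)
    (hq : ∀ v u : opDomain (gradWeightOps D W), q v u =
      ∑ j, ⟪gradWeightVal hD W v (some j), gradWeightVal hD W u (some j)⟫ +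
        ∫ x, (W x : ℂ) * ⟪v.1 x, u.1 x⟫ ∂μ) :
    ClosedForm (opDomain (gradWeightOps D W)) q (gradWeightVal hD W) := by
  set Q := opDomain (gradWeightOps D W)
  set J := gradWeightVal hD W
  have hint : ∀ v u : Q,
      Integrable (fun x => (W x : ℂ) * ⟪v.1 x, u.1 x⟫) μ :=
    fun v u => integrable_weight_inner hW (memLp _).1 (memLp _).1
      (integrable_of_mem_opDomain hD hW hb u) (integrable_of_mem_opDomain hD hW hb v)
  have hre : ∀ u : Q, ∃ b : ℝ, 0 ≤ b ∧ b ≤ ε * ∑ j, ‖J u (some j)‖ ^ 2 + C * ‖u.1‖ ^ 2 ∧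
      (q u u).re = ∑ j, ‖J u (some j)‖ ^ 2 + ‖J u none‖ ^ 2 - b := by
    intro u
    refine ⟨(∫⁻ x, ofReal (-W x) * ‖u.1 x‖ₑ ^ 2 ∂μ).toReal,
      toReal_nonneg, ?_, ?_⟩
    · refine ENNReal.toReal_le_of_le_ofReal (by positivity) ?_
      exact hb u _ (fun j => gradWeightVal_mem hD u (some j))
    · rw [hq]
      rw [integral_mul_inner_self, integral_eq_lintegral_pos_part_sub_lintegral_neg_part
        (integrable_of_mem_opDomain hD hW hb u), lintegral_ofReal_mul_eq]
      have h2 : ∀ x, -(W x * ‖u.1 x‖ ^ 2) = -W x * ‖u.1 x‖ ^ 2 :=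
        fun x => by ring
      simp only [h2]
      rw [lintegral_ofReal_mul_eq (fun x => -W x)]
      have h3 := norm_sq_of_mem_weightGraph (gradWeightVal_mem hD u none)
      rw [← h3, toReal_ofReal (sq_nonneg _)]
      simp only [inner_self_re, add_re, ofReal_re, ← ofReal_sum]
      ring
  have hJle : ∀ u : Q, ‖J u‖ ^ 2 ≤ ∑ j, ‖J u (some j)‖ ^ 2 + ‖J u none‖ ^ 2 := fun u => by
    refine (norm_opVal_sq_le (J u)).trans (le_of_eq ?_)
    rw [Fintype.sum_option, add_comm]
  have hJge : ∀ u : Q, ∑ j, ‖J u (some j)‖ ^ 2 + ‖J u none‖ ^ 2 ≤ 4 * ‖J u‖ ^ 2 := fun u => by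
    have h1 : ∀ i, ‖J u i‖ ^ 2 ≤ ‖J u‖ ^ 2 := fun i => by
      gcongr; exact norm_le_pi_norm (J u) i
    rw [Fin.sum_univ_three]
    linarith [h1 none, h1 (some 0), h1 (some 1), h1 (some 2)]
  exact
    { add_right := fun v hv u hu u' hu' => by
        have e := hq ⟨v, hv⟩ (⟨u, hu⟩ + ⟨u', hu'⟩)
        have h1 : ∫ x, (W x : ℂ) * ⟪v x, (u + u') x⟫ ∂μ = _ := (integral_congr_ae (by
          filter_upwards [coeFn_add u u'] with x hx
          rw [hx, Pi.add_apply, inner_add_right, mul_add])).trans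
            (integral_add (hint ⟨v, hv⟩ ⟨u, hu⟩) (hint ⟨v, hv⟩ ⟨u', hu'⟩))
        simp only [map_add, Pi.add_apply, inner_add_right, sum_add_distrib, coe_add] at e
        linear_combination e - hq ⟨v, hv⟩ ⟨u, hu⟩ - hq ⟨v, hv⟩ ⟨u', hu'⟩ + h1
      smul_right := fun v hv u hu a => by
        have e := hq ⟨v, hv⟩ (a • ⟨u, hu⟩)
        have h1 : ∫ x, (W x : ℂ) * ⟪v x, (a • u) x⟫ ∂μ = _ := (integral_congr_ae (by
          filter_upwards [coeFn_smul a u] with x hx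
          rw [hx, Pi.smul_apply, inner_smul_right, mul_left_comm])).trans
            (integral_const_mul a _)
        simp only [map_smul, Pi.smul_apply, inner_smul_right, ← mul_sum, coe_smul] at e
        linear_combination e - a * hq ⟨v, hv⟩ ⟨u, hu⟩ + h1
      symm := fun v hv u hu => by
        have e := hq ⟨v, hv⟩ ⟨u, hu⟩
        have e1 := hq ⟨u, hu⟩ ⟨v, hv⟩
        change q v u = _ at e
        change q u v = _ at e1
        rw [e, e1, map_add, map_sum, ← integral_conj]
        simp only [inner_conj_symm, map_mul, conj_ofReal]
      graph := opVal_graph _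
      lower := by
        refine ⟨C, 1 - ε, by linarith, fun u => ?_⟩
        obtain ⟨b, hb0, hb1, hb2⟩ := hre u
        have h1 := hJle u
        have h2 : (1 - ε) * ‖J u‖ ^ 2 ≤
            (1 - ε) * (∑ j, ‖J u (some j)‖ ^ 2 + ‖J u none‖ ^ 2) :=
          mul_le_mul_of_nonneg_left h1 (by linarith)
        have h3 : 0 ≤ ε * ‖J u none‖ ^ 2 := by positivity
        rw [hb2]
        linarith
      upper := by
        refine ⟨4, fun u => ?_⟩
        obtain ⟨b, hb0, hb1, hb2⟩ := hre u
        rw [hb2]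
        have := hJge u
        have h3 : 0 ≤ ‖u.1‖ ^ 2 := by positivity
        linarith }

end GradientForms

/-! ### The Schrödinger form -/

section Schrodinger

/-- A measurable potential whose negative part is form bounded, with arbitrarily small bound,
relative to `p²`. -/
class RegularPotential (V : E3 → ℝ) : Prop where
  meas : Measurable V
  bdd : NegPartFormBounded V

instance : RegularPotential 0 :=
  ⟨measurable_zero, fun _ _ => ⟨1, one_pos, by simp⟩⟩

variable {V : E3 → ℝ} [hV : RegularPotential V]

lemma coe_opDomain_schrodinger :
    (opDomain (gradWeightOps gradGraph V) : Set L2x) = schrodingerDomain V := by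
  ext u
  rw [SetLike.mem_coe, mem_opDomain]
  simp only [schrodingerDomain, sobolev1, Set.mem_ofPred_eq]
  rw [← exists_mem_weightGraph hV.meas.aemeasurable]
  constructor
  · intro h
    exact ⟨fun j => exists_mem_gradGraph.1 (h (some j)), h none⟩
  · rintro ⟨h1, h2⟩ (_ | j)
    · exact h2
    · exact exists_mem_gradGraph.2 (h1 j)

lemma partialX_ae_eq {j : Fin 3} {u g : L2x} (h : (u, g) ∈ gradGraph j) :
    partialX j u =ᵐ[volume] g := HasPartial.ae_eq h

lemma lintegral_partialX {j : Fin 3} {u g : L2x} (h : (u, g) ∈ gradGraph j) :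
    ∫⁻ x, ‖partialX j u x‖ₑ ^ 2 = ofReal (‖g‖ ^ 2) := by
  rw [norm_sq_eq_lintegral]
  exact lintegral_congr_ae ((partialX_ae_eq h).mono fun x hx => by simp only [hx])

lemma negFormBound_schrodinger {ε : ℝ} (hε : 0 < ε) :
    ∃ C, 0 < C ∧ NegFormBound gradGraph V ε C := by
  obtain ⟨C, hC, h⟩ := hV.bdd ε hε
  refine ⟨C, hC, fun u g hg => ?_⟩
  refine (h u fun j => ⟨g j, hg j⟩).trans (le_of_eq ?_)
  simp only [fun j => lintegral_partialX (hg j)]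
  rw [← norm_sq_eq_lintegral, ofReal_add (by positivity) (by positivity),
    ofReal_mul hε.le, ofReal_mul hC.le,
    ofReal_sum_of_nonneg fun j _ => sq_nonneg _]

lemma schrodingerForm_eq {u v : L2x} {gu gv : Fin 3 → L2x} (hu : ∀ j, (u, gu j) ∈ gradGraph j)
    (hv : ∀ j, (v, gv j) ∈ gradGraph j) :
    schrodingerForm V v u = ∑ j, ⟪gv j, gu j⟫ + ∫ x, (V x : ℂ) * ⟪v x, u x⟫ := by
  rw [schrodingerForm]
  congr 1
  refine sum_congr rfl fun j _ => ?_
  rw [L2.inner_def]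
  refine integral_congr_ae ?_
  filter_upwards [partialX_ae_eq (hu j), partialX_ae_eq (hv j)] with x h1 h2
  rw [h1, h2]

lemma closedForm_schrodinger :
    ClosedForm (opDomain (gradWeightOps gradGraph V)) (schrodingerForm V)
      (gradWeightVal isClosedOp_gradGraph V) := by
  obtain ⟨C, hC, hb⟩ := negFormBound_schrodinger (V := V) (ε := 1 / 2) (by norm_num)
  refine closedForm_gradWeight isClosedOp_gradGraph hV.meas.aemeasurable (by norm_num) (by norm_num)
    hC.le hb _ fun v u => ?_
  exact schrodingerForm_eq
    (fun j => gradWeightVal_mem isClosedOp_gradGraph u (some j))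
    (fun j => gradWeightVal_mem isClosedOp_gradGraph v (some j))

lemma schrodinger_ge {φ : L2x} {e₀ : ℝ}
    (hφ : IsGroundState V φ e₀) {u : L2x} (hu : u ∈ schrodingerDomain V) :
    -e₀ * ‖u‖ ^ 2 ≤ (schrodingerForm V u u).re := by
  have h := closedForm_schrodinger (V := V)
  have hne : φ ≠ 0 := fun h0 => by
    have := hφ.1; rw [h0, norm_zero] at this; norm_num at this
  have hmem : φ ∈ opDomain (gradWeightOps gradGraph V) := by
    have := hφ.2.1.1
    rwa [← coe_opDomain_schrodinger] at this
  have h1 := (h.exists_isLeast ⟨φ, hmem, hne⟩).1 u (by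
    rwa [← coe_opDomain_schrodinger] at hu)
  rwa [coe_opDomain_schrodinger, hφ.2.2] at h1

end Schrodinger

/-! ### Decay of the ground state and the commutator with the position -/

section Multipliers

variable {X F : Type*} [MeasurableSpace X] {μ : Measure X} [NormedAddCommGroup F]
  [InnerProductSpace ℂ F]

lemma tendsto_zero_of_sq {a : ℕ → ℝ≥0∞} (ha : Tendsto (fun n => a n ^ 2) atTop (𝓝 0)) :
    Tendsto a atTop (𝓝 0) := by
  have h6 := (ENNReal.continuous_rpow_const (y := (1 / 2 : ℝ))).tendsto 0 |>.comp ha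
  simp only [comp_def] at h6
  have h7 : ∀ n, (a n ^ 2) ^ (1 / 2 : ℝ) = a n := fun n => by
    rw [← rpow_natCast, ← rpow_mul]; simp
  simp only [h7] at h6
  simpa using h6

/-- Dominated convergence in `L²`. -/
lemma tendsto_eLpNorm_zero_of_dominated {h : ℕ → X → F} {b : X → ℝ} (hb : MemLp b 2 μ)
    (hm : ∀ n, AEStronglyMeasurable (h n) μ) (hle : ∀ n, ∀ᵐ x ∂μ, ‖h n x‖ ≤ b x)
    (hlim : ∀ᵐ x ∂μ, Tendsto (fun n => h n x) atTop (𝓝 0)) :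
    Tendsto (fun n => eLpNorm (h n) 2 μ) atTop (𝓝 0) := by
  refine tendsto_zero_of_sq ?_
  simp only [eLpNorm_two_sq]
  have h1 := tendsto_lintegral_of_dominated_convergence' (μ := μ) (F := fun n x => ‖h n x‖ₑ ^ 2)
    (f := fun _ => 0) (fun x => ‖b x‖ₑ ^ 2) (fun n => (hm n).enorm.pow_const 2) (fun n => ?_)
    ((memLp_two_iff hb.1).1 hb).ne ?_
  · simpa using h1
  · filter_upwards [hle n] with x hx
    gcongr
    refine enorm_le_iff_norm_le.2 (hx.trans (le_abs_self _))
  · filter_upwards [hlim] with x hx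
    have h2 := (continuous_enorm.tendsto (0 : F)).comp hx
    have h3 := ENNReal.Tendsto.pow (n := 2) h2
    simpa [comp_def] using h3

lemma memLp_bdd_smul {m : X → ℂ} {C : ℝ} (hm : AEStronglyMeasurable m μ) (hC : ∀ x, ‖m x‖ ≤ C)
    {u : X → F} (hu : MemLp u 2 μ) : MemLp (fun x => m x • u x) 2 μ :=
  hu.of_le_mul (c := C) (hm.smul hu.1) (of_forall fun x => by
    rw [norm_smul]; exact mul_le_mul_of_nonneg_right (hC x) (norm_nonneg _))

open Classical in
/-- The product `m u` as an element of `L²`, if it is square-integrable (and `0` otherwise). -/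
def mulLp (m : X → ℂ) (u : Lp F 2 μ) : Lp F 2 μ :=
  if h : MemLp (fun x => m x • u x) 2 μ then h.toLp _ else 0

lemma coeFn_mulLp {m : X → ℂ} {u : Lp F 2 μ} (h : MemLp (fun x => m x • u x) 2 μ) :
    mulLp m u =ᵐ[μ] fun x => m x • u x := by
  rw [mulLp, dif_pos h]; exact h.coeFn_toLp

lemma inner_mulLp_right {m : X → ℂ} {u : Lp F 2 μ} (h : MemLp (fun x => m x • u x) 2 μ)
    (v : Lp F 2 μ) : ⟪v, mulLp m u⟫ = ∫ x, m x * ⟪v x, u x⟫ ∂μ := by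
  rw [L2.inner_def]
  refine integral_congr_ae ?_
  filter_upwards [coeFn_mulLp h] with x hx
  rw [hx, inner_smul_right]

lemma inner_mulLp_left {m : X → ℂ} {u : Lp F 2 μ} (h : MemLp (fun x => m x • u x) 2 μ)
    (v : Lp F 2 μ) :
    ⟪mulLp m u, v⟫ = ∫ x, starRingEnd ℂ (m x) * ⟪u x, v x⟫ ∂μ := by
  rw [L2.inner_def]
  refine integral_congr_ae ?_
  filter_upwards [coeFn_mulLp h] with x hx
  rw [hx, inner_smul_left]

lemma inner_mulLp_real {m : X → ℝ} {u v : Lp F 2 μ} (h : MemLp (fun x => (m x : ℂ) • u x) 2 μ)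
    (h' : MemLp (fun x => (m x : ℂ) • v x) 2 μ) :
    ⟪mulLp (fun x => (m x : ℂ)) u, v⟫ = ⟪u, mulLp (fun x => (m x : ℂ)) v⟫ := by
  rw [inner_mulLp_left h, inner_mulLp_right h']
  simp only [conj_ofReal]

/-- Bounded pointwise convergence of multipliers gives convergence in `L²`. -/
lemma mulLp_sub {m m' : X → ℂ} {u : Lp F 2 μ} (h : MemLp (fun x => m x • u x) 2 μ)
    (h' : MemLp (fun x => m' x • u x) 2 μ) :
    mulLp (fun x => m x - m' x) u = mulLp m u - mulLp m' u := by
  have hd : MemLp (fun x => (m x - m' x) • u x) 2 μ := by simp only [sub_smul]; exact h.sub h'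
  rw [mulLp, mulLp, mulLp, dif_pos hd, dif_pos h, dif_pos h', ← MemLp.toLp_sub]
  exact MemLp.toLp_congr _ _ (of_forall fun x => sub_smul _ _ _)

lemma tendsto_mulLp {m : ℕ → X → ℝ} {m' : X → ℝ} {b : X → ℝ}
    (hm : ∀ n, AEStronglyMeasurable (m n) μ) (hm' : AEStronglyMeasurable m' μ) (u : Lp F 2 μ)
    (hb : MemLp (fun x => b x * ‖u x‖) 2 μ) (hle : ∀ n x, |m n x| ≤ b x) (hle' : ∀ x, |m' x| ≤ b x)
    (hlim : ∀ x, Tendsto (fun n => m n x) atTop (𝓝 (m' x))) :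
    Tendsto (fun n => mulLp (fun x => (m n x : ℂ)) u) atTop (𝓝 (mulLp (fun x => (m' x : ℂ)) u)) := by
  have hmem : ∀ {k : X → ℝ}, AEStronglyMeasurable k μ → (∀ x, |k x| ≤ b x) →
      MemLp (fun x => (k x : ℂ) • u x) 2 μ := fun {k} hk hkb =>
    hb.mono ((continuous_ofReal.comp_aestronglyMeasurable hk).smul (memLp u).1)
      (of_forall fun x => by
        rw [norm_smul, norm_real, norm_mul, norm_norm]
        gcongr
        exact (hkb x).trans (le_abs_self _))
  rw [Lp.tendsto_Lp_iff_tendsto_eLpNorm']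
  have h1 := tendsto_eLpNorm_zero_of_dominated (μ := μ)
    (h := fun n x => ((m n x : ℂ) - (m' x : ℂ)) • u x) (hb.const_mul 2)
    (fun n => ((continuous_ofReal.comp_aestronglyMeasurable (hm n)).sub
      (continuous_ofReal.comp_aestronglyMeasurable hm')).smul (memLp u).1)
    (fun n => of_forall fun x => by
      rw [norm_smul, ← ofReal_sub, norm_real, ← mul_assoc]
      gcongr
      rw [norm_eq_abs]
      calc |m n x - m' x| ≤ |m n x| + |m' x| := abs_sub _ _
        _ ≤ 2 * b x := by linarith [hle n x, hle' x])
    (of_forall fun x => by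
      have h2 := (continuous_ofReal.tendsto (m' x)).comp (hlim x)
      have h3 := (h2.sub_const (m' x : ℂ)).smul_const (u x)
      simpa using h3)
  refine h1.congr fun n => eLpNorm_congr_ae ?_
  filter_upwards [coeFn_mulLp (hmem (hm n) (hle n)), coeFn_mulLp (hmem hm' hle')] with x h2 h3
  rw [Pi.sub_apply, h2, h3, sub_smul]

end Multipliers

/-- A smooth cutoff `x_j / (1 + δ |x|²)` of the coordinate function `x_j`. -/
def cutX (j : Fin 3) (δ : ℝ) (x : E3) : ℝ := x j * (1 + δ * ‖x‖ ^ 2)⁻¹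

section CutX

variable {j : Fin 3} {δ : ℝ}

lemma contDiff_cutX (hδ : 0 ≤ δ) : ContDiff ℝ ∞ (cutX j δ) := by
  refine ContDiff.mul ?_ (ContDiff.inv ?_ fun x => ?_)
  · exact (proj (𝕜 := ℝ) j).contDiff
  · exact contDiff_const.add (contDiff_const.mul (contDiff_norm_sq ℝ))
  · positivity

lemma partial_cutX (hδ : 0 ≤ δ) (i : Fin 3) (x : E3) :
    fderiv ℝ (cutX j δ) x (single i 1) =
      (if j = i then 1 else 0) * (1 + δ * ‖x‖ ^ 2)⁻¹ -
        2 * δ * x i * x j * ((1 + δ * ‖x‖ ^ 2)⁻¹) ^ 2 := by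
  have hne : 1 + δ * ‖x‖ ^ 2 ≠ 0 := by positivity
  have h1 : HasFDerivAt (fun x : E3 => x j) (proj (𝕜 := ℝ) j) x :=
    (proj (𝕜 := ℝ) j : E3 →L[ℝ] ℝ).hasFDerivAt
  have h2 : HasFDerivAt (fun x : E3 => 1 + δ * ‖x‖ ^ 2) (δ • (2 • innerSL ℝ x)) x :=
    ((hasStrictFDerivAt_norm_sq x).hasFDerivAt.const_mul δ).const_add 1
  have h3 : HasFDerivAt (cutX j δ) _ x := h1.mul ((hasFDerivAt_inv hne).comp x h2)
  rw [h3.fderiv]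
  simp [inner_apply]
  by_cases hij : j = i
  · simp [hij]; field_simp; ring
  · simp [hij]; field_simp

lemma abs_coord_le (i : Fin 3) (x : E3) : |x i| ≤ ‖x‖ := by
  simpa using norm_apply_le x i

lemma one_add_pos (hδ : 0 ≤ δ) (x : E3) : 0 < 1 + δ * ‖x‖ ^ 2 := by positivity

lemma inv_one_add_le (hδ : 0 ≤ δ) (x : E3) : (1 + δ * ‖x‖ ^ 2)⁻¹ ≤ 1 :=
  inv_le_one_of_one_le₀ (by nlinarith [mul_nonneg hδ (sq_nonneg ‖x‖)])

lemma abs_cutX_le (hδ : 0 ≤ δ) (x : E3) : |cutX j δ x| ≤ |x j| := by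
  rw [cutX, abs_mul, abs_of_pos (inv_pos.2 (one_add_pos hδ x))]
  exact mul_le_of_le_one_right (abs_nonneg _) (inv_one_add_le hδ x)

lemma abs_cutX_le_const (hδ : 0 < δ) (x : E3) : |cutX j δ x| ≤ 1 + δ⁻¹ := by
  rw [cutX, abs_mul, abs_of_pos (inv_pos.2 (one_add_pos hδ.le x)), ← div_eq_mul_inv,
    div_le_iff₀ (one_add_pos hδ.le x)]
  have h1 := abs_coord_le j x
  have h2 : (1 + δ⁻¹) * (1 + δ * ‖x‖ ^ 2) = 1 + δ⁻¹ + δ * ‖x‖ ^ 2 + ‖x‖ ^ 2 := by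
    field_simp; ring
  have h3 : 0 < δ⁻¹ := inv_pos.2 hδ
  have h4 : 0 ≤ δ * ‖x‖ ^ 2 := by positivity
  nlinarith [sq_nonneg (‖x‖ - 1)]

lemma abs_partial_cutX_le (hδ : 0 ≤ δ) (i : Fin 3) (x : E3) :
    |fderiv ℝ (cutX j δ) x (single i 1)| ≤ 3 := by
  rw [partial_cutX hδ]
  have hp := one_add_pos hδ x
  have h1 : |(if j = i then 1 else 0) * (1 + δ * ‖x‖ ^ 2)⁻¹| ≤ 1 := by
    rw [abs_mul, abs_of_pos (inv_pos.2 hp)]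
    split_ifs
    · simpa using inv_one_add_le hδ x
    · simp
  have h2 : |2 * δ * x i * x j * ((1 + δ * ‖x‖ ^ 2)⁻¹) ^ 2| ≤ 2 := by
    rw [abs_mul, abs_of_pos (pow_pos (inv_pos.2 hp) 2), inv_pow, ← div_eq_mul_inv,
      div_le_iff₀ (pow_pos hp 2), abs_mul, abs_mul, abs_of_nonneg (by positivity : 0 ≤ 2 * δ)]
    have h3 : |x i| * |x j| ≤ ‖x‖ * ‖x‖ :=
      mul_le_mul (abs_coord_le i x) (abs_coord_le j x) (abs_nonneg _) (norm_nonneg _)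
    have h4 : 2 * δ * (|x i| * |x j|) ≤ 2 * δ * (‖x‖ * ‖x‖) :=
      mul_le_mul_of_nonneg_left h3 (by positivity)
    nlinarith [mul_nonneg hδ (sq_nonneg ‖x‖), sq_nonneg (δ * ‖x‖ ^ 2)]
  exact (abs_sub _ _).trans (by linarith)

lemma tendsto_cutX (x : E3) {δ : ℕ → ℝ} (hδ : Tendsto δ atTop (𝓝 0)) :
    Tendsto (fun n => cutX j (δ n) x) atTop (𝓝 (x j)) := by
  have hc : ContinuousAt (fun d : ℝ => cutX j d x) 0 := by
    refine continuousAt_const.mul (ContinuousAt.inv₀ (by fun_prop) (by simp))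
  have := hc.tendsto.comp hδ
  simpa [cutX, comp_def] using this

lemma tendsto_partial_cutX (x : E3) (i : Fin 3) {δ : ℕ → ℝ} (h0 : ∀ n, 0 ≤ δ n)
    (hδ : Tendsto δ atTop (𝓝 0)) :
    Tendsto (fun n => fderiv ℝ (cutX j (δ n)) x (single i 1)) atTop
      (𝓝 (if j = i then 1 else 0)) := by
  simp only [fun n => partial_cutX (j := j) (h0 n) i x]
  have hinv : ContinuousAt (fun d : ℝ => (1 + d * ‖x‖ ^ 2)⁻¹) 0 :=
    ContinuousAt.inv₀ (by fun_prop) (by simp)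
  have hc : ContinuousAt (fun d : ℝ => (if j = i then 1 else 0) * (1 + d * ‖x‖ ^ 2)⁻¹ -
        2 * d * x i * x j * ((1 + d * ‖x‖ ^ 2)⁻¹) ^ 2) 0 := by
    refine (continuousAt_const.mul hinv).sub (ContinuousAt.mul (by fun_prop) (hinv.pow 2))
  have := hc.tendsto.comp hδ
  simpa [comp_def] using this

end CutX

section GroundState

variable {V : E3 → ℝ} [hV : RegularPotential V]

/-- Product rule for `H¹` functions and bounded smooth multipliers. -/
lemma mem_gradGraph_mulLp {i : Fin 3} {u g : L2x} (h : (u, g) ∈ gradGraph i) {f : E3 → ℝ}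
    (hf : ContDiff ℝ ∞ f) {C C' : ℝ} (hC : ∀ x, |f x| ≤ C)
    (hC' : ∀ x, |fderiv ℝ f x (single i 1)| ≤ C') :
    (mulLp (fun x => (f x : ℂ)) u, mulLp (fun x => (f x : ℂ)) g +
      mulLp (fun x => (fderiv ℝ f x (single i 1) : ℂ)) u) ∈ gradGraph i := by
  have hfm : AEStronglyMeasurable (fun x => (f x : ℂ)) volume :=
    (continuous_ofReal.comp hf.continuous).aestronglyMeasurable
  have hfm' : AEStronglyMeasurable
      (fun x => (fderiv ℝ f x (single i 1) : ℂ)) (volume : Measure E3) :=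
    (continuous_ofReal.comp (contDiff_partial hf _).continuous).aestronglyMeasurable
  have m1 := memLp_bdd_smul hfm (C := C) (fun x => by rw [norm_real]; exact hC x)
    (memLp u)
  have m2 := memLp_bdd_smul hfm (C := C) (fun x => by rw [norm_real]; exact hC x)
    (memLp g)
  have m3 := memLp_bdd_smul hfm' (C := C') (fun x => by rw [norm_real]; exact hC' x)
    (memLp u)
  refine ⟨memLp _, ?_⟩
  refine (IsWeakPartial.mul h.2 (memLp u).locInt
    (memLp g).locInt hf).congr ?_ ?_
  · filter_upwards [coeFn_mulLp m1] with x hx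
    rw [hx, real_smul_eq]
  · filter_upwards [coeFn_add (mulLp (fun x => (f x : ℂ)) g)
      (mulLp (fun x => (fderiv ℝ f x (single i 1) : ℂ)) u), coeFn_mulLp m2,
      coeFn_mulLp m3] with x h1 h2 h3
    rw [h1, Pi.add_apply, h2, h3, real_smul_eq, real_smul_eq]

/-- The data of a bounded smooth multiplier with bounded first derivatives. -/
structure IsMultiplier (f : E3 → ℝ) (C C' : ℝ) : Prop where
  smooth : ContDiff ℝ ∞ f
  bound : ∀ x, |f x| ≤ C
  bound' : ∀ i x, |fderiv ℝ f x (single i 1)| ≤ C'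

lemma IsMultiplier.mul {f : E3 → ℝ} {C C' : ℝ} (hf : IsMultiplier f C C') (u : L2x) :
    MemLp (fun x => (f x : ℂ) • u x) 2 volume :=
  memLp_bdd_smul (m := fun x => (f x : ℂ))
    (continuous_ofReal.comp hf.smooth.continuous).aestronglyMeasurable (C := C)
    (fun x => by rw [norm_real]; exact hf.bound x) (memLp u)

lemma IsMultiplier.mul' {f : E3 → ℝ} {C C' : ℝ} (hf : IsMultiplier f C C') (i : Fin 3)
    (u : L2x) :
    MemLp (fun x => (fderiv ℝ f x (single i 1) : ℂ) • u x) 2 volume :=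
  memLp_bdd_smul (m := fun x => (fderiv ℝ f x (single i 1) : ℂ))
    (continuous_ofReal.comp (contDiff_partial hf.smooth _).continuous).aestronglyMeasurable (C := C')
    (fun x => by rw [norm_real]; exact hf.bound' i x) (memLp u)

/-- The form domain of `p² + V` as a subspace. -/
abbrev schrSpace (V : E3 → ℝ) : Submodule ℂ L2x := opDomain (gradWeightOps gradGraph V)

/-- The gradient and `√V₊` on the form domain of `p² + V`. -/
abbrev schrVal (V : E3 → ℝ) : schrSpace V →ₗ[ℂ] (Option (Fin 3) → L2x) :=
  gradWeightVal isClosedOp_gradGraph V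

lemma schrVal_mem (u : schrSpace V) (i : Fin 3) :
    (u.1, schrVal V u (some i)) ∈ gradGraph i :=
  gradWeightVal_mem isClosedOp_gradGraph u (some i)

lemma IsMultiplier.mem {f : E3 → ℝ} {C C' : ℝ} (hf : IsMultiplier f C C')
    (u : schrSpace V) : mulLp (fun x => (f x : ℂ)) (u : L2x) ∈ schrSpace V := by
  have hC : 0 ≤ C := (abs_nonneg _).trans (hf.bound 0)
  refine mem_opDomain.2 ?_
  rintro (_ | i)
  · refine (exists_mem_weightGraph hV.meas.aemeasurable).2 ?_
    have h1 := (exists_mem_weightGraph hV.meas.aemeasurable).1 (mem_opDomain.1 u.2 none)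
    have h2 : ∫⁻ x, ofReal (V x) * ‖mulLp (fun x => (f x : ℂ)) (u : L2x) x‖ₑ ^ 2 ≤
        ∫⁻ x, ofReal (C ^ 2) * (ofReal (V x) * ‖u.1 x‖ₑ ^ 2) := by
      refine lintegral_mono_ae ?_
      filter_upwards [coeFn_mulLp (hf.mul u)] with x hx
      rw [hx, enorm_smul, mul_pow]
      have h3 : ‖(f x : ℂ)‖ₑ ^ 2 ≤ ofReal (C ^ 2) := by
        rw [ofReal_pow hC, ← ofReal_norm, norm_real]
        gcongr
        exact hf.bound x
      calc _ ≤ ofReal (V x) * (ofReal (C ^ 2) * ‖u.1 x‖ₑ ^ 2) := by gcongr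
        _ = _ := by ring
    refine ne_top_of_le_ne_top ?_ h2
    rw [lintegral_const_mul' _ _ ofReal_ne_top]
    exact ENNReal.mul_ne_top ofReal_ne_top h1
  · exact ⟨_, mem_gradGraph_mulLp (schrVal_mem u i) hf.smooth hf.bound (hf.bound' i)⟩

lemma IsMultiplier.schrVal {f : E3 → ℝ} {C C' : ℝ}
    (hf : IsMultiplier f C C') (u : schrSpace V) (i : Fin 3) :
    PauliFierz.schrVal V ⟨_, hf.mem u⟩ (some i) =
      mulLp (fun x => (f x : ℂ)) (PauliFierz.schrVal V u (some i)) +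
      mulLp (fun x => (fderiv ℝ f x (single i 1) : ℂ)) (u : L2x) :=
  opVal_eq _ _ (some i) (mem_gradGraph_mulLp (schrVal_mem u i) hf.smooth hf.bound (hf.bound' i))

lemma schrodingerForm_eq' (v u : schrSpace V) : schrodingerForm V v u =
    ∑ j, ⟪schrVal V v (some j), schrVal V u (some j)⟫ +
      ∫ x, (V x : ℂ) * ⟪v.1 x, u.1 x⟫ :=
  schrodingerForm_eq (schrVal_mem u) (schrVal_mem v)

/-- A ground state as an element of the form domain. -/
lemma IsGroundState.mem {φ : L2x} {e₀ : ℝ} (hφ : IsGroundState V φ e₀) :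
    φ ∈ schrSpace V := by
  have := hφ.2.1.1
  rwa [← coe_opDomain_schrodinger] at this

/-- The gradient of a ground state. -/
abbrev IsGroundState.grad {φ : L2x} {e₀ : ℝ} (hφ : IsGroundState V φ e₀) (j : Fin 3) : L2x :=
  schrVal V ⟨φ, hφ.mem⟩ (some j)

lemma IsGroundState.form_eq {φ : L2x} {e₀ : ℝ} (hφ : IsGroundState V φ e₀)
    (v : schrSpace V) : schrodingerForm V v φ = -e₀ * ⟪v.1, φ⟫ := by
  have h1 := hφ.2.1.2 v (by rw [← coe_opDomain_schrodinger]; exact v.2)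
  rw [h1, inner_smul_right]

/-- The commutator of `p² + V` with a multiplication operator, applied to the ground state. -/
lemma schrodingerForm_mul {φ : L2x} {e₀ : ℝ}
    (hφ : IsGroundState V φ e₀) {f : E3 → ℝ} {C C' : ℝ} (hf : IsMultiplier f C C')
    (v : schrSpace V) :
    schrodingerForm V v (mulLp (fun x => (f x : ℂ)) φ) + e₀ * ⟪v.1, mulLp (fun x => (f x : ℂ)) φ⟫ =
      ∑ i, (⟪schrVal V v (some i), mulLp (fun x => (fderiv ℝ f x (single i 1) : ℂ)) φ⟫ -
        ⟪mulLp (fun x => (fderiv ℝ f x (single i 1) : ℂ)) (v : L2x), hφ.grad i⟫) := by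
  have h1 := hφ.form_eq ⟨_, hf.mem v⟩
  have h2 := schrodingerForm_eq' ⟨_, hf.mem v⟩ ⟨φ, hφ.mem⟩
  have h3 := schrodingerForm_eq' v ⟨_, hf.mem ⟨φ, hφ.mem⟩⟩
  have h4 : ∫ x, (V x : ℂ) * ⟪mulLp (fun x => (f x : ℂ)) (v : L2x) x, φ x⟫ =
      ∫ x, (V x : ℂ) * ⟪v.1 x, mulLp (fun x => (f x : ℂ)) φ x⟫ := by
    refine integral_congr_ae ?_
    filter_upwards [coeFn_mulLp (hf.mul φ), coeFn_mulLp (hf.mul v)] with x a b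
    rw [a, b, inner_smul_left, inner_smul_right, conj_ofReal]
  have h7 : ∀ i, schrVal V ⟨mulLp (fun x => (f x : ℂ)) φ, hf.mem ⟨φ, hφ.mem⟩⟩ (some i) = _ :=
    fun i => hf.schrVal ⟨φ, hφ.mem⟩ i
  simp only [hf.schrVal, inner_add_left, sum_add_distrib] at h2
  simp only [h7, inner_add_right, sum_add_distrib] at h3
  rw [h4] at h2
  rw [h3, sum_sub_distrib]
  have h5 : ⟪mulLp (fun x => (f x : ℂ)) (v : L2x), φ⟫ =
      ⟪v.1, mulLp (fun x => (f x : ℂ)) φ⟫ := inner_mulLp_real (hf.mul v) (hf.mul φ)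
  have h6 : ∀ i, ⟪mulLp (fun x => (f x : ℂ)) (schrVal V v (some i)), hφ.grad i⟫ = ⟪schrVal V v (some i), mulLp (fun x => (f x : ℂ)) (hφ.grad i)⟫ := fun i =>
    inner_mulLp_real (hf.mul _) (hf.mul _)
  simp only [h6] at h2
  rw [h2] at h1
  simp only [h5] at h1
  linear_combination h1

lemma norm_inner_symm_re (a b : L2x) : ⟪a, b⟫.re = ⟪b, a⟫.re := by
  rw [← inner_conj_symm, Complex.conj_re]

/-- The energy of `f φ` above the ground state is `∫ |∇f|² |φ|²`. -/
lemma schrodingerForm_mul_self {φ : L2x} {e₀ : ℝ}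
    (hφ : IsGroundState V φ e₀) {f : E3 → ℝ} {C C' : ℝ} (hf : IsMultiplier f C C') :
    (schrodingerForm V (mulLp (fun x => (f x : ℂ)) φ) (mulLp (fun x => (f x : ℂ)) φ)).re +
      e₀ * ‖mulLp (fun x => (f x : ℂ)) φ‖ ^ 2 =
      ∑ i, ‖mulLp (fun x => (fderiv ℝ f x (single i 1) : ℂ)) φ‖ ^ 2 := by
  have h1 := congrArg Complex.re
    (schrodingerForm_mul hφ hf ⟨_, hf.mem ⟨φ, hφ.mem⟩⟩)
  rw [add_re, re_ofReal_mul, inner_self_re, ofReal_re] at h1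
  rw [h1, re_sum]
  refine sum_congr rfl fun i _ => ?_
  rw [hf.schrVal, sub_re, inner_add_left, add_re, inner_self_re,
    ofReal_re]
  have h2 : ⟪mulLp (fun x => (f x : ℂ)) (hφ.grad i), mulLp (fun x => (fderiv ℝ f x (single i 1) : ℂ)) φ⟫ =
      ⟪hφ.grad i, mulLp (fun x => (fderiv ℝ f x (single i 1) : ℂ)) (mulLp (fun x => (f x : ℂ)) φ)⟫ := by
    rw [inner_mulLp_left (hf.mul _), inner_mulLp_right (hf.mul' i _)]
    refine integral_congr_ae ?_
    filter_upwards [coeFn_mulLp (hf.mul' i φ), coeFn_mulLp (hf.mul φ)] with x a b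
    rw [a, b, inner_smul_right, inner_smul_right, conj_ofReal]
    ring
  rw [h2, norm_inner_symm_re]
  change _ + _ - ⟪mulLp (fun x => (fderiv ℝ f x (single i 1) : ℂ)) (mulLp (fun x => (f x : ℂ)) φ), hφ.grad i⟫.re = _
  ring

/-- The lower bound `∫ (V + e₀) |u|² ≤ ⟨u, (p² + V + e₀) u⟩`. -/
lemma integral_le_schrodingerForm (u : schrSpace V) :
    ∫ x, V x * ‖u.1 x‖ ^ 2 ≤ (schrodingerForm V u u).re := by
  rw [schrodingerForm_eq', integral_mul_inner_self]
  simp only [inner_self_re, add_re, ofReal_re, ← ofReal_sum]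
  have : 0 ≤ ∑ j, ‖schrVal V u (some j)‖ ^ 2 := sum_nonneg fun i _ => sq_nonneg _
  linarith

lemma norm_sq_eq_integral {X F : Type*} [MeasurableSpace X] {μ : Measure X} [NormedAddCommGroup F]
    [InnerProductSpace ℂ F] (u : Lp F 2 μ) : ‖u‖ ^ 2 = ∫ x, ‖u x‖ ^ 2 ∂μ := by
  have h := inner_self_re u
  rw [L2.inner_def] at h
  simp only [inner_self_re] at h
  rw [integral_complex_ofReal] at h
  exact_mod_cast h.symm

lemma isMultiplier_cutX (j : Fin 3) {δ : ℝ} (hδ : 0 < δ) : IsMultiplier (cutX j δ) (1 + δ⁻¹) 3 :=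
  ⟨contDiff_cutX hδ.le, abs_cutX_le_const hδ, fun i x => abs_partial_cutX_le hδ.le i x⟩

lemma measurable_max_neg : Measurable fun x => max (-(V x)) 0 :=
  hV.meas.neg.max measurable_const

/-- The ground state has a finite second moment: the energy of `x_j φ`, suitably cut off, is
bounded, while `V₋ ≤ e₀ / 2` far out. -/
lemma exists_cutX_bound (hV2 : Tendsto (fun x => max (-(V x)) 0) (cocompact E3) (𝓝 0)) {φ : L2x} {e₀ : ℝ} [he₀ : Fact (0 < e₀)] (hφ : IsGroundState V φ e₀) (j : Fin 3) :
    ∃ B : ℝ, ∀ δ : ℝ, 0 < δ → ‖mulLp (fun x => (cutX j δ x : ℂ)) φ‖ ^ 2 ≤ B := by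
  obtain ⟨K, hK, hKV⟩ := mem_cocompact.1 (hV2.eventually (gt_mem_nhds (half_pos he₀.out)))
  obtain ⟨R, hR⟩ := hK.isBounded.subset_closedBall 0
  have hneg : Integrable (fun x => max (-(V x)) 0 * ‖φ x‖ ^ 2) volume := by
    obtain ⟨C, hC, hb⟩ := negFormBound_schrodinger (V := V) (ε := 1 / 2) (by norm_num)
    refine integrable_weight_sq measurable_max_neg.aemeasurable (memLp φ).1 ?_ ?_
    · have h1 := hb φ _ (schrVal_mem ⟨φ, hφ.mem⟩)
      refine ne_top_of_le_ne_top ofReal_ne_top (le_trans (le_of_eq ?_) h1)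
      refine lintegral_congr fun x => ?_
      congr 1
      rcases le_total (-(V x)) 0 with h | h
      · rw [max_eq_right h, ofReal_of_nonpos h, ENNReal.ofReal_zero]
      · rw [max_eq_left h]
    · have : ∀ x, ofReal (-max (-(V x)) 0) = 0 := fun x =>
        ofReal_of_nonpos (neg_nonpos.2 (le_max_right _ _))
      simp [this]
  set N := ∫ x, max (-(V x)) 0 * ‖φ x‖ ^ 2
  refine ⟨(27 + R ^ 2 * N) / (e₀ / 2), fun δ hδ => ?_⟩
  have hf := isMultiplier_cutX j hδ
  have hu := hf.mem ⟨φ, hφ.mem⟩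
  obtain ⟨C, hC, hb⟩ := negFormBound_schrodinger (V := V) (ε := 1 / 2) (by norm_num)
  have e1 := schrodingerForm_mul_self hφ hf
  have e2 := integral_le_schrodingerForm ⟨_, hu⟩
  change ∫ x, V x * ‖mulLp (fun x => (cutX j δ x : ℂ)) φ x‖ ^ 2 ≤
    (schrodingerForm V (mulLp (fun x => (cutX j δ x : ℂ)) φ)
      (mulLp (fun x => (cutX j δ x : ℂ)) φ)).re at e2
  have e3 : ∑ i, ‖mulLp (fun x => (fderiv ℝ (cutX j δ) x (single i 1) : ℂ)) φ‖ ^ 2 ≤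
      27 := by
    have h1 : ∀ i, ‖mulLp (fun x => (fderiv ℝ (cutX j δ) x (single i 1) : ℂ)) φ‖ ≤
        3 := fun i => by
      have := Lp.norm_le_mul_norm_of_ae_le_mul (c := 3)
        (f := mulLp (fun x => (fderiv ℝ (cutX j δ) x (single i 1) : ℂ)) φ) (g := φ) (by
          filter_upwards [coeFn_mulLp (hf.mul' i φ)] with x hx
          rw [hx, norm_smul, norm_real]
          exact mul_le_mul_of_nonneg_right (hf.bound' i x) (norm_nonneg _))
      rwa [hφ.1, mul_one] at this
    have h2 : ∀ i, ‖mulLp (fun x => (fderiv ℝ (cutX j δ) x (single i 1) : ℂ)) φ‖ ^ 2 ≤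
        3 ^ 2 := fun i => by gcongr; exact h1 i
    rw [Fin.sum_univ_three]
    linarith [h2 0, h2 1, h2 2]
  have e4 : -(e₀ / 2) * ‖mulLp (fun x => (cutX j δ x : ℂ)) φ‖ ^ 2 - R ^ 2 * N ≤
      ∫ x, V x * ‖mulLp (fun x => (cutX j δ x : ℂ)) φ x‖ ^ 2 := by
    rw [norm_sq_eq_integral, ← integral_const_mul, ← integral_const_mul,
      ← integral_sub ((memLp _).integrable_norm_pow (by norm_num) |>.const_mul _)
        (hneg.const_mul _)]
    refine integral_mono_ae (((memLp _).integrable_norm_pow (by norm_num) |>.const_mul _).sub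
        (hneg.const_mul _)) (integrable_of_mem_opDomain isClosedOp_gradGraph hV.meas.aemeasurable hb
          ⟨_, hu⟩) ?_
    filter_upwards [coeFn_mulLp (hf.mul φ)] with x hx
    rw [hx, norm_smul, norm_real, mul_pow, norm_eq_abs, sq_abs]
    set t := cutX j δ x ^ 2 * ‖φ x‖ ^ 2 with ht
    have ht0 : 0 ≤ t := by positivity
    have hVm : -max (-(V x)) 0 ≤ V x := by linarith [le_max_left (-(V x)) 0]
    by_cases hxK : x ∈ K
    · have h1 : t ≤ R ^ 2 * ‖φ x‖ ^ 2 := by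
        refine mul_le_mul_of_nonneg_right ?_ (sq_nonneg _)
        have h2 := hR hxK
        rw [mem_closedBall_zero_iff] at h2
        rw [← sq_abs (cutX j δ x)]
        gcongr
        exact (abs_cutX_le hδ.le x).trans ((abs_coord_le j x).trans h2)
      have h3 : 0 ≤ max (-(V x)) 0 := le_max_right _ _
      nlinarith [mul_le_mul_of_nonneg_left h1 h3, mul_nonneg he₀.out.le ht0,
        mul_le_mul_of_nonneg_right hVm ht0]
    · have h1 := hKV hxK
      change max (-(V x)) 0 < e₀ / 2 at h1
      have h3 : 0 ≤ max (-(V x)) 0 := le_max_right _ _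
      have h4 : 0 ≤ R ^ 2 * (max (-(V x)) 0 * ‖φ x‖ ^ 2) := by positivity
      nlinarith [mul_le_mul_of_nonneg_right hVm ht0, mul_le_mul_of_nonneg_right h1.le ht0]
  rw [le_div_iff₀ (half_pos he₀.out)]
  nlinarith

lemma memLp_coord_smul (hV2 : Tendsto (fun x => max (-(V x)) 0) (cocompact E3) (𝓝 0)) {φ : L2x} {e₀ : ℝ} [he₀ : Fact (0 < e₀)] (hφ : IsGroundState V φ e₀) (j : Fin 3) :
    MemLp (fun x : E3 => ((x j : ℝ) : ℂ) • φ x) 2 volume := by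
  obtain ⟨B, hB⟩ := exists_cutX_bound hV2 hφ j
  let δ : ℕ → ℝ := fun n => 1 / ((n : ℝ) + 1)
  have hδpos : ∀ n, 0 < δ n := fun n => by positivity
  have hδ0 : Tendsto δ atTop (𝓝 0) := tendsto_one_div_add_atTop_nhds_zero_nat
  have hcont : Continuous fun x : E3 => x j := (proj (𝕜 := ℝ) j).continuous
  have hm : AEStronglyMeasurable (fun x : E3 => ((x j : ℝ) : ℂ) • φ x) volume :=
    (continuous_ofReal.comp hcont).aestronglyMeasurable.smul (memLp φ).1
  rw [memLp_two_iff hm]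
  have hlim : ∀ x : E3, Tendsto (fun n => ‖((cutX j (δ n) x : ℝ) : ℂ) • φ x‖ₑ ^ 2) atTop
      (𝓝 (‖((x j : ℝ) : ℂ) • φ x‖ₑ ^ 2)) := fun x =>
    ENNReal.Tendsto.pow ((((continuous_ofReal.tendsto _).comp
      (tendsto_cutX x hδ0)).smul_const (φ x)).enorm)
  calc ∫⁻ x, ‖((x j : ℝ) : ℂ) • φ x‖ₑ ^ 2
      = ∫⁻ x, liminf (fun n => ‖((cutX j (δ n) x : ℝ) : ℂ) • φ x‖ₑ ^ 2) atTop :=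
        lintegral_congr fun x => (hlim x).liminf_eq.symm
    _ ≤ liminf (fun n => ∫⁻ x, ‖((cutX j (δ n) x : ℝ) : ℂ) • φ x‖ₑ ^ 2) atTop :=
        lintegral_liminf_le' fun n =>
          ((isMultiplier_cutX j (hδpos n)).mul φ).1.enorm.pow_const 2
    _ ≤ ofReal B := by
        refine liminf_le_of_frequently_le' (Eventually.frequently (of_forall fun n => ?_))
        have h1 : ∫⁻ x, ‖((cutX j (δ n) x : ℝ) : ℂ) • φ x‖ₑ ^ 2 =
            ofReal (‖mulLp (fun x => (cutX j (δ n) x : ℂ)) φ‖ ^ 2) := by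
          rw [norm_sq_eq_lintegral]
          refine lintegral_congr_ae ?_
          filter_upwards [coeFn_mulLp ((isMultiplier_cutX j (hδpos n)).mul φ)] with x hx
          rw [hx]
        rw [h1]
        exact ofReal_le_ofReal (hB _ (hδpos n))
    _ < ⊤ := ofReal_lt_top

/-- The function `x_j φ` lies in the form domain and `(p² + V + e₀) x_j φ = -2 ∂_j φ`. -/
lemma coord_groundState (hV2 : Tendsto (fun x => max (-(V x)) 0) (cocompact E3) (𝓝 0)) {φ : L2x} {e₀ : ℝ} [he₀ : Fact (0 < e₀)] (hφ : IsGroundState V φ e₀) (j : Fin 3) :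
    mulLp (fun x : E3 => ((x j : ℝ) : ℂ)) φ ∈ schrSpace V ∧ ∀ v : schrSpace V,
      schrodingerForm V v (mulLp (fun x : E3 => ((x j : ℝ) : ℂ)) φ) +
        e₀ * ⟪v.1, mulLp (fun x : E3 => ((x j : ℝ) : ℂ)) φ⟫ =
      -2 * ⟪v.1, hφ.grad j⟫ := by
  have hmem := memLp_coord_smul hV2 hφ j
  let δ : ℕ → ℝ := fun n => 1 / ((n : ℝ) + 1)
  have hδpos : ∀ n, 0 < δ n := fun n => by positivity
  have hδ0 : Tendsto δ atTop (𝓝 0) := tendsto_one_div_add_atTop_nhds_zero_nat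
  have hcont : Continuous fun x : E3 => x j := (proj (𝕜 := ℝ) j).continuous
  have hM : ∀ n, IsMultiplier (cutX j (δ n)) (1 + (δ n)⁻¹) 3 := fun n =>
    isMultiplier_cutX j (hδpos n)
  have hQ := closedForm_schrodinger (V := V)
  let S : L2x → L2x → ℂ := fun v u => schrodingerForm V v u - ((-e₀ : ℝ) : ℂ) * ⟪v, u⟫
  have hS : ClosedForm (schrSpace V) S (schrVal V) := hQ.shift (-e₀)
  have hSpos : ∀ u ∈ schrSpace V, 0 ≤ (S u u).re := fun u hu => by
    have h1 := schrodinger_ge hφ (u := u) (by rwa [← coe_opDomain_schrodinger])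
    have h2 := ClosedForm.re_shift (q := schrodingerForm V) (-e₀) u
    change 0 ≤ (schrodingerForm V u u - ((-e₀ : ℝ) : ℂ) * ⟪u, u⟫).re
    rw [h2]; linarith
  let w : ℕ → schrSpace V := fun n => ⟨_, (hM n).mem ⟨φ, hφ.mem⟩⟩
  have hSw : ∀ v n, S v (w n) = schrodingerForm V v (mulLp (fun x => (cutX j (δ n) x : ℂ)) φ) +
      e₀ * ⟪v, mulLp (fun x => (cutX j (δ n) x : ℂ)) φ⟫ := fun v n => by
    change schrodingerForm V v (mulLp (fun x => (cutX j (δ n) x : ℂ)) φ) - _ * ⟪_, mulLp (fun x => (cutX j (δ n) x : ℂ)) φ⟫ = _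
    push_cast; ring
  have hwt : Tendsto (fun n => (w n : L2x)) atTop
      (𝓝 (mulLp (fun x : E3 => ((x j : ℝ) : ℂ)) φ)) := by
    refine tendsto_mulLp (b := fun x : E3 => |x j|)
      (fun n => (hM n).smooth.continuous.aestronglyMeasurable) hcont.aestronglyMeasurable φ ?_
      (fun n x => abs_cutX_le (hδpos n).le x) (fun x => le_rfl) (fun x => tendsto_cutX x hδ0)
    have h1 := hmem.norm
    refine h1.congr_norm ?_ (of_forall fun x => ?_)
    · exact (hcont.abs.aestronglyMeasurable).mul (memLp φ).1.norm
    · simp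
  have hgrad : ∀ i (u : L2x), Tendsto
      (fun n => mulLp (fun x => (fderiv ℝ (cutX j (δ n)) x (single i 1) : ℂ)) u) atTop
      (𝓝 (mulLp (fun _ => (((if j = i then 1 else 0 : ℝ)) : ℂ)) u)) := fun i u => by
    refine tendsto_mulLp (b := fun _ => 3) (fun n =>
      (contDiff_partial (hM n).smooth _).continuous.aestronglyMeasurable)
      aestronglyMeasurable_const u ((memLp u).norm.const_mul 3) (fun n x => (hM n).bound' i x)
      (fun x => ?_) (fun x => tendsto_partial_cutX x i (fun n => (hδpos n).le) hδ0)
    split_ifs <;> norm_num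
  have hconst : ∀ i (u : L2x), mulLp (fun _ => (((if j = i then 1 else 0 : ℝ)) : ℂ)) u =
      (((if j = i then 1 else 0 : ℝ)) : ℂ) • u := fun i u => by
    refine Lp.ext ?_
    filter_upwards [coeFn_mulLp (memLp_bdd_smul (m := fun _ => (((if j = i then 1 else 0 : ℝ)) : ℂ))
      aestronglyMeasurable_const (C := ‖(((if j = i then 1 else 0 : ℝ)) : ℂ)‖) (fun _ => le_rfl)
      (memLp u)), coeFn_smul (((if j = i then 1 else 0 : ℝ)) : ℂ) u] with x a b
    rw [a, b, Pi.smul_apply]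
  -- the cutoffs of `x_j φ` form a Cauchy sequence for the form norm
  let G : ℕ → Fin 3 → L2x := fun n i =>
    mulLp (fun x => (fderiv ℝ (cutX j (δ n)) x (single i 1) : ℂ)) φ
  have hdiff : ∀ p : ℕ × ℕ, (S (w p.1 - w p.2) (w p.1 - w p.2)).re ≤
      ∑ i, ‖G p.1 i - G p.2 i‖ ^ 2 := fun ⟨m, n⟩ => by
    have hfd : ∀ i x, fderiv ℝ (fun x => cutX j (δ m) x - cutX j (δ n) x) x
        (single i 1) = fderiv ℝ (cutX j (δ m)) x (single i 1) -
          fderiv ℝ (cutX j (δ n)) x (single i 1) := fun i x => by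
      rw [fderiv_fun_sub ((hM m).smooth.differentiable (by simp) x)
        ((hM n).smooth.differentiable (by simp) x)]
      rfl
    have hf : IsMultiplier (fun x => cutX j (δ m) x - cutX j (δ n) x)
        ((1 + (δ m)⁻¹) + (1 + (δ n)⁻¹)) (3 + 3) :=
      ⟨(hM m).smooth.sub (hM n).smooth,
        fun x => (abs_sub _ _).trans (add_le_add ((hM m).bound x) ((hM n).bound x)), fun i x => by
          rw [hfd]; exact (abs_sub _ _).trans (add_le_add ((hM m).bound' i x) ((hM n).bound' i x))⟩
    have h1 := schrodingerForm_mul_self hφ hf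
    simp only [hfd, ofReal_sub, mulLp_sub ((hM m).mul φ) ((hM n).mul φ),
      mulLp_sub ((hM m).mul' _ φ) ((hM n).mul' _ φ)] at h1
    refine le_of_eq (Eq.trans ?_ h1)
    rw [← sub_neg_eq_add, ← neg_mul]
    exact ClosedForm.re_shift (q := schrodingerForm V) (-e₀) _
  have c0 : ∀ {a : ℕ → L2x} {x}, Tendsto a atTop (𝓝 x) →
      Tendsto (fun p : ℕ × ℕ => ‖a p.1 - a p.2‖ ^ 2) atTop (𝓝 0) := fun {a x} ha => by
    simpa using (cauchySeq_iff_tendsto_sub.1 ha.cauchySeq).norm.pow 2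
  -- the cutoffs of `x_j φ` converge for the form norm
  obtain ⟨hxQ, hy⟩ := hS.exists_tendsto hwt
    (by simpa using tendsto_finsetSum Finset.univ fun i _ => c0 (hgrad i φ)) hdiff
  refine ⟨hxQ, fun v => ?_⟩
  have hlim1 := hS.tendsto_right hSpos v.2 (x := ⟨_, hxQ⟩) hwt hy
  have hlim2 : Tendsto (fun n => S v (w n)) atTop
      (𝓝 (∑ i, (⟪schrVal V v (some i), (((if j = i then 1 else 0 : ℝ)) : ℂ) • φ⟫ -
        ⟪(((if j = i then 1 else 0 : ℝ)) : ℂ) • (v : L2x), hφ.grad i⟫))) := by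
    simp only [hSw, schrodingerForm_mul hφ (hM _) v]
    refine tendsto_finsetSum _ fun i _ => ?_
    rw [← hconst i, ← hconst i]
    exact (tendsto_const_nhds.inner (hgrad i φ)).sub ((hgrad i v).inner tendsto_const_nhds)
  have h1 := tendsto_nhds_unique hlim1 hlim2
  have h2 : ∑ i, (⟪schrVal V v (some i), (((if j = i then 1 else 0 : ℝ)) : ℂ) • φ⟫ -
        ⟪(((if j = i then 1 else 0 : ℝ)) : ℂ) • (v : L2x), hφ.grad i⟫) =
      ⟪schrVal V v (some j), φ⟫ - ⟪v.1, hφ.grad j⟫ := by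
    rw [Finset.sum_eq_single j]
    · simp
    · intro i _ hij
      simp [hij.symm]
    · simp
  have h3 : ⟪schrVal V v (some j), φ⟫ =
      -⟪v.1, hφ.grad j⟫ := by
    rw [L2.inner_def, L2.inner_def]
    exact (schrVal_mem v j).2.integral_inner (schrVal_mem ⟨φ, hφ.mem⟩ j).2 (memLp _)
      (memLp _) (memLp _) (memLp _)
  rw [h2, h3] at h1
  have h4 : S v (mulLp (fun x : E3 => ((x j : ℝ) : ℂ)) φ) =
      schrodingerForm V v (mulLp (fun x : E3 => ((x j : ℝ) : ℂ)) φ) +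
        e₀ * ⟪v.1, mulLp (fun x : E3 => ((x j : ℝ) : ℂ)) φ⟫ := by
    simp only [S]; push_cast; ring
  rw [← h4]
  refine h1.trans ?_
  ring

end GroundState

/-! ### Forms with parameters -/

lemma ClosedForm.restrict {H K : Type*} [NormedAddCommGroup H] [InnerProductSpace ℂ H]
    [NormedAddCommGroup K] [NormedSpace ℂ K] {Q : Submodule ℂ H} {q : H → H → ℂ}
    {J : Q →ₗ[ℂ] K} (h : ClosedForm Q q J) (S : Submodule ℂ H) :
    ClosedForm (Q.comap S.subtype) (fun v u => q v u)
      (J ∘ₗ (S.subtype.restrict (p := Q.comap S.subtype) (q := Q) fun _ hx => hx)) where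
  add_right v hv u hu u' hu' := h.add_right v hv u hu u' hu'
  smul_right v hv u hu a := h.smul_right v hv u hu a
  symm v hv u hu := h.symm v hv u hu
  graph u x y hu hy := by
    obtain ⟨h1, h2⟩ := h.graph (fun n => ⟨u n, (u n).2⟩) x y
      ((continuous_subtype_val.tendsto x).comp hu) hy
    exact ⟨h1, h2⟩
  lower := by
    obtain ⟨c, δ, hδ, h1⟩ := h.lower
    exact ⟨c, δ, hδ, fun u => h1 ⟨u, u.2⟩⟩
  upper := by
    obtain ⟨C, h1⟩ := h.upper
    exact ⟨C, fun u => h1 ⟨u, u.2⟩⟩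

section ParamForm

variable {Y F : Type*} [MeasurableSpace Y] {ν : Measure Y} [SFinite ν] [NormedAddCommGroup F]
  [InnerProductSpace ℂ F] [NormedSpace ℝ F] [IsScalarTower ℝ ℂ F] [CompleteSpace F]

lemma sum_enorm_sq_coord [FiniteDimensional ℂ F] (v : F) :
    ∑ i, ‖⟪stdOrthonormalBasis ℂ F i, v⟫‖ₑ ^ 2 = ‖v‖ₑ ^ 2 := by
  simp only [← ofReal_norm, ← ofReal_pow (norm_nonneg _)]
  rw [← ofReal_sum_of_nonneg fun _ _ => sq_nonneg _,
    OrthonormalBasis.sum_sq_norm_inner_right]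

/-- An inequality between quadratic forms in `x` extends to functions that depend on parameters
and have values in a finite-dimensional space. -/
lemma lintegral_le_of_fiber [FiniteDimensional ℂ F] {U : E3 → ℝ≥0∞} (hU : Measurable U)
    {ε C : ℝ≥0∞} (hε : ε ≠ ⊤) (hC : C ≠ ⊤)
    (h : ∀ v ∈ sobolev1, ∫⁻ x, U x * ‖v x‖ₑ ^ 2 ≤
      ε * (∑ j, ∫⁻ x, ‖partialX j v x‖ₑ ^ 2) + C * ∫⁻ x, ‖v x‖ₑ ^ 2)
    {u : Lp F 2 (vol× ν)} {g : Fin 3 → E3 × Y → F}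
    (hg : ∀ j, HasPartialParam ν j u (g j)) :
    ∫⁻ z, U z.1 * ‖u z‖ₑ ^ 2 ∂(vol× ν) ≤
      ε * (∑ j, ∫⁻ z, ‖g j z‖ₑ ^ 2 ∂(vol× ν)) + C * ∫⁻ z, ‖u z‖ₑ ^ 2 ∂(vol× ν) := by
  have m0 : AEMeasurable (fun z => ‖u z‖ₑ ^ 2) (vol× ν) :=
    (memLp u).1.enorm.pow_const 2
  have m2 : AEMeasurable (fun z => U z.1 * ‖u z‖ₑ ^ 2) (vol× ν) :=
    (hU.comp measurable_fst).aemeasurable.mul m0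
  have m3 : ∀ j, AEMeasurable (fun z => ‖g j z‖ₑ ^ 2) (vol× ν) := fun j =>
    (hg j).1.1.enorm.pow_const 2
  have hj : ∀ j, ∫⁻ z, ‖g j z‖ₑ ^ 2 ∂(vol× ν) =
      ∫⁻ y, ∫⁻ x, ‖g j (x, y)‖ₑ ^ 2 ∂volume ∂ν := fun j => lintegral_prod_symm _ (m3 j)
  rw [lintegral_prod_symm _ m0, lintegral_prod_symm _ m2]
  simp only [hj]
  have m4 : ∀ j, AEMeasurable (fun y => ∫⁻ x, ‖g j (x, y)‖ₑ ^ 2 ∂volume) ν :=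
    fun j => (m3 j).prod_swap.lintegral_prod_right'
  have m5 : AEMeasurable (fun y => ε * ∑ j, ∫⁻ x, ‖g j (x, y)‖ₑ ^ 2 ∂volume) ν :=
    (Finset.aemeasurable_fun_sum _ fun j _ => m4 j).const_mul ε
  rw [← lintegral_finsetSum' _ fun j _ => m4 j,
    ← lintegral_const_mul' _ _ hε, ← lintegral_const_mul' _ _ hC, ← lintegral_add_left' m5]
  refine lintegral_mono_ae ?_
  filter_upwards [ae_memLp_fiber (memLp u), ae_all_iff.2 fun j => ae_memLp_fiber (hg j).1,
    ae_all_iff.2 fun j => (hg j).2] with y h1 h2 h3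
  let T : Fin (Module.finrank ℂ F) → F →L[ℝ] ℂ := fun i =>
    (innerSL ℂ (stdOrthonormalBasis ℂ F i)).restrictScalars ℝ
  have hT : ∀ i v, T i v = ⟪stdOrthonormalBasis ℂ F i, v⟫ := fun i v => rfl
  have mu : ∀ i, MemLp (fun x => T i (u (x, y))) 2 volume := fun i => (T i).comp_memLp' h1
  have mg : ∀ i j, MemLp (fun x => T i (g j (x, y))) 2 volume := fun i j => (T i).comp_memLp' (h2 j)
  have hp : ∀ i j, HasPartial j ((mu i).toLp _) (fun x => T i (g j (x, y))) := fun i j =>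
    ⟨mg i j, ((h3 j).clm (T i) h1.locInt
      (h2 j).locInt).congr (mu i).coeFn_toLp.symm EventuallyEq.rfl⟩
  have h4 : ∀ i, ∫⁻ x, U x * ‖T i (u (x, y))‖ₑ ^ 2 ≤
      ε * (∑ j, ∫⁻ x, ‖T i (g j (x, y))‖ₑ ^ 2) + C * ∫⁻ x, ‖T i (u (x, y))‖ₑ ^ 2 := fun i => by
    have h5 := h ((mu i).toLp _) fun j => ⟨_, hp i j⟩
    have e1 : ∀ W : E3 → ℝ≥0∞, ∫⁻ x, W x * ‖(mu i).toLp _ x‖ₑ ^ 2 =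
        ∫⁻ x, W x * ‖T i (u (x, y))‖ₑ ^ 2 := fun W =>
      lintegral_congr_ae ((mu i).coeFn_toLp.mono fun x hx => by simp only [hx])
    have e2 : ∀ j, ∫⁻ x, ‖partialX j ((mu i).toLp _) x‖ₑ ^ 2 = ∫⁻ x, ‖T i (g j (x, y))‖ₑ ^ 2 :=
      fun j => lintegral_congr_ae ((hp i j).ae_eq.mono fun x hx => by simp only [hx])
    have e3 := e1 1
    simp only [Pi.one_apply, one_mul] at e3
    rw [e1, e3] at h5
    simpa only [e2] using h5
  have mT : ∀ {f : E3 → F} (_ : MemLp f 2 volume) i, AEMeasurable (fun x => ‖T i (f x)‖ₑ ^ 2) volume :=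
    fun hf i => ((T i).comp_memLp' hf).1.enorm.pow_const 2
  have hsum : ∀ (W : E3 → ℝ≥0∞) (_ : Measurable W) (f : E3 → F) (_ : MemLp f 2 volume),
      ∫⁻ x, W x * ‖f x‖ₑ ^ 2 = ∑ i, ∫⁻ x, W x * ‖T i (f x)‖ₑ ^ 2 := fun W hW f hf => by
    have m6 : ∀ i, AEMeasurable (fun x => W x * ‖T i (f x)‖ₑ ^ 2) volume := fun i =>
      hW.aemeasurable.mul (mT hf i)
    rw [← lintegral_finsetSum' _ fun i _ => m6 i]
    refine lintegral_congr fun x => ?_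
    rw [← mul_sum]
    simp only [hT]
    rw [sum_enorm_sq_coord]
  have hsum1 : ∀ (f : E3 → F) (_ : MemLp f 2 volume),
      ∫⁻ x, ‖f x‖ₑ ^ 2 = ∑ i, ∫⁻ x, ‖T i (f x)‖ₑ ^ 2 := fun f hf => by
    simpa only [one_mul] using hsum (fun _ => 1) measurable_const f hf
  change ∫⁻ x, U x * ‖u (x, y)‖ₑ ^ 2 ≤ ε * (∑ j, ∫⁻ x, ‖g j (x, y)‖ₑ ^ 2) +
    C * ∫⁻ x, ‖u (x, y)‖ₑ ^ 2
  rw [hsum U hU _ h1, hsum1 _ h1]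
  simp only [fun j => hsum1 _ (h2 j)]
  rw [Finset.sum_comm, mul_sum, mul_sum, ← sum_add_distrib]
  exact sum_le_sum fun i _ => h4 i

/-- A measurable non-negative energy of the second variable. -/
class EnergyWeight (m : Y → ℝ) : Prop where
  meas : Measurable m
  nonneg : ∀ y, 0 ≤ m y

variable {V : E3 → ℝ} [hV : RegularPotential V] {m : Y → ℝ} [hm : EnergyWeight m]

lemma lintegral_neg_le_param [FiniteDimensional ℂ F] {ε : ℝ} (hε : 0 < ε) :
    ∃ C : ℝ, 0 < C ∧ ∀ (u : Lp F 2 (vol× ν))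
      (g : Fin 3 → Lp F 2 (vol× ν)), (∀ j, (u, g j) ∈ gradGraphParam F ν j) →
      ∫⁻ z, ofReal (-(V z.1)) * ‖u z‖ₑ ^ 2 ∂(vol× ν) ≤
        ofReal (ε * ∑ j, ‖g j‖ ^ 2 + C * ‖u‖ ^ 2) := by
  obtain ⟨C, hC, h⟩ := hV.bdd ε hε
  refine ⟨C, hC, fun u g hg => ?_⟩
  refine (lintegral_le_of_fiber hV.meas.neg.ennreal_ofReal ofReal_ne_top ofReal_ne_top h
    (g := fun j => g j) hg).trans (le_of_eq ?_)
  simp only [← norm_sq_eq_lintegral]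
  rw [ofReal_add (by positivity) (by positivity), ofReal_mul hε.le, ofReal_mul hC.le,
    ofReal_sum_of_nonneg fun j _ => sq_nonneg _]

/-- The weight `V(x) + m(y)`. -/
def weightVm (V : E3 → ℝ) (m : Y → ℝ) (z : E3 × Y) : ℝ := V z.1 + m z.2

lemma measurable_weightVm :
    Measurable (weightVm V m) :=
  (hV.meas.comp measurable_fst).add (hm.meas.comp measurable_snd)

lemma negFormBound_param [FiniteDimensional ℂ F] {ε : ℝ} (hε : 0 < ε) :
    ∃ C : ℝ, 0 < C ∧ NegFormBound (gradGraphParam F ν) (weightVm V m) ε C := by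
  obtain ⟨C, hC, h⟩ := lintegral_neg_le_param (V := V) (F := F) (ν := ν) hε
  refine ⟨C, hC, fun u g hg => le_trans (lintegral_mono fun z => ?_) (h u g hg)⟩
  gcongr
  simp only [weightVm]
  linarith [hm.nonneg z.2]

/-- The form domain of `p² + V(x) + m(y)`. -/
abbrev paramSpace (F : Type*) [NormedAddCommGroup F] [InnerProductSpace ℂ F] [NormedSpace ℝ F]
    [IsScalarTower ℝ ℂ F] [CompleteSpace F] (ν : Measure Y) [SFinite ν] (V : E3 → ℝ) (m : Y → ℝ) :
    Submodule ℂ (Lp F 2 (vol× ν)) :=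
  opDomain (gradWeightOps (gradGraphParam F ν) (weightVm V m))

/-- The gradient and the square root of the positive part of the weight. -/
abbrev paramVal (F : Type*) [NormedAddCommGroup F] [InnerProductSpace ℂ F] [NormedSpace ℝ F]
    [IsScalarTower ℝ ℂ F] [CompleteSpace F] (ν : Measure Y) [SFinite ν] (V : E3 → ℝ) (m : Y → ℝ) :
    paramSpace F ν V m →ₗ[ℂ] (Option (Fin 3) → Lp F 2 (vol× ν)) :=
  gradWeightVal isClosedOp_gradGraphParam (weightVm V m)

lemma paramVal_mem (u : paramSpace F ν V m) (j : Fin 3) :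
    (u.1, paramVal F ν V m u (some j)) ∈
      gradGraphParam F ν j :=
  gradWeightVal_mem isClosedOp_gradGraphParam u (some j)

lemma lintegral_neg_ne_top [FiniteDimensional ℂ F] {u : Lp F 2 (vol× ν)}
    (hu : ∀ j, ∃ g, (u, g) ∈ gradGraphParam F ν j) :
    ∫⁻ z, ofReal (-(V z.1)) * ‖u z‖ₑ ^ 2 ∂(vol× ν) ≠ ⊤ := by
  obtain ⟨C, hC, h⟩ := lintegral_neg_le_param (V := V) (F := F) (ν := ν) one_pos
  choose g hg using hu
  exact ne_top_of_le_ne_top ofReal_ne_top (h u g hg)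

/-- On the form domain both parts of the weight have finite integrals. -/
lemma mem_paramSpace [FiniteDimensional ℂ F]
    {u : Lp F 2 (vol× ν)} :
    u ∈ paramSpace F ν V m ↔ (∀ j, ∃ g, (u, g) ∈ gradGraphParam F ν j) ∧
      ∫⁻ z, ofReal (m z.2) * ‖u z‖ₑ ^ 2 ∂(vol× ν) ≠ ⊤ ∧
      ∫⁻ z, ofReal (V z.1) * ‖u z‖ₑ ^ 2 ∂(vol× ν) ≠ ⊤ := by
  have m0 : AEMeasurable (fun z => ‖u z‖ₑ ^ 2) (vol× ν) :=
    (memLp u).1.enorm.pow_const 2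
  have hwm := measurable_weightVm (V := V) (m := m)
  rw [mem_opDomain]
  constructor
  · intro h
    have h1 : ∀ j, ∃ g, (u, g) ∈ gradGraphParam F ν j := fun j => h (some j)
    have h2 := (exists_mem_weightGraph hwm.aemeasurable).1 (h none)
    have h3 := lintegral_neg_ne_top (V := V) h1
    refine ⟨h1, ?_, ?_⟩
    · refine ne_top_of_le_ne_top (ENNReal.add_ne_top.2 ⟨h2, h3⟩) ?_
      rw [← lintegral_add_left' (f := fun z => ofReal (weightVm V m z) * ‖u z‖ₑ ^ 2)
        (hwm.ennreal_ofReal.aemeasurable.mul m0)]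
      refine lintegral_mono fun z => ?_
      rw [← add_mul]
      gcongr
      refine (ofReal_le_ofReal ?_).trans ofReal_add_le
      simp only [weightVm]; linarith
    · refine ne_top_of_le_ne_top h2 (lintegral_mono fun z => ?_)
      gcongr
      simp only [weightVm]; linarith [hm.nonneg z.2]
  · rintro ⟨h1, h2, h3⟩ (_ | j)
    · refine (exists_mem_weightGraph hwm.aemeasurable).2 ?_
      refine ne_top_of_le_ne_top (ENNReal.add_ne_top.2 ⟨h3, h2⟩) ?_
      rw [← lintegral_add_left' (f := fun z : E3 × Y => ofReal (V z.1) * ‖u z‖ₑ ^ 2)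
        ((hV.meas.comp measurable_fst).ennreal_ofReal.aemeasurable.mul m0)]
      refine lintegral_mono fun z => ?_
      rw [← add_mul]
      gcongr
      exact ofReal_add_le
    · exact h1 j

lemma integrable_V_sq [FiniteDimensional ℂ F]
    {u : Lp F 2 (vol× ν)} (hu : u ∈ paramSpace F ν V m) :
    Integrable (fun z => V z.1 * ‖u z‖ ^ 2) (vol× ν) :=
  integrable_weight_sq (hV.meas.comp measurable_fst).aemeasurable (memLp u).1
    (mem_paramSpace.1 hu).2.2
    (lintegral_neg_ne_top (mem_paramSpace.1 hu).1)

lemma integrable_m_sq [FiniteDimensional ℂ F]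
    {u : Lp F 2 (vol× ν)} (hu : u ∈ paramSpace F ν V m) :
    Integrable (fun z => m z.2 * ‖u z‖ ^ 2) (vol× ν) :=
  integrable_weight_sq (hm.meas.comp measurable_snd).aemeasurable (memLp u).1
    (mem_paramSpace.1 hu).2.1 (by
      simp [fun z : E3 × Y => ofReal_of_nonpos (neg_nonpos.2 (hm.nonneg z.2))])

lemma partialParam_ae_eq {j : Fin 3} {u g : Lp F 2 (vol× ν)}
    (h : (u, g) ∈ gradGraphParam F ν j) :
    partialParam ν j u =ᵐ[vol× ν] g := HasPartialParam.ae_eq h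

lemma closedForm_param [FiniteDimensional ℂ F]
    (q : Lp F 2 (vol× ν) → Lp F 2 (vol× ν) → ℂ)
    (hq : ∀ v u, q v u = (∑ j, ∫ z, ⟪partialParam ν j v z, partialParam ν j u z⟫
        ∂(vol× ν)) +
      ∫ z, (weightVm V m z : ℂ) * ⟪v z, u z⟫ ∂(vol× ν)) :
    ClosedForm (paramSpace F ν V m) q (paramVal F ν V m) := by
  obtain ⟨C, hC, hb⟩ := negFormBound_param (V := V) (F := F) (ν := ν) (m := m)
    (ε := 1 / 2) (by norm_num)
  refine closedForm_gradWeight isClosedOp_gradGraphParam measurable_weightVm.aemeasurable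
    (by norm_num) (by norm_num) hC.le hb _ fun v u => ?_
  rw [hq]
  congr 1
  refine sum_congr rfl fun j _ => ?_
  rw [L2.inner_def]
  refine integral_congr_ae ?_
  filter_upwards [partialParam_ae_eq (paramVal_mem u j), partialParam_ae_eq (paramVal_mem v j)]
    with x h1 h2
  rw [h1, h2]

end ParamForm

/-! ### Tensor products and multiplication operators in the parameters -/

section Tensors

variable {Y : Type*} [MeasurableSpace Y] {ν : Measure Y} [SFinite ν]

lemma memLp_tensor {ψ : E3 → ℂ} {g : Y → ℂ} (hψ : MemLp ψ 2 volume) (hg : MemLp g 2 ν) :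
    MemLp (fun z : E3 × Y => g z.2 * ψ z.1) 2 (vol× ν) := by
  have hm : AEStronglyMeasurable (fun z : E3 × Y => g z.2 * ψ z.1) (vol× ν) :=
    hg.1.comp_snd.mul hψ.1.comp_fst
  rw [memLp_two_iff hm]
  have h1 : ∀ z : E3 × Y, ‖g z.2 * ψ z.1‖ₑ ^ 2 = ‖ψ z.1‖ₑ ^ 2 * ‖g z.2‖ₑ ^ 2 := fun z => by
    rw [enorm_mul, mul_pow, mul_comm]
  simp only [h1]
  rw [lintegral_prod_mul (f := fun x => ‖ψ x‖ₑ ^ 2) (g := fun y => ‖g y‖ₑ ^ 2)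
    (hψ.1.enorm.pow_const 2) (hg.1.enorm.pow_const 2)]
  exact mul_lt_top ((memLp_two_iff hψ.1).1 hψ) ((memLp_two_iff hg.1).1 hg)

open Classical in
/-- The function `(x, y) ↦ g(y) ψ(x)` as an element of `L²`. -/
def tensLp (g : Y → ℂ) (hg : MemLp g 2 ν) (ψ : L2x) : Lp ℂ 2 (vol× ν) :=
  (memLp_tensor (memLp ψ) hg).toLp _

lemma coeFn_tensLp {g : Y → ℂ} (hg : MemLp g 2 ν) (ψ : L2x) :
    tensLp g hg ψ =ᵐ[vol× ν] fun z => g z.2 * ψ z.1 :=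
  (memLp_tensor (memLp ψ) hg).coeFn_toLp

lemma tensLp_mem_gradGraph {g : Y → ℂ} (hg : MemLp g 2 ν) {j : Fin 3} {ψ η : L2x}
    (h : (ψ, η) ∈ gradGraph j) : (tensLp g hg ψ, tensLp g hg η) ∈ gradGraphParam ℂ ν j := by
  refine ⟨memLp _, ?_⟩
  have h1 : IsWeakPartialParam ν j (fun z : E3 × Y => g z.2 * ψ z.1) (fun z => g z.2 * η z.1) :=
    of_forall fun y => by
      have := h.2.clm (((g y) • (1 : ℂ →L[ℂ] ℂ)).restrictScalars ℝ)
        (memLp ψ).locInt (memLp η).locInt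
      exact this
  exact h1.congr (coeFn_tensLp hg ψ).symm (coeFn_tensLp hg η).symm

variable {V : E3 → ℝ} [hV : RegularPotential V] {m : Y → ℝ} [hm : EnergyWeight m]

lemma tensLp_mem {g : Y → ℂ} (hg : MemLp g 2 ν)
    (hmg : ∫⁻ y, ofReal (m y) * ‖g y‖ₑ ^ 2 ∂ν ≠ ⊤) (ψ : schrSpace V) :
    tensLp g hg ψ ∈ paramSpace ℂ ν V m := by
  rw [mem_paramSpace]
  have h0 : ∀ z : E3 × Y, ‖g z.2 * (ψ : L2x) z.1‖ₑ ^ 2 = ‖(ψ : L2x) z.1‖ₑ ^ 2 * ‖g z.2‖ₑ ^ 2 :=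
    fun z => by rw [enorm_mul, mul_pow, mul_comm]
  refine ⟨fun j => ⟨_, tensLp_mem_gradGraph hg (schrVal_mem ψ j)⟩, ?_, ?_⟩
  · have h1 : ∫⁻ z, ofReal (m z.2) * ‖tensLp g hg ψ z‖ₑ ^ 2 ∂(vol× ν) =
        ∫⁻ z : E3 × Y, ‖(ψ : L2x) z.1‖ₑ ^ 2 * (ofReal (m z.2) * ‖g z.2‖ₑ ^ 2)
          ∂(vol× ν) := by
      refine lintegral_congr_ae ((coeFn_tensLp hg ψ).mono fun z hz => ?_)
      simp only [hz, h0]; ring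
    rw [h1, lintegral_prod_mul (f := fun x => ‖(ψ : L2x) x‖ₑ ^ 2)
      (g := fun y => ofReal (m y) * ‖g y‖ₑ ^ 2) ((memLp _).1.enorm.pow_const 2)
      (hm.meas.ennreal_ofReal.aemeasurable.mul (hg.1.enorm.pow_const 2))]
    exact ENNReal.mul_ne_top ((memLp_two_iff (memLp _).1).1 (memLp _)).ne hmg
  · have h1 : ∫⁻ z, ofReal (V z.1) * ‖tensLp g hg ψ z‖ₑ ^ 2 ∂(vol× ν) =
        ∫⁻ z : E3 × Y, (ofReal (V z.1) * ‖(ψ : L2x) z.1‖ₑ ^ 2) * ‖g z.2‖ₑ ^ 2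
          ∂(vol× ν) := by
      refine lintegral_congr_ae ((coeFn_tensLp hg ψ).mono fun z hz => ?_)
      simp only [hz, h0]; ring
    rw [h1, lintegral_prod_mul (f := fun x => ofReal (V x) * ‖(ψ : L2x) x‖ₑ ^ 2)
      (g := fun y => ‖g y‖ₑ ^ 2)
      (hV.meas.ennreal_ofReal.aemeasurable.mul ((memLp _).1.enorm.pow_const 2))
      (hg.1.enorm.pow_const 2)]
    refine ENNReal.mul_ne_top ?_ ((memLp_two_iff hg.1).1 hg).ne
    exact (exists_mem_weightGraph hV.meas.aemeasurable).1 (mem_opDomain.1 ψ.2 none)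

lemma paramVal_tensLp {g : Y → ℂ} (hg : MemLp g 2 ν) (ψ : schrSpace V)
    (h : tensLp g hg ψ ∈ paramSpace ℂ ν V m) (j : Fin 3) :
    paramVal ℂ ν V m ⟨_, h⟩ (some j) = tensLp g hg (schrVal V ψ (some j)) :=
  opVal_eq _ _ (some j) (tensLp_mem_gradGraph hg (schrVal_mem ψ j))

lemma mulY_mem_gradGraph {f : Y → ℝ} (hf : Measurable f) {C : ℝ} (hC : ∀ y, |f y| ≤ C) {j : Fin 3}
    {u g : Lp ℂ 2 (vol× ν)} (h : (u, g) ∈ gradGraphParam ℂ ν j) :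
    (mulLp (fun z => (f z.2 : ℂ)) u, mulLp (fun z => (f z.2 : ℂ)) g) ∈ gradGraphParam ℂ ν j := by
  have hfm : AEStronglyMeasurable (fun z : E3 × Y => (f z.2 : ℂ)) (vol× ν) :=
    (measurable_ofReal.comp (hf.comp measurable_snd)).aestronglyMeasurable
  have hb : ∀ z : E3 × Y, ‖(f z.2 : ℂ)‖ ≤ C := fun z => by
    rw [norm_real]; exact hC _
  refine ⟨memLp _, ?_⟩
  have h2 : IsWeakPartialParam ν j u g := h.2
  exact (h2.const_smul (memLp u) (memLp g) fun y => (f y : ℂ)).congr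
    (coeFn_mulLp (memLp_bdd_smul hfm hb (memLp u))).symm
    (coeFn_mulLp (memLp_bdd_smul hfm hb (memLp g))).symm

lemma memLp_mulY {f : Y → ℝ} (hf : Measurable f) {C : ℝ} (hC : ∀ y, |f y| ≤ C)
    (u : Lp ℂ 2 (vol× ν)) :
    MemLp (fun z : E3 × Y => (f z.2 : ℂ) • u z) 2 (vol× ν) :=
  memLp_bdd_smul (m := fun z : E3 × Y => (f z.2 : ℂ))
    (measurable_ofReal.comp (hf.comp measurable_snd)).aestronglyMeasurable (C := C)
    (fun z => by rw [norm_real]; exact hC _) (memLp u)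

lemma mulY_mem {f : Y → ℝ} (hf : Measurable f) {C : ℝ} (hC : ∀ y, |f y| ≤ C)
    (u : paramSpace ℂ ν V m) : mulLp (fun z => (f z.2 : ℂ)) u.1 ∈ paramSpace ℂ ν V m := by
  obtain ⟨h1, h2, h3⟩ := mem_paramSpace.1 u.2
  have key : ∀ W : E3 × Y → ℝ≥0∞, ∫⁻ z, W z * ‖u.1 z‖ₑ ^ 2 ∂(vol× ν) ≠ ⊤ →
      ∫⁻ z, W z * ‖mulLp (fun z => (f z.2 : ℂ)) u.1 z‖ₑ ^ 2 ∂(vol× ν) ≠ ⊤ := fun W hW => by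
    refine ne_top_of_le_ne_top (ENNReal.mul_ne_top (a := ofReal (C ^ 2)) ofReal_ne_top hW) ?_
    rw [← lintegral_const_mul' _ _ ofReal_ne_top]
    refine lintegral_mono_ae ?_
    filter_upwards [coeFn_mulLp (memLp_mulY hf hC u.1)] with z hz
    have h5 : ‖(f z.2 : ℂ)‖ₑ ^ 2 ≤ ofReal (C ^ 2) := by
      rw [ofReal_pow ((abs_nonneg _).trans (hC z.2)), ← ofReal_norm, norm_real]
      gcongr
      exact hC _
    rw [hz, enorm_smul, mul_pow, mul_left_comm]
    gcongr
  refine mem_paramSpace.2 ⟨fun j => ?_, key _ h2, key _ h3⟩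
  obtain ⟨g, hg⟩ := h1 j
  exact ⟨_, mulY_mem_gradGraph hf hC hg⟩

/-- The form of `(p² + V + e₀) ⊗ 1`. -/
def electronForm (V : E3 → ℝ) {m : Y → ℝ} (e₀ : ℝ) (v u : paramSpace ℂ ν V m) : ℂ :=
  ∑ j, ⟪paramVal ℂ ν V m v (some j), paramVal ℂ ν V m u (some j)⟫ +
    ∫ z, (V z.1 : ℂ) * ⟪v.1 z, u.1 z⟫ ∂(vol× ν) + e₀ * ⟪v.1, u.1⟫

/-- Almost every fiber of a vector in the form domain lies in the form domain of `p² + V`. -/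
lemma ae_exists_fiber (v : paramSpace ℂ ν V m) : ∀ᵐ y ∂ν, ∃ a : schrSpace V,
    a.1 =ᵐ[volume] (fun x => v.1 (x, y)) ∧
      ∀ j, schrVal V a (some j) =ᵐ[volume] fun x => paramVal ℂ ν V m v (some j) (x, y) := by
  obtain ⟨-, -, hVt⟩ := mem_paramSpace.1 v.2
  have mVt : AEMeasurable (fun z : E3 × Y => ofReal (V z.1) * ‖v.1 z‖ₑ ^ 2) (vol× ν) :=
    (hV.meas.comp measurable_fst).ennreal_ofReal.aemeasurable.mul ((memLp _).1.enorm.pow_const 2)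
  rw [lintegral_prod_symm _ mVt] at hVt
  filter_upwards [ae_memLp_fiber (memLp v.1),
    ae_all_iff.2 fun j => ae_memLp_fiber (memLp (paramVal ℂ ν V m v (some j))),
    ae_all_iff.2 fun j => (paramVal_mem v j).2,
    ae_lt_top' mVt.prod_swap.lintegral_prod_right' hVt] with y h1 h2 h3 h4
  have hw : ∀ j, (h1.toLp _, (h2 j).toLp _) ∈ gradGraph j := fun j =>
    ⟨memLp _, (h3 j).congr h1.coeFn_toLp.symm (h2 j).coeFn_toLp.symm⟩
  have hwm : h1.toLp _ ∈ schrSpace V := by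
    refine mem_opDomain.2 ?_
    rintro (_ | j)
    · refine (exists_mem_weightGraph hV.meas.aemeasurable).2 ?_
      refine ne_top_of_le_ne_top h4.ne (le_of_eq (lintegral_congr_ae ?_))
      filter_upwards [h1.coeFn_toLp] with x hx
      simp only [hx, Prod.swap_prod_mk]
    · exact ⟨_, hw j⟩
  refine ⟨⟨_, hwm⟩, h1.coeFn_toLp, fun j => ?_⟩
  have h5 : schrVal V ⟨_, hwm⟩ (some j) = (h2 j).toLp _ := opVal_eq _ _ (some j) (hw j)
  rw [h5]; exact (h2 j).coeFn_toLp

/-- The form of `(p² + V + e₀) ⊗ 1` is the integral of the forms of `p² + V + e₀` of the fibers. -/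
lemma electronForm_fiber (e₀ : ℝ) (v u : paramSpace ℂ ν V m) : ∃ I : Y → ℂ,
    electronForm V e₀ v u = ∫ y, I y ∂ν ∧ ∀ᵐ y ∂ν, ∃ a b : schrSpace V,
      a.1 =ᵐ[volume] (fun x => v.1 (x, y)) ∧ b.1 =ᵐ[volume] (fun x => u.1 (x, y)) ∧
        I y = schrodingerForm V a b + e₀ * ⟪a.1, b.1⟫ := by
  have iV : Integrable (fun z => (V z.1 : ℂ) * ⟪v.1 z, u.1 z⟫) (vol× ν) :=
    integrable_weight_inner (W := fun z : E3 × Y => V z.1) (hV.meas.comp measurable_fst).aemeasurable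
      (memLp _).1 (memLp _).1 (integrable_V_sq u.2) (integrable_V_sq v.2)
  have iL : ∀ a b : Lp ℂ 2 (vol× ν), Integrable (fun z => ⟪a z, b z⟫) (vol× ν) := fun a b =>
    integrable_inner_of_memLp (memLp a) (memLp b)
  have fub : ∀ {h : E3 × Y → ℂ}, Integrable h (vol× ν) →
      ∫ z, h z ∂(vol× ν) = ∫ y, ∫ x, h (x, y) ∂volume ∂ν := fun hh => integral_prod_symm _ hh
  have i1 : Integrable (fun y => (∑ j, ∫ x, ⟪paramVal ℂ ν V m v (some j) (x, y), paramVal ℂ ν V m u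
      (some j) (x, y)⟫) + ∫ x, (V x : ℂ) * ⟪v.1 (x, y), u.1 (x, y)⟫) ν :=
    (integrable_finsetSum _ fun j _ => (iL _ _).integral_prod_right).add iV.integral_prod_right
  refine ⟨fun y => (∑ j, ∫ x, ⟪paramVal ℂ ν V m v (some j) (x, y), paramVal ℂ ν V m u (some j)
    (x, y)⟫) + (∫ x, (V x : ℂ) * ⟪v.1 (x, y), u.1 (x, y)⟫) + e₀ * ∫ x, ⟪v.1 (x, y), u.1 (x, y)⟫,
    ?_, ?_⟩
  · rw [electronForm]
    simp only [L2.inner_def]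
    rw [fub iV]
    simp only [fub (iL _ _)]
    rw [← integral_finsetSum _ fun j _ => (iL _ _).integral_prod_right,
      ← integral_add (integrable_finsetSum _ fun j _ => (iL _ _).integral_prod_right)
        iV.integral_prod_right, ← integral_const_mul, ← integral_add i1
        ((iL _ _).integral_prod_right.const_mul _)]
  · filter_upwards [ae_exists_fiber v, ae_exists_fiber u] with y h1 h2
    obtain ⟨a, ha, ha'⟩ := h1
    obtain ⟨b, hb, hb'⟩ := h2
    have e : ∀ {f g f' g' : E3 → ℂ} (W : E3 → ℂ), f =ᵐ[volume] f' → g =ᵐ[volume] g' →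
        ∫ x, W x * ⟪f' x, g' x⟫ = ∫ x, W x * ⟪f x, g x⟫ := fun W h h' => integral_congr_ae (by
      filter_upwards [h, h'] with x p q
      rw [p, q])
    refine ⟨a, b, ha, hb, ?_⟩
    rw [schrodingerForm_eq', e (fun x => V x) ha hb]
    simp only [L2.inner_def]
    have e1 := e 1 ha hb
    have e2 := fun j => e 1 (ha' j) (hb' j)
    simp only [Pi.one_apply, one_mul] at e1 e2
    simp only [e1, e2]

/-- The equation `(p² + V + e₀) ψ = η` carries over to `g ⊗ ψ`. -/
lemma electronForm_tensLp {g : Y → ℂ} (hg : MemLp g 2 ν)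
    (hmg : ∫⁻ y, ofReal (m y) * ‖g y‖ₑ ^ 2 ∂ν ≠ ⊤) {ψ : schrSpace V} {η : L2x} {e₀ : ℝ}
    (hη : ∀ v : schrSpace V, schrodingerForm V v ψ + e₀ * ⟪v.1, ψ.1⟫ = ⟪v.1, η⟫)
    (v : paramSpace ℂ ν V m) :
    electronForm V e₀ v ⟨_, tensLp_mem hg hmg ψ⟩ = ⟪v.1, tensLp g hg η⟫ := by
  obtain ⟨I, hI, hae⟩ := electronForm_fiber e₀ v ⟨_, tensLp_mem hg hmg ψ⟩
  rw [hI, L2.inner_def, integral_prod_symm _ (integrable_inner_of_memLp (memLp _) (memLp _))]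
  refine integral_congr_ae ?_
  filter_upwards [hae, ae_fiber (coeFn_tensLp hg ψ.1), ae_fiber (coeFn_tensLp hg η)]
    with y ⟨a, b, ha, hb, h⟩ h1 h2
  have hb' : b.1 = g y • ψ.1 := Lp.ext (by
    filter_upwards [hb, h1, coeFn_smul (g y) ψ.1] with x p q r
    rw [p, q, r]; rfl)
  rw [h, hb', closedForm_schrodinger.smul_right _ a.2 _ ψ.2, inner_smul_right, mul_left_comm,
    ← mul_add, hη, L2.inner_def, ← integral_const_mul]
  refine integral_congr_ae ?_
  filter_upwards [ha, h2] with x p q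
  rw [p, q]
  simp only [RCLike.inner_apply]
  ring

/-- The form of `(p² + V + e₀) ⊗ 1` is nonnegative, also after weighting the fibers. -/
lemma electronForm_nonneg {φ : L2x} {e₀ : ℝ} (hφ : IsGroundState V φ e₀) {f : Y → ℝ}
    (hf : ∀ y, 0 ≤ f y) {v u : paramSpace ℂ ν V m}
    (h : ∀ᵐ z ∂(vol× ν), v.1 z = (f z.2 : ℂ) • u.1 z) : 0 ≤ (electronForm V e₀ v u).re := by
  obtain ⟨I, hI, hae⟩ := electronForm_fiber e₀ v u
  have key : ∀ᵐ y ∂ν, I y = ((I y).re : ℂ) ∧ 0 ≤ (I y).re := by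
    filter_upwards [hae, ae_fiber h] with y ⟨a, b, ha, hb, h1⟩ h2
    have ha' : a.1 = (f y : ℂ) • b.1 := Lp.ext (by
      filter_upwards [ha, hb, h2, coeFn_smul (f y : ℂ) b.1] with x p q r t
      rw [p, t, r, Pi.smul_apply, q])
    have hq := closedForm_schrodinger (V := V)
    have h3 := Complex.conj_eq_iff_re.1 (hq.symm _ b.2 _ b.2)
    have h4 := schrodinger_ge hφ (u := b.1) (by rw [← coe_opDomain_schrodinger]; exact b.2)
    have h5 : I y = ((f y * ((schrodingerForm V b b).re + e₀ * ‖b.1‖ ^ 2) : ℝ) : ℂ) := by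
      rw [h1, ha', hq.smul_left b.2 b.2, inner_smul_left, conj_ofReal,
        inner_self_eq_norm_sq_to_K]
      push_cast; rw [h3]; ring_nf; rfl
    rw [h5, ofReal_re]
    exact ⟨rfl, mul_nonneg (hf y) (by linarith)⟩
  rw [hI, integral_congr_ae (key.mono fun y hy => hy.1), integral_complex_ofReal, ofReal_re]
  exact integral_nonneg_of_ae (key.mono fun y hy => hy.2)

end Tensors

/-! ### One-photon couplings -/

instance : SigmaFinite μₖ := by unfold photonMeasure; infer_instance

/-- The infrared-singular ultraviolet cutoff `1_{|k| ≤ Λ} |k|^{-1/2}`, which dominates all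
couplings. -/
def cutoffBound (L : ℝ) (k : Photon) : ℝ := if ‖k.1‖ ≤ L then (√‖k.1‖)⁻¹ else 0

lemma cutoffBound_nonneg (L : ℝ) (k : Photon) : 0 ≤ cutoffBound L k := by
  rw [cutoffBound]; split_ifs <;> positivity

lemma measurable_cutoffBound (L : ℝ) : Measurable (cutoffBound L) :=
  Measurable.ite (measurableSet_le measurable_fst.norm measurable_const)
    (measurable_fst.norm.sqrt.inv) measurable_const

/-- The photon energy `|k|`. -/
def photonEnergy (k : Photon) : ℝ := ‖k.1‖

lemma measurable_photonEnergy : Measurable photonEnergy := measurable_fst.norm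

lemma photonEnergy_nonneg (k : Photon) : 0 ≤ photonEnergy k := norm_nonneg _

lemma cutoffBound_eq_zero {L : ℝ} {k : Photon} (h : k.1 = 0) : cutoffBound L k = 0 := by
  rw [cutoffBound, h]; simp

lemma ae_photon_ne_zero : ∀ᵐ k ∂μₖ, k.1 ≠ 0 := by
  have h : ∀ᵐ x : E3, x ≠ 0 := by
    rw [ae_iff]; simp
  exact quasiMeasurePreserving_fst.ae h

/-- The infrared singularity `|k|^{-2}` is integrable in three dimensions. -/
lemma lintegral_cutoffBound_sq_div (L : ℝ) :
    ∫⁻ k, ofReal (cutoffBound L k ^ 2 / photonEnergy k) ∂μₖ < ⊤ := by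
  have h1 : IntegrableOn (fun y : ℝ => y ^ (Module.finrank ℝ E3 - 1) •
      (if y ≤ L then (y ^ 2)⁻¹ else 0)) (Set.Ioi 0) := by
    have h2 : IntegrableOn (fun y : ℝ => Set.indicator (Set.Iic L) (fun _ => (1 : ℝ)) y)
        (Set.Ioi 0) := by
      rw [IntegrableOn, integrable_indicator_iff measurableSet_Iic, IntegrableOn,
        Measure.restrict_restrict measurableSet_Iic, Set.inter_comm, Set.Ioi_inter_Iic]
      exact integrableOn_const (by simp)
    refine h2.congr_fun (fun y hy => ?_) measurableSet_Ioi
    have hy : 0 < y := hy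
    simp only [finrank_euclideanSpace, Fintype.card_fin, Set.indicator, Set.mem_Iic, smul_eq_mul]
    split_ifs
    · field_simp
    · simp
  have h3 := ((integrable_fun_norm_addHaar (volume : Measure E3)).2 h1).lintegral_lt_top
  have h4 : ∫⁻ k, ofReal (cutoffBound L k ^ 2 / photonEnergy k) ∂μₖ =
      ∫⁻ k : Photon, ofReal (if ‖k.1‖ ≤ L then (‖k.1‖ ^ 2)⁻¹ else 0) *
        (fun _ : Fin 2 => (1 : ℝ≥0∞)) k.2 ∂μₖ := by
    refine lintegral_congr fun k => ?_
    rw [cutoffBound, photonEnergy, mul_one]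
    split_ifs
    · rw [inv_pow, sq_sqrt (norm_nonneg _)]
      congr 1
      rw [div_eq_mul_inv, ← mul_inv, sq]
    · simp
  rw [h4, photonMeasure, lintegral_prod_mul (f := fun x : E3 =>
    ofReal (if ‖x‖ ≤ L then (‖x‖ ^ 2)⁻¹ else 0)) (g := fun _ => 1) ?_ (by fun_prop)]
  · exact mul_lt_top h3 (by simp)
  · exact (Measurable.ite (measurableSet_le measurable_norm measurable_const)
      (measurable_norm.pow_const 2).inv measurable_const).ennreal_ofReal.aemeasurable

lemma cutoffBound_sq_le (L : ℝ) (k : Photon) :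
    cutoffBound L k ^ 2 ≤ L * (cutoffBound L k ^ 2 / photonEnergy k) := by
  rw [cutoffBound, photonEnergy]
  split_ifs with h
  · rcases eq_or_lt_of_le (norm_nonneg k.1) with h0 | h0
    · rw [← h0]; simp
    · rw [mul_div_assoc', le_div_iff₀ h0, mul_comm]
      gcongr
  · simp

lemma lintegral_cutoffBound_sq {L : ℝ} (hL : 0 < L) :
    ∫⁻ k, ofReal (cutoffBound L k ^ 2) ∂μₖ < ⊤ := by
  refine lt_of_le_of_lt (lintegral_mono fun k => ofReal_le_ofReal (cutoffBound_sq_le L k))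
    ?_
  simp only [ofReal_mul hL.le]
  rw [lintegral_const_mul' _ _ ofReal_ne_top]
  exact mul_lt_top ofReal_lt_top (lintegral_cutoffBound_sq_div L)

/-- A photon amplitude dominated by the cutoff is square-integrable. -/
lemma memLp_of_le_cutoffBound {E : Type*} [NormedAddCommGroup E] {L : ℝ} (hL : 0 < L)
    {g : Photon → E} (hg : AEStronglyMeasurable g μₖ) {K : ℝ}
    (hK : ∀ k, ‖g k‖ ≤ K * cutoffBound L k) : MemLp g 2 μₖ := by
  have h1 : MemLp (cutoffBound L) 2 μₖ := by
    rw [memLp_two_iff (measurable_cutoffBound L).aestronglyMeasurable]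
    refine lt_of_eq_of_lt (lintegral_congr fun k => ?_) (lintegral_cutoffBound_sq hL)
    rw [Real.enorm_eq_ofReal (cutoffBound_nonneg L k), ← ofReal_pow (cutoffBound_nonneg L k)]
  refine h1.of_le_mul (c := K) hg (of_forall fun k => ?_)
  rw [norm_of_nonneg (cutoffBound_nonneg L k)]
  exact hK k

/-- `|k|² + |k|`, the kinetic energy of the recoil plus the energy of a photon. -/
def recoilEnergy (k : Photon) : ℝ := ‖k.1‖ ^ 2 + ‖k.1‖

lemma measurable_recoilEnergy : Measurable recoilEnergy :=
  (measurable_fst.norm.pow_const 2).add measurable_fst.norm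

lemma recoilEnergy_nonneg (k : Photon) : 0 ≤ recoilEnergy k := by
  rw [recoilEnergy]; positivity

lemma recoilEnergy_pos {k : Photon} (h : k.1 ≠ 0) : 0 < recoilEnergy k := by
  have := norm_pos_iff.2 h
  rw [recoilEnergy]; positivity

lemma norm_le_of_cutoffBound {L : ℝ} {k : Photon} (h : cutoffBound L k ≠ 0) : ‖k.1‖ ≤ L := by
  by_contra hc
  exact h (by rw [cutoffBound, if_neg hc])

/-! ### The coupling functions -/

section Couplings

variable {L : ℝ} {ε : Fin 2 → E3 → E3}

lemma cutoffFactor_eq (L : ℝ) (k : Photon) :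
    cutoffFactor L k.1 = (2 * Real.pi)⁻¹ * cutoffBound L k := by
  rw [cutoffFactor, cutoffBound]
  split_ifs
  · rw [one_div, mul_inv]
  · simp

lemma cutoffFactor_nonneg (L : ℝ) (k : E3) : 0 ≤ cutoffFactor L k := by
  rw [cutoffFactor]; split_ifs <;> positivity

lemma cutoffFactor_le (L : ℝ) (k : Photon) : cutoffFactor L k.1 ≤ cutoffBound L k := by
  rw [cutoffFactor_eq]
  refine mul_le_of_le_one_left (cutoffBound_nonneg L k) (inv_le_one_of_one_le₀ ?_)
  linarith [Real.pi_gt_three]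

lemma cutoffFactor_zero (L : ℝ) : cutoffFactor L 0 = 0 := by
  rw [cutoffFactor]; simp

lemma measurable_cutoffFactor (L : ℝ) : Measurable (cutoffFactor L) :=
  Measurable.ite (measurableSet_le measurable_norm measurable_const)
    ((measurable_const.mul measurable_norm.sqrt).const_div 1) measurable_const

lemma IsPolarization.measurable_coord (hε : IsPolarization ε) (j : Fin 3) :
    Measurable fun k : Photon => ε k.2 k.1 j := by
  have h1 : ∀ l, Measurable fun x : E3 => ε l x j := fun l =>
    (proj (𝕜 := ℝ) j : E3 →L[ℝ] ℝ).measurable.comp (hε.measurable l)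
  exact measurable_from_prod_countable_left h1

lemma IsPolarization.norm_eq_one (hε : IsPolarization ε) (l : Fin 2) {k : E3} (hk : k ≠ 0) :
    ‖ε l k‖ = 1 := (hε.orthonormal k hk).1 l

lemma norm_couplingG_le (hε : IsPolarization ε) (j : Fin 3) (k : Photon) :
    ‖couplingG L ε j k‖ ≤ cutoffBound L k := by
  rw [couplingG, norm_real, norm_mul, norm_of_nonneg (cutoffFactor_nonneg L _)]
  by_cases hk : k.1 = 0
  · rw [hk, cutoffFactor_zero]; simpa using cutoffBound_nonneg L k
  · have h1 : ‖ε k.2 k.1 j‖ ≤ 1 := by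
      rw [← hε.norm_eq_one k.2 hk]; exact norm_apply_le _ _
    calc _ ≤ cutoffBound L k * 1 := by
          gcongr
          · exact cutoffBound_nonneg L k
          · exact cutoffFactor_le L k
      _ = _ := mul_one _

lemma measurable_couplingG (hε : IsPolarization ε) (j : Fin 3) :
    Measurable (couplingG L ε j) :=
  measurable_ofReal.comp (((measurable_cutoffFactor L).comp measurable_fst).mul
    (hε.measurable_coord j))

lemma memLp_couplingG (hL : 0 < L) (hε : IsPolarization ε) (j : Fin 3) :
    MemLp (couplingG L ε j) 2 μₖ :=
  memLp_of_le_cutoffBound hL (measurable_couplingG hε j).aestronglyMeasurable (K := 1) fun k => by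
    rw [one_mul]; exact norm_couplingG_le hε j k

/-- The couplings of the vector potential are transversal: `k · G(k) = 0`. -/
lemma sum_mul_couplingG (hε : IsPolarization ε) (k : Photon) :
    ∑ j, (k.1 j : ℂ) * couplingG L ε j k = 0 := by
  have h1 : ∑ j, k.1 j * (cutoffFactor L k.1 * ε k.2 k.1 j) = 0 := by
    by_cases hk : k.1 = 0
    · simp [hk]
    · have h2 := hε.transversal k.2 k.1 hk
      rw [inner_apply] at h2
      simp only [RCLike.inner_apply, conj_trivial] at h2
      calc _ = cutoffFactor L k.1 * ∑ j, ε k.2 k.1 j * k.1 j := by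
            rw [mul_sum]; exact sum_congr rfl fun j _ => by ring
        _ = 0 := by rw [h2, mul_zero]
  simp only [couplingG, ← Complex.ofReal_mul, ← ofReal_sum, h1, Complex.ofReal_zero]

/-- The sign of the polarization `ε_λ` under `k ↦ -k`. -/
def paritySign (ε : Fin 2 → E3 → E3) (l : Fin 2) : ℝ :=
  open Classical in if ∀ k, k ≠ 0 → ε l (-k) = ε l k then 1 else -1

lemma paritySign_sq (ε : Fin 2 → E3 → E3) (l : Fin 2) : paritySign ε l * paritySign ε l = 1 := by
  rw [paritySign]; split_ifs <;> norm_num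

lemma abs_paritySign (ε : Fin 2 → E3 → E3) (l : Fin 2) : |paritySign ε l| = 1 := by
  rw [paritySign]; split_ifs <;> norm_num

lemma IsPolarization.neg_eq (hε : IsPolarization ε) (l : Fin 2) {k : E3} (hk : k ≠ 0) :
    ε l (-k) = paritySign ε l • ε l k := by
  rw [paritySign]
  split_ifs with h
  · rw [one_smul]; exact h k hk
  · rw [(hε.parity l).resolve_left h k hk, neg_one_smul]

/-- Inversion of the photon momentum. -/
def reflect (k : Photon) : Photon := (-k.1, k.2)

lemma reflect_reflect (k : Photon) : reflect (reflect k) = k := by simp [reflect]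

lemma measurable_reflect : Measurable reflect := measurable_fst.neg.prodMk measurable_snd

lemma measurePreserving_reflect : MeasurePreserving reflect μₖ μₖ :=
  (Measure.measurePreserving_neg (volume : Measure E3)).prod (MeasurePreserving.id _)

lemma cutoffFactor_neg (L : ℝ) (k : E3) : cutoffFactor L (-k) = cutoffFactor L k := by
  simp [cutoffFactor]

lemma couplingG_reflect (hε : IsPolarization ε) (j : Fin 3) (k : Photon) :
    couplingG L ε j (reflect k) = paritySign ε k.2 * couplingG L ε j k := by
  rw [couplingG, couplingG]
  simp only [reflect]
  by_cases hk : k.1 = 0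
  · simp [hk, cutoffFactor_zero]
  · rw [cutoffFactor_neg, hε.neg_eq _ hk]
    simp only [PiLp.smul_apply, smul_eq_mul]
    push_cast
    ring

end Couplings

/-! ### The operator `A_V` -/

section AV

variable {V : E3 → ℝ} [hV : RegularPotential V] {e₀ : ℝ} [he₀ : Fact (0 < e₀)]

instance : EnergyWeight fun k => recoilEnergy k + e₀ :=
  ⟨measurable_recoilEnergy.add_const e₀, fun k => add_nonneg (recoilEnergy_nonneg k) he₀.out.le⟩

/-- The form domain of `A_V` as a subspace. -/
abbrev avSpace (V : E3 → ℝ) (e₀ : ℝ) : Submodule ℂ L2pair :=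
  paramSpace ℂ μₖ V fun k => recoilEnergy k + e₀

/-- The gradient on the form domain of `A_V`. -/
abbrev avVal (V : E3 → ℝ) (e₀ : ℝ) : avSpace V e₀ →ₗ[ℂ] (Option (Fin 3) → L2pair) :=
  paramVal ℂ μₖ V fun k => recoilEnergy k + e₀

lemma lintegral_recoil_add_ne_top (u : L2pair) :
    ∫⁻ z, ofReal (recoilEnergy z.2 + e₀) * ‖u z‖ₑ ^ 2 ∂μₚ ≠ ⊤ ↔
      ∫⁻ z, ofReal (recoilEnergy z.2) * ‖u z‖ₑ ^ 2 ∂μₚ ≠ ⊤ := by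
  have m0 : AEMeasurable (fun z => ‖u z‖ₑ ^ 2) μₚ := (memLp u).1.enorm.pow_const 2
  simp only [fun z : E3 × Photon => ofReal_add (recoilEnergy_nonneg z.2) he₀.out.le, add_mul]
  rw [lintegral_add_left' (f := fun z : E3 × Photon => ofReal (recoilEnergy z.2) * ‖u z‖ₑ ^ 2)
    ((measurable_recoilEnergy.comp measurable_snd).ennreal_ofReal.aemeasurable.mul m0),
    lintegral_const_mul' _ _ ofReal_ne_top, ← norm_sq_eq_lintegral, ENNReal.add_ne_top]
  exact ⟨fun h => h.1, fun h => ⟨h, ENNReal.mul_ne_top ofReal_ne_top ofReal_ne_top⟩⟩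

lemma coe_avSpace :
    (avSpace V e₀ : Set L2pair) = avDomain V := by
  ext u
  rw [SetLike.mem_coe, mem_paramSpace,
    lintegral_recoil_add_ne_top]
  simp only [exists_mem_gradGraphParam]
  rfl

lemma closedForm_av :
    ClosedForm (avSpace V e₀) (avForm V e₀) (avVal V e₀) := by
  refine closedForm_param _ fun v u => ?_
  have h1 : ∀ z : E3 × Photon, V z.1 + e₀ + ‖z.2.1‖ ^ 2 + ‖z.2.1‖ =
      weightVm V (fun k => recoilEnergy k + e₀) z := fun z => by
    simp only [weightVm, recoilEnergy]; ring
  rw [avForm]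
  simp only [h1]

lemma integrable_V_inner (v u : avSpace V e₀) : Integrable (fun z => (V z.1 : ℂ) * ⟪v.1 z, u.1 z⟫) μₚ :=
  integrable_weight_inner (W := fun z : E3 × Photon => V z.1)
    (hV.meas.comp measurable_fst).aemeasurable (memLp _).1 (memLp _).1
    (integrable_V_sq u.2)
    (integrable_V_sq v.2)

lemma integrable_recoil_sq (u : avSpace V e₀) :
    Integrable (fun z => recoilEnergy z.2 * ‖u.1 z‖ ^ 2) μₚ := by
  refine integrable_weight_sq (measurable_recoilEnergy.comp measurable_snd).aemeasurable
    (memLp _).1 ((lintegral_recoil_add_ne_top _).1 (mem_paramSpace.1 u.2).2.1) (by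
      simp [fun z : E3 × Photon => ofReal_of_nonpos (neg_nonpos.2 (recoilEnergy_nonneg z.2))])

lemma integrable_recoil_inner (v u : avSpace V e₀) : Integrable (fun z => (recoilEnergy z.2 : ℂ) * ⟪v.1 z, u.1 z⟫) μₚ :=
  integrable_weight_inner (W := fun z : E3 × Photon => recoilEnergy z.2)
    (measurable_recoilEnergy.comp measurable_snd).aemeasurable (memLp _).1 (memLp _).1
    (integrable_recoil_sq u) (integrable_recoil_sq v)

/-- The form of `A_V` is the sum of the electron and photon energies. -/
lemma avForm_eq (v u : avSpace V e₀) : avForm V e₀ v u = electronForm V e₀ v u +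
      ∫ z, (recoilEnergy z.2 : ℂ) * ⟪v.1 z, u.1 z⟫ ∂μₚ := by
  have iI : Integrable (fun z => ⟪v.1 z, u.1 z⟫) μₚ :=
    integrable_inner_of_memLp (memLp _) (memLp _)
  have i2 : Integrable (fun z : E3 × Photon => (e₀ : ℂ) * ⟪v.1 z, u.1 z⟫ +
      (recoilEnergy z.2 : ℂ) * ⟪v.1 z, u.1 z⟫) μₚ :=
    (iI.const_mul _).add (integrable_recoil_inner v u)
  rw [avForm, electronForm, L2.inner_def v.1, ← integral_const_mul, add_assoc, add_assoc,
    ← integral_add (iI.const_mul _) (integrable_recoil_inner v u),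
    ← integral_add (integrable_V_inner v u) i2]
  congr 1
  · refine sum_congr rfl fun j _ => ?_
    rw [L2.inner_def]
    refine integral_congr_ae ?_
    filter_upwards [partialParam_ae_eq (paramVal_mem u j), partialParam_ae_eq (paramVal_mem v j)]
      with x h1 h2
    rw [h1, h2]
  · refine integral_congr_ae (of_forall fun z => ?_)
    simp only [recoilEnergy]
    push_cast; ring

lemma re_electronForm_self (u : avSpace V e₀) : (electronForm V e₀ u u).re =
    ∑ j, ‖avVal V e₀ u (some j)‖ ^ 2 + ∫ z, V z.1 * ‖u.1 z‖ ^ 2 ∂μₚ +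
      e₀ * ‖u.1‖ ^ 2 := by
  rw [electronForm, integral_mul_inner_self fun z : E3 × Photon => V z.1]
  simp only [inner_self_re, add_re, ofReal_re, ← ofReal_sum,
    re_ofReal_mul]

variable {φ : L2x}

lemma re_integral_recoil (u : avSpace V e₀) :
    (∫ z, (recoilEnergy z.2 : ℂ) * ⟪u.1 z, u.1 z⟫ ∂μₚ).re =
      ∫ z, recoilEnergy z.2 * ‖u.1 z‖ ^ 2 ∂μₚ := by
  rw [integral_mul_inner_self fun z : E3 × Photon => recoilEnergy z.2, ofReal_re]

lemma avForm_ge (hφ : IsGroundState V φ e₀) (u : avSpace V e₀) :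
    ∫ z, recoilEnergy z.2 * ‖u.1 z‖ ^ 2 ∂μₚ ≤ (avForm V e₀ u u).re := by
  rw [avForm_eq, add_re, re_integral_recoil]
  linarith [electronForm_nonneg (v := u) (u := u) hφ (f := fun _ => 1) (fun _ => zero_le_one)
    (of_forall fun z => by simp)]

lemma avForm_nonneg (hφ : IsGroundState V φ e₀) : ∀ u ∈ avSpace V e₀, 0 ≤ (avForm V e₀ u u).re := fun u hu =>
  (integral_nonneg fun _ => mul_nonneg (recoilEnergy_nonneg _) (sq_nonneg _)).trans
    (avForm_ge hφ ⟨u, hu⟩)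

lemma eq_zero_of_avForm (hφ : IsGroundState V φ e₀) (u : avSpace V e₀) (h : (avForm V e₀ u u).re = 0) :
    u.1 = 0 := by
  have h1 := avForm_ge hφ u
  have h2 : ∀ z : E3 × Photon, 0 ≤ recoilEnergy z.2 * ‖u.1 z‖ ^ 2 := fun z =>
    mul_nonneg (recoilEnergy_nonneg _) (sq_nonneg _)
  have h3 : ∫ z, recoilEnergy z.2 * ‖u.1 z‖ ^ 2 ∂μₚ = 0 :=
    le_antisymm (h1.trans h.le) (integral_nonneg h2)
  rw [integral_eq_zero_iff_of_nonneg h2 (integrable_recoil_sq u)] at h3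
  have h4 : ∀ᵐ z ∂μₚ, z.2.1 ≠ 0 := Measure.quasiMeasurePreserving_snd.ae ae_photon_ne_zero
  refine (Lp.eq_zero_iff_ae_eq_zero).2 ?_
  filter_upwards [h3, h4] with z hz hz0
  rcases mul_eq_zero.1 hz with h5 | h5
  · exact absurd h5 (recoilEnergy_pos hz0).ne'
  · simpa using h5

/-- `A_V` is injective. -/
lemma formOp_av_unique (hφ : IsGroundState V φ e₀) {u u' F : L2pair}
    (h : FormOp (avSpace V e₀ : Set L2pair) (avForm V e₀) u F)
    (h' : FormOp (avSpace V e₀ : Set L2pair) (avForm V e₀) u' F) : u = u' := by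
  have hq := closedForm_av (V := V) (e₀ := e₀)
  have hd : u - u' ∈ avSpace V e₀ := Submodule.sub_mem _ h.1 h'.1
  refine sub_eq_zero.1 (eq_zero_of_avForm hφ ⟨_, hd⟩ ?_)
  change (avForm V e₀ (u - u') (u - u')).re = 0
  rw [hq.sub_right hd h.1 h'.1, h.2 _ hd, h'.2 _ hd, sub_self, zero_re]

/-- Solvability of `A_V χ = F`, if `F` lies in the range of `(p² + V + e₀) ⊗ 1`. -/
lemma exists_formOp_av (hφ : IsGroundState V φ e₀) {F : L2pair} (ζ : avSpace V e₀)
    (hζ : ∀ v : avSpace V e₀, electronForm V e₀ v ζ = ⟪v.1, F⟫) :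
    ∃ χ, FormOp (avSpace V e₀ : Set L2pair) (avForm V e₀) χ F := by
  have hq := closedForm_av (V := V) (e₀ := e₀)
  refine hq.exists_formOp_of_bounded (avForm_nonneg hφ) F (2 * ‖ζ.1‖) fun δ u hδ hu => ?_
  set d : avSpace V e₀ := ζ - ⟨u, hu.1⟩ with hd
  -- test the equation for `d = ζ - u` with `(|k|² + |k| + δ)⁻¹ d`
  let f : Photon → ℝ := fun k => (recoilEnergy k + δ)⁻¹
  have hpos : ∀ k, 0 < recoilEnergy k + δ := fun k =>
    add_pos_of_nonneg_of_pos (recoilEnergy_nonneg k) hδ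
  have hf0 : ∀ k, 0 ≤ f k := fun k => (inv_pos.2 (hpos k)).le
  have hfm : Measurable f := (measurable_recoilEnergy.add_const δ).inv
  have hfb : ∀ k, |f k| ≤ δ⁻¹ := fun k => by
    rw [abs_of_nonneg (hf0 k)]; exact inv_anti₀ hδ (by linarith [recoilEnergy_nonneg k])
  set v : avSpace V e₀ := ⟨_, mulY_mem hfm hfb d⟩ with hv
  have hvd : ∀ᵐ z ∂μₚ, v.1 z = (f z.2 : ℂ) • d.1 z := coeFn_mulLp (memLp_mulY hfm hfb d.1)
  have hwv : ∀ x : avSpace V e₀, (∫ z, (recoilEnergy z.2 : ℂ) * ⟪v.1 z, x.1 z⟫ ∂μₚ) +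
      δ * ⟪v.1, x.1⟫ = ⟪d.1, x.1⟫ := fun x => by
    rw [L2.inner_def, L2.inner_def, ← integral_const_mul, ← integral_add
      (integrable_recoil_inner v x) ((integrable_inner_of_memLp (memLp _) (memLp _)).const_mul _)]
    refine integral_congr_ae ?_
    filter_upwards [hvd] with z hz
    rw [hz, inner_smul_left, conj_ofReal, ← mul_assoc, ← mul_assoc, ← add_mul, ← add_mul,
      ← Complex.ofReal_add, ← Complex.ofReal_mul, mul_inv_cancel₀ (hpos z.2).ne', ofReal_one,
      one_mul]
  have h1 := hu.2 v v.2
  rw [inner_sub_right, inner_smul_right, ← hζ v] at h1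
  have h2 := avForm_eq v ζ
  have h3 := avForm_eq v d
  have h4 : avForm V e₀ v d = avForm V e₀ v ζ - avForm V e₀ v u := hq.sub_right v.2 ζ.2 hu.1
  have h5 : ⟪v.1, d.1⟫ = ⟪v.1, ζ.1⟫ - ⟪v.1, u⟫ := inner_sub_right _ _ _
  have h6 : electronForm V e₀ v d + ⟪d.1, d.1⟫ = ⟪d.1, ζ.1⟫ := by
    rw [← hwv d, ← hwv ζ]
    linear_combination h4 - h3 + h2 - h1 + (δ : ℂ) * h5
  have h7 := congrArg Complex.re h6
  rw [add_re, inner_self_re, ofReal_re] at h7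
  have h8 := electronForm_nonneg hφ hf0 hvd
  have h9 : ⟪d.1, ζ.1⟫.re ≤ ‖d.1‖ * ‖ζ.1‖ := (re_le_norm _).trans (norm_inner_le_norm _ _)
  have h10 : ‖d.1‖ ≤ ‖ζ.1‖ := by
    by_contra hc
    push Not at hc
    nlinarith [norm_nonneg ζ.1]
  have h11 : u = ζ.1 - d.1 := by rw [hd]; simp
  rw [h11, two_mul]
  exact (norm_sub_le _ _).trans (add_le_add le_rfl h10)

end AV

/-! ### The vector `D* p φ` and its preimage -/

section DStar

variable {V : E3 → ℝ} [hV : RegularPotential V] {e₀ L : ℝ} [he₀ : Fact (0 < e₀)] {φ : L2x} {ε : Fin 2 → E3 → E3}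
  (hL : 0 < L) (hε : IsPolarization ε) (hφ : IsGroundState V φ e₀)

lemma lintegral_recoil_coupling (hL : 0 < L) {e₀ : ℝ} {g : Photon → ℂ}
    (hg : AEStronglyMeasurable g μₖ) {K : ℝ} (hK : ∀ k, ‖g k‖ ≤ K * cutoffBound L k) :
    ∫⁻ k, ofReal (recoilEnergy k + e₀) * ‖g k‖ₑ ^ 2 ∂μₖ ≠ ⊤ := by
  have h1 := (memLp_two_iff hg).1 (memLp_of_le_cutoffBound hL hg hK)
  have h2 : ∫⁻ k, ofReal (recoilEnergy k + e₀) * ‖g k‖ₑ ^ 2 ∂μₖ ≤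
      ∫⁻ k, ofReal (L ^ 2 + L + e₀) * ‖g k‖ₑ ^ 2 ∂μₖ := by
    refine lintegral_mono fun k => ?_
    by_cases h : cutoffBound L k = 0
    · have : g k = 0 := by
        have := hK k
        rw [h, mul_zero] at this
        exact norm_le_zero_iff.1 this
      simp [this]
    · gcongr
      have := norm_le_of_cutoffBound h
      rw [recoilEnergy]; gcongr
  refine ne_top_of_le_ne_top ?_ h2
  rw [lintegral_const_mul' _ _ ofReal_ne_top]
  exact ENNReal.mul_ne_top ofReal_ne_top h1.ne

lemma formOp_av_tensLp (hL : 0 < L)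
    (hV2 : Tendsto (fun x => max (-(V x)) 0) (cocompact E3) (𝓝 0))
    (hφ : IsGroundState V φ e₀) (j : Fin 3) {g : Photon → ℂ} (hg : MemLp g 2 μₖ) {K : ℝ}
    (hK : ∀ k, ‖g k‖ ≤ K * cutoffBound L k) :
    ∃ χ, FormOp (avSpace V e₀ : Set L2pair) (avForm V e₀) χ
      (tensLp g hg ((-I) • hφ.grad j)) := by
  obtain ⟨h1, h2⟩ := coord_groundState hV2 hφ j
  -- `x_j φ` solves `(p² + V + e₀) (x_j φ) = -2 ∂_j φ`
  refine exists_formOp_av hφ _ (electronForm_tensLp hg (lintegral_recoil_coupling hL hg.1 hK)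
    (ψ := (I / 2) • ⟨_, h1⟩) fun v => ?_)
  rw [coe_smul, closedForm_schrodinger.smul_right _ v.2 _ h1, inner_smul_right, inner_smul_right]
  linear_combination (I / 2) * h2 v

/-- `D* p φ` as an element of `L²`. -/
def dStarLp : L2pair :=
  ∑ j, tensLp (couplingG L ε j) (memLp_couplingG hL hε j)
    ((-I) • hφ.grad j)

lemma dStarLp_ae_eq : dStarLp hL hε hφ =ᵐ[μₚ] dStarP L ε φ := by
  have h1 : ∀ j, ∀ᵐ z ∂μₚ, tensLp (couplingG L ε j) (memLp_couplingG hL hε j)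
      ((-I) • hφ.grad j) z =
      couplingG L ε j z.2 * (-I * partialX j φ z.1) := fun j => by
    have ae1 : ∀ᵐ x : E3, ((-I) • hφ.grad j : L2x) x =
        -I * partialX j φ x := by
      filter_upwards [coeFn_smul (-I) (hφ.grad j),
        partialX_ae_eq (schrVal_mem ⟨φ, hφ.mem⟩ j)] with x a b
      rw [a, b]; rfl
    filter_upwards [coeFn_tensLp (memLp_couplingG hL hε j)
      ((-I) • hφ.grad j),
      quasiMeasurePreserving_fst.ae ae1] with z a b
    rw [a, b]
  rw [dStarLp]
  have h2 := ae_all_iff.2 h1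
  rw [Fin.sum_univ_three]
  refine (coeFn_add _ _).trans ?_
  refine ((coeFn_add _ _).add EventuallyEq.rfl).trans ?_
  filter_upwards [h2] with z hz
  simp only [Pi.add_apply, hz, dStarP, Fin.sum_univ_three]

lemma exists_formOp_dStar (hV2 : Tendsto (fun x => max (-(V x)) 0) (cocompact E3) (𝓝 0))
    (hφ : IsGroundState V φ e₀) :
    ∃ χ, FormOp (avSpace V e₀ : Set L2pair) (avForm V e₀) χ (dStarLp hL hε hφ) := by
  have h := fun j => formOp_av_tensLp hL hV2 hφ j (memLp_couplingG (L := L) hL hε j) (fun k => by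
      rw [one_mul]; exact norm_couplingG_le hε j k)
  choose χ hχ using h
  have hq := closedForm_av (V := V) (e₀ := e₀)
  have h01 := Submodule.add_mem _ (hχ 0).1 (hχ 1).1
  refine ⟨χ 0 + χ 1 + χ 2, Submodule.add_mem _ h01 (hχ 2).1, fun v hv => ?_⟩
  rw [hq.add_right v hv _ h01 _ (hχ 2).1, hq.add_right v hv _ (hχ 0).1 _ (hχ 1).1, (hχ 0).2 v hv,
    (hχ 1).2 v hv, (hχ 2).2 v hv, dStarLp, Fin.sum_univ_three, inner_add_right, inner_add_right]

/-- A ground state is not constant: its gradient does not vanish. -/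
lemma grad_ne_zero (hV2 : Tendsto (fun x => max (-(V x)) 0) (cocompact E3) (𝓝 0))
    (hφ : IsGroundState V φ e₀) (j : Fin 3) : hφ.grad j ≠ 0 := by
  intro h0
  obtain ⟨h1, -⟩ := coord_groundState hV2 hφ j
  have hgr : IsWeakPartial j φ (hφ.grad j) := (schrVal_mem ⟨φ, hφ.mem⟩ j).2
  have hw := (schrVal_mem ⟨_, h1⟩ j).2
  rw [h0] at hgr
  -- if `∂_j φ = 0`, then `∂_j (x_j φ) = φ`, and integration by parts gives `‖φ‖² = 0`
  have h2 := ((hgr.mul (memLp φ).locInt (memLp _).locInt (m := fun x => x j)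
    (proj (𝕜 := ℝ) j).contDiff).congr (coeFn_mulLp (memLp_coord_smul hV2 hφ j)).symm
    (g' := φ) (by
      filter_upwards [coeFn_zero ℂ 2 (volume : Measure E3)] with x hx
      have h3 : fderiv ℝ (fun x : E3 => x j) x = proj (𝕜 := ℝ) j := (proj (𝕜 := ℝ) j).fderiv
      rw [hx, h3]; simp)).unique hw (memLp _).locInt (memLp _).locInt
  have h4 := hgr.integral_inner hw (memLp _) (memLp _) (memLp _) (memLp _)
  rw [← L2.inner_def, inner_zero_left, integral_congr_ae (g := fun x => ⟪φ x, φ x⟫)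
    (h2.mono fun x hx => by simp only [hx]), ← L2.inner_def, inner_self_eq_norm_sq_to_K, hφ.1] at h4
  norm_num at h4

/-- A vector orthogonal to both polarizations is parallel to the momentum. -/
lemma IsPolarization.eq_smul (hε : IsPolarization ε) {k b : E3} (hk : k ≠ 0)
    (hb : ∀ l, inner ℝ (ε l k) b = 0) : ∃ t : ℝ, t • k = b := by
  have ho := hε.orthonormal k hk
  set W := span ℝ (Set.range fun l => ε l k) with hW
  have h1 : Module.finrank ℝ W = 2 := by
    rw [hW, finrank_span_eq_card ho.linearIndependent]; simp
  have h2 : Module.finrank ℝ Wᗮ = 1 := by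
    have := Submodule.finrank_add_finrank_orthogonal W
    rw [h1, finrank_euclideanSpace, Fintype.card_fin] at this
    omega
  have hmem : ∀ c : E3, (∀ l, inner ℝ (ε l k) c = 0) → c ∈ Wᗮ := fun c hc => by
    rw [Submodule.mem_orthogonal]
    intro u hu
    induction hu using Submodule.span_induction with
    | mem x hx => obtain ⟨l, rfl⟩ := hx; exact hc l
    | zero => simp
    | add x y _ _ hx hy => rw [inner_add_left, hx, hy, add_zero]
    | smul a x _ hx => rw [inner_smul_left, hx, mul_zero]
  have hkm : k ∈ Wᗮ := hmem k fun l => by rw [real_inner_comm]; exact hε.transversal l k hk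
  obtain ⟨t, ht⟩ := (finrank_eq_one_iff_of_nonzero' (⟨k, hkm⟩ : Wᗮ) (by
    simpa [Subtype.ext_iff] using hk)).1 h2 ⟨b, hmem b hb⟩
  exact ⟨t, congrArg Subtype.val ht⟩

lemma volume_ball_diff_span_pos (hL : 0 < L) (b : E3) :
    ∃ᵐ k : E3, ‖k‖ ≤ L ∧ k ≠ 0 ∧ k ∉ span ℝ {b} := by
  have h1 : volume (span ℝ {b} : Set E3) = 0 := by
    refine Measure.addHaar_submodule _ _ fun h => ?_
    have h2 : Module.finrank ℝ (span ℝ {b}) ≤ 1 := by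
      simpa using finrank_span_le_card (R := ℝ) ({b} : Set E3)
    rw [h, finrank_top, finrank_euclideanSpace, Fintype.card_fin] at h2
    norm_num at h2
  have h2 : ∀ᵐ k : E3, k ∉ span ℝ {b} := by
    rw [ae_iff]; simpa using h1
  have h3 : ∃ᵐ k : E3, ‖k‖ ≤ L := by
    rw [frequently_ae_iff]
    have h4 : {k : E3 | ‖k‖ ≤ L} = Metric.closedBall 0 L := by ext; simp
    rw [h4]
    exact (Metric.measure_closedBall_pos volume _ hL).ne'
  refine (h3.and_eventually h2).mono fun k hk => ⟨hk.1, ?_, hk.2⟩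
  rintro rfl
  exact hk.2 (Submodule.zero_mem _)

/-- The coupling to the transversal modes detects all nonzero vectors. -/
lemma eq_zero_of_ae_couplingG (hL : 0 < L) (hε : IsPolarization ε) {a : Fin 3 → ℂ}
    (h : ∀ᵐ k ∂μₖ, ∑ j, couplingG L ε j k * a j = 0) : a = 0 := by
  have h1 : ∀ l, ∀ᵐ k : E3, ∑ j, couplingG L ε j (k, l) * a j = 0 := by
    rw [← ae_all_iff]
    have h2 := Measure.ae_ae_of_ae_prod h
    filter_upwards [h2] with k hk l
    rw [Measure.ae_count_iff] at hk
    exact hk l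
  have key : ∀ b : E3, (∀ l, ∀ᵐ k : E3, ‖k‖ ≤ L → k ≠ 0 → inner ℝ (ε l k) b = 0) → b = 0 := by
    intro b hb
    by_contra hb0
    obtain ⟨k, ⟨hk1, hk2, hk3⟩, hk4⟩ :=
      ((volume_ball_diff_span_pos hL b).and_eventually (ae_all_iff.2 hb)).exists
    obtain ⟨t, ht⟩ := hε.eq_smul hk2 fun l => hk4 l hk1 hk2
    have ht0 : t ≠ 0 := by rintro rfl; exact hb0 (by rw [← ht, zero_smul])
    exact hk3 (Submodule.mem_span_singleton.2 ⟨t⁻¹, by rw [← ht, smul_smul, inv_mul_cancel₀ ht0,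
      one_smul]⟩)
  have h3 : ∀ l, ∀ᵐ k : E3, ‖k‖ ≤ L → k ≠ 0 → ∑ j, (ε l k j : ℂ) * a j = 0 := fun l => by
    filter_upwards [h1 l] with k hk h4 h5
    have h6 : cutoffFactor L k ≠ 0 := by
      rw [cutoffFactor, if_pos h4]
      have := norm_pos_iff.2 h5
      positivity
    have h7 : ((cutoffFactor L k : ℝ) : ℂ) * ∑ j, (ε l k j : ℂ) * a j = 0 := by
      rw [← hk, mul_sum]
      refine sum_congr rfl fun j _ => ?_
      rw [couplingG]; push_cast; ring
    exact (mul_eq_zero.1 h7).resolve_left (ofReal_ne_zero.2 h6)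
  have hre := key (WithLp.toLp 2 fun j => (a j).re) fun l => by
    filter_upwards [h3 l] with k hk h4 h5
    have := congrArg Complex.re (hk h4 h5)
    rw [re_sum] at this
    simp only [re_ofReal_mul, zero_re] at this
    rw [inner_apply, ← this]
    exact sum_congr rfl fun j _ => by simp [mul_comm]
  have him := key (WithLp.toLp 2 fun j => (a j).im) fun l => by
    filter_upwards [h3 l] with k hk h4 h5
    have := congrArg Complex.im (hk h4 h5)
    rw [Complex.im_sum] at this
    simp only [Complex.im_ofReal_mul, Complex.zero_im] at this
    rw [inner_apply, ← this]
    exact sum_congr rfl fun j _ => by simp [mul_comm]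
  funext j
  exact Complex.ext (by simpa using congrArg (fun v : E3 => v j) hre)
    (by simpa using congrArg (fun v : E3 => v j) him)

end DStar

/-! ### Parity in the photon momentum -/

section Parity

variable {V : E3 → ℝ} [hV : RegularPotential V] {e₀ L : ℝ} [he₀ : Fact (0 < e₀)] {φ : L2x} {ε : Fin 2 → E3 → E3}
  (hL : 0 < L) (hε : IsPolarization ε) (hφ : IsGroundState V φ e₀)

/-- The map `(x, k) ↦ (x, -k)`. -/
def reflectEquiv : (E3 × Photon) ≃ᵐ (E3 × Photon) where
  toFun z := (z.1, reflect z.2)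
  invFun z := (z.1, reflect z.2)
  left_inv z := by simp [reflect_reflect]
  right_inv z := by simp [reflect_reflect]
  measurable_toFun := measurable_fst.prodMk (measurable_reflect.comp measurable_snd)
  measurable_invFun := measurable_fst.prodMk (measurable_reflect.comp measurable_snd)

lemma measurePreserving_reflectEquiv : MeasurePreserving reflectEquiv μₚ μₚ :=
  (MeasurePreserving.id _).prod measurePreserving_reflect

/-- The parity operator `u(x, k, λ) ↦ s_λ u(x, -k, λ)`. -/
def reflLp (ε : Fin 2 → E3 → E3) (u : L2pair) : L2pair :=
  mulLp (fun z => (paritySign ε z.2.2 : ℂ))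
    (Lp.compMeasurePreserving reflectEquiv measurePreserving_reflectEquiv u)

lemma measurable_paritySign (ε : Fin 2 → E3 → E3) :
    Measurable fun k : Photon => paritySign ε k.2 :=
  (measurable_of_countable (paritySign ε)).comp measurable_snd

lemma coeFn_reflLp (ε : Fin 2 → E3 → E3) (u : L2pair) :
    reflLp ε u =ᵐ[μₚ] fun z => (paritySign ε z.2.2 : ℂ) * u (reflectEquiv z) := by
  filter_upwards [coeFn_mulLp (memLp_mulY (measurable_paritySign ε) (C := 1)
    (fun k => (abs_paritySign ε k.2).le)
    (Lp.compMeasurePreserving reflectEquiv measurePreserving_reflectEquiv u)),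
    Lp.coeFn_compMeasurePreserving u measurePreserving_reflectEquiv] with z a b
  rw [reflLp, a, b]; rfl

lemma reflectEquiv_reflectEquiv (z : E3 × Photon) : reflectEquiv (reflectEquiv z) = z :=
  reflectEquiv.left_inv z

lemma reflLp_reflLp (u : L2pair) : reflLp ε (reflLp ε u) = u := by
  refine Lp.ext ?_
  filter_upwards [coeFn_reflLp ε (reflLp ε u),
    measurePreserving_reflectEquiv.quasiMeasurePreserving.ae (coeFn_reflLp ε u)] with z a b
  rw [a, b, reflectEquiv_reflectEquiv, ← mul_assoc]
  have : (reflectEquiv z).2.2 = z.2.2 := rfl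
  rw [this, ← Complex.ofReal_mul, paritySign_sq, ofReal_one, one_mul]

lemma integral_reflectEquiv (h : E3 × Photon → ℂ) :
    ∫ z, h (reflectEquiv z) ∂μₚ = ∫ z, h z ∂μₚ :=
  measurePreserving_reflectEquiv.integral_comp' h

/-- Inner products with a weight that is even in the momentum. -/
lemma integral_inner_reflLp (W : E3 × Photon → ℂ) (hW : ∀ z, W (reflectEquiv z) = W z)
    (v u : L2pair) : ∫ z, W z * ⟪reflLp ε v z, reflLp ε u z⟫ ∂μₚ =
      ∫ z, W z * ⟪v z, u z⟫ ∂μₚ := by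
  rw [← integral_reflectEquiv fun z => W z * ⟪v z, u z⟫]
  refine integral_congr_ae ?_
  filter_upwards [coeFn_reflLp ε v, coeFn_reflLp ε u] with z a b
  rw [a, b, hW]
  simp only [RCLike.inner_apply, map_mul, conj_ofReal]
  have := congrArg (fun r : ℝ => (r : ℂ)) (paritySign_sq ε z.2.2)
  simp only [Complex.ofReal_mul, ofReal_one] at this
  linear_combination (W z * (u (reflectEquiv z) * starRingEnd ℂ (v (reflectEquiv z)))) * this

lemma inner_reflLp (v u : L2pair) :
    ⟪reflLp ε v, reflLp ε u⟫ = ⟪v, u⟫ := by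
  have := integral_inner_reflLp (ε := ε) (fun _ => 1) (fun _ => rfl) v u
  simpa only [L2.inner_def, one_mul] using this

lemma reflLp_mem_gradGraph {j : Fin 3} {u g : L2pair} (h : (u, g) ∈ gradGraphParam ℂ μₖ j) :
    (reflLp ε u, reflLp ε g) ∈ gradGraphParam ℂ μₖ j := by
  refine mulY_mem_gradGraph (measurable_paritySign ε) (C := 1)
    (fun k => (abs_paritySign ε k.2).le) ⟨memLp _, ?_⟩
  have h1 : IsWeakPartialParam μₖ j (fun z => u (reflectEquiv z))
      (fun z => g (reflectEquiv z)) :=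
    measurePreserving_reflect.quasiMeasurePreserving.ae h.2
  exact h1.congr (Lp.coeFn_compMeasurePreserving u measurePreserving_reflectEquiv).symm
    (Lp.coeFn_compMeasurePreserving g measurePreserving_reflectEquiv).symm

lemma recoilEnergy_reflect (k : Photon) : recoilEnergy (reflect k) = recoilEnergy k := by
  simp [recoilEnergy, reflect]

lemma lintegral_reflLp (W : E3 × Photon → ℝ≥0∞) (hW : ∀ z, W (reflectEquiv z) = W z)
    (u : L2pair) : ∫⁻ z, W z * ‖reflLp ε u z‖ₑ ^ 2 ∂μₚ =
      ∫⁻ z, W z * ‖u z‖ₑ ^ 2 ∂μₚ := by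
  rw [← measurePreserving_reflectEquiv.lintegral_comp_emb reflectEquiv.measurableEmbedding
    fun z => W z * ‖u z‖ₑ ^ 2]
  refine lintegral_congr_ae ?_
  filter_upwards [coeFn_reflLp ε u] with z a
  have h1 : ‖(paritySign ε z.2.2 : ℂ)‖ₑ = 1 := by
    rw [← ofReal_norm, norm_real, norm_eq_abs, abs_paritySign, ENNReal.ofReal_one]
  rw [a, hW, enorm_mul, h1, one_mul]

lemma reflLp_mem (u : avSpace V e₀) : reflLp ε (u : L2pair) ∈ avSpace V e₀ := by
  obtain ⟨h1, h2, h3⟩ := mem_paramSpace.1 u.2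
  refine mem_paramSpace.2 ⟨fun j => ?_, ?_, ?_⟩
  · obtain ⟨g, hg⟩ := h1 j
    exact ⟨_, reflLp_mem_gradGraph hg⟩
  · rwa [lintegral_reflLp (fun z => ofReal (recoilEnergy z.2 + e₀)) fun z => by
      change ofReal (recoilEnergy (reflect z.2) + e₀) = _
      rw [recoilEnergy_reflect]]
  · rwa [lintegral_reflLp (fun z => ofReal (V z.1)) fun z => rfl]

lemma avVal_reflLp (u : avSpace V e₀) (j : Fin 3) :
    avVal V e₀ ⟨_, reflLp_mem (ε := ε) u⟩ (some j) = reflLp ε (avVal V e₀ u (some j)) :=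
  opVal_eq _ _ (some j) (reflLp_mem_gradGraph (paramVal_mem u j))

lemma avForm_reflLp (v u : avSpace V e₀) :
    avForm V e₀ (reflLp ε (v : L2pair)) (reflLp ε (u : L2pair)) = avForm V e₀ v u := by
  have h1 := avForm_eq ⟨_, reflLp_mem (ε := ε) v⟩
    ⟨_, reflLp_mem (ε := ε) u⟩
  rw [electronForm] at h1
  simp only [avVal_reflLp, inner_reflLp] at h1
  rw [h1, avForm_eq, electronForm, integral_inner_reflLp (fun z => (V z.1 : ℂ)) fun z => rfl,
    integral_inner_reflLp (fun z => (recoilEnergy z.2 : ℂ)) fun z => by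
      change ((recoilEnergy (reflect z.2) : ℝ) : ℂ) = _
      rw [recoilEnergy_reflect]]

lemma reflLp_dStarLp : reflLp ε (dStarLp hL hε hφ) = dStarLp hL hε hφ := by
  have h1 := dStarLp_ae_eq hL hε hφ
  refine Lp.ext ?_
  filter_upwards [coeFn_reflLp ε (dStarLp hL hε hφ), h1,
    measurePreserving_reflectEquiv.quasiMeasurePreserving.ae h1] with z a b c
  rw [a, b, c, dStarP, dStarP, mul_sum]
  refine sum_congr rfl fun j _ => ?_
  change _ * (couplingG L ε j (reflect z.2) * (-I * partialX j φ z.1)) = _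
  rw [couplingG_reflect hε]
  have := congrArg (fun r : ℝ => (r : ℂ)) (paritySign_sq ε z.2.2)
  simp only [Complex.ofReal_mul, ofReal_one] at this
  linear_combination (couplingG L ε j z.2 * (-I * partialX j φ z.1)) * this

/-- The solution of `A_V χ = D* p φ` inherits the parity of the right-hand side. -/
lemma reflLp_solution {χ : L2pair}
    (hχ : FormOp (avSpace V e₀ : Set L2pair) (avForm V e₀) χ (dStarLp hL hε hφ)) :
    reflLp ε χ = χ := by
  refine formOp_av_unique hφ ⟨reflLp_mem ⟨χ, hχ.1⟩, fun v hv => ?_⟩ hχ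
  have h1 := avForm_reflLp (ε := ε) ⟨_, reflLp_mem (ε := ε) ⟨v, hv⟩⟩ ⟨χ, hχ.1⟩
  have h2 := inner_reflLp (ε := ε) (reflLp ε v) (dStarLp hL hε hφ)
  simp only [reflLp_reflLp] at h1 h2
  rw [h1, hχ.2 _ (reflLp_mem ⟨v, hv⟩), ← h2, reflLp_dStarLp]

/-- Integrals of the form `∫ k_j ⟨g, u⟩` vanish for functions of the same parity. -/
lemma integral_momentum_inner {g u : L2pair} (hg : reflLp ε g = g) (hu : reflLp ε u = u)
    (j : Fin 3) : ∫ z, (z.2.1 j : ℂ) * ⟪g z, u z⟫ ∂μₚ = 0 := by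
  have h1 : ∫ z, (z.2.1 j : ℂ) * ⟪g z, u z⟫ ∂μₚ =
      - ∫ z, (z.2.1 j : ℂ) * ⟪g z, u z⟫ ∂μₚ := by
    conv_rhs => rw [← integral_reflectEquiv fun z => (z.2.1 j : ℂ) * ⟪g z, u z⟫]
    rw [← integral_neg]
    refine integral_congr_ae ?_
    have a := coeFn_reflLp ε g
    have b := coeFn_reflLp ε u
    rw [hg] at a
    rw [hu] at b
    filter_upwards [a, b] with z a b
    have h2 : ((reflectEquiv z).2.1 j : ℂ) = -(z.2.1 j : ℂ) := by
      change (((-z.2.1 : E3) j : ℝ) : ℂ) = _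
      simp
    rw [h2, a, b]
    simp only [RCLike.inner_apply, map_mul, conj_ofReal]
    have := congrArg (fun r : ℝ => (r : ℂ)) (paritySign_sq ε z.2.2)
    simp only [Complex.ofReal_mul, ofReal_one] at this
    linear_combination ((z.2.1 j : ℂ) * (u (reflectEquiv z) *
      starRingEnd ℂ (g (reflectEquiv z)))) * this
  exact self_eq_neg.1 h1

lemma reflLp_avVal (u : avSpace V e₀) (hu : reflLp ε (u : L2pair) = u) (j : Fin 3) :
    reflLp ε (avVal V e₀ u (some j)) = avVal V e₀ u (some j) := by
  rw [← avVal_reflLp]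
  have : (⟨_, reflLp_mem (ε := ε) u⟩ : avSpace V e₀) = u := Subtype.ext hu
  rw [this]

end Parity

/-! ### Integration over photon configurations -/

section Configurations

lemma measurableSet_config {s : Set Config} :
    MeasurableSet s ↔ ∀ n, MeasurableSet ((fun κ : Fin n → Photon => (⟨n, κ⟩ : Config)) ⁻¹' s) := by
  rw [show (Sigma.instMeasurableSpace : MeasurableSpace Config) = ⨅ n, _ from rfl,
    MeasurableSpace.measurableSet_iInf]
  rfl

lemma measurableEmbedding_mk (n : ℕ) :
    MeasurableEmbedding (fun κ : Fin n → Photon => (⟨n, κ⟩ : Config)) where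
  injective := fun a b h => sigma_mk_injective (β := fun n => Fin n → Photon) h
  measurable := fun s hs => measurableSet_config.1 hs n
  measurableSet_image' := fun {s} hs => by
    refine measurableSet_config.2 fun m => ?_
    by_cases h : m = n
    · subst h
      rwa [Set.preimage_image_eq _ fun a b h =>
        sigma_mk_injective (β := fun n => Fin n → Photon) h]
    · convert MeasurableSet.empty
      ext κ
      simp only [Set.mem_preimage, Set.mem_image, Set.mem_empty_iff_false, iff_false]
      rintro ⟨κ', _, h'⟩
      exact h (congrArg Sigma.fst h').symm

/-- The states with `n` photons. -/
def sector (n : ℕ) (z : E3 × (Fin n → Photon)) : E3 × Config := (z.1, ⟨n, z.2⟩)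

lemma measurableEmbedding_sector (n : ℕ) : MeasurableEmbedding (sector n) :=
  MeasurableEmbedding.id.prodMap (measurableEmbedding_mk n)

lemma measurable_stateP {E : Type*} [MeasurableSpace E] {h : 𝓧 → E}
    (hh : ∀ n, Measurable fun w : (E3 × (Fin n → Photon)) × Photon => h (sector n w.1, w.2)) :
    Measurable h := by
  have e : ∀ n, MeasurableEmbedding
      (Prod.map (sector n) id : (E3 × (Fin n → Photon)) × Photon → 𝓧) :=
    fun n => (measurableEmbedding_sector n).prodMap MeasurableEmbedding.id
  intro s hs
  have : h ⁻¹' s = ⋃ n, Prod.map (sector n) id '' ((fun w => h (sector n w.1, w.2)) ⁻¹' s) := by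
    ext ⟨⟨x, n, κ⟩, k⟩
    simp only [Set.mem_preimage, Set.mem_iUnion, Set.mem_image]
    constructor
    · intro h
      exact ⟨n, ((x, κ), k), h, rfl⟩
    · rintro ⟨m, z, h1, h2⟩
      rw [← h2]; exact h1
  rw [this]
  exact MeasurableSet.iUnion fun n => (e n).measurableSet_image.2 (hh n hs)

lemma measurable_state {E : Type*} [MeasurableSpace E] {f : E3 × Config → E}
    (h : ∀ n, Measurable fun z => f (sector n z)) : Measurable f :=
  (measurable_stateP (h := fun w => f w.1) fun n => (h n).comp measurable_fst).comp
    (measurable_id.prodMk (measurable_const (a := ((0, 0) : Photon))))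

lemma Measurable.sector {E : Type*} [MeasurableSpace E] {f : E3 × Config → E} (h : Measurable f)
    (n : ℕ) : Measurable fun z => f (sector n z) := h.comp (measurableEmbedding_sector n).measurable

/-- The measure on the configurations of `n` photons. -/
abbrev sectorMeasure (n : ℕ) : Measure (Fin n → Photon) := Measure.pi fun _ => μₖ

instance : SFinite configMeasure := by unfold configMeasure; infer_instance

lemma stateMeasure_eq : μₛ =
    Measure.sum fun n => (vol× (sectorMeasure n)).map (sector n) := by
  rw [stateMeasure, configMeasure, Measure.prod_sum_right]
  congr 1
  funext n
  have h := Measure.map_prod_map (volume : Measure E3) (sectorMeasure n) measurable_id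
    (measurableEmbedding_mk n).measurable
  rw [Measure.map_id] at h
  exact h

lemma lintegral_state (h : E3 × Config → ℝ≥0∞) : ∫⁻ z, h z ∂μₛ =
    ∑' n, ∫⁻ z, h (sector n z) ∂(vol× (sectorMeasure n)) := by
  rw [stateMeasure_eq, lintegral_sum_measure]
  exact tsum_congr fun n => (measurableEmbedding_sector n).lintegral_map h

/-- Adding a photon to a configuration. -/
def addPhoton (w : 𝓧) : E3 × Config :=
  (w.1.1, ⟨w.1.2.1 + 1, Fin.cons w.2 w.1.2.2⟩)

lemma measurable_cons {n : ℕ} :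
    Measurable fun w : (E3 × (Fin n → Photon)) × Photon => (Fin.cons w.2 w.1.2 : Fin (n + 1) → Photon) :=
  measurable_pi_iff.2 fun i => by
    refine Fin.cases ?_ (fun j => ?_) i
    · exact measurable_snd
    · exact (measurable_pi_apply j).comp (measurable_snd.comp measurable_fst)

lemma measurable_addPhoton : Measurable addPhoton := by
  refine measurable_stateP fun n => ?_
  exact (measurableEmbedding_sector (n + 1)).measurable.comp
    ((measurable_fst.comp measurable_fst).prodMk measurable_cons)

/-- Removing the `i`-th photon from a configuration. -/
def removePhoton {n : ℕ} (x : E3) (κ : Fin (n + 1) → Photon) (i : Fin (n + 1)) :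
    𝓧 := ((x, ⟨n, i.removeNth κ⟩), κ i)

lemma measurable_removePhoton {n : ℕ} (i : Fin (n + 1)) :
    Measurable fun z : E3 × (Fin (n + 1) → Photon) => removePhoton z.1 z.2 i := by
  refine Measurable.prodMk ?_ ((measurable_pi_apply i).comp measurable_snd)
  refine (measurableEmbedding_sector n).measurable.comp (measurable_fst.prodMk ?_)
  exact measurable_pi_iff.2 fun j => (measurable_pi_apply _).comp measurable_snd

lemma lintegral_removePhoton {n : ℕ} (i : Fin (n + 1)) {h : 𝓧 → ℝ≥0∞}
    (hh : Measurable h) :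
    ∫⁻ z, h (removePhoton z.1 z.2 i) ∂((volume : Measure E3).prod (sectorMeasure (n + 1))) =
      ∫⁻ z, ∫⁻ k, h (sector n z, k) ∂μₖ ∂(vol× (sectorMeasure n)) := by
  have m1 : Measurable fun z : E3 × (Fin n → Photon) => ∫⁻ k, h (sector n z, k) ∂μₖ :=
    hh.lintegral_prod_right'.comp (measurableEmbedding_sector n).measurable
  have m3 : Measurable fun z : E3 × (Fin (n + 1) → Photon) => h (removePhoton z.1 z.2 i) :=
    hh.comp (measurable_removePhoton i)
  rw [lintegral_prod _ m3.aemeasurable, lintegral_prod _ m1.aemeasurable]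
  refine lintegral_congr fun x => ?_
  have h1 := measurePreserving_piFinSuccAbove (fun _ : Fin (n + 1) => μₖ) i
  have m2 : Measurable fun w : Photon × (Fin n → Photon) => h ((x, ⟨n, w.2⟩), w.1) :=
    hh.comp (((measurableEmbedding_sector n).measurable.comp
      (measurable_const.prodMk measurable_snd)).prodMk measurable_fst)
  have h2 := h1.lintegral_comp m2
  refine Eq.trans h2 ?_
  rw [lintegral_prod_symm _ m2.aemeasurable]
  rfl

lemma lintegral_addPhoton_le {h : E3 × Config → ℝ≥0∞} (hh : Measurable h) :
    ∫⁻ w, h (addPhoton w) ∂μₛₖ ≤ ∫⁻ z, h z ∂μₛ := by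
  have m : Measurable fun w => h (addPhoton w) := hh.comp measurable_addPhoton
  rw [lintegral_prod _ m.aemeasurable, lintegral_state, lintegral_state,
    tsum_eq_zero_add' (f := fun n => ∫⁻ z, h (sector n z)
      ∂(vol× (sectorMeasure n))) ENNReal.summable]
  refine le_trans (le_of_eq (tsum_congr fun n => ?_)) le_add_self
  have h1 := lintegral_removePhoton (n := n) 0 m
  rw [← h1]
  refine lintegral_congr fun z => ?_
  simp only [removePhoton, addPhoton, sector]
  congr 3
  exact Fin.cons_self_tail z.2

lemma quasiMeasurePreserving_addPhoton : Measure.QuasiMeasurePreserving addPhoton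
    μₛₖ μₛ := by
  refine ⟨measurable_addPhoton, Measure.AbsolutelyContinuous.mk fun s hs h0 => ?_⟩
  rw [map_apply measurable_addPhoton hs, ← lintegral_indicator_one
    (measurable_addPhoton hs)]
  refine le_antisymm ?_ bot_le
  have h1 := lintegral_addPhoton_le (measurable_one.indicator hs : Measurable (s.indicator 1))
  rw [lintegral_indicator_one hs, h0] at h1
  exact h1

/-- The mean over the photons of a configuration of `h(configuration without the photon, photon)`. -/
def meanL (h : 𝓧 → ℝ≥0∞) : E3 × Config → ℝ≥0∞
  | (_, ⟨0, _⟩) => 0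
  | (x, ⟨n + 1, κ⟩) => ((n + 1 : ℕ) : ℝ≥0∞)⁻¹ * ∑ i, h (removePhoton x κ i)

lemma measurable_meanL {h : 𝓧 → ℝ≥0∞} (hh : Measurable h) :
    Measurable (meanL h) := by
  refine measurable_state fun n => ?_
  cases n with
  | zero => exact measurable_const
  | succ n =>
    exact (Finset.measurable_fun_sum _ fun i _ => hh.comp (measurable_removePhoton i)).const_mul _

/-- Mecke's formula: averaging over the photons of a configuration amounts to integrating over an
additional photon. -/
lemma lintegral_meanL {h : 𝓧 → ℝ≥0∞} (hh : Measurable h) :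
    ∫⁻ z, meanL h z ∂μₛ = ∫⁻ w, h w ∂μₛₖ := by
  rw [lintegral_prod _ hh.aemeasurable, lintegral_state, lintegral_state,
    tsum_eq_zero_add' ENNReal.summable]
  have h0 : ∫⁻ z, meanL h (sector 0 z) ∂((volume : Measure E3).prod (sectorMeasure 0)) = 0 := by
    simp [sector, meanL]
  rw [h0, zero_add]
  refine tsum_congr fun n => ?_
  simp only [sector, meanL]
  have m : ∀ i : Fin (n + 1), Measurable fun z : E3 × (Fin (n + 1) → Photon) =>
      h (removePhoton z.1 z.2 i) := fun i => hh.comp (measurable_removePhoton i)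
  rw [lintegral_const_mul' _ _ (by simp), lintegral_finsetSum _ fun i _ => m i]
  rw [sum_congr rfl fun i _ => lintegral_removePhoton (n := n) i hh, Finset.sum_const,
    Finset.card_univ, Fintype.card_fin, nsmul_eq_mul, ← mul_assoc, ENNReal.inv_mul_cancel (by simp)
    (by simp), one_mul]
  rfl

/-- The complex-valued version of `meanL`. -/
def meanC (h : 𝓧 → ℂ) : E3 × Config → ℂ
  | (_, ⟨0, _⟩) => 0
  | (x, ⟨n + 1, κ⟩) => ((n + 1 : ℕ) : ℂ)⁻¹ * ∑ i, h (removePhoton x κ i)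

/-- The kernel which removes one of the photons of a configuration at random. -/
def removal : ProbabilityTheory.Kernel (E3 × Config) 𝓧 where
  toFun
    | (_, ⟨0, _⟩) => 0
    | (x, ⟨n + 1, κ⟩) => ((n + 1 : ℕ) : ℝ≥0∞)⁻¹ • ∑ i, Measure.dirac (removePhoton x κ i)
  measurable' := by
    refine Measure.measurable_of_measurable_coe _ fun s hs => ?_
    convert measurable_meanL (measurable_one.indicator hs : Measurable (s.indicator 1)) with z
    obtain ⟨x, n, κ⟩ := z
    cases n <;> simp [meanL, hs]

lemma lintegral_removal {h : 𝓧 → ℝ≥0∞} (hh : Measurable h) (z : E3 × Config) :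
    ∫⁻ w, h w ∂removal z = meanL h z := by
  obtain ⟨x, n, κ⟩ := z
  cases n <;> simp [removal, meanL, lintegral_dirac' _ hh]

lemma integral_removal {h : 𝓧 → ℂ} (hh : Measurable h) (z : E3 × Config) :
    ∫ w, h w ∂removal z = meanC h z := by
  obtain ⟨x, n, κ⟩ := z
  cases n with
  | zero => simp [removal, meanC]
  | succ n =>
    simp [-Nat.cast_add, -Nat.cast_one, removal, meanC, integral_finsetSum_measure fun i _ =>
      integrable_dirac' hh.stronglyMeasurable enorm_lt_top, integral_dirac' _ _ hh.stronglyMeasurable]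

/-- Mecke's formula for complex-valued functions. -/
lemma integral_meanC {h : 𝓧 → ℂ} (hh : Measurable h) (hi : Integrable h μₛₖ) :
    Integrable (meanC h) μₛ ∧ ∫ z, meanC h z ∂μₛ = ∫ w, h w ∂μₛₖ := by
  have e : (removal.comp (ProbabilityTheory.Kernel.const Unit μₛ)) () = μₛₖ := by
    refine Measure.ext_of_lintegral _ fun h hh => ?_
    rw [ProbabilityTheory.Kernel.lintegral_comp _ _ _ hh, ← lintegral_meanL hh]
    exact lintegral_congr fun z => lintegral_removal hh z
  rw [← e] at hi ⊢
  rw [ProbabilityTheory.Kernel.integral_comp hi, ← funext (integral_removal hh)]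
  exact ⟨hi.integral_comp, rfl⟩

end Configurations

/-! ### Adding and removing photons: adjointness and commutation -/

section Fock

/-- Bose symmetry. -/
def IsSymm {E : Type*} (f : E3 × Config → E) : Prop :=
  ∀ (x : E3) (n : ℕ) (κ : Fin n → Photon) (π : Equiv.Perm (Fin n)),
    f (x, ⟨n, κ ∘ π⟩) = f (x, ⟨n, κ⟩)

/-- The operator-valued distribution `a_λ(k)`, applied to `f`. -/
def pull (f : 𝓦) (w : 𝓧) : Spin :=
  (√(w.1.2.1 + 1) : ℂ) • f (addPhoton w)

/-- The operation `∫ a*_λ(k) e(·, k) dk`. -/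
def raise (e : 𝓧 → Spin) : 𝓦
  | (_, ⟨0, _⟩) => 0
  | (x, ⟨n + 1, κ⟩) => ((√(n + 1))⁻¹ : ℂ) • ∑ i, e (removePhoton x κ i)

lemma create_eq_raise (g : E3 → Photon → ℂ) (Ψ : 𝓦) :
    create g Ψ = raise fun w => g w.1.1 w.2 • Ψ w.1 := by
  funext ⟨x, n, κ⟩
  cases n <;> rfl

lemma annihilate_eq_integral (g : E3 → Photon → ℂ) (Ψ : 𝓦) (z : E3 × Config) :
    annihilate g Ψ z = ∫ k, (starRingEnd ℂ) (g z.1 k) • pull Ψ (z, k) ∂μₖ := by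
  rw [annihilate, ← integral_smul]
  refine integral_congr_ae (of_forall fun k => ?_)
  simp only [pull, addPhoton]
  rw [smul_comm]

lemma cast_sqrt_ne_zero (n : ℕ) : ((√(n + 1) : ℝ) : ℂ) ≠ 0 := by
  rw [ofReal_ne_zero]
  positivity

lemma cast_sqrt_mul_self (n : ℕ) :
    ((√(n + 1) : ℝ) : ℂ) * ((√(n + 1) : ℝ) : ℂ) = ((n + 1 : ℕ) : ℂ) := by
  rw [← Complex.ofReal_mul, mul_self_sqrt (by positivity)]
  push_cast; rfl

lemma measurable_pull {f : 𝓦} (hf : Measurable f) : Measurable (pull f) := by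
  have h1 : Measurable fun w : 𝓧 => ((√(w.1.2.1 + 1) : ℝ) : ℂ) :=
    measurable_stateP fun n => (measurable_const :
      Measurable fun _ : (E3 × (Fin n → Photon)) × Photon => ((√(n + 1) : ℝ) : ℂ))
  exact h1.smul (hf.comp measurable_addPhoton)

lemma measurable_raise {e : 𝓧 → Spin} (he : Measurable e) :
    Measurable (raise e) := by
  refine measurable_state fun n => ?_
  cases n with
  | zero => exact measurable_const
  | succ n =>
    have h1 : Measurable fun z : E3 × (Fin (n + 1) → Photon) => ∑ i, e (removePhoton z.1 z.2 i) :=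
      Finset.measurable_fun_sum _ fun i _ => he.comp (measurable_removePhoton i)
    exact h1.const_smul (((√(n + 1) : ℝ) : ℂ)⁻¹)

lemma IsSymm.addPhoton_removePhoton {E : Type*} {f : E3 × Config → E} (hf : IsSymm f) (x : E3)
    {n : ℕ} (κ : Fin (n + 1) → Photon) (i : Fin (n + 1)) :
    f (addPhoton (removePhoton x κ i)) = f (x, ⟨n + 1, κ⟩) := by
  rw [← hf x (n + 1) κ i.cycleRange.symm]
  simp only [addPhoton, removePhoton]
  congr 3
  funext j
  refine Fin.cases ?_ (fun j => ?_) j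
  · simp [Fin.cycleRange_symm_zero]
  · simp [Fin.cycleRange_symm_succ, Fin.removeNth]

lemma IsSymm.raise {e : 𝓧 → Spin} (he : ∀ k, IsSymm fun z => e (z, k)) :
    IsSymm (raise e) := by
  intro x n κ π
  cases n with
  | zero => rfl
  | succ n =>
    simp only [PauliFierz.raise]
    congr 1
    rw [← Equiv.sum_comp π fun i => e (removePhoton x κ i)]
    refine sum_congr rfl fun i _ => ?_
    have h1 : ∀ j : Fin n, ∃ j', (π i).succAbove j' = π (i.succAbove j) := fun j =>
      Fin.exists_succAbove_eq fun h => Fin.succAbove_ne i j (π.injective h)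
    choose σ hσ using h1
    have hinj : Function.Injective σ := fun a b hab =>
      Fin.succAbove_right_injective (π.injective (by rw [← hσ, ← hσ, hab]))
    have h2 := he (κ (π i)) x n ((π i).removeNth κ)
      (Equiv.ofBijective σ (Finite.injective_iff_bijective.1 hinj))
    simp only [removePhoton, Function.comp] at h2 ⊢
    rw [← h2]
    congr 4
    funext j
    simp only [Fin.removeNth, Equiv.ofBijective_apply, Function.comp, hσ]

/-- Creation is adjoint to annihilation, pointwise before integration. -/
lemma inner_raise {f : 𝓦} (hf : IsSymm f) (e : 𝓧 → Spin)
    (z : E3 × Config) :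
    ⟪f z, raise e z⟫ = meanC (fun w => ⟪pull f w, e w⟫) z := by
  obtain ⟨x, n, κ⟩ := z
  cases n with
  | zero => simp [raise, meanC]
  | succ n =>
    simp only [raise, meanC]
    rw [inner_smul_right, inner_sum, mul_sum, mul_sum]
    refine sum_congr rfl fun i _ => ?_
    rw [pull, hf.addPhoton_removePhoton x κ i, inner_smul_left, conj_ofReal,
      ← cast_sqrt_mul_self n, mul_inv]
    have h := cast_sqrt_ne_zero n
    simp only [removePhoton]
    field_simp

lemma integrable_inner_raise {f : 𝓦} (hf : IsSymm f) (hfm : Measurable f)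
    {e : 𝓧 → Spin} (he : Measurable e)
    (hi : Integrable (fun w => ⟪pull f w, e w⟫) μₛₖ) :
    Integrable (fun z => ⟪f z, raise e z⟫) μₛ ∧
    ∫ z, ⟪f z, raise e z⟫ ∂μₛ =
      ∫ w, ⟪pull f w, e w⟫ ∂μₛₖ := by
  have m : Measurable fun w => ⟪pull f w, e w⟫ := (measurable_pull hfm).inner he
  simp only [inner_raise hf]
  exact integral_meanC m hi

lemma enorm_sqrt_smul_sq' (n : ℕ) (v : Spin) :
    ‖((√(n + 1) : ℝ) : ℂ) • v‖ₑ ^ 2 = ((n + 1 : ℕ) : ℝ≥0∞) * ‖v‖ₑ ^ 2 := by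
  rw [enorm_sqrt_smul_sq]
  congr 1
  rw [← ofReal_natCast]
  push_cast; rfl

lemma meanL_weight {f : 𝓦} (hf : IsSymm f) (W : Photon → ℝ≥0∞)
    (z : E3 × Config) :
    meanL (fun w => W w.2 * ‖pull f w‖ₑ ^ 2) z = (∑ i, W (z.2.2 i)) * ‖f z‖ₑ ^ 2 := by
  obtain ⟨x, n, κ⟩ := z
  cases n with
  | zero => simp [meanL]
  | succ n =>
    simp only [meanL]
    rw [mul_sum, sum_mul]
    refine sum_congr rfl fun i _ => ?_
    rw [pull, hf.addPhoton_removePhoton x κ i]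
    simp only [removePhoton]
    rw [enorm_sqrt_smul_sq', mul_left_comm (W (κ i)), ← mul_assoc, ENNReal.inv_mul_cancel
      (by simp) (by simp), one_mul]

/-- `∫ W(k) ‖a(k) Ψ‖² dk` is the expectation of the second quantization of `W`. -/
lemma lintegral_pull {f : 𝓦} (hf : IsSymm f) (hfm : Measurable f)
    {W : Photon → ℝ≥0∞} (hW : Measurable W) :
    ∫⁻ w, W w.2 * ‖pull f w‖ₑ ^ 2 ∂μₛₖ =
      ∫⁻ z, (∑ i, W (z.2.2 i)) * ‖f z‖ₑ ^ 2 ∂μₛ := by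
  have m : Measurable fun w => W w.2 * ‖pull f w‖ₑ ^ 2 :=
    (hW.comp measurable_snd).mul ((measurable_pull hfm).enorm.pow_const 2)
  rw [← lintegral_meanL m]
  exact lintegral_congr fun z => meanL_weight hf W z

/-- The commutation relation: apart from the contraction, which gives back `e`, annihilating after
creating is a product of two annihilations, seen from the other side. -/
lemma enorm_pull_raise_sub_mul_le {f : 𝓦} (hf : IsSymm f)
    {e : 𝓧 → Spin} {b : Photon → ℝ≥0∞}
    (hb : ∀ w, ‖e w‖ₑ ≤ b w.2 * ‖f w.1‖ₑ) (z : E3 × Config) (k : Photon) :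
    ‖pull (raise e) (z, k) - e (z, k)‖ₑ * ‖e (z, k)‖ₑ ≤
      meanL (fun w => (b k * ‖pull f (w.1, k)‖ₑ) * (b w.2 * ‖pull f w‖ₑ)) z := by
  obtain ⟨x, n, γ⟩ := z
  have h0 : pull (raise e) ((x, ⟨n, γ⟩), k) = ∑ i, e (removePhoton x (Fin.cons k γ) i) := by
    simp only [pull, addPhoton, raise]
    rw [smul_smul, mul_inv_cancel₀ (cast_sqrt_ne_zero n), one_smul]
  have h1 : removePhoton x (Fin.cons k γ : Fin (n + 1) → Photon) 0 = ((x, ⟨n, γ⟩), k) := by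
    simp [removePhoton, Fin.removeNth_zero]
  rw [h0, Fin.sum_univ_succ, h1, add_sub_cancel_left]
  cases n with
  | zero => simp
  | succ n =>
    have h2 : ∀ i : Fin (n + 1), removePhoton x (Fin.cons k γ : Fin (n + 2) → Photon) i.succ =
        (addPhoton ((x, ⟨n, i.removeNth γ⟩), k), γ i) := by
      intro i
      simp only [removePhoton, addPhoton, Fin.cons_succ]
      congr 3
      funext j
      refine Fin.cases ?_ (fun j => ?_) j
      · simp [Fin.removeNth]
      · simp [Fin.removeNth]
    simp only [h2, meanL]
    refine le_trans (mul_le_mul' (enorm_sum_le _ _) (hb _)) ?_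
    rw [sum_mul, mul_sum]
    refine sum_le_sum fun i _ => ?_
    refine le_trans (mul_le_mul' (hb _) le_rfl) (le_of_eq ?_)
    rw [pull, pull, hf.addPhoton_removePhoton x γ i]
    simp only [removePhoton, enorm_smul]
    have h3 : ‖((√(n + 1) : ℝ) : ℂ)‖ₑ * ‖((√(n + 1) : ℝ) : ℂ)‖ₑ =
        ((n + 1 : ℕ) : ℝ≥0∞) := by
      rw [← enorm_mul, cast_sqrt_mul_self, ← ofReal_norm, Complex.norm_natCast,
        ofReal_natCast]
    calc b (γ i) * ‖f (addPhoton ((x, ⟨n, i.removeNth γ⟩), k))‖ₑ * (b k * ‖f (x, ⟨n + 1, γ⟩)‖ₑ)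
        = (((n + 1 : ℕ) : ℝ≥0∞)⁻¹ * ((n + 1 : ℕ) : ℝ≥0∞)) *
          (b (γ i) * ‖f (addPhoton ((x, ⟨n, i.removeNth γ⟩), k))‖ₑ *
            (b k * ‖f (x, ⟨n + 1, γ⟩)‖ₑ)) := by
          rw [ENNReal.inv_mul_cancel (by simp) (by simp), one_mul]
      _ = _ := by rw [← h3]; ring

lemma lintegral_mul_sq_le {X : Type*} [MeasurableSpace X] {μ : Measure X} {f g : X → ℝ≥0∞}
    (hf : AEMeasurable f μ) (hg : AEMeasurable g μ) :
    (∫⁻ x, f x * g x ∂μ) ^ 2 ≤ (∫⁻ x, f x ^ 2 ∂μ) * ∫⁻ x, g x ^ 2 ∂μ := by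
  have h := ENNReal.lintegral_mul_le_Lp_mul_Lq μ Real.HolderConjugate.two_two hf hg
  have h2 : ∀ a : ℝ≥0∞, (a ^ (1 / 2 : ℝ)) ^ 2 = a := fun a => by
    rw [← rpow_natCast, ← rpow_mul]; simp
  refine le_trans (pow_le_pow_left' h 2) (le_of_eq ?_)
  rw [mul_pow, h2, h2]
  simp only [ENNReal.rpow_ofNat]

/-- The bound on the exchange term. -/
lemma lintegral_pull_raise_le {f : 𝓦} (hf : IsSymm f) (hfm : Measurable f)
    {e : 𝓧 → Spin} (he : Measurable e) {b₁ v : Photon → ℝ≥0∞}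
    (hb₁ : Measurable b₁) (hv : Measurable v)
    (hb : ∀ w, ‖e w‖ₑ ≤ (b₁ w.2 * v w.2) * ‖f w.1‖ₑ) :
    ∫⁻ w, ‖pull (raise e) w - e w‖ₑ * ‖e w‖ₑ ∂μₛₖ ≤
      (∫⁻ k, b₁ k ^ 2 ∂μₖ) *
        ∫⁻ w, v w.2 ^ 2 * ‖pull f w‖ₑ ^ 2 ∂μₛₖ := by
  have m1 : Measurable fun w => ‖pull (raise e) w - e w‖ₑ * ‖e w‖ₑ :=
    ((measurable_pull (measurable_raise he)).sub he).enorm.mul he.enorm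
  let P : 𝓧 → ℝ≥0∞ := fun w => b₁ w.2 * v w.2 * ‖pull f w‖ₑ
  have mP : Measurable P := ((hb₁.comp measurable_snd).mul (hv.comp measurable_snd)).mul
    (measurable_pull hfm).enorm
  have mP' : ∀ k, Measurable fun z => P (z, k) := fun k => mP.comp (measurable_id.prodMk measurable_const)
  have mPz : ∀ z, Measurable fun k => P (z, k) := fun z => mP.comp (measurable_const.prodMk measurable_id)
  have mI : Measurable fun z => ∫⁻ k, P (z, k) ∂μₖ := mP.lintegral_prod_right'
  have m2 : Measurable fun w => v w.2 ^ 2 * ‖pull f w‖ₑ ^ 2 :=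
    ((hv.comp measurable_snd).pow_const 2).mul ((measurable_pull hfm).enorm.pow_const 2)
  calc ∫⁻ w, ‖pull (raise e) w - e w‖ₑ * ‖e w‖ₑ ∂μₛₖ
      = ∫⁻ k, ∫⁻ z, ‖pull (raise e) (z, k) - e (z, k)‖ₑ * ‖e (z, k)‖ₑ ∂μₛ ∂μₖ :=
        lintegral_prod_symm _ m1.aemeasurable
    _ ≤ ∫⁻ k, ∫⁻ z, meanL (fun w => P (w.1, k) * P w) z ∂μₛ ∂μₖ :=
        lintegral_mono fun k => lintegral_mono fun z =>
          enorm_pull_raise_sub_mul_le hf (b := fun k => b₁ k * v k) hb z k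
    _ = ∫⁻ k, ∫⁻ z, P (z, k) * ∫⁻ k', P (z, k') ∂μₖ ∂μₛ ∂μₖ := by
        refine lintegral_congr fun k => ?_
        have m3 : Measurable fun w : 𝓧 => P (w.1, k) * P w :=
          ((mP' k).comp measurable_fst).mul mP
        rw [lintegral_meanL m3, lintegral_prod _ m3.aemeasurable]
        exact lintegral_congr fun z => lintegral_const_mul (P (z, k)) (mPz z)
    _ = ∫⁻ z, ∫⁻ k, P (z, k) * ∫⁻ k', P (z, k') ∂μₖ ∂μₖ ∂μₛ := by
        have m3 : Measurable fun w : Photon × (E3 × Config) =>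
            P (w.2, w.1) * ∫⁻ k', P (w.2, k') ∂μₖ :=
          (mP.comp measurable_swap).mul (mI.comp measurable_snd)
        exact lintegral_lintegral_swap m3.aemeasurable
    _ ≤ ∫⁻ z, (∫⁻ k, b₁ k ^ 2 ∂μₖ) *
          ∫⁻ k, v k ^ 2 * ‖pull f (z, k)‖ₑ ^ 2 ∂μₖ ∂μₛ := by
        refine lintegral_mono fun z => ?_
        simp only
        rw [lintegral_mul_const _ (mPz z), ← sq]
        have m4 : Measurable fun k => v k * ‖pull f (z, k)‖ₑ :=
          hv.mul ((measurable_pull hfm).comp (measurable_const.prodMk measurable_id)).enorm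
        have h := lintegral_mul_sq_le (μ := μₖ) hb₁.aemeasurable m4.aemeasurable
        simp only [mul_pow, ← mul_assoc] at h
        exact h
    _ = _ := by
        rw [lintegral_const_mul _ m2.lintegral_prod_right', lintegral_prod _ m2.aemeasurable]

/-- The norm of a created vector: up to the exchange term it is the norm of the source. -/
lemma norm_raise_sq {f : 𝓦} (hf : IsSymm f) (hfm : Measurable f)
    {e : 𝓧 → Spin} (he : Measurable e) (hes : ∀ k, IsSymm fun z => e (z, k))
    {b₁ v : Photon → ℝ≥0∞} (hb₁ : Measurable b₁) (hv : Measurable v)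
    (hb : ∀ w, ‖e w‖ₑ ≤ (b₁ w.2 * v w.2) * ‖f w.1‖ₑ) (heL : MemLp e 2 μₛₖ)
    (hB : ∫⁻ k, b₁ k ^ 2 ∂μₖ ≠ ⊤)
    (hD : ∫⁻ w, v w.2 ^ 2 * ‖pull f w‖ₑ ^ 2 ∂μₛₖ ≠ ⊤) :
    MemLp (raise e) 2 μₛ ∧
    |∫ z, ‖raise e z‖ ^ 2 ∂μₛ - ∫ w, ‖e w‖ ^ 2 ∂μₛₖ| ≤
      (∫⁻ k, b₁ k ^ 2 ∂μₖ).toReal *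
        (∫⁻ w, v w.2 ^ 2 * ‖pull f w‖ₑ ^ 2 ∂μₛₖ).toReal := by
  have h1 := lintegral_pull_raise_le hf hfm he hb₁ hv hb
  have hm := measurable_raise he
  have hfin := ENNReal.mul_ne_top hB hD
  have m1 : Measurable fun w => ⟪pull (raise e) w - e w, e w⟫ :=
    ((measurable_pull hm).sub he).inner he
  have h2 : ∫⁻ w, ‖⟪pull (raise e) w - e w, e w⟫‖ₑ
      ∂μₛₖ ≤ (∫⁻ k, b₁ k ^ 2 ∂μₖ) *
        ∫⁻ w, v w.2 ^ 2 * ‖pull f w‖ₑ ^ 2 ∂μₛₖ := by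
    refine le_trans (lintegral_mono fun w => ?_) h1
    simp only [← ofReal_norm]
    rw [← ofReal_mul (norm_nonneg _)]
    exact ofReal_le_ofReal (norm_inner_le_norm _ _)
  have i1 : Integrable (fun w => ⟪pull (raise e) w - e w, e w⟫)
      μₛₖ :=
    ⟨m1.aestronglyMeasurable, lt_of_le_of_lt h2 hfin.lt_top⟩
  have i2 : Integrable (fun w => ⟪e w, e w⟫) μₛₖ :=
    integrable_inner_of_memLp heL heL
  have e1 : ∀ w, ⟪pull (raise e) w, e w⟫ =
      ⟪pull (raise e) w - e w, e w⟫ + ⟪e w, e w⟫ := fun w => by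
    rw [← inner_add_left, sub_add_cancel]
  have i3 : Integrable (fun w => ⟪pull (raise e) w, e w⟫)
      μₛₖ := by
    simp only [e1]; exact i1.add i2
  obtain ⟨j1, j2⟩ := integrable_inner_raise (IsSymm.raise hes) hm he i3
  simp only [inner_self_re] at j1 j2
  have j3 : Integrable (fun z => ‖raise e z‖ ^ 2) μₛ := by
    exact j1.re.congr (of_forall fun z => ofReal_re _)
  refine ⟨(memLp_two_iff_integrable_sq_norm hm.aestronglyMeasurable).2 j3, ?_⟩
  have e2 : ((∫ z, ‖raise e z‖ ^ 2 ∂μₛ -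
      ∫ w, ‖e w‖ ^ 2 ∂μₛₖ : ℝ) : ℂ) =
      ∫ w, ⟪pull (raise e) w - e w, e w⟫ ∂μₛₖ := by
    have e3 : ∫ w, ⟪e w, e w⟫ ∂μₛₖ =
        ((∫ w, ‖e w‖ ^ 2 ∂μₛₖ : ℝ) : ℂ) := by
      simp only [inner_self_re]; exact integral_complex_ofReal
    rw [integral_complex_ofReal] at j2
    rw [ofReal_sub, j2]
    simp only [e1]
    rw [integral_add i1 i2, e3, add_sub_cancel_right]
  rw [← norm_eq_abs, ← norm_real, e2, ← ENNReal.toReal_mul]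
  refine le_trans (norm_integral_le_integral_norm _) ?_
  rw [integral_norm_eq_lintegral_enorm m1.aestronglyMeasurable]
  exact ENNReal.toReal_mono hfin h2

end Fock

/-! ### Symmetric representatives, couplings and their source maps -/

section Representatives

lemma ae_state {p : E3 × Config → Prop} : (∀ᵐ z ∂μₛ, p z) ↔
    ∀ n, ∀ᵐ z ∂(vol× (sectorMeasure n)), p (sector n z) := by
  rw [stateMeasure_eq, Measure.ae_sum_iff]
  exact forall_congr' fun n => (measurableEmbedding_sector n).ae_map_iff

lemma measurable_perm {n : ℕ} (π : Equiv.Perm (Fin n)) :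
    Measurable fun κ : Fin n → Photon => κ ∘ π :=
  measurable_pi_iff.2 fun i => measurable_pi_apply (π i)

lemma measurePreserving_perm_config {n : ℕ} (π : Equiv.Perm (Fin n)) :
    MeasurePreserving (fun κ : Fin n → Photon => κ ∘ π) (sectorMeasure n) (sectorMeasure n) := by
  have h := measurePreserving_piCongrLeft (fun _ : Fin n => μₖ) π.symm
  have h1 : (fun κ : Fin n → Photon => κ ∘ π) =
      MeasurableEquiv.piCongrLeft (fun _ : Fin n => Photon) π.symm := by
    funext κ i
    rw [show (MeasurableEquiv.piCongrLeft (fun _ : Fin n => Photon) π.symm) κ i =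
      (Equiv.piCongrLeft (fun _ : Fin n => Photon) π.symm) κ i from rfl, Equiv.piCongrLeft_apply]
    simp
  rwa [← h1] at h

lemma measurePreserving_perm {n : ℕ} (π : Equiv.Perm (Fin n)) :
    MeasurePreserving (fun z : E3 × (Fin n → Photon) => (z.1, z.2 ∘ π))
      (vol× (sectorMeasure n)) (vol× (sectorMeasure n)) :=
  (MeasurePreserving.id (volume : Measure E3)).prod (measurePreserving_perm_config π)

/-- A function which is almost everywhere symmetric has a representative which is symmetric
everywhere. -/
lemma exists_symm_of_perm {g : 𝓦} (mg : Measurable g)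
    (h : ∀ (n : ℕ) (π : Equiv.Perm (Fin n)), ∀ᵐ z ∂(vol× (sectorMeasure n)),
      g (z.1, ⟨n, z.2 ∘ π⟩) = g (sector n z)) :
    ∃ f : 𝓦, Measurable f ∧ IsSymm f ∧ g =ᵐ[μₛ] f := by
  let f : 𝓦 := fun z => ((z.2.1.factorial : ℂ))⁻¹ •
    ∑ π : Equiv.Perm (Fin z.2.1), g (z.1, ⟨z.2.1, z.2.2 ∘ π⟩)
  refine ⟨f, measurable_state fun n => ?_, fun x n κ π => ?_, ae_state.2 fun n => ?_⟩
  · have h2 : Measurable fun z : E3 × (Fin n → Photon) =>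
        ∑ π : Equiv.Perm (Fin n), g (z.1, ⟨n, z.2 ∘ π⟩) :=
      Finset.measurable_fun_sum _ fun π _ => mg.comp ((measurableEmbedding_sector n).measurable.comp
        (measurable_fst.prodMk ((measurable_perm π).comp measurable_snd)))
    exact h2.const_smul ((n.factorial : ℂ)⁻¹)
  · simp only [f]
    congr 1
    exact Fintype.sum_equiv (Equiv.mulLeft π) _ _ fun σ => rfl
  · filter_upwards [ae_all_iff.2 (h n)] with z hz
    simp only [f, sector] at hz ⊢
    rw [sum_congr rfl fun π _ => hz π, Finset.sum_const, Finset.card_univ, Fintype.card_perm,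
      Fintype.card_fin, ← Nat.cast_smul_eq_nsmul ℂ, smul_smul, inv_mul_cancel₀
      (by exact_mod_cast n.factorial_ne_zero), one_smul]

lemma ae_perm_of_mem {Ψ : 𝓗} (hΨ : Ψ ∈ stateSpace) (n : ℕ)
    (π : Equiv.Perm (Fin n)) : ∀ᵐ z ∂(vol× (sectorMeasure n)),
      Ψ (z.1, ⟨n, z.2 ∘ π⟩) = Ψ (sector n z) := by
  obtain ⟨f, h0, h1⟩ := hΨ
  rw [EventuallyEq, ae_state] at h1
  filter_upwards [(measurePreserving_perm π).quasiMeasurePreserving.ae (h1 n), h1 n] with z h2 h3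
  exact (h2.trans (h0 z.1 n z.2 π)).trans h3.symm

/-- Every state has a measurable representative which is symmetric everywhere. -/
lemma exists_symm_rep {Ψ : 𝓗} (hΨ : Ψ ∈ stateSpace) :
    ∃ f : 𝓦, Measurable f ∧ IsSymm f ∧ Ψ =ᵐ[μₛ] f :=
  exists_symm_of_perm (Lp.stronglyMeasurable Ψ).measurable (ae_perm_of_mem hΨ)

lemma mem_stateSpace_of_perm {Ψ : 𝓗}
    (h : ∀ (n : ℕ) (π : Equiv.Perm (Fin n)), ∀ᵐ z ∂(vol× (sectorMeasure n)),
      Ψ (z.1, ⟨n, z.2 ∘ π⟩) = Ψ (sector n z)) : Ψ ∈ stateSpace := by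
  obtain ⟨f, -, hf, hΨ⟩ := exists_symm_of_perm (Lp.stronglyMeasurable Ψ).measurable h
  exact ⟨f, hf, hΨ⟩

lemma pull_congr {f g : 𝓦} (h : f =ᵐ[μₛ] g) :
    pull f =ᵐ[μₛₖ] pull g := by
  filter_upwards [quasiMeasurePreserving_addPhoton.ae h] with w hw
  rw [pull, pull, hw]

lemma raise_congr {e e' : 𝓧 → Spin}
    (h : e =ᵐ[μₛₖ] e') : raise e =ᵐ[μₛ] raise e' := by
  let N := toMeasurable μₛₖ {w | ¬ e w = e' w}
  have hN : MeasurableSet N := measurableSet_toMeasurable _ _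
  have m : Measurable (N.indicator (1 : 𝓧 → ℝ≥0∞)) :=
    measurable_one.indicator hN
  have h1 := lintegral_meanL m
  rw [lintegral_indicator_one hN, measure_toMeasurable, ae_iff.1 h,
    lintegral_eq_zero_iff (measurable_meanL m)] at h1
  filter_upwards [h1] with z hz
  obtain ⟨x, n, κ⟩ := z
  cases n with
  | zero => rfl
  | succ n =>
    simp only [meanL, Pi.zero_apply, mul_eq_zero, Finset.sum_eq_zero_iff] at hz
    simp only [raise]
    congr 1
    refine sum_congr rfl fun i _ => ?_
    by_contra hc
    have h3 := (hz.resolve_left (by simp)) i (mem_univ i)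
    rw [Set.indicator_of_mem (subset_toMeasurable _ _ hc)] at h3
    exact one_ne_zero h3

end Representatives

section Couplings

variable {L : ℝ}

lemma lintegral_cutoffBound_sq_lt (L : ℝ) :
    ∫⁻ k, ofReal (cutoffBound L k ^ 2) ∂μₖ < ⊤ := by
  have h1 : ∀ k, cutoffBound L k ^ 2 ≤ |L| * (cutoffBound L k ^ 2 / photonEnergy k) := fun k =>
    (cutoffBound_sq_le L k).trans (mul_le_mul_of_nonneg_right (le_abs_self L)
      (div_nonneg (sq_nonneg _) (photonEnergy_nonneg k)))
  refine lt_of_le_of_lt (lintegral_mono fun k => ofReal_le_ofReal (h1 k)) ?_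
  simp only [ofReal_mul (abs_nonneg L)]
  rw [lintegral_const_mul' _ _ ofReal_ne_top]
  exact mul_lt_top ofReal_lt_top (lintegral_cutoffBound_sq_div L)

/-- The matrix-valued coupling functions: they are dominated by the ultraviolet cutoff. -/
def couplings (L : ℝ) : Submodule ℂ (Photon → Spin →L[ℂ] Spin) where
  carrier := {t | (∀ s, Measurable fun k => t k s) ∧ ∃ K : ℝ, 0 ≤ K ∧ ∀ k, ‖t k‖ ≤ K * cutoffBound L k}
  zero_mem' := ⟨fun s => measurable_const, 0, le_rfl, fun k => by simp⟩
  add_mem' := by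
    rintro t t' ⟨h, K, hK0, hK⟩ ⟨h', K', hK0', hK'⟩
    refine ⟨fun s => (h s).add (h' s), K + K', add_nonneg hK0 hK0', fun k => ?_⟩
    rw [add_mul]
    exact (norm_add_le _ _).trans (add_le_add (hK k) (hK' k))
  smul_mem' := by
    rintro c t ⟨h, K, hK0, hK⟩
    refine ⟨fun s => (h s).const_smul c, ‖c‖ * K, mul_nonneg (norm_nonneg c) hK0, fun k => ?_⟩
    rw [Pi.smul_apply, norm_smul, mul_assoc]
    exact mul_le_mul_of_nonneg_left (hK k) (norm_nonneg c)

lemma measurable_clm_apply {X : Type*} [MeasurableSpace X] {t : X → Spin →L[ℂ] Spin}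
    (ht : ∀ s, Measurable fun k => t k s) {f : X → Spin} (hf : Measurable f) :
    Measurable fun x => t x (f x) := by
  have h1 : ∀ x, t x (f x) = ∑ i, f x i • t x (single i 1) := fun x => by
    conv_lhs => rw [show f x = ∑ i, f x i • (single i 1 : Spin) by
      ext j; simp [Fin.sum_univ_two]; fin_cases j <;> simp]
    simp only [map_sum, map_smul]
  simp only [h1]
  refine Finset.measurable_fun_sum _ fun i _ => ?_
  have h2 : Measurable fun x => f x i :=
    (proj (𝕜 := ℂ) i : Spin →L[ℂ] ℂ).measurable.comp hf
  exact h2.smul (ht _)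

lemma measurable_phase : Measurable fun w : 𝓧 => phase w.1.1 w.2 := by
  unfold phase
  refine Complex.measurable_exp.comp (Measurable.neg (measurable_const.mul
    (measurable_ofReal.comp ?_)))
  exact (measurable_fst.comp measurable_snd).inner (measurable_fst.comp measurable_fst)

lemma norm_phase (x : E3) (k : Photon) : ‖phase x k‖ = 1 := by
  rw [phase, ← mul_neg, mul_comm, ← Complex.ofReal_neg, mul_comm, mul_comm,
    Complex.norm_exp_ofReal_mul_I]

lemma conj_phase_mul (x : E3) (k : Photon) : starRingEnd ℂ (phase x k) * phase x k = 1 := by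
  rw [← Complex.normSq_eq_conj_mul_self, Complex.normSq_eq_norm_sq, norm_phase]; simp

/-- The one-photon source `e^{-ik·x} c(k) t(k) f`, with a weight `c`. -/
def src (c : Photon → ℝ) (t : Photon → Spin →L[ℂ] Spin) (f : 𝓦)
    (w : 𝓧) : Spin := ((c w.2 : ℂ) * phase w.1.1 w.2) • t w.2 (f w.1)

lemma measurable_src {c : Photon → ℝ} (hc : Measurable c) {t : Photon → Spin →L[ℂ] Spin}
    (ht : t ∈ couplings L) {f : 𝓦} (hf : Measurable f) : Measurable (src c t f) :=
  ((measurable_ofReal.comp (hc.comp measurable_snd)).mul measurable_phase).smul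
    (measurable_clm_apply (t := fun w : 𝓧 => t w.2)
      (fun s => (ht.1 s).comp measurable_snd) (hf.comp measurable_fst))

lemma norm_src (c : Photon → ℝ) (t : Photon → Spin →L[ℂ] Spin) (f : 𝓦)
    (w : 𝓧) : ‖src c t f w‖ = |c w.2| * ‖t w.2 (f w.1)‖ := by
  rw [src, norm_smul, norm_mul, norm_phase, mul_one, norm_real, norm_eq_abs]

lemma norm_src_le (c : Photon → ℝ) {t : Photon → Spin →L[ℂ] Spin} {K : ℝ}
    (hK : ∀ k, ‖t k‖ ≤ K * cutoffBound L k) (f : 𝓦)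
    (w : 𝓧) :
    ‖src c t f w‖ ≤ (|c w.2| * (K * cutoffBound L w.2)) * ‖f w.1‖ := by
  rw [norm_src, mul_assoc]
  exact mul_le_mul_of_nonneg_left ((le_opNorm _ _).trans
    (mul_le_mul_of_nonneg_right (hK _) (norm_nonneg _))) (abs_nonneg _)

lemma src_congr (c : Photon → ℝ) (t : Photon → Spin →L[ℂ] Spin) {f g : 𝓦}
    (h : f =ᵐ[μₛ] g) : src c t f =ᵐ[μₛₖ] src c t g := by
  have h1 : ∀ᵐ w ∂μₛₖ, f w.1 = g w.1 :=
    quasiMeasurePreserving_fst.ae h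
  filter_upwards [h1] with w hw
  rw [src, src, hw]

/-- The admissible weights: `c(k)² ≤ 1 + 1/|k|`. -/
def IsWeight (c : Photon → ℝ) : Prop := Measurable c ∧ ∀ k, c k ^ 2 ≤ 1 + (photonEnergy k)⁻¹

lemma isWeight_one : IsWeight fun _ => 1 :=
  ⟨measurable_const, fun k => by have := inv_nonneg.2 (photonEnergy_nonneg k); linarith⟩

/-- The weight `|k|^{-1/2}`. -/
def invSqrt (k : Photon) : ℝ := (√(photonEnergy k))⁻¹

lemma invSqrt_sq (k : Photon) : invSqrt k ^ 2 = (photonEnergy k)⁻¹ := by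
  rw [invSqrt, inv_pow, sq_sqrt (photonEnergy_nonneg k)]

lemma invSqrt_nonneg (k : Photon) : 0 ≤ invSqrt k := by rw [invSqrt]; positivity

lemma isWeight_invSqrt : IsWeight invSqrt :=
  ⟨measurable_photonEnergy.sqrt.inv, fun k => by rw [invSqrt_sq]; linarith⟩

lemma IsWeight.lintegral {c : Photon → ℝ} (hc : IsWeight c) (L K : ℝ) :
    ∫⁻ k, ofReal ((|c k| * (K * cutoffBound L k)) ^ 2) ∂μₖ < ⊤ := by
  have h1 : ∀ k, ofReal ((|c k| * (K * cutoffBound L k)) ^ 2) ≤ ofReal (K ^ 2) *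
      (ofReal (cutoffBound L k ^ 2) +
        ofReal (cutoffBound L k ^ 2 / photonEnergy k)) := fun k => by
    have h0 := photonEnergy_nonneg k
    rw [← ofReal_add (by positivity) (by positivity), ← ofReal_mul (by positivity)]
    refine ofReal_le_ofReal ?_
    rw [mul_pow, sq_abs, mul_pow]
    calc c k ^ 2 * (K ^ 2 * cutoffBound L k ^ 2)
        ≤ (1 + (photonEnergy k)⁻¹) * (K ^ 2 * cutoffBound L k ^ 2) := by gcongr; exact hc.2 k
      _ = _ := by rw [div_eq_mul_inv]; ring
  refine lt_of_le_of_lt (lintegral_mono h1) ?_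
  have m : Measurable fun k => ofReal (cutoffBound L k ^ 2) :=
    ((measurable_cutoffBound L).pow_const 2).ennreal_ofReal
  rw [lintegral_const_mul' _ _ ofReal_ne_top, lintegral_add_left m]
  exact mul_lt_top ofReal_lt_top
    (ENNReal.add_lt_top.2 ⟨lintegral_cutoffBound_sq_lt L, lintegral_cutoffBound_sq_div L⟩)

lemma lintegral_src_le {c : Photon → ℝ} (hc : IsWeight c) {t : Photon → Spin →L[ℂ] Spin} {K : ℝ}
    (hK : ∀ k, ‖t k‖ ≤ K * cutoffBound L k) {f : 𝓦}
    (hf : AEStronglyMeasurable f μₛ) :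
    ∫⁻ w, ‖src c t f w‖ₑ ^ 2 ∂μₛₖ ≤
      (∫⁻ k, ofReal ((|c k| * (K * cutoffBound L k)) ^ 2) ∂μₖ) *
        ∫⁻ z, ‖f z‖ₑ ^ 2 ∂μₛ := by
  have m1 : Measurable fun k => ofReal ((|c k| * (K * cutoffBound L k)) ^ 2) :=
    ((hc.1.abs.mul ((measurable_cutoffBound L).const_mul K)).pow_const 2).ennreal_ofReal
  have h1 : ∀ w, ‖src c t f w‖ₑ ^ 2 ≤
      ‖f w.1‖ₑ ^ 2 * ofReal ((|c w.2| * (K * cutoffBound L w.2)) ^ 2) := fun w => by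
    rw [← ofReal_norm, ← ofReal_norm, ← ofReal_pow (norm_nonneg _),
      ← ofReal_pow (norm_nonneg _), ← ofReal_mul (by positivity), ← mul_pow]
    refine ofReal_le_ofReal (pow_le_pow_left₀ (norm_nonneg _) ?_ 2)
    rw [mul_comm]; exact norm_src_le c hK f w
  refine (lintegral_mono h1).trans (le_of_eq ?_)
  rw [mul_comm]
  exact lintegral_prod_mul (f := fun z => ‖f z‖ₑ ^ 2) (hf.enorm.pow_const 2) m1.aemeasurable

lemma memLp_src {c : Photon → ℝ} (hc : IsWeight c) {t : Photon → Spin →L[ℂ] Spin}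
    (ht : t ∈ couplings L) {f : 𝓦} (hf : MemLp f 2 μₛ) :
    MemLp (src c t f) 2 μₛₖ := by
  obtain ⟨K, hK0, hK⟩ := ht.2
  have m : AEStronglyMeasurable (src c t f) μₛₖ := by
    have h1 := (measurable_src hc.1 ht hf.1.stronglyMeasurable_mk.measurable).aestronglyMeasurable
      (μ := μₛₖ)
    exact h1.congr (src_congr c t hf.1.ae_eq_mk.symm)
  rw [memLp_two_iff m]
  exact lt_of_le_of_lt (lintegral_src_le hc hK hf.1)
    (mul_lt_top (hc.lintegral L K) ((memLp_two_iff hf.1).1 hf))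

/-- The Hilbert space of states with a distinguished photon. -/
abbrev L2photon : Type := Lp Spin 2 μₛₖ

lemma exists_norm_src_le {c : Photon → ℝ} (hc : IsWeight c) {t : Photon → Spin →L[ℂ] Spin}
    (ht : t ∈ couplings L) : ∃ C : ℝ, ∀ Ψ : 𝓗,
      ‖(memLp_src hc ht (memLp Ψ)).toLp‖ ≤ C * ‖Ψ‖ := by
  obtain ⟨K, hK0, hK⟩ := ht.2
  let B := (∫⁻ k, ofReal ((|c k| * (K * cutoffBound L k)) ^ 2) ∂μₖ).toReal
  have hB : ofReal B =
      ∫⁻ k, ofReal ((|c k| * (K * cutoffBound L k)) ^ 2) ∂μₖ :=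
    ofReal_toReal (hc.lintegral L K).ne
  refine ⟨√B, fun Ψ => ?_⟩
  refine le_of_sq_le_sq ?_ (by positivity)
  have hB0 : 0 ≤ B := toReal_nonneg
  rw [mul_pow, sq_sqrt hB0]
  refine (ENNReal.ofReal_le_ofReal_iff (by positivity)).1 ?_
  rw [ofReal_mul hB0, norm_sq_eq_lintegral, norm_sq_eq_lintegral, hB]
  refine le_trans (le_of_eq (lintegral_congr_ae ?_)) (lintegral_src_le hc hK (memLp Ψ).1)
  filter_upwards [(memLp_src hc ht (memLp Ψ)).coeFn_toLp] with w hw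
  rw [hw]

/-- The map `Ψ ↦ e^{-ik·x} c(k) t(k) Ψ`, for a fixed coupling. -/
def sourceCLM {c : Photon → ℝ} (hc : IsWeight c) (t : couplings L) :
    𝓗 →L[ℂ] L2photon :=
  LinearMap.mkContinuousOfExistsBound
    { toFun := fun Ψ => (memLp_src hc t.2 (memLp Ψ)).toLp
      map_add' := fun Ψ Φ => by
        rw [← MemLp.toLp_add]
        refine MemLp.toLp_congr _ _ ((src_congr c _ (coeFn_add Ψ Φ)).trans (of_forall
          fun w => ?_))
        simp only [src, Pi.add_apply, map_add, smul_add]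
      map_smul' := fun a Ψ => by
        rw [RingHom.id_apply, ← MemLp.toLp_const_smul]
        refine MemLp.toLp_congr _ _ ((src_congr c _ (coeFn_smul a Ψ)).trans (of_forall
          fun w => ?_))
        simp only [src, Pi.smul_apply, map_smul]
        rw [smul_comm] }
    (exists_norm_src_le hc t.2)

lemma coeFn_sourceCLM {c : Photon → ℝ} (hc : IsWeight c) (t : couplings L)
    (Ψ : 𝓗) :
    sourceCLM hc t Ψ =ᵐ[μₛₖ] src c t Ψ :=
  (memLp_src hc t.2 (memLp Ψ)).coeFn_toLp

/-- The map `Ψ ↦ e^{-ik·x} c(k) t(k) Ψ`, linear in the coupling as well. -/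
def source {c : Photon → ℝ} (hc : IsWeight c) (L : ℝ) :
    couplings L →ₗ[ℂ] 𝓗 →L[ℂ] L2photon where
  toFun t := sourceCLM hc t
  map_add' t t' := by
    ext1 Ψ
    refine Lp.ext ?_
    filter_upwards [coeFn_sourceCLM hc (t + t') Ψ, coeFn_sourceCLM hc t Ψ, coeFn_sourceCLM hc t' Ψ,
      coeFn_add (sourceCLM hc t Ψ) (sourceCLM hc t' Ψ)] with w h1 h2 h3 h4
    rw [h1, add_apply, h4, Pi.add_apply, h2, h3]
    simp [src]
  map_smul' a t := by
    ext1 Ψ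
    refine Lp.ext ?_
    filter_upwards [coeFn_sourceCLM hc (a • t) Ψ, coeFn_sourceCLM hc t Ψ,
      coeFn_smul a (sourceCLM hc t Ψ)] with w h1 h2 h4
    rw [h1, RingHom.id_apply, smul_apply, h4, Pi.smul_apply, h2]
    simp only [src, coe_smul, Pi.smul_apply, smul_apply]
    rw [smul_comm]

lemma coeFn_source {c : Photon → ℝ} (hc : IsWeight c) (t : couplings L)
    (Ψ : 𝓗) :
    source hc L t Ψ =ᵐ[μₛₖ] src c t Ψ := coeFn_sourceCLM hc t Ψ

/-- For couplings acting as multiples of isometries, the source map is a multiple of an isometry. -/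
lemma norm_source_sq {c : Photon → ℝ} (hc : IsWeight c) (t : couplings L) {r : Photon → ℝ}
    (hr : ∀ k s, ‖(t : Photon → Spin →L[ℂ] Spin) k s‖ = r k * ‖s‖) (Ψ : 𝓗) :
    ‖source hc L t Ψ‖ ^ 2 = (∫ k, (c k * r k) ^ 2 ∂μₖ) * ‖Ψ‖ ^ 2 := by
  rw [norm_sq_eq_integral, norm_sq_eq_integral, mul_comm, ← integral_prod_mul]
  refine integral_congr_ae ?_
  filter_upwards [coeFn_source hc t Ψ] with w hw
  rw [hw, norm_src, hr, mul_pow, mul_pow, mul_pow, sq_abs]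
  ring

end Couplings

/-! ### Creation and annihilation operators on states of finite field energy -/

section Operators

variable {L : ℝ}

lemma measurable_fieldEnergy : Measurable fun z : E3 × Config => fieldEnergy z.2 :=
  measurable_state fun n => by
    simp only [sector, fieldEnergy]
    have h1 : ∀ i : Fin n, Measurable fun z : E3 × (Fin n → Photon) => z.2 i := fun i =>
      (measurable_pi_apply i).comp measurable_snd
    have h2 : Measurable fun z : E3 × (Fin n → Photon) => ∑ i : Fin n, ‖(z.2 i).1‖ :=
      Finset.measurable_fun_sum _ fun i _ => (h1 i).fst.norm
    exact h2

lemma fieldEnergy_nonneg (γ : Config) : 0 ≤ fieldEnergy γ :=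
  sum_nonneg fun _ _ => norm_nonneg _

/-- The states of finite field energy. -/
def fockDom : Submodule ℂ 𝓗 :=
  stateSpace ⊓ (weightGraph Spin μₛ fun z => fieldEnergy z.2).map (LinearMap.fst ℂ _ _)

lemma mem_fockDom {Ψ : 𝓗} : Ψ ∈ fockDom ↔ Ψ ∈ stateSpace ∧
    ∫⁻ z, ofReal (fieldEnergy z.2) * ‖Ψ z‖ₑ ^ 2 ∂μₛ ≠ ⊤ := by
  rw [← exists_mem_weightGraph (F := Spin) measurable_fieldEnergy.aemeasurable]
  simp [fockDom, Submodule.mem_map]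

/-- The distribution `|k|^{1/2} a_λ(k)`, applied to `f`. -/
def wpull (f : 𝓦) (w : 𝓧) : Spin :=
  ((√(photonEnergy w.2) : ℝ) : ℂ) • pull f w

lemma measurable_wpull {f : 𝓦} (hf : Measurable f) : Measurable (wpull f) :=
  (measurable_ofReal.comp (measurable_photonEnergy.sqrt.comp measurable_snd)).smul
    (measurable_pull hf)

lemma wpull_congr {f g : 𝓦} (h : f =ᵐ[μₛ] g) :
    wpull f =ᵐ[μₛₖ] wpull g := by
  filter_upwards [pull_congr h] with w hw
  rw [wpull, wpull, hw]

lemma lintegral_wpull {Ψ : 𝓗} (hΨ : Ψ ∈ stateSpace) :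
    ∫⁻ w, ‖wpull Ψ w‖ₑ ^ 2 ∂μₛₖ =
      ∫⁻ z, ofReal (fieldEnergy z.2) * ‖Ψ z‖ₑ ^ 2 ∂μₛ := by
  obtain ⟨f, hfm, hf, hΨf⟩ := exists_symm_rep hΨ
  have h1 := lintegral_pull hf hfm (W := fun k => ofReal (photonEnergy k))
    measurable_photonEnergy.ennreal_ofReal
  calc ∫⁻ w, ‖wpull Ψ w‖ₑ ^ 2 ∂μₛₖ
      = ∫⁻ w, ofReal (photonEnergy w.2) * ‖pull f w‖ₑ ^ 2
          ∂μₛₖ := by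
        refine lintegral_congr_ae ?_
        filter_upwards [wpull_congr hΨf] with w hw
        rw [hw, wpull, enorm_sqrt_smul_sq]
    _ = _ := h1
    _ = _ := by
        refine lintegral_congr_ae ?_
        filter_upwards [hΨf] with z hz
        rw [hz, fieldEnergy, ofReal_sum_of_nonneg fun i _ => norm_nonneg _]
        rfl

lemma memLp_wpull {Ψ : 𝓗} (hΨ : Ψ ∈ fockDom) :
    MemLp (wpull Ψ) 2 μₛₖ := by
  rw [memLp_two_iff (measurable_wpull (Lp.stronglyMeasurable Ψ).measurable).aestronglyMeasurable,
    lintegral_wpull (mem_fockDom.1 hΨ).1]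
  exact (mem_fockDom.1 hΨ).2.lt_top

/-- The map `Ψ ↦ |k|^{1/2} a_λ(k) Ψ`. Its norm square is the field energy. -/
def pullP : fockDom →ₗ[ℂ] L2photon where
  toFun Ψ := (memLp_wpull Ψ.2).toLp
  map_add' Ψ Φ := by
    rw [← MemLp.toLp_add]
    refine MemLp.toLp_congr _ _ ((wpull_congr (coeFn_add _ _)).trans (of_forall
      fun w => ?_))
    simp only [wpull, pull, Pi.add_apply, smul_add]
  map_smul' a Ψ := by
    rw [RingHom.id_apply, ← MemLp.toLp_const_smul]
    refine MemLp.toLp_congr _ _ ((wpull_congr (coeFn_smul a _)).trans (of_forall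
      fun w => ?_))
    simp only [wpull, pull, Pi.smul_apply]
    rw [smul_comm a, smul_comm a]

lemma coeFn_pullP (Ψ : fockDom) : pullP Ψ =ᵐ[μₛₖ] wpull Ψ.1 :=
  (memLp_wpull Ψ.2).coeFn_toLp

lemma norm_pullP_sq (Ψ : fockDom) : ofReal (‖pullP Ψ‖ ^ 2) =
    ∫⁻ z, ofReal (fieldEnergy z.2) * ‖(Ψ : 𝓗) z‖ₑ ^ 2 ∂μₛ := by
  rw [norm_sq_eq_lintegral, ← lintegral_wpull (mem_fockDom.1 Ψ.2).1]
  exact lintegral_congr_ae ((coeFn_pullP Ψ).mono fun w hw => by simp only [hw])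

/-- The creation operator with coupling `e^{-ik·x} t(k)`, as a function. -/
def createFun (t : Photon → Spin →L[ℂ] Spin) (f : 𝓦) : 𝓦 :=
  raise (src (fun _ => 1) t f)

lemma createFun_congr (t : Photon → Spin →L[ℂ] Spin) {f g : 𝓦}
    (h : f =ᵐ[μₛ] g) : createFun t f =ᵐ[μₛ] createFun t g :=
  raise_congr (src_congr _ t h)

lemma IsSymm.src {t : Photon → Spin →L[ℂ] Spin} {f : 𝓦} (hf : IsSymm f)
    (k : Photon) : IsSymm fun z => PauliFierz.src (fun _ => 1) t f (z, k) := fun x n κ π => by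
  simp only [PauliFierz.src]
  rw [hf x n κ π]

lemma enorm_le_of_le_cutoffBound {K : ℝ} (hK0 : 0 ≤ K) {a c : ℝ} {k : Photon}
    (h : a ≤ K * cutoffBound L k * c) :
    ofReal a ≤ (ofReal (|invSqrt k| * (K * cutoffBound L k)) *
      ofReal (√(photonEnergy k))) * ofReal c := by
  have h0 := cutoffBound_nonneg L k
  rw [← ofReal_mul (by positivity), ← ofReal_mul (by positivity)]
  refine ofReal_le_ofReal (h.trans (le_of_eq ?_))
  congr 1
  rw [abs_of_nonneg (invSqrt_nonneg _), invSqrt]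
  rcases eq_or_ne k.1 0 with h | h
  · rw [cutoffBound_eq_zero h]; simp
  · have : 0 < photonEnergy k := norm_pos_iff.2 h
    have := sqrt_pos.2 this
    field_simp

/-- The norm of a created vector, for sources dominated by a state of finite field energy. -/
lemma raise_bound (L : ℝ) {K : ℝ} (hK0 : 0 ≤ K) : ∃ C : ℝ, 0 ≤ C ∧ ∀ (Ψ : fockDom)
    (f : 𝓦) (e : 𝓧 → Spin), Measurable f → IsSymm f →
      (Ψ : 𝓗) =ᵐ[μₛ] f → Measurable e →
      (∀ k, IsSymm fun z => e (z, k)) → (∀ w, ‖e w‖ ≤ K * cutoffBound L w.2 * ‖f w.1‖) →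
      MemLp (raise e) 2 μₛ ∧ |∫ z, ‖raise e z‖ ^ 2 ∂μₛ -
        ∫ w, ‖e w‖ ^ 2 ∂μₛₖ| ≤ C * ‖pullP Ψ‖ ^ 2 := by
  let b₁ : Photon → ℝ≥0∞ := fun k => ofReal (|invSqrt k| * (K * cutoffBound L k))
  let v : Photon → ℝ≥0∞ := fun k => ofReal (√(photonEnergy k))
  have hb₁ : Measurable b₁ := (isWeight_invSqrt.1.abs.mul
    ((measurable_cutoffBound L).const_mul K)).ennreal_ofReal
  have hv : Measurable v := measurable_photonEnergy.sqrt.ennreal_ofReal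
  have hB : ∫⁻ k, b₁ k ^ 2 ∂μₖ ≠ ⊤ := by
    have h := isWeight_invSqrt.lintegral L K
    refine ne_of_lt (lt_of_eq_of_lt (lintegral_congr fun k => ?_) h)
    have h0 := cutoffBound_nonneg L k
    simp only [b₁]
    rw [ofReal_pow (by positivity)]
  refine ⟨(∫⁻ k, b₁ k ^ 2 ∂μₖ).toReal, toReal_nonneg,
    fun Ψ f e hfm hf hΨf he hes heb => ?_⟩
  have hfL : MemLp f 2 μₛ := (memLp_congr_ae hΨf).1 (memLp _)
  have hD : ∫⁻ w, v w.2 ^ 2 * ‖pull f w‖ₑ ^ 2 ∂μₛₖ =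
      ofReal (‖pullP Ψ‖ ^ 2) := by
    rw [norm_sq_eq_lintegral]
    refine lintegral_congr_ae ?_
    filter_upwards [coeFn_pullP Ψ, wpull_congr hΨf] with w h1 h2
    rw [h1, h2, wpull, enorm_sqrt_smul_sq, ← ofReal_pow (sqrt_nonneg _),
      sq_sqrt (photonEnergy_nonneg _)]
  have heL : MemLp e 2 μₛₖ := by
    let T : Photon → Spin →L[ℂ] Spin := fun k =>
      ((K * cutoffBound L k : ℝ) : ℂ) • ContinuousLinearMap.id ℂ Spin
    have hT : T ∈ couplings L := by
      refine ⟨fun s => ?_, K, hK0, fun k => ?_⟩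
      · exact (measurable_ofReal.comp ((measurable_cutoffBound L).const_mul K)).smul
          (measurable_const (a := s))
      · have h0 := mul_nonneg hK0 (cutoffBound_nonneg L k)
        simp only [T]
        rw [norm_smul, norm_real, norm_of_nonneg h0]
        exact mul_le_of_le_one_right h0 ContinuousLinearMap.norm_id_le
    refine (memLp_src isWeight_one hT hfL).mono he.aestronglyMeasurable
      (of_forall fun w => (heb w).trans (le_of_eq ?_))
    rw [norm_src, abs_one, one_mul]
    simp only [T, smul_apply, ContinuousLinearMap.id_apply]
    rw [norm_smul, norm_real,
      norm_of_nonneg (mul_nonneg hK0 (cutoffBound_nonneg L w.2))]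
  obtain ⟨h1, h2⟩ := norm_raise_sq hf hfm he hes hb₁ hv (fun w => by
    rw [← ofReal_norm, ← ofReal_norm]
    exact enorm_le_of_le_cutoffBound hK0 (heb w)) heL hB
    (by rw [hD]; exact ofReal_ne_top)
  rw [hD, toReal_ofReal (sq_nonneg _)] at h2
  exact ⟨h1, h2⟩

lemma createFun_bound {t : Photon → Spin →L[ℂ] Spin} (ht : t ∈ couplings L) :
    ∃ C : ℝ, 0 ≤ C ∧ ∀ Ψ : fockDom, MemLp (createFun t Ψ.1) 2 μₛ ∧
      |∫ z, ‖createFun t Ψ.1 z‖ ^ 2 ∂μₛ -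
        ∫ w, ‖src (fun _ => 1) t Ψ.1 w‖ ^ 2 ∂μₛₖ| ≤
        C * ‖pullP Ψ‖ ^ 2 := by
  obtain ⟨K, hK0, hK⟩ := ht.2
  obtain ⟨C, hC, h⟩ := raise_bound L hK0
  refine ⟨C, hC, fun Ψ => ?_⟩
  obtain ⟨f, hfm, hf, hΨf⟩ := exists_symm_rep (mem_fockDom.1 Ψ.2).1
  obtain ⟨h1, h2⟩ := h Ψ f (src (fun _ => 1) t f) hfm hf hΨf (measurable_src measurable_const ht hfm)
    (fun k => hf.src k) (fun w => by simpa using norm_src_le (fun _ => 1) hK f w)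
  refine ⟨(memLp_congr_ae (createFun_congr t hΨf)).2 h1, le_trans (le_of_eq ?_) h2⟩
  congr 2
  · refine integral_congr_ae ?_
    filter_upwards [createFun_congr t hΨf] with z hz
    rw [hz, createFun]
  · refine integral_congr_ae ?_
    filter_upwards [src_congr (fun _ => 1) t hΨf] with z hz
    rw [hz]

lemma memLp_createFun {t : Photon → Spin →L[ℂ] Spin} (ht : t ∈ couplings L) (Ψ : fockDom) :
    MemLp (createFun t Ψ.1) 2 μₛ :=
  ((createFun_bound ht).choose_spec.2 Ψ).1

/-- The creation operator with coupling `e^{-ik·x} t(k)`. -/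
def creat (t : couplings L) : fockDom →ₗ[ℂ] 𝓗 where
  toFun Ψ := (memLp_createFun t.2 Ψ).toLp
  map_add' Ψ Φ := by
    rw [← MemLp.toLp_add]
    refine MemLp.toLp_congr _ _ ((createFun_congr _ (coeFn_add _ _)).trans (of_forall
      fun ⟨x, n, κ⟩ => ?_))
    cases n with
    | zero => simp [createFun, raise]
    | succ n =>
      simp only [createFun, raise, src, Pi.add_apply, map_add, smul_add, sum_add_distrib]
  map_smul' a Ψ := by
    rw [RingHom.id_apply, ← MemLp.toLp_const_smul]
    refine MemLp.toLp_congr _ _ ((createFun_congr _ (coeFn_smul a _)).trans (of_forall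
      fun ⟨x, n, κ⟩ => ?_))
    cases n with
    | zero => simp [createFun, raise]
    | succ n =>
      simp only [createFun, raise, src, Pi.smul_apply, map_smul, Finset.smul_sum, smul_smul]
      refine sum_congr rfl fun i _ => ?_
      congr 1
      ring

lemma coeFn_creat (t : couplings L) (Ψ : fockDom) :
    creat t Ψ =ᵐ[μₛ] createFun t Ψ.1 := (memLp_createFun t.2 Ψ).coeFn_toLp

lemma norm_creat_sq (t : couplings L) : ∃ C : ℝ, 0 ≤ C ∧ ∀ Ψ : fockDom,
    |‖creat t Ψ‖ ^ 2 - ‖source isWeight_one L t Ψ.1‖ ^ 2| ≤ C * ‖pullP Ψ‖ ^ 2 := by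
  obtain ⟨C, hC, h⟩ := createFun_bound t.2
  refine ⟨C, hC, fun Ψ => le_trans (le_of_eq ?_) (h Ψ).2⟩
  rw [norm_sq_eq_integral, norm_sq_eq_integral]
  congr 2
  · exact integral_congr_ae ((coeFn_creat t Ψ).mono fun w hw => by simp only [hw])
  · exact integral_congr_ae ((coeFn_source isWeight_one t Ψ.1).mono fun w hw => by simp only [hw])

lemma enorm_meanC_ofReal {ρ : 𝓧 → ℝ} (hρ : ∀ w, 0 ≤ ρ w) (z : E3 × Config) :
    ‖meanC (fun w => (ρ w : ℂ)) z‖ₑ = meanL (fun w => ofReal (ρ w)) z := by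
  obtain ⟨x, n, κ⟩ := z
  cases n with
  | zero => simp [meanC, meanL]
  | succ n =>
    simp only [meanC, meanL]
    rw [← ofReal_sum, ← Complex.ofReal_natCast, ← Complex.ofReal_inv, ← Complex.ofReal_mul,
      ← ofReal_norm, norm_real, norm_of_nonneg (mul_nonneg (by positivity)
      (sum_nonneg fun i _ => hρ _)), ofReal_mul (by positivity),
      ofReal_sum_of_nonneg fun i _ => hρ _, ENNReal.ofReal_inv_of_pos (by positivity),
      ofReal_natCast]

/-- Creation is adjoint to annihilation; the integrals converge as soon as one of the states has
finite field energy. -/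
lemma inner_creat_eq_integral (t : couplings L) {Φ : 𝓗} (hΦ : Φ ∈ stateSpace)
    (Ψ : fockDom) :
    Integrable (fun w => ⟪pull Φ w, src (fun _ => 1) t Ψ.1 w⟫)
      μₛₖ ∧
    ⟪Φ, creat t Ψ⟫ =
      ∫ w, ⟪pull Φ w, src (fun _ => 1) t Ψ.1 w⟫ ∂μₛₖ := by
  obtain ⟨K, hK0, hK⟩ := t.2.2
  obtain ⟨f, hfm, hf, hΨf⟩ := exists_symm_rep (mem_fockDom.1 Ψ.2).1
  obtain ⟨g, hgm, hg, hΦg⟩ := exists_symm_rep hΦ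
  have ms : Measurable (src (fun _ => 1) t f) := measurable_src measurable_const t.2 hfm
  have e1 : (fun w => ⟪pull Φ w, src (fun _ => 1) t Ψ.1 w⟫)
      =ᵐ[μₛₖ] fun w => ⟪pull g w, src (fun _ => 1) t f w⟫ := by
    filter_upwards [pull_congr hΦg, src_congr (fun _ => 1) t hΨf] with w h1 h2
    rw [h1, h2]
  have i1 : Integrable (fun w => ⟪pull g w, src (fun _ => 1) t f w⟫)
      μₛₖ := by
    -- the moduli of the functions involved form states of the same kind
    let s₀ : Spin := single 0 1
    have hs₀ : ‖s₀‖ = 1 := by simp [s₀]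
    let ρ : 𝓧 → ℝ := fun w => K * cutoffBound L w.2 * ‖f w.1‖
    have hρ0 : ∀ w, 0 ≤ ρ w := fun w =>
      mul_nonneg (mul_nonneg hK0 (cutoffBound_nonneg L w.2)) (norm_nonneg _)
    have mρ : Measurable ρ :=
      (((measurable_cutoffBound L).const_mul K).comp measurable_snd).mul (hfm.comp measurable_fst).norm
    let g' : 𝓦 := fun z => ((‖g z‖ : ℝ) : ℂ) • s₀
    let e' : 𝓧 → Spin := fun w => ((ρ w : ℝ) : ℂ) • s₀
    have hne' : ∀ w, ‖e' w‖ = ρ w := fun w => by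
      simp only [e', norm_smul, hs₀, mul_one, norm_real, norm_of_nonneg (hρ0 w)]
    have mg' : Measurable g' := (measurable_ofReal.comp hgm.norm).smul_const s₀
    have hg' : IsSymm g' := fun x n κ π => by simp only [g', hg x n κ π]
    obtain ⟨C, -, hC⟩ := raise_bound L hK0
    have h1 := (hC Ψ f e' hfm hf hΨf ((measurable_ofReal.comp mρ).smul_const s₀)
      (fun k x n κ π => by simp only [e', ρ, hf x n κ π]) (fun w => le_of_eq (hne' w))).1
    have h2 : MemLp g' 2 μₛ := ((memLp_congr_ae hΦg).1 (memLp _)).of_le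
      mg'.aestronglyMeasurable (of_forall fun z => by simp [g', norm_smul, hs₀])
    have h3 := (integrable_inner_of_memLp h2 h1).2
    have h4 : ∀ w, ⟪pull g' w, e' w⟫ = ((‖pull g w‖ * ρ w : ℝ) : ℂ) := fun w => by
      simp only [pull, g', e', inner_smul_left, inner_smul_right, norm_smul, conj_ofReal,
        inner_self_eq_norm_sq_to_K, hs₀, norm_real, norm_of_nonneg (sqrt_nonneg _)]
      push_cast; simp; ring
    have m1 : Measurable fun w => ‖pull g w‖ * ρ w := (measurable_pull hgm).norm.mul mρ
    have h5 : ∫⁻ w, ofReal (‖pull g w‖ * ρ w) ∂μₛₖ < ⊤ := by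
      rw [← lintegral_meanL m1.ennreal_ofReal]
      refine lt_of_eq_of_lt (lintegral_congr fun z => ?_) h3
      simp only
      rw [inner_raise hg', ← enorm_meanC_ofReal fun w => mul_nonneg (norm_nonneg _) (hρ0 w)]
      simp only [h4]
    refine ⟨((measurable_pull hgm).inner ms).aestronglyMeasurable,
      lt_of_le_of_lt (lintegral_mono fun w => ?_) h5⟩
    rw [← ofReal_norm]
    refine ofReal_le_ofReal ((norm_inner_le_norm _ _).trans ?_)
    refine mul_le_mul_of_nonneg_left ?_ (norm_nonneg _)
    simpa using norm_src_le (fun _ => 1) hK f w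
  refine ⟨i1.congr e1.symm, ?_⟩
  rw [integral_congr_ae e1, ← (integrable_inner_raise hg hgm ms i1).2, L2.inner_def]
  refine integral_congr_ae ?_
  filter_upwards [hΦg, coeFn_creat t Ψ, createFun_congr t.1 hΨf] with z h1 h2 h3
  rw [h1, h2, h3, createFun]

/-- The annihilation operator with coupling `e^{-ik·x} t(k)`. -/
def annih (t : couplings L) : fockDom →ₗ[ℂ] 𝓗 :=
  (adjoint (source isWeight_invSqrt L t)).toLinearMap ∘ₗ pullP

lemma annih_apply (t : couplings L) (Ψ : fockDom) :
    annih t Ψ = adjoint (source isWeight_invSqrt L t) (pullP Ψ) := rfl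

lemma inner_annih (t : couplings L) (Ψ : fockDom) (Φ : 𝓗) :
    ⟪annih t Ψ, Φ⟫ = ⟪pullP Ψ, source isWeight_invSqrt L t Φ⟫ :=
  ContinuousLinearMap.adjoint_inner_left (source isWeight_invSqrt L t) Φ (pullP Ψ)

lemma inner_annih_eq_integral (t : couplings L) (Ψ : fockDom) (Φ : 𝓗) :
    Integrable (fun w => ⟪pull Ψ.1 w, src (fun _ => 1) t Φ w⟫)
      μₛₖ ∧
    ⟪annih t Ψ, Φ⟫ =
      ∫ w, ⟪pull Ψ.1 w, src (fun _ => 1) t Φ w⟫ ∂μₛₖ := by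
  have e : (fun w => ⟪pullP Ψ w, source isWeight_invSqrt L t Φ w⟫)
      =ᵐ[μₛₖ]
      fun w => ⟪pull Ψ.1 w, src (fun _ => 1) t Φ w⟫ := by
    have h0 : ∀ᵐ w ∂μₛₖ, w.2.1 ≠ 0 :=
      Measure.quasiMeasurePreserving_snd.ae ae_photon_ne_zero
    filter_upwards [coeFn_pullP Ψ, coeFn_source isWeight_invSqrt t Φ, h0] with w h1 h2 h3
    have h4 : 0 < photonEnergy w.2 := norm_pos_iff.2 h3
    have h5 : ((√(photonEnergy w.2) : ℝ) : ℂ) ≠ 0 :=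
      ofReal_ne_zero.2 (sqrt_pos.2 h4).ne'
    rw [h1, h2, wpull, src, src, inner_smul_left, inner_smul_right, inner_smul_right,
      conj_ofReal, invSqrt]
    push_cast
    field_simp
  refine ⟨(integrable_inner_of_memLp (memLp _) (memLp _)).congr e, ?_⟩
  rw [inner_annih, L2.inner_def]
  exact integral_congr_ae e

lemma inner_creat_eq_annih (t : couplings L) (Φ Ψ : fockDom) :
    ⟪Φ.1, creat t Ψ⟫ = ⟪annih t Φ, Ψ.1⟫ := by
  rw [(inner_creat_eq_integral t (mem_fockDom.1 Φ.2).1 Ψ).2, (inner_annih_eq_integral t Φ Ψ.1).2]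

lemma inner_creat (t : couplings L) (Φ Ψ : fockDom) :
    ⟪Φ.1, creat t Ψ⟫ = ⟪pullP Φ, source isWeight_invSqrt L t Ψ.1⟫ := by
  rw [inner_creat_eq_annih, inner_annih]

end Operators

/-! ### Spin matrices and contractions -/

section SpinMatrices

variable {L : ℝ}

/-- A constant matrix acting on the spin. -/
def spinOp (M : Spin →L[ℂ] Spin) : 𝓗 →L[ℂ] 𝓗 :=
  M.compLpL 2 μₛ

lemma coeFn_spinOp (M : Spin →L[ℂ] Spin) (Ψ : 𝓗) :
    spinOp M Ψ =ᵐ[μₛ] fun z => M (Ψ z) := M.coeFn_compLpL Ψ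

lemma spinOp_mem_stateSpace (M : Spin →L[ℂ] Spin) {Ψ : 𝓗}
    (hΨ : Ψ ∈ stateSpace) : spinOp M Ψ ∈ stateSpace := by
  obtain ⟨f, hf, hΨf⟩ := hΨ
  refine ⟨fun z => M (f z), fun x n κ π => by simp only [hf x n κ π], ?_⟩
  filter_upwards [coeFn_spinOp M Ψ, hΨf] with z h1 h2
  rw [h1, h2]

lemma spinOp_mem (M : Spin →L[ℂ] Spin) (Ψ : fockDom) : spinOp M Ψ.1 ∈ fockDom := by
  obtain ⟨h1, h2⟩ := mem_fockDom.1 Ψ.2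
  refine mem_fockDom.2 ⟨spinOp_mem_stateSpace M h1, ne_top_of_le_ne_top (ENNReal.mul_ne_top
    (ofReal_ne_top (r := ‖M‖ ^ 2)) h2) ?_⟩
  rw [← lintegral_const_mul' _ _ ofReal_ne_top]
  refine lintegral_mono_ae ?_
  filter_upwards [coeFn_spinOp M Ψ.1] with z hz
  rw [hz, mul_left_comm]
  refine mul_le_mul_right ?_ _
  rw [← ofReal_norm, ← ofReal_norm, ← ofReal_pow (norm_nonneg _),
    ← ofReal_pow (norm_nonneg _), ← ofReal_mul (sq_nonneg _), ← mul_pow]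
  exact ofReal_le_ofReal (pow_le_pow_left₀ (norm_nonneg _) (M.le_opNorm _) 2)

lemma pullP_spinOp (M : Spin →L[ℂ] Spin) (Ψ : fockDom) :
    pullP ⟨spinOp M Ψ.1, spinOp_mem M Ψ⟩ =
      M.compLpL 2 μₛₖ (pullP Ψ) := by
  refine Lp.ext ?_
  filter_upwards [coeFn_pullP ⟨spinOp M Ψ.1, spinOp_mem M Ψ⟩, wpull_congr (coeFn_spinOp M Ψ.1),
    M.coeFn_compLpL (pullP Ψ), coeFn_pullP Ψ] with w h1 h2 h3 h4
  rw [h1, h2, h3, h4]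
  simp only [wpull, pull, map_smul]

lemma norm_pullP_spinOp_le (M : Spin →L[ℂ] Spin) (Ψ : fockDom) :
    ‖pullP ⟨spinOp M Ψ.1, spinOp_mem M Ψ⟩‖ ≤ ‖M‖ * ‖pullP Ψ‖ := by
  rw [pullP_spinOp]
  exact M.norm_compLp_le _

lemma inner_matrix (c : Matrix (Fin 2) (Fin 2) ℂ) (φ ψ : Spin) :
    ⟪φ, Matrix.toEuclideanCLM (𝕜 := ℂ) c ψ⟫ =
      ∑ i, ∑ j, c i j * (starRingEnd ℂ (φ i) * ψ j) := by
  rw [inner_apply]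
  simp only [Matrix.ofLp_toEuclideanCLM, Matrix.mulVec, dotProduct, RCLike.inner_apply,
    sum_mul]
  exact sum_congr rfl fun i _ => sum_congr rfl fun j _ => by ring

lemma spin_eq_sum (s : Spin) : s = ∑ i, s i • (single i 1 : Spin) := by
  ext j
  fin_cases j <;> simp

/-- Annihilating a photon that has just been created gives back the electron state, up to a constant
spin matrix. -/
lemma exists_contraction (t s : couplings L) : ∃ M : Spin →L[ℂ] Spin,
    ∀ Ψ : 𝓗, adjoint (source isWeight_invSqrt L t)
      (source isWeight_invSqrt L s Ψ) = spinOp M Ψ := by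
  let e : Fin 2 → Spin := fun i => single i 1
  let γ : Fin 2 → Fin 2 → Photon → ℂ := fun i j k =>
    ((invSqrt k : ℝ) : ℂ) ^ 2 * ⟪t.1 k (e i), s.1 k (e j)⟫
  have hL2 : ∀ (u : couplings L) i, MemLp (fun k => ((invSqrt k : ℝ) : ℂ) • u.1 k (e i)) 2
      μₖ := fun u i => by
    obtain ⟨K, hK0, hK⟩ := u.2.2
    have m : AEStronglyMeasurable (fun k => ((invSqrt k : ℝ) : ℂ) • u.1 k (e i)) μₖ :=
      ((measurable_ofReal.comp isWeight_invSqrt.1).smul (u.2.1 (e i))).aestronglyMeasurable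
    rw [memLp_two_iff m]
    refine lt_of_le_of_lt (lintegral_mono fun k => ?_) (isWeight_invSqrt.lintegral L K)
    rw [← ofReal_norm, ← ofReal_pow (norm_nonneg _)]
    refine ofReal_le_ofReal (pow_le_pow_left₀ (norm_nonneg _) ?_ 2)
    rw [norm_smul, norm_real, norm_eq_abs]
    refine mul_le_mul_of_nonneg_left ((le_opNorm _ _).trans ?_) (abs_nonneg _)
    simpa [e] using hK k
  have hγ : ∀ i j, Integrable (γ i j) μₖ := fun i j => by
    refine (integrable_inner_of_memLp (hL2 t i) (hL2 s j)).congr (of_forall fun k => ?_)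
    simp only [γ, inner_smul_left, inner_smul_right, conj_ofReal]
    ring
  refine ⟨Matrix.toEuclideanCLM (𝕜 := ℂ) (Matrix.of fun i j => ∫ k, γ i j k ∂μₖ),
    fun Ψ => ext_inner_left ℂ fun Φ => ?_⟩
  rw [ContinuousLinearMap.adjoint_inner_right, L2.inner_def, L2.inner_def]
  have hcoord : ∀ (u : 𝓗) i, MemLp (fun z => u z i) 2 μₛ := fun u i =>
    (proj (𝕜 := ℂ) i : Spin →L[ℂ] ℂ).comp_memLp' (memLp u)
  have hΦΨ : ∀ i j, Integrable (fun z => starRingEnd ℂ (Φ z i) * Ψ z j) μₛ := fun i j => by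
    refine (integrable_inner_of_memLp (hcoord Φ i) (hcoord Ψ j)).congr
      (of_forall fun z => ?_)
    simp [mul_comm]
  have h1 : ∫ w, ⟪source isWeight_invSqrt L t Φ w, source isWeight_invSqrt L s Ψ w⟫
      ∂μₛₖ = ∫ w, ∑ i, ∑ j, (starRingEnd ℂ (Φ w.1 i) * Ψ w.1 j) *
        γ i j w.2 ∂μₛₖ := by
    refine integral_congr_ae ?_
    filter_upwards [coeFn_source isWeight_invSqrt t Φ, coeFn_source isWeight_invSqrt s Ψ] with w h2 h3
    have h4 := conj_phase_mul w.1.1 w.2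
    rw [h2, h3, src, src, inner_smul_left, inner_smul_right, map_mul, conj_ofReal]
    conv_lhs => rw [spin_eq_sum (Φ w.1), spin_eq_sum (Ψ w.1)]
    simp only [map_sum, map_smul, sum_inner, inner_sum, inner_smul_left, inner_smul_right,
      mul_sum]
    rw [Finset.sum_comm]
    refine sum_congr rfl fun i _ => sum_congr rfl fun j _ => ?_
    simp only [γ, e]
    linear_combination (((invSqrt w.2 : ℝ) : ℂ) ^ 2 * (starRingEnd ℂ (Φ w.1 i) * (Ψ w.1 j *
      ⟪t.1 w.2 (single i 1), s.1 w.2 (single j 1)⟫))) * h4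
  have h2 : ∀ i j, Integrable (fun w : 𝓧 =>
      (starRingEnd ℂ (Φ w.1 i) * Ψ w.1 j) * γ i j w.2) μₛₖ := fun i j =>
    (hΦΨ i j).mul_prod (hγ i j)
  rw [h1, integral_finsetSum _ fun i _ => integrable_finsetSum _ fun j _ => h2 i j]
  have h3 : ∫ z, ⟪Φ z, spinOp (Matrix.toEuclideanCLM (𝕜 := ℂ) (Matrix.of fun i j => ∫ k, γ i j k ∂μₖ)) Ψ z⟫ ∂μₛ =
      ∫ z, ∑ i, ∑ j, (∫ k, γ i j k ∂μₖ) * (starRingEnd ℂ (Φ z i) * Ψ z j)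
        ∂μₛ := by
    refine integral_congr_ae ?_
    filter_upwards [coeFn_spinOp (Matrix.toEuclideanCLM (𝕜 := ℂ)
      (Matrix.of fun i j => ∫ k, γ i j k ∂μₖ)) Ψ] with z hz
    rw [hz, inner_matrix]
    rfl
  rw [h3, integral_finsetSum _ fun i _ => integrable_finsetSum _ fun j _ => (hΦΨ i j).const_mul _]
  refine sum_congr rfl fun i _ => ?_
  rw [integral_finsetSum _ fun j _ => h2 i j,
    integral_finsetSum _ fun j _ => (hΦΨ i j).const_mul _]
  refine sum_congr rfl fun j _ => ?_
  rw [integral_const_mul, mul_comm]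
  exact integral_prod_mul (fun z => starRingEnd ℂ (Φ z i) * Ψ z j) (γ i j)

lemma norm_creat_le (t : couplings L) : ∃ C : ℝ, 0 ≤ C ∧ ∀ Ψ : fockDom,
    ‖creat t Ψ‖ ≤ C * (‖Ψ.1‖ + ‖pullP Ψ‖) := by
  obtain ⟨C, hC, h⟩ := norm_creat_sq t
  refine ⟨‖source isWeight_one L t‖ + √C, by positivity, fun Ψ => ?_⟩
  refine le_of_sq_le_sq ?_ (by positivity)
  have h1 := (abs_le.1 (h Ψ)).2
  have h2 := (source isWeight_one L t).le_opNorm Ψ.1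
  have h3 : ‖source isWeight_one L t Ψ.1‖ ^ 2 ≤ (‖source isWeight_one L t‖ * ‖Ψ.1‖) ^ 2 :=
    pow_le_pow_left₀ (norm_nonneg _) h2 2
  have h4 := sq_sqrt hC
  have h5 := sqrt_nonneg C
  have h6 := norm_nonneg (source isWeight_one L t)
  have h7 := norm_nonneg Ψ.1
  have h8 := norm_nonneg (pullP Ψ)
  calc ‖creat t Ψ‖ ^ 2 ≤ (‖source isWeight_one L t‖ * ‖Ψ.1‖) ^ 2 + (√C * ‖pullP Ψ‖) ^ 2 := by
        rw [mul_pow (√C), h4]; linarith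
    _ ≤ (‖source isWeight_one L t‖ * ‖Ψ.1‖ + √C * ‖pullP Ψ‖) ^ 2 := by
        have := mul_nonneg (mul_nonneg h6 h7) (mul_nonneg h5 h8)
        nlinarith
    _ ≤ _ := by
        refine pow_le_pow_left₀ (by positivity) ?_ 2
        have := mul_nonneg h6 h8
        have := mul_nonneg h5 h7
        nlinarith

lemma norm_annih_le (t : couplings L) (Ψ : fockDom) :
    ‖annih t Ψ‖ ≤ ‖source isWeight_invSqrt L t‖ * ‖pullP Ψ‖ := by
  rw [annih_apply, ← (adjoint (𝕜 := ℂ)).norm_map (source isWeight_invSqrt L t)]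
  exact le_opNorm _ _

lemma cross_bound_aux {A C M S T r α n b : ℝ} (hA : 0 ≤ A) (hC : 0 ≤ C) (hM : 0 ≤ M) (hS : 0 ≤ S)
    (hT : 0 ≤ T) (hr0 : 0 ≤ r) (hr1 : r ≤ 1) (hrr : r * r = α) (hn : 0 ≤ n) (hb : 0 ≤ b) :
    (A * b) * (C * (n + (b + r * (S * n)))) + r * (M * (b + r * (S * n)) * (T * n)) ≤
      (A * C * (1 + S) + M * T * (1 + S)) * (b * n + b ^ 2 + α * n ^ 2) := by
  have e1 := mul_nonneg hb hn
  have e2 := mul_le_of_le_one_left (mul_nonneg hS e1) hr1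
  have e3 := mul_le_of_le_one_left e1 hr1
  have e4 : 0 ≤ α * n ^ 2 := mul_nonneg (hrr ▸ mul_nonneg hr0 hr0) (sq_nonneg n)
  have e5 := mul_nonneg hS e4
  have e6 := mul_nonneg hS (sq_nonneg b)
  have e7 := sq_nonneg b
  have e8 := mul_nonneg hS e1
  calc (A * b) * (C * (n + (b + r * (S * n)))) + r * (M * (b + r * (S * n)) * (T * n))
      = A * C * (b * n + b ^ 2 + r * (S * (b * n))) +
        M * T * (r * (b * n) + (r * r) * (S * n ^ 2)) := by ring
    _ ≤ A * C * ((1 + S) * (b * n + b ^ 2 + α * n ^ 2)) +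
        M * T * ((1 + S) * (b * n + b ^ 2 + α * n ^ 2)) := by
        rw [hrr]
        refine add_le_add (mul_le_mul_of_nonneg_left ?_ (mul_nonneg hA hC))
          (mul_le_mul_of_nonneg_left ?_ (mul_nonneg hM hT)) <;> nlinarith
    _ = _ := by ring

set_option maxHeartbeats 800000 in
/-- Products of an annihilated and a created state are small for states which have almost the right
one-photon amplitude `-√α e^{-ik·x} s(k) Ψ`, although each of the two factors need not be. -/
lemma inner_annih_creat_le (t t' s : couplings L) : ∃ C : ℝ, 0 ≤ C ∧ ∀ (α : ℝ) (Ψ : fockDom),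
    0 ≤ α → α ≤ 1 → ‖⟪annih t Ψ, creat t' Ψ⟫‖ ≤
      C * (‖pullP Ψ + (√α : ℂ) • source isWeight_invSqrt L s Ψ.1‖ * ‖Ψ.1‖ +
        ‖pullP Ψ + (√α : ℂ) • source isWeight_invSqrt L s Ψ.1‖ ^ 2 + α * ‖Ψ.1‖ ^ 2) := by
  obtain ⟨C₁, hC₁, h1⟩ := norm_creat_le t'
  obtain ⟨M, hM⟩ := exists_contraction t s
  obtain ⟨A, hAe⟩ : ∃ A, A = ‖source isWeight_invSqrt L t‖ := ⟨_, rfl⟩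
  obtain ⟨S, hSe⟩ : ∃ S, S = ‖source isWeight_invSqrt L s‖ := ⟨_, rfl⟩
  obtain ⟨T, hTe⟩ : ∃ T, T = ‖source isWeight_invSqrt L t'‖ := ⟨_, rfl⟩
  have hA : 0 ≤ A := hAe ▸ norm_nonneg _
  have hS : 0 ≤ S := hSe ▸ norm_nonneg _
  have hT : 0 ≤ T := hTe ▸ norm_nonneg _
  have hM0 := norm_nonneg M
  refine ⟨A * C₁ * (1 + S) + ‖M‖ * T * (1 + S), by positivity, fun α Ψ hα0 hα1 => ?_⟩
  obtain ⟨b, hb⟩ : ∃ b, b = pullP Ψ + (√α : ℂ) • source isWeight_invSqrt L s Ψ.1 :=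
    ⟨_, rfl⟩
  rw [← hb]
  obtain ⟨r, hr⟩ : ∃ r, r = √α := ⟨_, rfl⟩
  rw [← hr] at hb
  have hr0 : 0 ≤ r := hr ▸ sqrt_nonneg _
  have hr1 : r ≤ 1 := hr ▸ Real.sqrt_le_one.2 hα1
  have hrr : r * r = α := hr ▸ mul_self_sqrt hα0
  have hP : pullP Ψ = b - (r : ℂ) • source isWeight_invSqrt L s Ψ.1 := eq_sub_of_add_eq hb.symm
  have hn := norm_nonneg Ψ.1
  have hb0 := norm_nonneg b
  have hPn : ‖pullP Ψ‖ ≤ ‖b‖ + r * (S * ‖Ψ.1‖) := by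
    rw [hP]
    refine (norm_sub_le _ _).trans (add_le_add le_rfl ?_)
    rw [norm_smul, norm_real, norm_of_nonneg hr0]
    rw [hSe]
    exact mul_le_mul_of_nonneg_left (le_opNorm _ _) hr0
  have ha : annih t Ψ = adjoint (source isWeight_invSqrt L t) b -
      (r : ℂ) • spinOp M Ψ.1 := by
    rw [annih_apply, hP, map_sub, map_smul, hM]
  rw [ha, inner_sub_left, inner_smul_left, conj_ofReal]
  have h2 : ‖⟪adjoint (source isWeight_invSqrt L t) b, creat t' Ψ⟫‖ ≤ (A * ‖b‖) * (C₁ * (‖Ψ.1‖ + (‖b‖ + r * (S * ‖Ψ.1‖)))) := by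
    refine (norm_inner_le_norm _ _).trans (mul_le_mul ?_ ?_ (norm_nonneg _) (by positivity))
    · have := (adjoint (source isWeight_invSqrt L t)).le_opNorm b
      rwa [LinearIsometryEquiv.norm_map, ← hAe] at this
    · refine (h1 Ψ).trans (mul_le_mul_of_nonneg_left ?_ hC₁)
      linarith
  have h3 : ‖⟪spinOp M Ψ.1, creat t' Ψ⟫‖ ≤
      ‖M‖ * (‖b‖ + r * (S * ‖Ψ.1‖)) * (T * ‖Ψ.1‖) := by
    rw [inner_creat t' ⟨spinOp M Ψ.1, spinOp_mem M Ψ⟩ Ψ]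
    have h4 : ‖source isWeight_invSqrt L t' Ψ.1‖ ≤ T * ‖Ψ.1‖ :=
      by rw [hTe]; exact le_opNorm _ _
    have h5 := (norm_pullP_spinOp_le M Ψ).trans (mul_le_mul_of_nonneg_left hPn hM0)
    have h6 : 0 ≤ ‖M‖ * (‖b‖ + r * (S * ‖Ψ.1‖)) :=
      mul_nonneg hM0 (add_nonneg hb0 (mul_nonneg hr0 (mul_nonneg hS hn)))
    exact (norm_inner_le_norm _ _).trans (mul_le_mul h5 h4 (norm_nonneg _) h6)
  refine (norm_sub_le _ _).trans ?_
  rw [norm_mul, norm_real, norm_of_nonneg hr0]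
  exact (add_le_add h2 (mul_le_mul_of_nonneg_left h3 hr0)).trans
    (cross_bound_aux hA hC₁ hM0 hS hT hr0 hr1 hrr hn hb0)

end SpinMatrices

/-! ### The electron momentum and the photon field -/

section Momentum

variable {L : ℝ} {j : Fin 3}

section Phase

variable {F : Type*} [NormedAddCommGroup F] [InnerProductSpace ℂ F] [NormedSpace ℝ F]
  [IsScalarTower ℝ ℂ F] [CompleteSpace F]

lemma phase_eq (x : E3) (k : Photon) : phase x k =
    ((Real.cos (inner ℝ k.1 x) : ℝ) : ℂ) + (-I) * ((Real.sin (inner ℝ k.1 x) : ℝ) : ℂ) := by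
  rw [phase, ← neg_mul, mul_comm (-I), mul_neg, ← neg_mul, ← Complex.ofReal_neg,
    Complex.exp_ofReal_mul_I, Real.cos_neg, Real.sin_neg]
  push_cast; ring

lemma continuous_phase (k : Photon) : Continuous fun x => phase x k := by
  unfold phase
  fun_prop

/-- The plane wave `e^{-ik·x}` shifts the momentum by `-k`. -/
lemma IsWeakPartial.phase {f g : E3 → F} (h : IsWeakPartial j f g) (hf : MemLp f 2 volume)
    (hg : MemLp g 2 volume) (k : Photon) :
    IsWeakPartial j (fun x => PauliFierz.phase x k • f x) (fun x => PauliFierz.phase x k • g x +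
      (-I * (k.1 j : ℂ)) • (PauliFierz.phase x k • f x)) := by
  have hc : ContDiff ℝ ∞ fun x : E3 => Real.cos (inner ℝ k.1 x) :=
    Real.contDiff_cos.comp (innerSL ℝ k.1).contDiff
  have hs : ContDiff ℝ ∞ fun x : E3 => Real.sin (inner ℝ k.1 x) :=
    Real.contDiff_sin.comp (innerSL ℝ k.1).contDiff
  have hd : ∀ x : E3, HasFDerivAt (fun x : E3 => inner ℝ k.1 x) (innerSL ℝ k.1) x := fun x =>
    (innerSL ℝ k.1).hasFDerivAt
  have hk : (innerSL ℝ k.1) (single j 1) = k.1 j := by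
    simp [EuclideanSpace.inner_single_right]
  have dc : ∀ x : E3, fderiv ℝ (fun x : E3 => Real.cos (inner ℝ k.1 x)) x
      (single j 1) = -Real.sin (inner ℝ k.1 x) * k.1 j := fun x => by
    rw [(hd x).cos.fderiv, smul_apply, hk, smul_eq_mul]
  have ds : ∀ x : E3, fderiv ℝ (fun x : E3 => Real.sin (inner ℝ k.1 x)) x
      (single j 1) = Real.cos (inner ℝ k.1 x) * k.1 j := fun x => by
    rw [(hd x).sin.fderiv, smul_apply, hk, smul_eq_mul]
  have bd : ∀ {m : E3 → ℝ}, Continuous m → (∀ x, |m x| ≤ |k.1 j| + 1) → ∀ {u : E3 → F},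
      MemLp u 2 volume → MemLp (fun x => m x • u x) 2 volume := fun {m} hm hb {u} hu => by
    refine (hu.const_smul (|k.1 j| + 1)).mono (hm.aestronglyMeasurable.smul hu.1)
      (of_forall fun x => ?_)
    rw [norm_smul, Pi.smul_apply, norm_smul, norm_eq_abs, norm_of_nonneg (by positivity)]
    exact mul_le_mul_of_nonneg_right (hb x) (norm_nonneg _)
  have b1 : ∀ x : E3, |Real.cos (inner ℝ k.1 x)| ≤ |k.1 j| + 1 := fun x =>
    (Real.abs_cos_le_one _).trans (by linarith [abs_nonneg (k.1 j)])
  have b2 : ∀ x : E3, |Real.sin (inner ℝ k.1 x)| ≤ |k.1 j| + 1 := fun x =>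
    (Real.abs_sin_le_one _).trans (by linarith [abs_nonneg (k.1 j)])
  have b3 : ∀ x : E3, |-Real.sin (inner ℝ k.1 x) * k.1 j| ≤ |k.1 j| + 1 := fun x => by
    rw [abs_mul, abs_neg]
    have := mul_le_of_le_one_left (abs_nonneg (k.1 j)) (Real.abs_sin_le_one (inner ℝ k.1 x))
    linarith
  have b4 : ∀ x : E3, |Real.cos (inner ℝ k.1 x) * k.1 j| ≤ |k.1 j| + 1 := fun x => by
    rw [abs_mul]
    have := mul_le_of_le_one_left (abs_nonneg (k.1 j)) (Real.abs_cos_le_one (inner ℝ k.1 x))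
    linarith
  have h1 := h.mul hf.locInt hg.locInt hc
  have h2 := h.mul hf.locInt hg.locInt hs
  simp only [dc] at h1
  simp only [ds] at h2
  have m1 := bd hc.continuous b1 hf
  have m2 := bd hs.continuous b2 hf
  have m3 := (bd hc.continuous b1 hg).add (bd (by fun_prop) b3 hf)
  have m4 := (bd hs.continuous b2 hg).add (bd (by fun_prop) b4 hf)
  have h3 := h1.add (h2.const_smul m2.locInt m4.locInt
    (-I)) m1.locInt
    (m2.const_smul (-I)).locInt m3.locInt
    (m4.const_smul (-I)).locInt
  refine h3.congr (of_forall fun x => ?_) (of_forall fun x => ?_)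
  · simp only [phase_eq, add_smul, mul_smul, real_smul_eq]
  · simp only [phase_eq, real_smul_eq, smul_add, smul_smul, add_smul]
    have e : ((-Real.sin (inner ℝ k.1 x) * k.1 j : ℝ) : ℂ) =
        (-I * (k.1 j : ℂ)) * (-I * ((Real.sin (inner ℝ k.1 x) : ℝ) : ℂ)) := by
      push_cast
      linear_combination (-(Complex.sin (inner ℝ k.1 x : ℝ) * (k.1 j : ℂ))) * Complex.I_mul_I
    rw [e]
    push_cast
    module

end Phase

lemma ae_config {p : Config → Prop} : (∀ᵐ γ ∂configMeasure, p γ) ↔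
    ∀ n, ∀ᵐ κ ∂(sectorMeasure n), p ⟨n, κ⟩ := by
  rw [configMeasure, Measure.ae_sum_iff]
  exact forall_congr' fun n => (measurableEmbedding_mk n).ae_map_iff

/-- The momentum preserves Bose symmetry. -/
lemma mem_stateSpace_of_gradGraph {Ψ g : 𝓗} (hΨ : Ψ ∈ stateSpace)
    (h : (Ψ, g) ∈ gradGraphParam Spin configMeasure j) : g ∈ stateSpace := by
  refine mem_stateSpace_of_perm fun n π => ?_
  have mg : Measurable (⇑g) := (Lp.stronglyMeasurable g).measurable
  have mp := measurePreserving_perm_config π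
  have h1 : ∀ᵐ κ ∂(sectorMeasure n), IsWeakPartial j (fun x => Ψ (x, ⟨n, κ⟩)) (fun x => g (x, ⟨n, κ⟩)) :=
    ae_config.1 h.2 n
  have h2 : ∀ᵐ κ ∂(sectorMeasure n), MemLp (fun x => g (x, (⟨n, κ⟩ : Config))) 2 volume :=
    ae_config.1 (ae_memLp_fiber (memLp g)) n
  have h3 : ∀ᵐ κ ∂(sectorMeasure n), ∀ᵐ x : E3, Ψ (x, ⟨n, κ ∘ π⟩) = Ψ (x, ⟨n, κ⟩) :=
    ae_fiber (ae_perm_of_mem hΨ n π)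
  refine ae_prod_of_ae_fiber (f := fun z => g (z.1, ⟨n, z.2 ∘ π⟩)) (g := fun z => g (sector n z))
    (mg.comp ((measurableEmbedding_sector n).measurable.comp (measurable_fst.prodMk
      ((measurable_perm π).comp measurable_snd)))).aestronglyMeasurable
    (Measurable.sector mg n).aestronglyMeasurable ?_
  filter_upwards [h1, mp.quasiMeasurePreserving.ae h1, h2, mp.quasiMeasurePreserving.ae h2, h3]
    with κ a1 a2 a3 a4 a5
  exact IsWeakPartial.unique (a2.congr a5 EventuallyEq.rfl) a1 a4.locInt
    a3.locInt

lemma integral_photon_eq {h : 𝓧 → ℂ}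
    (hi : Integrable h μₛₖ) :
    ∫ w, h w ∂μₛₖ =
      ∫ y, ∫ x, h ((x, y.1), y.2) ∂volume ∂(configMeasure.prod μₖ) := by
  have h1 := measurePreserving_prodAssoc (volume : Measure E3) configMeasure μₖ
  have h2 : Integrable (fun w : E3 × (Config × Photon) => h ((w.1, w.2.1), w.2.2))
      ((volume : Measure E3).prod (configMeasure.prod μₖ)) := by
    rw [← h1.integrable_comp_emb MeasurableEquiv.prodAssoc.measurableEmbedding]
    exact hi
  rw [← integral_prod_symm _ h2, ← h1.integral_comp MeasurableEquiv.prodAssoc.measurableEmbedding]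
  rfl

lemma quasiMeasurePreserving_addPhoton_config : Measure.QuasiMeasurePreserving
    (fun y : Config × Photon => (⟨y.1.1 + 1, Fin.cons y.2 y.1.2⟩ : Config))
    (configMeasure.prod μₖ) configMeasure := by
  have m : Measurable fun y : Config × Photon => (⟨y.1.1 + 1, Fin.cons y.2 y.1.2⟩ : Config) :=
    measurable_snd.comp (measurable_addPhoton.comp (((measurable_const (a := (0 : E3))).prodMk
      measurable_fst).prodMk measurable_snd))
  refine ⟨m, Measure.AbsolutelyContinuous.mk fun s hs h0 => ?_⟩
  have h1 : ∀ᵐ z ∂μₛ, z.2 ∉ s :=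
    Measure.quasiMeasurePreserving_snd.ae (by rwa [ae_iff, show {a | ¬ a ∉ s} = s by ext; simp])
  have h2 := quasiMeasurePreserving_addPhoton.ae h1
  have h3 := (measurePreserving_prodAssoc (volume : Measure E3) configMeasure
    μₖ).symm.quasiMeasurePreserving.ae h2
  have h4 := (ae_fiber h3).mono fun y hy => hy.exists
  rw [map_apply m hs, ← compl_mem_ae_iff]
  filter_upwards [h4] with y ⟨x, hx⟩
  exact hx

/-- The multipliers `m(k)` which are bounded below the ultraviolet cutoff. -/
def IsCutoffMultiplier (L : ℝ) (m : Photon → ℝ) : Prop :=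
  Measurable m ∧ ∃ M : ℝ, 0 ≤ M ∧ ∀ k : Photon, ‖k.1‖ ≤ L → |m k| ≤ M

/-- The product of a coupling with a bounded function of the photon momentum. -/
def mulCoupling {m : Photon → ℝ} (hm : IsCutoffMultiplier L m) (t : couplings L) : couplings L :=
  ⟨fun k => (m k : ℂ) • t.1 k, fun s => (measurable_ofReal.comp hm.1).smul (t.2.1 s), by
    obtain ⟨K, hK0, hK⟩ := t.2.2
    obtain ⟨M, hM0, hM⟩ := hm.2
    refine ⟨M * K, mul_nonneg hM0 hK0, fun k => ?_⟩
    rw [norm_smul, norm_real, norm_eq_abs, mul_assoc]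
    by_cases h : ‖k.1‖ ≤ L
    · exact mul_le_mul (hM k h) (hK k) (norm_nonneg _) hM0
    · have h0 : cutoffBound L k = 0 := by rw [cutoffBound, if_neg h]
      have h1 := hK k
      rw [h0, mul_zero] at h1 ⊢
      rw [le_antisymm h1 (norm_nonneg _)]; simp⟩

lemma isCutoffMultiplier_coord (L : ℝ) (j : Fin 3) : IsCutoffMultiplier L fun k => k.1 j :=
  ⟨(proj (𝕜 := ℝ) j : E3 →L[ℝ] ℝ).measurable.comp measurable_fst, |L|, abs_nonneg L,
    fun k hk => (norm_apply_le k.1 j).trans (hk.trans (le_abs_self L))⟩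

/-- The coupling `k_j t(k)`. -/
abbrev momCoupling (j : Fin 3) (t : couplings L) : couplings L :=
  mulCoupling (isCutoffMultiplier_coord L j) t

set_option maxHeartbeats 1600000 in
/-- Integration by parts: the momentum commutes with creation up to the recoil of the photon. -/
lemma inner_grad_creat (t : couplings L) (Ψ : fockDom) {g : 𝓗}
    (h : (Ψ.1, g) ∈ gradGraphParam Spin configMeasure j) :
    ⟪g, creat t Ψ⟫ =
      -⟪annih t Ψ, g⟫ + I * ⟪annih (momCoupling j t) Ψ, Ψ.1⟫ := by
  obtain ⟨i1, e1⟩ := inner_creat_eq_integral t (mem_stateSpace_of_gradGraph (mem_fockDom.1 Ψ.2).1 h) Ψ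
  obtain ⟨i2, e2⟩ := inner_annih_eq_integral t Ψ g
  obtain ⟨i3, e3⟩ := inner_annih_eq_integral (momCoupling j t) Ψ Ψ.1
  have i4 : Integrable (fun w => -⟪pull Ψ.1 w, src (fun _ => 1) t g w⟫ +
      I * ⟪pull Ψ.1 w, src (fun _ => 1) (momCoupling j t).1 Ψ.1 w⟫)
      μₛₖ := i2.neg.add (i3.const_mul I)
  have e4 : -⟪annih t Ψ, g⟫ + I * ⟪annih (momCoupling j t) Ψ, Ψ.1⟫ =
      ∫ w, (-⟪pull Ψ.1 w, src (fun _ => 1) t g w⟫ +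
        I * ⟪pull Ψ.1 w, src (fun _ => 1) (momCoupling j t).1 Ψ.1 w⟫)
        ∂μₛₖ := by
    rw [e2, e3, ← integral_neg, ← integral_const_mul]
    exact (integral_add i2.neg (i3.const_mul I)).symm
  rw [e1, e4, integral_photon_eq i1, integral_photon_eq i4]
  refine integral_congr_ae ?_
  have f1 : ∀ᵐ y ∂(configMeasure.prod μₖ),
      IsWeakPartial j (fun x => Ψ.1 (x, y.1)) (fun x => g (x, y.1)) ∧
      MemLp (fun x => Ψ.1 (x, y.1)) 2 volume ∧ MemLp (fun x => g (x, y.1)) 2 volume :=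
    quasiMeasurePreserving_fst.ae (h.2.and ((ae_memLp_fiber (memLp Ψ.1)).and
      (ae_memLp_fiber (memLp g))))
  have f2 := quasiMeasurePreserving_addPhoton_config.ae (h.2.and
    ((ae_memLp_fiber (memLp Ψ.1)).and (ae_memLp_fiber (memLp g))))
  filter_upwards [f1, f2] with y ⟨a1, a2, a3⟩ ⟨b1, b2, b3⟩
  let T : Spin →L[ℝ] Spin := (t.1 y.2).restrictScalars ℝ
  have c1 : IsWeakPartial j (fun x => t.1 y.2 (Ψ.1 (x, y.1))) (fun x => t.1 y.2 (g (x, y.1))) :=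
    a1.clm T a2.locInt a3.locInt
  have c2 : MemLp (fun x => t.1 y.2 (Ψ.1 (x, y.1))) 2 volume := (t.1 y.2).comp_memLp' a2
  have c3 : MemLp (fun x => t.1 y.2 (g (x, y.1))) 2 volume := (t.1 y.2).comp_memLp' a3
  have ph : ∀ {u : E3 → Spin}, MemLp u 2 volume → MemLp (fun x => phase x y.2 • u x) 2 volume :=
    fun {u} hu => hu.of_le ((continuous_phase y.2).aestronglyMeasurable.smul hu.1)
      (of_forall fun x => by rw [norm_smul, norm_phase, one_mul])
  have c4 := c1.phase c2 c3 y.2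
  have d1 : IsWeakPartial j (fun x => pull Ψ.1 ((x, y.1), y.2)) (fun x => pull g ((x, y.1), y.2)) :=
    b1.const_smul b2.locInt b3.locInt
      ((√(y.1.1 + 1) : ℝ) : ℂ)
  have d2 : MemLp (fun x => pull Ψ.1 ((x, y.1), y.2)) 2 volume :=
    b2.const_smul ((√(y.1.1 + 1) : ℝ) : ℂ)
  have d3 : MemLp (fun x => pull g ((x, y.1), y.2)) 2 volume :=
    b3.const_smul ((√(y.1.1 + 1) : ℝ) : ℂ)
  have c5 := ph c3
  have c6 := (ph c2).const_smul (-I * (y.2.1 j : ℂ))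
  have key := d1.integral_inner c4 d2 d3 (ph c2) (c5.add c6)
  simp only [src]
  simp only [ofReal_one, one_mul]
  rw [key, ← integral_neg]
  refine integral_congr_ae (of_forall fun x => ?_)
  simp only [mulCoupling, smul_apply, inner_add_right, inner_smul_right]
  ring

end Momentum

/-! ### The field operators of the model -/

section FieldOperators

variable {L : ℝ} {ε : Fin 2 → E3 → E3}
  (hε : IsPolarization ε)

/-- The scalar coupling functions. -/
def IsCoupling (L : ℝ) (g : Photon → ℂ) : Prop :=
  Measurable g ∧ ∃ K : ℝ, 0 ≤ K ∧ ∀ k, ‖g k‖ ≤ K * cutoffBound L k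

/-- The matrix-valued coupling `g(k) M`. -/
def IsCoupling.toCoupling {g : Photon → ℂ} (hg : IsCoupling L g) (M : Spin →L[ℂ] Spin) :
    couplings L :=
  ⟨fun k => g k • M, fun s => hg.1.smul_const (M s), by
    obtain ⟨K, hK0, hK⟩ := hg.2
    refine ⟨K * ‖M‖, mul_nonneg hK0 (norm_nonneg _), fun k => ?_⟩
    rw [norm_smul, mul_right_comm]
    exact mul_le_mul_of_nonneg_right (hK k) (norm_nonneg _)⟩

lemma clm_create (M : Spin →L[ℂ] Spin) (g : Photon → ℂ) (f : 𝓦)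
    (z : E3 × Config) :
    M (create (fun x k => g k * phase x k) f z) = createFun (fun k => g k • M) f z := by
  rw [create_eq_raise]
  obtain ⟨x, n, κ⟩ := z
  cases n with
  | zero => simp [raise, createFun]
  | succ n =>
    simp only [raise, createFun, map_smul, map_sum, src, smul_apply, smul_smul]
    congr 1
    refine sum_congr rfl fun i _ => ?_
    congr 1
    push_cast; ring

lemma clm_annihilate {g : Photon → ℂ} (hg : IsCoupling L g) {M M' : Spin →L[ℂ] Spin}
    (hM : ∀ s s' : Spin, ⟪M s, s'⟫ = ⟪s, M' s'⟫) (Ψ : fockDom) :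
    (fun z => M (annihilate (fun x k => g k * phase x k) Ψ.1 z)) =ᵐ[μₛ]
      annih (hg.toCoupling M') Ψ := by
  obtain ⟨K, hK0, hK⟩ := hg.2
  have hYm := memLp (pullP Ψ)
  have mY : AEMeasurable (fun w => ‖pullP Ψ w‖ₑ ^ 2) μₛₖ :=
    hYm.1.enorm.pow_const 2
  have mg : Measurable fun k => ‖((invSqrt k : ℝ) : ℂ) * g k‖ₑ :=
    ((measurable_ofReal.comp isWeight_invSqrt.1).mul hg.1).enorm
  have hB : ∫⁻ k, ‖((invSqrt k : ℝ) : ℂ) * g k‖ₑ ^ 2 ∂μₖ < ⊤ := by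
    refine lt_of_le_of_lt (lintegral_mono fun k => ?_) (isWeight_invSqrt.lintegral L K)
    rw [← ofReal_norm, ← ofReal_pow (norm_nonneg _), norm_mul, norm_real]
    exact ofReal_le_ofReal (pow_le_pow_left₀ (by positivity)
      (mul_le_mul_of_nonneg_left (hK k) (abs_nonneg _)) 2)
  have hY : ∫⁻ z, ∫⁻ k, ‖pullP Ψ (z, k)‖ₑ ^ 2 ∂μₖ ∂μₛ < ⊤ := by
    rw [← lintegral_prod _ mY]; exact (memLp_two_iff hYm.1).1 hYm
  let h : 𝓧 → Spin := fun w =>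
    starRingEnd ℂ (g w.2 * phase w.1.1 w.2) • pull Ψ.1 w
  let h' : 𝓧 → Spin := fun w =>
    starRingEnd ℂ (((invSqrt w.2 : ℝ) : ℂ) * g w.2 * phase w.1.1 w.2) • pullP Ψ w
  have mh' : AEStronglyMeasurable h' μₛₖ := by
    have m : Measurable fun w : 𝓧 =>
        starRingEnd ℂ (((invSqrt w.2 : ℝ) : ℂ) * g w.2 * phase w.1.1 w.2) :=
      Complex.continuous_conj.measurable.comp ((((measurable_ofReal.comp isWeight_invSqrt.1).mul
        hg.1).comp measurable_snd).mul measurable_phase)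
    exact m.aestronglyMeasurable.smul hYm.1
  have e : h =ᵐ[μₛₖ] h' := by
    have h0 : ∀ᵐ w ∂μₛₖ, w.2.1 ≠ 0 :=
      Measure.quasiMeasurePreserving_snd.ae ae_photon_ne_zero
    filter_upwards [coeFn_pullP Ψ, h0] with w h1 h3
    have h4 : 0 < photonEnergy w.2 := norm_pos_iff.2 h3
    have h5 : ((√(photonEnergy w.2) : ℝ) : ℂ) ≠ 0 :=
      ofReal_ne_zero.2 (sqrt_pos.2 h4).ne'
    simp only [h, h']
    rw [h1, wpull, smul_smul, invSqrt]
    congr 1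
    simp only [map_mul, conj_ofReal]
    push_cast
    field_simp
  have mh : AEStronglyMeasurable h μₛₖ := mh'.congr e.symm
  have hle : ∀ᵐ z ∂μₛ, (∫⁻ k, ‖h (z, k)‖ₑ ∂μₖ) ^ 2 ≤
      (∫⁻ k, ‖((invSqrt k : ℝ) : ℂ) * g k‖ₑ ^ 2 ∂μₖ) *
        ∫⁻ k, ‖pullP Ψ (z, k)‖ₑ ^ 2 ∂μₖ := by
    filter_upwards [Measure.ae_ae_of_ae_prod e, hYm.1.prodMk_left] with z h1 h2
    refine le_trans (le_of_eq ?_) (lintegral_mul_sq_le mg.aemeasurable h2.enorm)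
    congr 1
    refine lintegral_congr_ae (h1.mono fun k hk => ?_)
    simp only [hk, h']
    rw [enorm_smul, ← ofReal_norm, RCLike.norm_conj, norm_mul, norm_phase, mul_one, ofReal_norm]
  have hi : ∀ᵐ z ∂μₛ, Integrable (fun k => h (z, k)) μₖ := by
    filter_upwards [hle, ae_lt_top' mY.lintegral_prod_right' hY.ne, mh.prodMk_left] with z h1 h2 h3
    refine ⟨h3, lt_top_iff_ne_top.2 fun hc => ?_⟩
    rw [hc] at h1
    simp only [ENNReal.top_pow (two_ne_zero), top_le_iff] at h1
    exact (mul_lt_top hB h2).ne h1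
  have hU : ∀ z, annihilate (fun x k => g k * phase x k) Ψ.1 z = ∫ k, h (z, k) ∂μₖ :=
    annihilate_eq_integral _ _
  have hUL : MemLp (fun z => M (annihilate (fun x k => g k * phase x k) Ψ.1 z)) 2 μₛ := by
    simp only [hU]
    refine M.comp_memLp' ((memLp_two_iff mh.integral_prod_right').2 (lt_of_le_of_lt
      (lintegral_mono_ae ?_) (lt_of_eq_of_lt (lintegral_const_mul'' _ mY.lintegral_prod_right')
      (mul_lt_top hB hY))))
    filter_upwards [hle] with z hz
    exact (pow_le_pow_left' (enorm_integral_le_lintegral_enorm _) 2).trans hz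
  have key : hUL.toLp = annih (hg.toCoupling M') Ψ := by
    refine ext_inner_right ℂ fun Φ => ?_
    obtain ⟨i1, e1⟩ := inner_annih_eq_integral (hg.toCoupling M') Ψ Φ
    rw [e1, integral_prod _ i1, L2.inner_def]
    refine integral_congr_ae ?_
    filter_upwards [hUL.coeFn_toLp, hi] with z h1 h2
    rw [h1, hM, hU, ← inner_conj_symm, ← integral_inner h2, ← integral_conj]
    refine integral_congr_ae (of_forall fun k => ?_)
    simp only [h, src, IsCoupling.toCoupling, smul_apply, inner_smul_right, map_mul, inner_conj_symm,
      Complex.conj_conj]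
    push_cast; ring
  rw [← key]
  exact hUL.coeFn_toLp.symm

lemma isCoupling_G (hε : IsPolarization ε) (j : Fin 3) : IsCoupling L (couplingG L ε j) :=
  ⟨measurable_couplingG hε j, 1, zero_le_one, fun k => by rw [one_mul]; exact norm_couplingG_le hε j k⟩

/-- The coupling of the `j`-th component of the vector potential. -/
abbrev couplA (L : ℝ) (hε : IsPolarization ε) (j : Fin 3) : couplings L :=
  (isCoupling_G hε j).toCoupling (ContinuousLinearMap.id ℂ Spin)

/-- The real amplitude of the coupling to the magnetic field. -/
def curlAmp (L : ℝ) (ε : Fin 2 → E3 → E3) (j : Fin 3) (k : Photon) : ℝ :=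
  cutoffFactor L k.1 * crossProduct (WithLp.ofLp k.1) (WithLp.ofLp (ε k.2 k.1)) j

lemma measurable_curlAmp (hε : IsPolarization ε) (j : Fin 3) : Measurable (curlAmp L ε j) := by
  have h1 : ∀ i, Measurable fun k : Photon => k.1 i := fun i =>
    (proj (𝕜 := ℝ) i : E3 →L[ℝ] ℝ).measurable.comp measurable_fst
  have h2 := fun i => hε.measurable_coord i
  refine ((measurable_cutoffFactor L).comp measurable_fst).mul ?_
  fin_cases j <;> simp only [cross_apply] <;>
    exact ((h1 _).mul (h2 _)).sub ((h1 _).mul (h2 _))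

lemma abs_curlAmp_le (hε : IsPolarization ε) (j : Fin 3) (k : Photon) :
    |curlAmp L ε j k| ≤ 2 * photonEnergy k * cutoffBound L k := by
  rw [curlAmp, abs_mul, abs_of_nonneg (cutoffFactor_nonneg L _)]
  by_cases hk : k.1 = 0
  · rw [hk, cutoffFactor_zero, zero_mul]
    exact mul_nonneg (mul_nonneg zero_le_two (photonEnergy_nonneg k)) (cutoffBound_nonneg L k)
  have h1 : ∀ i, |k.1 i| ≤ photonEnergy k := fun i => (norm_apply_le k.1 i :)
  have h2 : ∀ i, |ε k.2 k.1 i| ≤ 1 := fun i => by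
    rw [← hε.norm_eq_one k.2 hk]; exact (norm_apply_le (ε k.2 k.1) i :)
  have h3 : ∀ a b, |k.1 a * ε k.2 k.1 b - k.1 b * ε k.2 k.1 a| ≤ 2 * photonEnergy k := fun a b => by
    have e : ∀ a b, |k.1 a * ε k.2 k.1 b| ≤ photonEnergy k := fun a b => by
      rw [abs_mul]
      exact (mul_le_mul (h1 a) (h2 b) (abs_nonneg _) (photonEnergy_nonneg k)).trans_eq (mul_one _)
    exact (abs_sub _ _).trans (by linarith [e a b, e b a])
  rw [mul_comm]
  refine mul_le_mul ?_ (cutoffFactor_le L k) (cutoffFactor_nonneg L _)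
    (mul_nonneg zero_le_two (photonEnergy_nonneg k))
  fin_cases j <;> simp only [cross_apply] <;> exact h3 _ _

lemma isCoupling_H (hε : IsPolarization ε) (j : Fin 3) : IsCoupling L (couplingH L ε j) := by
  refine ⟨measurable_const.mul (measurable_ofReal.comp (measurable_curlAmp hε j)), 2 * |L|,
    by positivity, fun k => ?_⟩
  have h : ‖couplingH L ε j k‖ = |curlAmp L ε j k| := by
    rw [couplingH, norm_mul, norm_neg, norm_I, one_mul, norm_real]; rfl
  rw [h]
  refine (abs_curlAmp_le hε j k).trans ?_
  by_cases hc : cutoffBound L k = 0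
  · simp [hc]
  · have h1 : photonEnergy k ≤ |L| := (norm_le_of_cutoffBound hc).trans (le_abs_self L)
    have h2 := cutoffBound_nonneg L k
    gcongr

/-- The Pauli matrices as operators. -/
def pauliOp (j : Fin 3) : Spin →L[ℂ] Spin := Matrix.toEuclideanCLM (𝕜 := ℂ) (pauli j)

lemma pauliAct_eq (j : Fin 3) (s : Spin) : pauliAct j s = pauliOp j s := rfl

lemma inner_pauliOp (j : Fin 3) (s s' : Spin) :
    ⟪pauliOp j s, s'⟫ = ⟪s, pauliOp j s'⟫ := by
  rw [← inner_conj_symm, pauliOp, inner_matrix, inner_matrix]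
  fin_cases j <;> simp [pauli, Fin.sum_univ_two] <;> ring

/-- The coupling of `σ·B`. -/
def couplB (L : ℝ) (hε : IsPolarization ε) : couplings L :=
  ∑ j, (isCoupling_H hε j).toCoupling (pauliOp j)

/-- The one-photon amplitude of the dressed electron, `(|k|² + |k|)⁻¹ σ·H(k)`. -/
def dressFun (L : ℝ) (ε : Fin 2 → E3 → E3) (j : Fin 3) (k : Photon) : ℂ :=
  ((recoilEnergy k)⁻¹ : ℝ) * couplingH L ε j k

lemma norm_dressFun (j : Fin 3) (k : Photon) :
    ‖dressFun L ε j k‖ = (recoilEnergy k)⁻¹ * |curlAmp L ε j k| := by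
  rw [dressFun, norm_mul, norm_real, norm_of_nonneg (inv_nonneg.2 (recoilEnergy_nonneg k)),
    couplingH, norm_mul, norm_neg, norm_I, one_mul, norm_real]
  rfl

lemma isCoupling_dress (hε : IsPolarization ε) (j : Fin 3) : IsCoupling L (dressFun L ε j) := by
  refine ⟨(measurable_ofReal.comp measurable_recoilEnergy.inv).mul (isCoupling_H hε j).1, 2,
    zero_le_two, fun k => ?_⟩
  rw [norm_dressFun]
  rcases (recoilEnergy_nonneg k).eq_or_lt with h | h
  · rw [← h, inv_zero, zero_mul]
    exact mul_nonneg zero_le_two (cutoffBound_nonneg L k)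
  · rw [inv_mul_le_iff₀ h]
    refine (abs_curlAmp_le hε j k).trans ?_
    have h1 : photonEnergy k ≤ recoilEnergy k := by
      rw [recoilEnergy]; exact le_add_of_nonneg_left (sq_nonneg _)
    rw [mul_comm 2, mul_assoc]
    exact mul_le_mul_of_nonneg_right h1 (mul_nonneg zero_le_two (cutoffBound_nonneg L k))

/-- The matrix-valued amplitude of the dressed electron. -/
def dress (L : ℝ) (hε : IsPolarization ε) : couplings L :=
  ∑ j, (isCoupling_dress hε j).toCoupling (pauliOp j)

lemma isCutoffMultiplier_energy (L : ℝ) : IsCutoffMultiplier L photonEnergy :=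
  ⟨measurable_photonEnergy, |L|, abs_nonneg L, fun k hk => by
    rw [abs_of_nonneg (photonEnergy_nonneg k)]; exact hk.trans (le_abs_self L)⟩

lemma coe_dress (k : Photon) :
    (dress L hε).1 k = ∑ j, dressFun L ε j k • pauliOp j := by
  simp [dress, IsCoupling.toCoupling]

lemma coe_couplB (k : Photon) :
    (couplB L hε).1 k = (recoilEnergy k : ℂ) • (dress L hε).1 k := by
  have h : ∀ j, couplingH L ε j k = recoilEnergy k * dressFun L ε j k := fun j => by
    rw [dressFun]
    by_cases hk : k.1 = 0
    · rw [couplingH, hk, cutoffFactor_zero]; simp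
    · have := ofReal_ne_zero.2 (recoilEnergy_pos hk).ne'
      push_cast; field_simp
  rw [coe_dress]
  simp [couplB, IsCoupling.toCoupling, h, Finset.smul_sum, smul_smul]

/-- The magnetic coupling as the recoil energy times the amplitude of the dressed electron. -/
lemma couplB_eq : couplB L hε =
    mulCoupling (isCutoffMultiplier_energy L) (dress L hε) +
      ∑ j, momCoupling j (momCoupling j (dress L hε)) := by
  refine Subtype.ext (funext fun k => ?_)
  rw [coe_couplB]
  have h1 : recoilEnergy k = photonEnergy k + ∑ j, k.1 j * k.1 j := by
    rw [recoilEnergy, photonEnergy, norm_sq_eq, add_comm]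
    congr 1
    exact sum_congr rfl fun j _ => by rw [norm_eq_abs, sq_abs, sq]
  rw [h1]
  refine ContinuousLinearMap.ext fun s => ?_
  simp [mulCoupling, smul_smul, Fin.sum_univ_three, add_smul, add_assoc]

lemma sum_momCoupling_couplA :
    ∑ j, momCoupling j (couplA L hε j) = 0 := by
  refine Subtype.ext (funext fun k => ?_)
  have h := sum_mul_couplingG (L := L) hε k
  simp only [Fin.sum_univ_three] at h
  refine ContinuousLinearMap.ext fun s => ?_
  simp [mulCoupling, IsCoupling.toCoupling, smul_smul, Fin.sum_univ_three, ← add_smul, h]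

/-- The modulus of the amplitude of the dressed electron, which is a multiple of an isometry. -/
def dressNorm (L : ℝ) (ε : Fin 2 → E3 → E3) (k : Photon) : ℝ :=
  (recoilEnergy k)⁻¹ * √(∑ j, curlAmp L ε j k ^ 2)

lemma norm_dress (k : Photon) (s : Spin) :
    ‖(dress L hε).1 k s‖ = dressNorm L ε k * ‖s‖ := by
  have hr := inv_nonneg.2 (recoilEnergy_nonneg k)
  have h0 : 0 ≤ ∑ j, curlAmp L ε j k ^ 2 := sum_nonneg fun j _ => sq_nonneg _
  rw [dressNorm]
  refine (sq_eq_sq₀ (norm_nonneg _) (by positivity)).1 ?_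
  rw [mul_pow, mul_pow, sq_sqrt h0, norm_sq_eq, norm_sq_eq, coe_dress]
  simp only [Fin.sum_univ_three, Fin.sum_univ_two, add_apply, smul_apply, PiLp.add_apply, PiLp.smul_apply,
    pauliOp, Matrix.ofLp_toEuclideanCLM, pauli, ← Complex.normSq_eq_norm_sq, dressFun, couplingH]
  simp [Matrix.mulVec, dotProduct, Fin.sum_univ_two, Complex.normSq_apply]
  simp only [curlAmp]
  ring

end FieldOperators

/-! ### The form of the Pauli–Fierz operator -/

section PauliFierzForm

lemma ClosedForm.perturb {H K : Type*} [NormedAddCommGroup H] [InnerProductSpace ℂ H]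
    [NormedAddCommGroup K] [NormedSpace ℂ K] {Q : Submodule ℂ H} {q₀ : H → H → ℂ} {J : Q →ₗ[ℂ] K}
    (h : ClosedForm Q q₀ J) : ∃ η : ℝ, 0 < η ∧ ∀ (q : H → H → ℂ) (r : Q → Q → ℂ) (C : ℝ),
      (∀ v u : Q, q v u = q₀ v u + r v u) → (∀ v u u', r v (u + u') = r v u + r v u') →
      (∀ v u (a : ℂ), r v (a • u) = a * r v u) → (∀ v u, starRingEnd ℂ (r u v) = r v u) →
      (∀ u, |(r u u).re| ≤ η * ‖J u‖ ^ 2 + C * ‖(u : H)‖ ^ 2) → ClosedForm Q q J := by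
  obtain ⟨c, δ, hδ, hl⟩ := h.lower
  obtain ⟨C₁, hu⟩ := h.upper
  refine ⟨δ / 2, by positivity, fun q r C hq hadd hsmul hsymm hr => ⟨fun v hv u hu u' hu' => ?_,
    fun v hv u hu a => ?_, fun v hv u hu => ?_, h.graph, ⟨c + C, δ / 2, by positivity, fun u => ?_⟩,
    ⟨|C₁| + δ / 2 + |C|, fun u => ?_⟩⟩⟩
  · have h1 := hq ⟨v, hv⟩ (⟨u, hu⟩ + ⟨u', hu'⟩)
    rw [hadd, coe_add, h.add_right v hv u hu u' hu'] at h1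
    linear_combination h1 - hq ⟨v, hv⟩ ⟨u, hu⟩ - hq ⟨v, hv⟩ ⟨u', hu'⟩
  · have h1 := hq ⟨v, hv⟩ (a • ⟨u, hu⟩)
    rw [hsmul, coe_smul, h.smul_right v hv u hu a] at h1
    linear_combination h1 - a * hq ⟨v, hv⟩ ⟨u, hu⟩
  · rw [hq ⟨v, hv⟩ ⟨u, hu⟩, hq ⟨u, hu⟩ ⟨v, hv⟩, map_add, hsymm, h.symm v hv u hu]
  · have h1 := (abs_le.1 (hr u)).1
    rw [hq u u, add_re]
    linarith [hl u]
  · have h1 := (abs_le.1 (hr u)).2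
    rw [hq u u, add_re]
    nlinarith [hu u, sq_nonneg ‖J u‖, sq_nonneg ‖(u : H)‖, le_abs_self C₁, le_abs_self C, abs_nonneg C,
      abs_nonneg C₁]

lemma isClosed_stateSpace : IsClosed (stateSpace : Set 𝓗) := by
  refine IsSeqClosed.isClosed fun Ψ Φ hΨ h => ?_
  have h1 : TendstoInMeasure μₛ (fun n => (Ψ n : 𝓦)) atTop Φ :=
    tendstoInMeasure_of_tendsto_Lp h
  obtain ⟨a, -, ha⟩ := h1.exists_seq_tendsto_ae
  refine mem_stateSpace_of_perm fun n π => ?_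
  have h2 := ae_state.1 ha n
  filter_upwards [h2, (measurePreserving_perm π).quasiMeasurePreserving.ae h2,
    ae_all_iff.2 fun i => ae_perm_of_mem (hΨ (a i)) n π] with z h3 h4 h5
  exact tendsto_nhds_unique h4 (h3.congr fun i => (h5 i).symm)

instance : CompleteSpace stateSpace := isClosed_stateSpace.completeSpace_coe

variable {L : ℝ} {ε : Fin 2 → E3 → E3} {V : E3 → ℝ} [hV : RegularPotential V] {α : ℝ}
  (hε : IsPolarization ε)

instance : EnergyWeight fieldEnergy :=
  ⟨measurable_fieldEnergy.comp ((measurable_const (a := (0 : E3))).prodMk measurable_id),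
    fieldEnergy_nonneg⟩

/-- The form domain of the Pauli–Fierz operator as a subspace. -/
abbrev pfSpace (V : E3 → ℝ) : Submodule ℂ stateSpace :=
  (paramSpace Spin configMeasure V fieldEnergy).comap stateSpace.subtype

/-- The gradient and the root of the positive part of the weight on the form domain. -/
def pfVal (V : E3 → ℝ) : pfSpace V →ₗ[ℂ] (Option (Fin 3) → 𝓗) :=
  paramVal Spin configMeasure V fieldEnergy ∘ₗ
    (stateSpace.subtype.restrict (p := pfSpace V) (q := paramSpace Spin configMeasure V fieldEnergy)
      fun _ hx => hx)

lemma pfVal_mem (u : pfSpace V) (j : Fin 3) :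
    (u.1.1, pfVal V u (some j)) ∈ gradGraphParam Spin configMeasure j :=
  paramVal_mem (V := V) (m := fieldEnergy) ⟨u.1.1, u.2⟩ j

lemma mem_pfSpace {u : stateSpace} :
    u ∈ pfSpace V ↔ (∀ j, ∃ g, (u.1, g) ∈ gradGraphParam Spin configMeasure j) ∧
      ∫⁻ z, ofReal (fieldEnergy z.2) * ‖u.1 z‖ₑ ^ 2 ∂μₛ ≠ ⊤ ∧
      ∫⁻ z, ofReal (V z.1) * ‖u.1 z‖ₑ ^ 2 ∂μₛ ≠ ⊤ :=
  mem_paramSpace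

lemma coe_pfSpace :
    (pfSpace V : Set stateSpace) = pauliFierzDomain V := by
  ext u
  rw [SetLike.mem_coe, mem_pfSpace]
  simp only [exists_mem_gradGraphParam]
  rfl

/-- States in the form domain have finite field energy. -/
def toFock : pfSpace V →ₗ[ℂ] fockDom where
  toFun u := ⟨u.1.1, mem_fockDom.2 ⟨u.1.2, (mem_pfSpace.1 u.2).2.1⟩⟩
  map_add' _ _ := rfl
  map_smul' _ _ := rfl

/-- The vector potential `A_j`. -/
def fieldA (L : ℝ) (hε : IsPolarization ε) (j : Fin 3) : fockDom →ₗ[ℂ] 𝓗 :=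
  annih (couplA L hε j) + creat (couplA L hε j)

/-- The kinetic momentum `p_j + √α A_j`. -/
def kin (L α : ℝ)
    (j : Fin 3) : pfSpace V →ₗ[ℂ] 𝓗 :=
  (-I) • (LinearMap.proj (some j) ∘ₗ pfVal V) +
    (√α : ℂ) • (fieldA L hε j ∘ₗ toFock)

set_option maxHeartbeats 1600000 in
lemma kinetic_ae_eq (j : Fin 3) (u : pfSpace V) : kinetic L ε α j u.1 =ᵐ[μₛ] kin hε L α j u := by
  have e : kin hε L α j u = (-I) • pfVal V u (some j) +
    (√α : ℂ) • (annih (couplA L hε j) (toFock u) +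
      creat (couplA L hε j) (toFock u)) := rfl
  filter_upwards [clm_annihilate (isCoupling_G (L := L) hε j) (M := ContinuousLinearMap.id ℂ Spin)
      (M' := ContinuousLinearMap.id ℂ Spin) (fun _ _ => rfl) (toFock u), coeFn_creat (couplA L hε j) (toFock u),
    partialParam_ae_eq (pfVal_mem u j),
    coeFn_add ((-I) • pfVal V u (some j)) ((√α : ℂ) •
      (annih (couplA L hε j) (toFock u) + creat (couplA L hε j) (toFock u))),
    coeFn_smul (-I) (pfVal V u (some j)), coeFn_smul (√α : ℂ)
      (annih (couplA L hε j) (toFock u) + creat (couplA L hε j) (toFock u)),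
    coeFn_add (annih (couplA L hε j) (toFock u)) (creat (couplA L hε j) (toFock u))]
    with z h1 h2 h3 h4 h5 h6 h7
  have h8 := clm_create (ContinuousLinearMap.id ℂ Spin) (couplingG L ε j) u.1.1 z
  rw [ContinuousLinearMap.id_apply] at h8
  rw [e, h4, Pi.add_apply, h5, h6, Pi.smul_apply, Pi.smul_apply, h7, Pi.add_apply, ← h1, h2, kinetic,
    h3, vectorPotential, fieldOp, Pi.add_apply, h8]
  rfl

lemma inner_annih_sum (t : Fin 3 → couplings L) (Ψ : fockDom) (Φ : 𝓗) :
    ⟪annih (∑ j, t j) Ψ, Φ⟫ = ∑ j, ⟪annih (t j) Ψ, Φ⟫ := by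
  simp only [inner_annih, map_sum, sum_apply, inner_sum]

/-- The magnetic energy in terms of the annihilation operator. -/
lemma magnetic_eq (Φ Ψ : fockDom) :
    ∑ j, ∫ z, ⟪Φ.1 z, pauliAct j (magneticField L ε j Ψ.1 z)⟫ ∂μₛ =
      ⟪Φ.1, annih (couplB L hε) Ψ⟫ + ⟪annih (couplB L hε) Φ, Ψ.1⟫ := by
  have h1 : ⟪Φ.1, annih (couplB L hε) Ψ⟫ =
      ∑ j, ⟪Φ.1, annih ((isCoupling_H (L := L) hε j).toCoupling (pauliOp j)) Ψ⟫ := by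
    rw [← inner_conj_symm, couplB, inner_annih_sum, map_sum]
    exact sum_congr rfl fun j _ => inner_conj_symm _ _
  rw [h1, couplB, inner_annih_sum, ← sum_add_distrib]
  refine sum_congr rfl fun j _ => ?_
  rw [← inner_creat_eq_annih, ← inner_add_right, L2.inner_def]
  refine integral_congr_ae ?_
  filter_upwards [clm_annihilate (isCoupling_H (L := L) hε j) (inner_pauliOp j) Ψ,
    coeFn_creat ((isCoupling_H (L := L) hε j).toCoupling (pauliOp j)) Ψ,
    coeFn_add (annih ((isCoupling_H (L := L) hε j).toCoupling (pauliOp j)) Ψ)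
      (creat ((isCoupling_H hε j).toCoupling (pauliOp j)) Ψ)] with z h1 h2 h3
  have h8 := clm_create (pauliOp j) (couplingH L ε j) Ψ.1 z
  rw [h3, Pi.add_apply, ← h1, h2, pauliAct_eq, magneticField, fieldOp, Pi.add_apply, map_add]
  exact congrArg _ (congrArg _ h8)

/-- The interaction terms of the form. -/
def interaction (L α : ℝ)
    (v u : pfSpace V) : ℂ :=
  ∑ j, (⟪kin hε L α j v, kin hε L α j u⟫ -
    ⟪pfVal V v (some j), pfVal V u (some j)⟫) +
  (√α : ℂ) * (⟪u.1.1, annih (couplB L hε) (toFock v)⟫ +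
    ⟪annih (couplB L hε) (toFock u), v.1.1⟫ |> starRingEnd ℂ)

lemma integrable_weights (v u : pfSpace V) :
    Integrable (fun z => (V z.1 : ℂ) * ⟪v.1.1 z, u.1.1 z⟫) μₛ ∧
    Integrable (fun z => (fieldEnergy z.2 : ℂ) * ⟪v.1.1 z, u.1.1 z⟫) μₛ := by
  have h := fun w : pfSpace V => integrable_V_sq w.2
  have h' := fun w : pfSpace V => integrable_m_sq w.2
  exact ⟨integrable_weight_inner (W := fun z : E3 × Config => V z.1)
    (hV.meas.comp measurable_fst).aemeasurable (memLp _).1 (memLp _).1 (h u) (h v),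
    integrable_weight_inner (W := fun z : E3 × Config => fieldEnergy z.2)
    measurable_fieldEnergy.aemeasurable (memLp _).1 (memLp _).1 (h' u) (h' v)⟩

/-- The form of `p² + V + H_f`. -/
def freeForm (V : E3 → ℝ) (v u : 𝓗) : ℂ :=
  (∑ j, ∫ z, ⟪partialParam configMeasure j v z, partialParam configMeasure j u z⟫
    ∂μₛ) + ∫ z, (weightVm V fieldEnergy z : ℂ) * ⟪v z, u z⟫ ∂μₛ

lemma freeForm_eq (v u : pfSpace V) :
    freeForm V v.1.1 u.1.1 = ∑ j, ⟪pfVal V v (some j), pfVal V u (some j)⟫ +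
      ((∫ z, (fieldEnergy z.2 : ℂ) * ⟪v.1.1 z, u.1.1 z⟫ ∂μₛ) +
        ∫ z, (V z.1 : ℂ) * ⟪v.1.1 z, u.1.1 z⟫ ∂μₛ) := by
  obtain ⟨i1, i2⟩ := integrable_weights v u
  rw [freeForm, ← integral_add i2 i1]
  congr 1
  · refine sum_congr rfl fun j _ => ?_
    rw [L2.inner_def]
    refine integral_congr_ae ?_
    filter_upwards [partialParam_ae_eq (pfVal_mem u j), partialParam_ae_eq (pfVal_mem v j)] with z a b
    rw [a, b]
  · refine integral_congr_ae (of_forall fun z => ?_)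
    simp only [weightVm]
    push_cast; ring

lemma pauliFierzForm_eq (v u : pfSpace V) : pauliFierzForm L ε V α v.1 u.1 =
      freeForm V v.1.1 u.1.1 + interaction hε L α v u := by
  have h1 : ∀ j, ∫ z, ⟪kinetic L ε α j v.1 z, kinetic L ε α j u.1 z⟫ ∂μₛ =
      ⟪kin hε L α j v, kin hε L α j u⟫ := fun j => by
    rw [L2.inner_def]
    refine integral_congr_ae ?_
    filter_upwards [kinetic_ae_eq (L := L) (α := α) hε j u,
      kinetic_ae_eq (L := L) (α := α) hε j v] with z a b
    rw [a, b]
  have h2 := magnetic_eq (L := L) hε (toFock v) (toFock u)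
  rw [pauliFierzForm, freeForm_eq, interaction, sum_sub_distrib]
  simp only [h1]
  erw [h2]
  simp only [map_add, inner_conj_symm]
  change _ + _ * (⟪v.1.1, _⟫ + ⟪_, u.1.1⟫) + _ + _ = _
  ring

/-- On the form domain the field energy is controlled by the norm of the form. -/
lemma norm_pullP_sq_le :
    ∃ C : ℝ, 0 ≤ C ∧ ∀ u : pfSpace V,
      ‖pullP (toFock u)‖ ^ 2 ≤ C * (‖pfVal V u‖ ^ 2 + ‖u‖ ^ 2) := by
  obtain ⟨C, hC, h⟩ := lintegral_neg_le_param (V := V) (F := Spin) (ν := configMeasure) one_pos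
  refine ⟨4 + C, by positivity, fun u => ?_⟩
  have hn : (u.1.1, pfVal V u none) ∈ weightGraph Spin μₛ (weightVm V fieldEnergy) :=
    gradWeightVal_mem isClosedOp_gradGraphParam ⟨u.1.1, u.2⟩ none
  have h1 := h u.1.1 (fun j => pfVal V u (some j)) fun j => pfVal_mem u j
  have h2 : ofReal (‖pullP (toFock u)‖ ^ 2) ≤ ofReal (‖pfVal V u none‖ ^ 2) +
      ofReal (1 * ∑ j, ‖pfVal V u (some j)‖ ^ 2 + C * ‖u.1.1‖ ^ 2) := by
    refine le_trans ?_ (add_le_add le_rfl h1)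
    have m : AEMeasurable (fun z => ofReal (weightVm V fieldEnergy z) * ‖u.1.1 z‖ₑ ^ 2)
        μₛ := measurable_weightVm.ennreal_ofReal.aemeasurable.mul
      ((memLp _).1.enorm.pow_const 2)
    rw [norm_pullP_sq, norm_sq_of_mem_weightGraph hn, ← lintegral_add_left' m]
    refine lintegral_mono fun z => ?_
    rw [← add_mul]
    refine mul_le_mul_left (le_trans (ofReal_le_ofReal (le_of_eq ?_)) ofReal_add_le) _
    simp only [weightVm]; ring
  rw [← ofReal_add (sq_nonneg _) (by positivity),
    ENNReal.ofReal_le_ofReal_iff (by positivity)] at h2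
  have h3 : ∀ i, ‖pfVal V u i‖ ^ 2 ≤ ‖pfVal V u‖ ^ 2 := fun i =>
    pow_le_pow_left₀ (norm_nonneg _) (norm_le_pi_norm _ i) 2
  have h4 : ‖u.1.1‖ = ‖u‖ := rfl
  rw [h4, Fin.sum_univ_three] at h2
  nlinarith [h3 none, h3 (some 0), h3 (some 1), h3 (some 2), sq_nonneg ‖u‖, sq_nonneg ‖pfVal V u‖]

lemma norm_fieldA_le (j : Fin 3) : ∃ C : ℝ, 0 ≤ C ∧ ∀ Ψ : fockDom,
    ‖fieldA L hε j Ψ‖ ^ 2 ≤ C * (‖Ψ.1‖ ^ 2 + ‖pullP Ψ‖ ^ 2) := by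
  obtain ⟨C, hC, h⟩ := norm_creat_le (couplA L hε j)
  obtain ⟨A, hA⟩ : ∃ A, A = ‖source isWeight_invSqrt L (couplA L hε j)‖ := ⟨_, rfl⟩
  have hA0 : 0 ≤ A := hA ▸ norm_nonneg _
  refine ⟨2 * (A + C) ^ 2, by positivity, fun Ψ => ?_⟩
  have h1 := norm_annih_le (couplA L hε j) Ψ
  rw [← hA] at h1
  have h2 : ‖fieldA L hε j Ψ‖ ≤ (A + C) * (‖Ψ.1‖ + ‖pullP Ψ‖) := by
    refine (norm_add_le _ _).trans ?_
    nlinarith [h Ψ, mul_nonneg hA0 (norm_nonneg Ψ.1)]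
  refine (pow_le_pow_left₀ (norm_nonneg _) h2 2).trans ?_
  rw [mul_pow, mul_comm 2, mul_assoc]
  refine mul_le_mul_of_nonneg_left ?_ (sq_nonneg _)
  nlinarith [sq_nonneg (‖Ψ.1‖ - ‖pullP Ψ‖)]

lemma kin_apply (j : Fin 3) (u : pfSpace V) : kin hε L α j u = (-I) • pfVal V u (some j) +
      (√α : ℂ) • fieldA L hε j (toFock u) := rfl

lemma norm_add_smul_sq {H : Type*} [NormedAddCommGroup H] [InnerProductSpace ℂ H] (p a : H) (r : ℝ) :
    ‖p + (r : ℂ) • a‖ ^ 2 = ‖p‖ ^ 2 + 2 * r * ⟪p, a⟫.re + r ^ 2 * ‖a‖ ^ 2 := by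
  rw [norm_add_sq (𝕜 := ℂ), inner_smul_right, norm_smul, norm_real, mul_pow, norm_eq_abs,
    sq_abs]
  change _ + 2 * ((r : ℂ) * _).re + _ = _
  rw [re_ofReal_mul]; ring

lemma re_inner_comm {H : Type*} [NormedAddCommGroup H] [InnerProductSpace ℂ H] (a b : H) :
    ⟪a, b⟫.re = ⟪b, a⟫.re := inner_re_symm (𝕜 := ℂ) a b

set_option maxHeartbeats 1600000 in
lemma re_interaction (hα : 0 ≤ α) (u : pfSpace V) : (interaction hε L α u u).re =
      ∑ j, (2 * √α * ⟪(-I) • pfVal V u (some j), fieldA L hε j (toFock u)⟫.re + α * ‖fieldA L hε j (toFock u)‖ ^ 2) +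
      2 * √α * ⟪annih (couplB L hε) (toFock u), u.1.1⟫.re := by
  obtain ⟨b, hb⟩ : ∃ b, b = annih (couplB L hε) (toFock u) := ⟨_, rfl⟩
  have h1 : ⟪u.1.1, b⟫.re = ⟪b, u.1.1⟫.re := re_inner_comm _ _
  rw [interaction, ← hb, add_re, re_sum, re_ofReal_mul, Complex.conj_re,
    add_re, h1]
  congr 1
  · refine sum_congr rfl fun j _ => ?_
    rw [sub_re, inner_self_re, inner_self_re, ofReal_re, ofReal_re, kin_apply,
      norm_add_smul_sq, norm_smul, norm_neg, norm_I, one_mul, sq_sqrt hα]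
    ring
  · ring

lemma interaction_aux {r α x p a c N : ℝ} (hr0 : 0 ≤ r) (hr1 : r ≤ 1) (hrr : r * r = α)
    (h4 : a ^ 2 ≤ c * N) (h5 : p ^ 2 ≤ N) (h6 : |x| ≤ p * a) :
    2 * r * |x| + α * a ^ 2 ≤ r * (1 + 2 * c) * N := by
  have h7 : 2 * (p * a) ≤ N + c * N := by nlinarith [sq_nonneg (p - a)]
  have h8 : α ≤ r := by rw [← hrr]; exact mul_le_of_le_one_left hr0 hr1
  have h9 := mul_le_mul h8 h4 (sq_nonneg _) hr0
  have h10 := mul_le_mul_of_nonneg_left (h6.trans (le_refl _)) hr0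
  have h11 := mul_le_mul_of_nonneg_left h7 hr0
  linarith

lemma magnetic_aux {r x p b n B C N : ℝ} (hr0 : 0 ≤ r) (hP : p ^ 2 ≤ C * N) (hun : n ^ 2 ≤ N)
    (h6 : |x| ≤ b * n) (h7 : b ≤ B * p) (hn : 0 ≤ n) : |2 * r * x| ≤ r * (B ^ 2 * C + 1) * N := by
  rw [abs_mul, abs_of_nonneg (by positivity), mul_assoc r, mul_comm 2, mul_assoc]
  refine mul_le_mul_of_nonneg_left ?_ hr0
  have h8 := h6.trans (mul_le_mul_of_nonneg_right h7 hn)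
  have h9 := mul_le_mul_of_nonneg_left hP (sq_nonneg B)
  nlinarith [sq_nonneg (B * p - n)]

lemma interaction_bound :
    ∃ C : ℝ, 0 ≤ C ∧ ∀ α, 0 ≤ α → α ≤ 1 → ∀ u : pfSpace V, |(interaction hε L α u u).re| ≤
      √α * C * (‖pfVal V u‖ ^ 2 + ‖u‖ ^ 2) := by
  obtain ⟨C₁, hC₁, h1⟩ := norm_pullP_sq_le (V := V)
  choose C₂ hC₂ h2 using fun j => norm_fieldA_le (L := L) hε j
  obtain ⟨B, hB⟩ : ∃ B, B = ‖source isWeight_invSqrt L (couplB L hε)‖ := ⟨_, rfl⟩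
  have hB0 : 0 ≤ B := hB ▸ norm_nonneg _
  refine ⟨∑ j, (1 + 2 * (C₂ j * (1 + C₁))) + (B ^ 2 * C₁ + 1), add_nonneg (sum_nonneg fun j _ => by
    have := hC₂ j; positivity) (by positivity), fun α h0 h3 u => ?_⟩
  have hr1 := Real.sqrt_le_one.2 h3
  have hr0 := sqrt_nonneg α
  have hrr := mul_self_sqrt h0
  have e := re_interaction (L := L) hε h0 u
  obtain ⟨Ψ, hΨ⟩ : ∃ Ψ, Ψ = toFock u := ⟨_, rfl⟩
  have hΨ1 : u.1.1 = Ψ.1 := by rw [hΨ]; rfl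
  have hΨn : ‖u‖ = ‖Ψ.1‖ := by rw [← hΨ1]; rfl
  have hP := h1 u
  rw [← hΨ, hΨ1] at e
  rw [← hΨ] at hP
  obtain ⟨N, hN⟩ : ∃ N, N = ‖pfVal V u‖ ^ 2 + ‖u‖ ^ 2 := ⟨_, rfl⟩
  have hun : ‖Ψ.1‖ ^ 2 ≤ N := by
    rw [hN, hΨn]; exact le_add_of_nonneg_left (sq_nonneg _)
  rw [← hN] at hP
  rw [e, ← hN, mul_add, add_mul]
  refine (abs_add_le _ _).trans (add_le_add ?_ ?_)
  · rw [mul_sum, sum_mul]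
    refine (Finset.abs_sum_le_sum_abs _ _).trans (sum_le_sum fun j _ => ?_)
    have h4 : ‖fieldA L hε j Ψ‖ ^ 2 ≤ C₂ j * (1 + C₁) * N := by
      refine (h2 j _).trans ?_
      rw [mul_assoc]
      exact mul_le_mul_of_nonneg_left (by linarith) (hC₂ j)
    have h5 : ‖pfVal V u (some j)‖ ^ 2 ≤ N := (pow_le_pow_left₀ (norm_nonneg _)
      (norm_le_pi_norm _ (some j)) 2).trans (by rw [hN]; exact le_add_of_nonneg_right (sq_nonneg _))
    have h6 := (abs_re_le_norm _).trans (norm_inner_le_norm (𝕜 := ℂ)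
      ((-I) • pfVal V u (some j)) (fieldA L hε j Ψ))
    rw [norm_smul, norm_neg, norm_I, one_mul] at h6
    refine (abs_add_le _ _).trans ?_
    rw [abs_of_nonneg (mul_nonneg h0 (sq_nonneg _)), abs_mul, abs_of_nonneg (by positivity)]
    exact interaction_aux hr0 hr1 hrr h4 h5 h6
  · have h6 := (abs_re_le_norm _).trans (norm_inner_le_norm (𝕜 := ℂ)
      (annih (couplB L hε) Ψ) Ψ.1)
    have h7 := norm_annih_le (couplB L hε) Ψ
    rw [← hB] at h7
    exact magnetic_aux hr0 hP hun h6 h7 (norm_nonneg _)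

/-- The Pauli–Fierz form is closed for small coupling; its ground state energy is the greatest lower
bound of the form. -/
lemma groundEnergy_spec (L : ℝ) (hε : IsPolarization ε) (hne : ∃ u ∈ pfSpace V, u ≠ 0) :
    ∃ α₀ : ℝ, 0 < α₀ ∧ α₀ ≤ 1 ∧ ∀ α, 0 < α → α ≤ α₀ →
      (∀ u : pfSpace V, groundEnergy L ε V α * ‖u‖ ^ 2 ≤ (pauliFierzForm L ε V α u.1 u.1).re) ∧
      ∀ m : ℝ, (∀ u : pfSpace V, m * ‖u‖ ^ 2 ≤ (pauliFierzForm L ε V α u.1 u.1).re) →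
        m ≤ groundEnergy L ε V α := by
  have h0 : ClosedForm (pfSpace V) (fun v u => freeForm V v u) (pfVal V) :=
    (closedForm_param (freeForm V)
      fun _ _ => rfl).restrict stateSpace
  obtain ⟨η, hη, h1⟩ := h0.perturb
  obtain ⟨C, hC, h2⟩ := interaction_bound (L := L) (V := V) hε
  refine ⟨min 1 ((η / (C + 1)) ^ 2), by positivity, min_le_left _ _, fun α h3 h4 => ?_⟩
  have h5 : √α * C ≤ η := by
    have h6 : √α ≤ η / (C + 1) := Real.sqrt_le_iff.2 ⟨by positivity, h4.trans (min_le_right _ _)⟩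
    rw [le_div_iff₀ (by positivity)] at h6
    linarith [sqrt_nonneg α]
  have h7 : ClosedForm (pfSpace V) (pauliFierzForm L ε V α) (pfVal V) := by
    refine h1 _ (interaction hε L α) η (pauliFierzForm_eq hε) (fun v u u' => ?_)
      (fun v u a => ?_) (fun v u => ?_) fun u => ?_
    · simp only [interaction, map_add, Pi.add_apply, inner_add_right, inner_add_left,
        coe_add, sum_add_distrib, sum_sub_distrib]
      ring
    · simp only [interaction, map_smul, Pi.smul_apply, inner_smul_right, inner_smul_left,
        coe_smul, sum_sub_distrib, ← mul_sum, map_add, map_mul,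
        Complex.conj_conj]
      ring
    · simp only [interaction, map_add, map_mul, map_sum, map_sub, inner_conj_symm, conj_ofReal]
      ring
    · refine (h2 α h3.le (h4.trans (min_le_left _ _)) u).trans ?_
      rw [← mul_add]
      exact mul_le_mul_of_nonneg_right h5 (add_nonneg (sq_nonneg _) (sq_nonneg _))
  have h8 := h7.exists_isLeast hne
  rw [coe_pfSpace] at h8
  exact ⟨fun u => h8.1 u.1 u.2, fun m hm => h8.2 m fun u hu => hm ⟨u, hu⟩⟩

lemma integral_fieldEnergy (Ψ : fockDom) :
    ∫ z, fieldEnergy z.2 * ‖Ψ.1 z‖ ^ 2 ∂μₛ = ‖pullP Ψ‖ ^ 2 := by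
  have m : AEMeasurable (fun z => fieldEnergy z.2 * ‖Ψ.1 z‖ ^ 2) μₛ :=
    measurable_fieldEnergy.aemeasurable.mul ((memLp Ψ.1).1.norm.aemeasurable.pow_const 2)
  have h0 : ∀ z : E3 × Config, 0 ≤ fieldEnergy z.2 * ‖Ψ.1 z‖ ^ 2 := fun z =>
    mul_nonneg (fieldEnergy_nonneg z.2) (sq_nonneg _)
  rw [integral_eq_lintegral_of_nonneg_ae (of_forall h0) m.aestronglyMeasurable,
    ← toReal_ofReal (sq_nonneg ‖pullP Ψ‖), norm_pullP_sq]
  congr 1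
  refine lintegral_congr fun z => ?_
  rw [ofReal_mul (fieldEnergy_nonneg _), ofReal_pow (norm_nonneg _), ofReal_norm]

set_option maxHeartbeats 800000 in
/-- The form after integration by parts. -/
lemma re_pauliFierzForm (hα : 0 ≤ α) (u : pfSpace V) : (pauliFierzForm L ε V α u.1 u.1).re =
      ∑ j, (‖pfVal V u (some j)‖ ^ 2 + 4 * √α * ⟪annih (couplA L hε j) (toFock u), (-I) • pfVal V u (some j)⟫.re +
        α * ‖fieldA L hε j (toFock u)‖ ^ 2) +
      2 * √α * ⟪annih (couplB L hε) (toFock u), u.1.1⟫.re +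
      ‖pullP (toFock u)‖ ^ 2 + ∫ z, V z.1 * ‖u.1.1 z‖ ^ 2 ∂μₛ := by
  obtain ⟨Ψ, hΨ⟩ : ∃ Ψ, Ψ = toFock u := ⟨_, rfl⟩
  have hΨ1 : u.1.1 = Ψ.1 := by rw [hΨ]; rfl
  have hsq : ∀ W : E3 × Config → ℝ, (∫ z, (W z : ℂ) * ⟪u.1.1 z, u.1.1 z⟫ ∂μₛ).re =
      ∫ z, W z * ‖u.1.1 z‖ ^ 2 ∂μₛ := fun W => by
    rw [integral_mul_inner_self, ofReal_re]
  have hp : ∀ j, ⟪(-I) • pfVal V u (some j), fieldA L hε j Ψ⟫.re =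
      2 * ⟪annih (couplA L hε j) Ψ, (-I) • pfVal V u (some j)⟫.re -
        ⟪annih (momCoupling j (couplA L hε j)) Ψ, Ψ.1⟫.re := fun j => by
    have h1 := inner_grad_creat (couplA L hε j) Ψ (hΨ1 ▸ pfVal_mem u j)
    change ⟪_, annih (couplA L hε j) Ψ + creat (couplA L hε j) Ψ⟫.re = _
    rw [inner_add_right, add_re, re_inner_comm _ (annih (couplA L hε j) Ψ), inner_smul_left, h1, inner_smul_right]
    simp
    ring
  have ht : ∑ j, ⟪annih (momCoupling j (couplA L hε j)) Ψ, Ψ.1⟫.re = 0 := by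
    rw [← re_sum, ← inner_annih_sum, sum_momCoupling_couplA, inner_annih, map_zero]
    simp
  have hV' := hsq fun z => V z.1
  have hf' := hsq fun z => fieldEnergy z.2
  have e1 := re_interaction (L := L) hε hα u
  have e2 := congrArg Complex.re (freeForm_eq u u)
  rw [add_re, add_re, hf', hV', hΨ1, integral_fieldEnergy, ← hΨ1, re_sum] at e2
  simp only [inner_self_re, ofReal_re] at e2
  rw [← hΨ, hΨ1] at e1
  simp only [hp] at e1
  rw [pauliFierzForm_eq hε, add_re, e1, e2, ← hΨ, hΨ1]
  simp only [Fin.sum_univ_three] at ht ⊢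
  linear_combination (-2 * √α) * ht

end PauliFierzForm

/-! ### The lower bound on the self-energy -/

section LowerBound

variable {L : ℝ} {ε : Fin 2 → E3 → E3}
  (hε : IsPolarization ε)

lemma pull_sq_aux {H : Type*} [NormedAddCommGroup H] [InnerProductSpace ℂ H] (p e : H) {α : ℝ}
    (hα : 0 ≤ α) : ‖p‖ ^ 2 ≤ 2 * ‖p + (√α : ℂ) • e‖ ^ 2 + 2 * α * ‖e‖ ^ 2 := by
  have h := parallelogram_law_with_norm ℂ (p + (√α : ℂ) • e) ((√α : ℂ) • e)
  have h1 : ‖(√α : ℂ) • e‖ ^ 2 = α * ‖e‖ ^ 2 := by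
    rw [norm_smul, norm_real, mul_pow, norm_eq_abs, sq_abs, sq_sqrt hα]
  rw [add_sub_cancel_right] at h
  nlinarith [mul_self_nonneg ‖p + (√α : ℂ) • e + (√α : ℂ) • e‖]

lemma pull_sq_le_aux {p h α e S n : ℝ} (h0 : 0 ≤ α) (hh : 0 ≤ h) (hn : 0 ≤ n)
    (hp : p ^ 2 ≤ 2 * h ^ 2 + 2 * α * e ^ 2) (he : e ^ 2 ≤ (S * n) ^ 2) :
    p ^ 2 ≤ (2 + 2 * S ^ 2) * (h * n + h ^ 2 + α * n ^ 2) := by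
  have h1 := mul_le_mul_of_nonneg_left he h0
  have h2 : 0 ≤ 2 * (h * n) + 2 * α * n ^ 2 + 2 * S ^ 2 * (h * n) + 2 * S ^ 2 * h ^ 2 := by positivity
  linarith

lemma norm_sq_sub_norm_sq_aux {H : Type*} [NormedAddCommGroup H] [InnerProductSpace ℂ H]
    (a c a' c' : H) {A A' p C₁ C₂ C₃ X : ℝ} (ha : ‖a‖ ≤ A * p) (ha' : ‖a'‖ ≤ A' * p)
    (h1 : ‖⟪a, c⟫‖ ≤ C₁ * X) (h2 : ‖⟪a, c'⟫‖ ≤ C₂ * X)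
    (h3 : ‖⟪a', c'⟫‖ ≤ C₃ * X) :
    ‖c‖ ^ 2 - ‖c'‖ ^ 2 - (2 * C₁ + 4 * C₂ + 2 * C₃) * X - (8 * A ^ 2 + 2 * A' ^ 2) * p ^ 2 ≤
      ‖a + c‖ ^ 2 - ‖(a + a) + (a' - c')‖ ^ 2 := by
  have e1 : ‖a + c‖ ^ 2 = ‖a‖ ^ 2 + 2 * ⟪a, c⟫.re + ‖c‖ ^ 2 := norm_add_sq (𝕜 := ℂ) a c
  have e2 : ‖(a + a) + (a' - c')‖ ^ 2 = ‖a + a + a'‖ ^ 2 - 2 * ⟪a + a + a', c'⟫.re +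
      ‖c'‖ ^ 2 := by
    rw [← add_sub_assoc]; exact norm_sub_sq (𝕜 := ℂ) _ _
  rw [inner_add_left, inner_add_left, add_re, add_re] at e2
  have b1 := (abs_le.1 ((abs_re_le_norm _).trans h1)).1
  have b2 := (abs_le.1 ((abs_re_le_norm _).trans h2)).1
  have b3 := (abs_le.1 ((abs_re_le_norm _).trans h3)).1
  have b4 : ‖a + a + a'‖ ≤ 2 * (A * p) + A' * p :=
    (norm_add_le _ _).trans (add_le_add ((norm_add_le _ _).trans (by linarith)) ha')
  have b5 := pow_le_pow_left₀ (norm_nonneg _) b4 2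
  nlinarith [sq_nonneg (2 * (A * p) - A' * p), sq_nonneg ‖a‖]

/-- To leading order, the field fluctuations are given by the creation operators. -/
lemma field_sq_sub_ge (t t' s : couplings L) : ∃ C : ℝ, 0 ≤ C ∧ ∀ (α : ℝ) (Ψ : fockDom),
    0 ≤ α → α ≤ 1 → ‖source isWeight_one L t Ψ.1‖ ^ 2 - ‖source isWeight_one L t' Ψ.1‖ ^ 2 -
      C * (‖pullP Ψ + (√α : ℂ) • source isWeight_invSqrt L s Ψ.1‖ * ‖Ψ.1‖ +
        ‖pullP Ψ + (√α : ℂ) • source isWeight_invSqrt L s Ψ.1‖ ^ 2 + α * ‖Ψ.1‖ ^ 2) ≤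
      ‖annih t Ψ + creat t Ψ‖ ^ 2 -
        ‖(annih t Ψ + annih t Ψ) + (annih t' Ψ - creat t' Ψ)‖ ^ 2 := by
  obtain ⟨C₁, hC₁, h1⟩ := inner_annih_creat_le t t s
  obtain ⟨C₂, hC₂, h2⟩ := inner_annih_creat_le t t' s
  obtain ⟨C₃, hC₃, h3⟩ := inner_annih_creat_le t' t' s
  obtain ⟨D₁, hD₁, k1⟩ := norm_creat_sq t
  obtain ⟨D₂, hD₂, k2⟩ := norm_creat_sq t'
  obtain ⟨A, hA⟩ : ∃ A, A = ‖source isWeight_invSqrt L t‖ := ⟨_, rfl⟩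
  obtain ⟨A', hA'⟩ : ∃ A, A = ‖source isWeight_invSqrt L t'‖ := ⟨_, rfl⟩
  obtain ⟨S, hS⟩ : ∃ A, A = ‖source isWeight_invSqrt L s‖ := ⟨_, rfl⟩
  refine ⟨(2 * C₁ + 4 * C₂ + 2 * C₃) + (8 * A ^ 2 + 2 * A' ^ 2 + D₁ + D₂) * (2 + 2 * S ^ 2),
    by positivity, fun α Ψ h0 h01 => ?_⟩
  have m := norm_sq_sub_norm_sq_aux _ _ _ _ (hA ▸ norm_annih_le t Ψ) (hA' ▸ norm_annih_le t' Ψ)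
    (h1 α Ψ h0 h01) (h2 α Ψ h0 h01) (h3 α Ψ h0 h01)
  have p := pull_sq_aux (pullP Ψ) (source isWeight_invSqrt L s Ψ.1) h0
  have q := (source isWeight_invSqrt L s).le_opNorm Ψ.1
  rw [← hS] at q
  have b1 := (abs_le.1 (k1 Ψ)).1
  have b2 := (abs_le.1 (k2 Ψ)).2
  obtain ⟨h, hh⟩ : ∃ h, h = ‖pullP Ψ + (√α : ℂ) • source isWeight_invSqrt L s Ψ.1‖ := ⟨_, rfl⟩
  rw [← hh] at m p ⊢
  have hh0 : 0 ≤ h := hh ▸ norm_nonneg _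
  have p2 := pull_sq_le_aux h0 hh0 (norm_nonneg Ψ.1) p (pow_le_pow_left₀ (norm_nonneg _) q 2)
  have p3 := mul_le_mul_of_nonneg_left p2
    (by positivity : 0 ≤ 8 * A ^ 2 + 2 * A' ^ 2 + D₁ + D₂)
  linarith

/-- The vacuum fluctuation `∫ |G_j|²` of the vector potential. -/
def fieldVar (L : ℝ) (ε : Fin 2 → E3 → E3) (j : Fin 3) : ℝ :=
  ∫ k, (1 * ‖couplingG L ε j k‖) ^ 2 ∂μₖ

/-- The energy `∫ |k| |τ|²` of the dressing photons. -/
def dressField (L : ℝ) (ε : Fin 2 → E3 → E3) : ℝ :=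
  ∫ k, (invSqrt k * (photonEnergy k * dressNorm L ε k)) ^ 2 ∂μₖ

/-- The recoil energy `∫ k_j² |τ|²` of the dressing photons. -/
def dressRecoil (L : ℝ) (ε : Fin 2 → E3 → E3) (j : Fin 3) : ℝ :=
  ∫ k, (1 * (|k.1 j| * dressNorm L ε k)) ^ 2 ∂μₖ

lemma norm_mulCoupling {m r : Photon → ℝ} (hm : IsCutoffMultiplier L m) {t : couplings L}
    (h : ∀ k s, ‖t.1 k s‖ = r k * ‖s‖) (k : Photon) (s : Spin) :
    ‖(mulCoupling hm t).1 k s‖ = |m k| * r k * ‖s‖ := by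
  change ‖(m k : ℂ) • t.1 k s‖ = _
  rw [norm_smul, norm_real, norm_eq_abs, h, mul_assoc]

lemma norm_source_couplA (j : Fin 3) (Ψ : 𝓗) :
    ‖source isWeight_one L (couplA L hε j) Ψ‖ ^ 2 = fieldVar L ε j * ‖Ψ‖ ^ 2 := by
  have h : ∀ k s, ‖(couplA L hε j).1 k s‖ = ‖couplingG L ε j k‖ * ‖s‖ := fun k s => by
    change ‖couplingG L ε j k • s‖ = _
    exact norm_smul _ s
  exact norm_source_sq isWeight_one (couplA L hε j) h Ψ

lemma norm_source_momCoupling (j : Fin 3) (Ψ : 𝓗) :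
    ‖source isWeight_one L (momCoupling j (dress L hε)) Ψ‖ ^ 2 = dressRecoil L ε j * ‖Ψ‖ ^ 2 :=
  norm_source_sq isWeight_one _ (norm_mulCoupling _ (norm_dress hε)) Ψ

lemma norm_source_energy (Ψ : 𝓗) :
    ‖source isWeight_invSqrt L (mulCoupling (isCutoffMultiplier_energy L) (dress L hε)) Ψ‖ ^ 2 =
      dressField L ε * ‖Ψ‖ ^ 2 := by
  have h := norm_source_sq isWeight_invSqrt _
    (norm_mulCoupling (isCutoffMultiplier_energy L) (norm_dress hε)) Ψ
  simp only [abs_of_nonneg (photonEnergy_nonneg _)] at h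
  exact h

/-- The coefficient of `α` in the self-energy. -/
def selfEnergyCoeff (L : ℝ) (ε : Fin 2 → E3 → E3) : ℝ :=
  ∑ j, (fieldVar L ε j - dressRecoil L ε j) - dressField L ε

lemma magnetic_split (Ψ : fockDom) {g : Fin 3 → 𝓗}
    (hg : ∀ j, (Ψ.1, g j) ∈ gradGraphParam Spin configMeasure j) :
    ⟪annih (couplB L hε) Ψ, Ψ.1⟫.re =
      ⟪pullP Ψ, source isWeight_invSqrt L (mulCoupling (isCutoffMultiplier_energy L) (dress L hε)) Ψ.1⟫.re +
      ∑ j, ⟪(-I) • g j, annih (momCoupling j (dress L hε)) Ψ - creat (momCoupling j (dress L hε)) Ψ⟫.re := by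
  rw [couplB_eq, inner_annih, map_add, add_apply, inner_add_right, ← inner_annih _ _ Ψ.1,
    ← inner_annih _ _ Ψ.1, inner_annih_sum, add_re, inner_annih, re_sum]
  congr 1
  refine sum_congr rfl fun j _ => ?_
  have h1 := inner_grad_creat (momCoupling j (dress L hε)) Ψ (hg j)
  rw [inner_sub_right, sub_re, re_inner_comm _ (annih _ Ψ), inner_smul_left, h1,
    inner_smul_right]
  simp

lemma lower_aux {q h n α c C : ℝ} (hα1 : α * C ≤ 1 / 4)
    (hq : h ^ 2 + α * c * n ^ 2 - α * C * (h * n + h ^ 2 + α * n ^ 2) ≤ q) :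
    (α * c - (C ^ 2 + C) * α ^ 2) * n ^ 2 ≤ q := by
  nlinarith [sq_nonneg (h - 2 * α * C * n), mul_le_mul_of_nonneg_right hα1 (sq_nonneg h), sq_nonneg h]

set_option maxHeartbeats 800000 in
/-- Completing squares in the field energy and in the kinetic energy bounds the form without external
potential from below. -/
lemma form_ge (hε : IsPolarization ε) :
    ∃ C : ℝ, 0 ≤ C ∧ ∀ α, 0 < α → α ≤ 1 → α * C ≤ 1 / 4 → ∀ u : pfSpace 0,
      (α * selfEnergyCoeff L ε - C * (C + 1) * α ^ 2) * ‖u‖ ^ 2 ≤ (pauliFierzForm L ε 0 α u.1 u.1).re := by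
  choose C hC h using fun j => field_sq_sub_ge (couplA L hε j) (momCoupling j (dress L hε))
    (mulCoupling (isCutoffMultiplier_energy L) (dress L hε))
  refine ⟨∑ j, C j, sum_nonneg fun j _ => hC j, fun α hα h1 hαC u => ?_⟩
  have e := re_pauliFierzForm (L := L) (V := 0) hε hα.le u
  obtain ⟨Ψ, hΨ⟩ : ∃ Ψ, Ψ = toFock u := ⟨_, rfl⟩
  have hΨ1 : u.1.1 = Ψ.1 := by rw [hΨ]; rfl
  have hΨn : ‖u‖ = ‖Ψ.1‖ := by rw [← hΨ1]; rfl
  have hm := magnetic_split (L := L) hε Ψ (g := fun j => pfVal 0 u (some j))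
    fun j => hΨ1 ▸ pfVal_mem u j
  rw [← hΨ, hΨ1, hm] at e
  have hz : ∫ z, (0 : E3 → ℝ) z.1 * ‖Ψ.1 z‖ ^ 2 ∂μₛ = 0 := by simp
  rw [hz, add_zero] at e
  obtain ⟨E, hE⟩ : ∃ E, E = source isWeight_invSqrt L (mulCoupling (isCutoffMultiplier_energy L)
    (dress L hε)) Ψ.1 := ⟨_, rfl⟩
  have hE2 : ‖E‖ ^ 2 = dressField L ε * ‖Ψ.1‖ ^ 2 := hE ▸ norm_source_energy hε Ψ.1
  have hh := norm_add_smul_sq (pullP Ψ) E (√α)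
  rw [← hE] at e
  rw [sq_sqrt hα.le, hE2] at hh
  have hj : ∀ j, α * ((fieldVar L ε j - dressRecoil L ε j) * ‖Ψ.1‖ ^ 2 - C j *
      (‖pullP Ψ + (√α : ℂ) • E‖ * ‖Ψ.1‖ + ‖pullP Ψ + (√α : ℂ) • E‖ ^ 2 +
        α * ‖Ψ.1‖ ^ 2)) ≤ ‖pfVal 0 u (some j)‖ ^ 2 + 4 * √α *
      ⟪annih (couplA L hε j) Ψ, (-I) • pfVal 0 u (some j)⟫.re +
      α * ‖fieldA L hε j Ψ‖ ^ 2 + 2 * √α * ⟪(-I) • pfVal 0 u (some j), annih (momCoupling j (dress L hε)) Ψ - creat (momCoupling j (dress L hε)) Ψ⟫.re :=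
    fun j => by
    have b1 := h j α Ψ hα.le h1
    rw [norm_source_couplA, norm_source_momCoupling, ← hE] at b1
    have b2 := norm_add_smul_sq ((-I) • pfVal 0 u (some j))
      ((annih (couplA L hε j) Ψ + annih (couplA L hε j) Ψ) +
        (annih (momCoupling j (dress L hε)) Ψ - creat (momCoupling j (dress L hε)) Ψ)) (√α)
    rw [sq_sqrt hα.le, inner_add_right, inner_add_right, add_re, add_re,
      re_inner_comm _ (annih (couplA L hε j) Ψ), norm_smul, norm_neg, norm_I, one_mul] at b2
    have b3 := mul_le_mul_of_nonneg_left b1 hα.le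
    have b4 : fieldA L hε j Ψ = annih (couplA L hε j) Ψ + creat (couplA L hε j) Ψ := rfl
    rw [b4]
    have b5 := b2 ▸ sq_nonneg ‖((-I) • pfVal 0 u (some j)) + (√α : ℂ) •
      ((annih (couplA L hε j) Ψ + annih (couplA L hε j) Ψ) +
        (annih (momCoupling j (dress L hε)) Ψ - creat (momCoupling j (dress L hε)) Ψ))‖
    linarith
  rw [hΨn, show (∑ j, C j) * (∑ j, C j + 1) = (∑ j, C j) ^ 2 + ∑ j, C j by ring]
  refine lower_aux (h := ‖pullP Ψ + (√α : ℂ) • E‖) hαC ?_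
  have t0 := hj 0
  have t1 := hj 1
  have t2 := hj 2
  rw [e, selfEnergyCoeff]
  simp only [Fin.sum_univ_three]
  linarith

end LowerBound

/-! ### States with at most one photon -/

section Trial

/-- The state `(x, ∅)` without photons. -/
def vac (x : E3) : E3 × Config := (x, ⟨0, Fin.elim0⟩)

/-- The configuration with a single photon. -/
def one (z : E3 × Photon) : E3 × Config := (z.1, ⟨1, fun _ => z.2⟩)

lemma restrict_sector (n : ℕ) : stateMeasure.restrict {z | z.2.1 = n} =
    (vol× (sectorMeasure n)).map (sector n) := by
  refine Measure.ext fun t ht => ?_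
  have hS : MeasurableSet {z : E3 × Config | z.2.1 = n} :=
    measurableSet_eq_fun (measurable_state fun m => measurable_const) measurable_const
  rw [Measure.restrict_apply ht, stateMeasure_eq, Measure.sum_apply _ (ht.inter hS), tsum_eq_single n,
    map_apply (measurableEmbedding_sector n).measurable (ht.inter hS),
    map_apply (measurableEmbedding_sector n).measurable ht]
  · congr 1
    ext z
    exact ⟨fun h => h.1, fun h => ⟨h, rfl⟩⟩
  · intro m hm
    rw [map_apply (measurableEmbedding_sector m).measurable (ht.inter hS)]
    convert measure_empty (μ := (volume : Measure E3).prod (sectorMeasure m))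
    ext z
    exact ⟨fun h => hm h.2, fun h => h.elim⟩

lemma measurable_vac : Measurable vac := measurable_id.prodMk measurable_const

lemma measurable_one : Measurable one :=
  measurable_fst.prodMk ((measurableEmbedding_mk 1).measurable.comp
    (measurable_pi_lambda _ fun _ => measurable_snd))

lemma restrict_vac : stateMeasure.restrict {z | z.2.1 = 0} = volume.map vac := by
  rw [restrict_sector, sectorMeasure, Measure.pi_of_empty _ Fin.elim0, Measure.prod_dirac,
    Measure.map_map (measurableEmbedding_sector 0).measurable (by fun_prop)]
  rfl

lemma measurePreserving_single : MeasurePreserving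
    (fun z : E3 × Photon => (z.1, fun _ : Fin 1 => z.2)) μₚ
    ((volume : Measure E3).prod (sectorMeasure 1)) :=
  (MeasurePreserving.id volume).prod (measurePreserving_funUnique μₖ (Fin 1)).symm

lemma restrict_one : stateMeasure.restrict {z | z.2.1 = 1} = pairMeasure.map one := by
  rw [restrict_sector, ← measurePreserving_single.map_eq, Measure.map_map
    (measurableEmbedding_sector 1).measurable measurePreserving_single.measurable]
  rfl

lemma integral_state {h : E3 × Config → ℝ} (hm : AEStronglyMeasurable h μₛ)
    (h2 : ∀ z, 2 ≤ z.2.1 → h z = 0) (i0 : Integrable (fun x => h (vac x)) volume)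
    (i1 : Integrable (fun z => h (one z)) μₚ) : Integrable h μₛ ∧
    ∫ z, h z ∂μₛ = (∫ x, h (vac x)) + ∫ z, h (one z) ∂μₚ := by
  have hS : ∀ n, MeasurableSet {z : E3 × Config | z.2.1 = n} := fun n =>
    measurableSet_eq_fun (measurable_state fun m => measurable_const) measurable_const
  have e : stateMeasure.restrict ({z | z.2.1 = 0} ∪ {z | z.2.1 = 1}) =
      volume.map vac + pairMeasure.map one := by
    rw [Measure.restrict_union (Set.disjoint_left.2 fun z h h' => by
      change z.2.1 = 0 at h; change z.2.1 = 1 at h'; omega)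
      (hS 1), restrict_vac, restrict_one]
  have h0 : ∀ z, z ∉ ({z | z.2.1 = 0} ∪ {z | z.2.1 = 1} : Set (E3 × Config)) → h z = 0 := fun z hz =>
    h2 z (by change ¬(z.2.1 = 0 ∨ z.2.1 = 1) at hz; omega)
  have m := hm.restrict (s := {z | z.2.1 = 0} ∪ {z | z.2.1 = 1})
  rw [e] at m
  have m0 : AEStronglyMeasurable h (volume.map vac) := m.mono_measure (Measure.le_add_right le_rfl)
  have m1 : AEStronglyMeasurable h (pairMeasure.map one) := m.mono_measure (Measure.le_add_left le_rfl)
  have j0 : Integrable h (volume.map vac) := (integrable_map_measure m0 measurable_vac.aemeasurable).2 i0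
  have j1 : Integrable h (pairMeasure.map one) :=
    (integrable_map_measure m1 measurable_one.aemeasurable).2 i1
  constructor
  · refine (integrableOn_iff_integrable_of_support_subset (f := h)
      (s := {z | z.2.1 = 0} ∪ {z | z.2.1 = 1}) fun z hz => ?_).1 ?_
    · by_contra h'; exact hz (h0 z h')
    · rw [IntegrableOn, e]; exact j0.add_measure j1
  · rw [← setIntegral_eq_integral_of_forall_compl_eq_zero h0, e, integral_add_measure j0 j1,
      integral_map measurable_vac.aemeasurable m0, integral_map measurable_one.aemeasurable m1]

lemma integral_stateP {h : 𝓧 → ℂ}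
    (hm : AEStronglyMeasurable h μₛₖ) (h2 : ∀ w, w.1.2.1 ≠ 0 → h w = 0) :
    ∫ w, h w ∂μₛₖ = ∫ z, h (vac z.1, z.2) ∂μₚ := by
  have e : (μₛₖ).restrict ({z : E3 × Config | z.2.1 = 0} ×ˢ Set.univ) =
      pairMeasure.map (Prod.map vac id) := by
    rw [← Measure.prod_restrict, restrict_vac, Measure.restrict_univ,
      ← Measure.map_prod_map _ _ measurable_vac measurable_id, Measure.map_id]
  have m := hm.restrict (s := {z : E3 × Config | z.2.1 = 0} ×ˢ Set.univ)
  rw [← setIntegral_eq_integral_of_forall_compl_eq_zero (s := {z : E3 × Config | z.2.1 = 0} ×ˢ Set.univ)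
    (fun w hw => h2 w fun h => hw (Set.mk_mem_prod h trivial)), e]
  rw [e] at m
  exact integral_map (measurable_vac.prodMap measurable_id).aemeasurable m

/-- The spinor with the given components. -/
def spinor (a : Fin 2 → ℂ) : Spin := WithLp.toLp 2 a

lemma inner_spinor (a : Fin 2 → ℂ) (v : Spin) :
    ⟪spinor a, v⟫ = ∑ i, ⟪a i, v i⟫ := inner_apply _ _

lemma norm_spinor_sq (a : Fin 2 → ℂ) : ‖spinor a‖ ^ 2 = ∑ i, ‖a i‖ ^ 2 := norm_sq_eq _

lemma spinor_eq (a : Fin 2 → ℂ) : spinor a = a 0 • (single 0 1 : Spin) +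
    a 1 • (single 1 1 : Spin) := by
  rw [spin_eq_sum (spinor a), Fin.sum_univ_two]; rfl

/-- The state with the electron function `f`, spin `s` and no photon, together with the one-photon
component `e^{-ik·x} η`. -/
def trialFun (s : Fin 2) (f : E3 → ℂ) (η : Fin 2 → E3 × Photon → ℂ) : 𝓦
  | (x, ⟨0, _⟩) => f x • single s 1
  | (x, ⟨1, κ⟩) => phase x (κ 0) • spinor fun i => η i (x, κ 0)
  | (_, ⟨_ + 2, _⟩) => 0

lemma trialFun_of_two_le {s : Fin 2} {f : E3 → ℂ} {η : Fin 2 → E3 × Photon → ℂ} {z : E3 × Config}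
    (h : 2 ≤ z.2.1) : trialFun s f η z = 0 := by
  obtain ⟨x, n, κ⟩ := z
  obtain ⟨n, rfl⟩ := Nat.exists_eq_add_of_le' h
  rfl

lemma measurable_trialFun {s : Fin 2} {f : E3 → ℂ} {η : Fin 2 → E3 × Photon → ℂ} (hf : Measurable f)
    (hη : ∀ i, Measurable (η i)) : Measurable (trialFun s f η) := by
  refine measurable_state fun n => ?_
  match n with
  | 0 => exact (hf.comp measurable_fst).smul_const _
  | 1 =>
    have m : Measurable fun z : E3 × (Fin 1 → Photon) => (z.1, z.2 0) :=
      measurable_fst.prodMk ((measurable_pi_apply 0).comp measurable_snd)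
    have hp : Measurable fun z : E3 × (Fin 1 → Photon) => phase z.1 (z.2 0) :=
      measurable_phase.comp (f := fun z : E3 × (Fin 1 → Photon) => (vac z.1, z.2 0))
        ((measurable_vac.comp measurable_fst).prodMk ((measurable_pi_apply 0).comp measurable_snd))
    change Measurable fun z : E3 × (Fin 1 → Photon) => phase z.1 (z.2 0) • spinor _
    simp only [spinor_eq]
    exact hp.smul ((((hη 0).comp m).smul_const _).add (((hη 1).comp m).smul_const _))
  | n + 2 => exact measurable_const

lemma norm_trialFun_vac (s : Fin 2) (f : E3 → ℂ) (η : Fin 2 → E3 × Photon → ℂ) (x : E3) :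
    ‖trialFun s f η (vac x)‖ ^ 2 = ‖f x‖ ^ 2 := by
  change ‖f x • (single s 1 : Spin)‖ ^ 2 = _
  rw [norm_smul, norm_single, norm_one, mul_one]

lemma norm_trialFun_one (s : Fin 2) (f : E3 → ℂ) (η : Fin 2 → E3 × Photon → ℂ) (z : E3 × Photon) :
    ‖trialFun s f η (one z)‖ ^ 2 = ∑ i, ‖η i z‖ ^ 2 := by
  change ‖phase z.1 z.2 • spinor _‖ ^ 2 = _
  rw [norm_smul, norm_phase, one_mul, norm_spinor_sq]

lemma integral_trialFun (s : Fin 2) (f : L2x) (η : Fin 2 → L2pair) {W : E3 × Config → ℝ}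
    (hW : Measurable W) (i0 : Integrable (fun x => W (vac x) * ‖f x‖ ^ 2) volume)
    (i1 : ∀ i, Integrable (fun z => W (one z) * ‖η i z‖ ^ 2) μₚ) :
    Integrable (fun z => W z * ‖trialFun s f (fun i => η i) z‖ ^ 2) μₛ ∧
    ∫ z, W z * ‖trialFun s f (fun i => η i) z‖ ^ 2 ∂μₛ =
      (∫ x, W (vac x) * ‖f x‖ ^ 2) + ∑ i, ∫ z, W (one z) * ‖η i z‖ ^ 2 ∂μₚ := by
  have m : Measurable fun z => W z * ‖trialFun s f (fun i => η i) z‖ ^ 2 :=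
    hW.mul ((measurable_trialFun (Lp.stronglyMeasurable f).measurable fun i =>
      (Lp.stronglyMeasurable (η i)).measurable).norm.pow_const 2)
  have h := integral_state m.aestronglyMeasurable (fun z hz => by
    rw [trialFun_of_two_le hz, norm_zero, zero_pow two_ne_zero, mul_zero])
    (by simp only [norm_trialFun_vac]; exact i0)
    (by simp only [norm_trialFun_one, mul_sum]; exact integrable_finsetSum _ fun i _ => i1 i)
  simp only [norm_trialFun_vac, norm_trialFun_one, mul_sum] at h
  rwa [integral_finsetSum _ fun i _ => i1 i] at h

lemma memLp_trialFun (s : Fin 2) (f : L2x) (η : Fin 2 → L2pair) :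
    MemLp (trialFun s f fun i => η i) 2 μₛ := by
  have m := measurable_trialFun (s := s) (Lp.stronglyMeasurable f).measurable fun i =>
    (Lp.stronglyMeasurable (η i)).measurable
  rw [memLp_two_iff_integrable_sq_norm m.aestronglyMeasurable]
  have h := (integral_trialFun s f η (W := fun _ => 1) measurable_const
    (by simpa using (memLp f).integrable_norm_pow two_ne_zero) fun i => by
    simpa using (memLp (η i)).integrable_norm_pow two_ne_zero).1
  simpa using h

/-- The element of `L²` given by `trialFun`. -/
def trial (s : Fin 2) (f : L2x) (η : Fin 2 → L2pair) : 𝓗 :=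
  (memLp_trialFun s f η).toLp

lemma coeFn_trial (s : Fin 2) (f : L2x) (η : Fin 2 → L2pair) :
    trial s f η =ᵐ[μₛ] trialFun s f fun i => η i := (memLp_trialFun s f η).coeFn_toLp

lemma integral_trial (s : Fin 2) (f : L2x) (η : Fin 2 → L2pair) {W : E3 × Config → ℝ}
    (hW : Measurable W) (i0 : Integrable (fun x => W (vac x) * ‖f x‖ ^ 2) volume)
    (i1 : ∀ i, Integrable (fun z => W (one z) * ‖η i z‖ ^ 2) μₚ) :
    Integrable (fun z => W z * ‖trial s f η z‖ ^ 2) μₛ ∧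
    ∫ z, W z * ‖trial s f η z‖ ^ 2 ∂μₛ =
      (∫ x, W (vac x) * ‖f x‖ ^ 2) + ∑ i, ∫ z, W (one z) * ‖η i z‖ ^ 2 ∂μₚ := by
  have h := integral_trialFun s f η hW i0 i1
  have e : (fun z => W z * ‖trial s f η z‖ ^ 2) =ᵐ[μₛ]
      fun z => W z * ‖trialFun s f (fun i => η i) z‖ ^ 2 := by
    filter_upwards [coeFn_trial s f η] with z hz
    rw [hz]
  exact ⟨h.1.congr e.symm, (integral_congr_ae e).trans h.2⟩

lemma norm_trial_sq (s : Fin 2) (f : L2x) (η : Fin 2 → L2pair) :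
    ‖trial s f η‖ ^ 2 = ‖f‖ ^ 2 + ∑ i, ‖η i‖ ^ 2 := by
  have h := (integral_trial s f η (W := fun _ => 1) measurable_const
    (by simpa using (memLp f).integrable_norm_pow two_ne_zero) fun i => by
    simpa using (memLp (η i)).integrable_norm_pow two_ne_zero).2
  simp only [one_mul] at h
  simp only [norm_sq_eq_integral, h]

lemma trial_mem (s : Fin 2) (f : L2x) (η : Fin 2 → L2pair) : trial s f η ∈ stateSpace := by
  refine ⟨_, fun x n κ π => ?_, coeFn_trial s f η⟩
  match n with
  | 0 => rfl
  | 1 => rw [Subsingleton.elim π 1]; rfl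
  | n + 2 => rfl

/-- The momentum of the electron in a state with one photon is shifted by the photon momentum. -/
lemma trial_mem_gradGraph {j : Fin 3} (s : Fin 2) {f f' : L2x} {η g ζ : Fin 2 → L2pair}
    (hf : (f, f') ∈ gradGraph j) (hη : ∀ i, (η i, g i) ∈ gradGraphParam ℂ μₖ j)
    (hζ : ∀ i, ζ i =ᵐ[μₚ] fun z => g i z + (-I * (z.2.1 j : ℂ)) * η i z) :
    (trial s f η, trial s f' ζ) ∈ gradGraphParam Spin configMeasure j := by
  refine ⟨memLp _, ?_⟩
  let T : Fin 2 → ℂ →L[ℝ] Spin := fun i =>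
    (ContinuousLinearMap.toSpanSingleton ℂ (single i 1 : Spin)).restrictScalars ℝ
  have h1 : ∀ᵐ γ ∂configMeasure, IsWeakPartial j (fun x => trialFun s f (fun i => η i) (x, γ))
      fun x => trialFun s f' (fun i => ζ i) (x, γ) := by
    refine ae_config.2 fun n => ?_
    match n with
    | 0 =>
      exact of_forall fun κ => hf.2.clm (T s)
        ((memLp f).locallyIntegrable one_le_two) ((memLp f').locallyIntegrable one_le_two)
    | 1 =>
      have h2 : ∀ᵐ k ∂μₖ, ∀ i, IsWeakPartial j (fun x => η i (x, k)) (fun x => g i (x, k)) ∧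
          MemLp (fun x => η i (x, k)) 2 volume ∧ MemLp (fun x => g i (x, k)) 2 volume ∧
          ∀ᵐ x : E3, ζ i (x, k) = g i (x, k) + (-I * (k.1 j : ℂ)) * η i (x, k) := by
        refine ae_all_iff.2 fun i => ?_
        filter_upwards [(hη i).2, ae_memLp_fiber (memLp (η i)), ae_memLp_fiber (memLp (g i)),
          ae_fiber (hζ i)] with k a b c d
        exact ⟨a, b, c, d⟩
      filter_upwards [(measurePreserving_funUnique μₖ (Fin 1)).quasiMeasurePreserving.ae h2]
        with κ h
      have e : (MeasurableEquiv.funUnique (Fin 1) Photon) κ = κ 0 := rfl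
      rw [e] at h
      have w : ∀ i, IsWeakPartial j (fun x => T i (η i (x, κ 0))) fun x => T i (g i (x, κ 0)) := fun i =>
        (h i).1.clm (T i) ((h i).2.1.locallyIntegrable one_le_two)
          ((h i).2.2.1.locallyIntegrable one_le_two)
      have mT : ∀ i {u : E3 → ℂ}, MemLp u 2 volume → MemLp (fun x => T i (u x)) 2 volume := fun i u hu =>
        (T i).comp_memLp' hu
      have l : ∀ {u : E3 → Spin}, MemLp u 2 volume → LocallyIntegrable u := fun hu =>
        hu.locallyIntegrable one_le_two
      have w2 := (w 0).add (w 1) (l (mT 0 (h 0).2.1)) (l (mT 1 (h 1).2.1)) (l (mT 0 (h 0).2.2.1))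
        (l (mT 1 (h 1).2.2.1))
      refine (w2.phase ((mT 0 (h 0).2.1).add (mT 1 (h 1).2.1))
        ((mT 0 (h 0).2.2.1).add (mT 1 (h 1).2.2.1)) (κ 0)).congr
        (of_forall fun x => ?_) ?_
      · change _ = phase x (κ 0) • spinor _
        rw [spinor_eq]; rfl
      · filter_upwards [(h 0).2.2.2, (h 1).2.2.2] with x a b
        change _ = phase x (κ 0) • spinor _
        rw [spinor_eq]
        simp only [a, b, T, ContinuousLinearMap.coe_restrictScalars', ContinuousLinearMap.toSpanSingleton_apply]
        module
    | n + 2 =>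
      refine of_forall fun κ θ _ _ => ?_
      simp [trialFun]
  filter_upwards [h1, ae_fiber (coeFn_trial s f η), ae_fiber (coeFn_trial s f' ζ)] with γ a b c
  exact a.congr (b.mono fun _ h => h.symm) (c.mono fun _ h => h.symm)

/-- Annihilation of the photon of a state with at most one photon. -/
lemma inner_annih_trial {L : ℝ} (t : couplings L) {Ψ : fockDom} {s : Fin 2} {f : L2x}
    {η : Fin 2 → L2pair} (hΨ : Ψ.1 = trial s f η) {Φ : 𝓗} {G : 𝓦}
    (hG : Φ =ᵐ[μₛ] G) : ⟪annih t Ψ, Φ⟫ =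
      ∫ z, ∑ i, ⟪η i z, t.1 z.2 (G (vac z.1)) i⟫ ∂μₚ := by
  obtain ⟨h1, h2⟩ := inner_annih_eq_integral t Ψ Φ
  have e : (fun w => ⟪pull Ψ.1 w, src (fun _ => 1) t Φ w⟫)
      =ᵐ[μₛₖ] fun w =>
        ⟪pull (trialFun s f fun i => η i) w, src (fun _ => 1) t G w⟫ := by
    filter_upwards [pull_congr (hΨ ▸ coeFn_trial s f η), src_congr (fun _ => 1) t.1 hG] with w a b
    rw [a, b]
  rw [h2, integral_congr_ae e, integral_stateP (h1.congr e).1]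
  · refine integral_congr_ae (of_forall fun z => ?_)
    have e1 : pull (trialFun s f fun i => η i) (vac z.1, z.2) =
        phase z.1 z.2 • spinor fun i => η i z := by
      change ((√((0 : ℕ) + 1) : ℝ) : ℂ) • (phase z.1 z.2 • spinor fun i => η i z) = _
      simp
    simp only [e1]
    rw [src, inner_smul_left, inner_smul_right, ← mul_assoc, ofReal_one, one_mul]
    change (starRingEnd ℂ) (phase z.1 z.2) * phase z.1 z.2 * _ = _
    rw [conj_phase_mul, one_mul, inner_spinor]
  · intro w hw
    have e1 : pull (trialFun s f fun i => η i) w = 0 := by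
      rw [pull, trialFun_of_two_le, smul_zero]
      change 2 ≤ w.1.2.1 + 1
      omega
    simp only [e1, inner_zero_left]

end Trial

/-! ### The energy of states with at most one photon -/

section TrialEnergy

variable {L : ℝ} {ε : Fin 2 → E3 → E3} {V : E3 → ℝ} [hV : RegularPotential V] {e₀ α : ℝ} [he₀ : Fact (0 < e₀)] {φ : L2x}
  (hL : 0 < L) (hε : IsPolarization ε) (hφ : IsGroundState V φ e₀)

lemma sum_coord_sq (k : E3) : ∑ j, k j ^ 2 = ‖k‖ ^ 2 := by
  rw [norm_sq_eq]; simp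

lemma integrable_coord_sq (u : avSpace V e₀) (j : Fin 3) :
    Integrable (fun z : E3 × Photon => z.2.1 j ^ 2 * ‖u.1 z‖ ^ 2) μₚ := by
  have m : Measurable fun z : E3 × Photon => z.2.1 j :=
    (proj (𝕜 := ℝ) j : E3 →L[ℝ] ℝ).measurable.comp (measurable_fst.comp measurable_snd)
  refine (integrable_recoil_sq u).mono' ((m.pow_const 2).aestronglyMeasurable.mul
    ((memLp u.1).1.norm.pow 2)) (of_forall fun z => ?_)
  rw [norm_of_nonneg (by positivity)]
  refine mul_le_mul_of_nonneg_right ?_ (sq_nonneg _)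
  rw [recoilEnergy, ← sum_coord_sq]
  exact (single_le_sum (f := fun j => z.2.1 j ^ 2) (fun i _ => sq_nonneg _)
    (mem_univ j)).trans (le_add_of_nonneg_right (norm_nonneg _))

lemma memLp_mom (u : avSpace V e₀) (j : Fin 3) :
    MemLp (fun z : E3 × Photon => (z.2.1 j : ℂ) • u.1 z) 2 μₚ := by
  have m : Measurable fun z : E3 × Photon => (z.2.1 j : ℂ) := measurable_ofReal.comp
    ((proj (𝕜 := ℝ) j : E3 →L[ℝ] ℝ).measurable.comp (measurable_fst.comp measurable_snd))
  refine (memLp_two_iff_integrable_sq_norm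
    (m.aestronglyMeasurable.smul (memLp u.1).1)).2 ?_
  refine (integrable_coord_sq u j).congr (of_forall fun z => ?_)
  change _ = ‖(z.2.1 j : ℂ) • u.1 z‖ ^ 2
  rw [norm_smul, norm_real, mul_pow, norm_eq_abs, sq_abs]

/-- Multiplication by the photon momentum `k_j`. -/
def momLp (j : Fin 3) :
    avSpace V e₀ →ₗ[ℂ] L2pair where
  toFun u := (memLp_mom u j).toLp
  map_add' u v := by
    rw [← MemLp.toLp_add]
    refine MemLp.toLp_congr _ _ ?_
    filter_upwards [coeFn_add u.1 v] with z h
    simp only [coe_add, h, Pi.add_apply, smul_add]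
  map_smul' a u := by
    rw [RingHom.id_apply, ← MemLp.toLp_const_smul]
    refine MemLp.toLp_congr _ _ ?_
    filter_upwards [coeFn_smul a u.1] with z h
    simp only [coe_smul, h, Pi.smul_apply, smul_comm a]

lemma coeFn_momLp (j : Fin 3)
    (u : avSpace V e₀) : momLp j u =ᵐ[μₚ] fun z => (z.2.1 j : ℂ) • u.1 z :=
  (memLp_mom u j).coeFn_toLp

lemma integrable_photonEnergy_sq (u : avSpace V e₀) :
    Integrable (fun z => photonEnergy z.2 * ‖u.1 z‖ ^ 2) μₚ := by
  refine (integrable_recoil_sq u).mono' ((measurable_photonEnergy.comp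
    measurable_snd).aestronglyMeasurable.mul ((memLp u.1).1.norm.pow 2))
    (of_forall fun z => ?_)
  rw [norm_of_nonneg (mul_nonneg (photonEnergy_nonneg _) (sq_nonneg _))]
  exact mul_le_mul_of_nonneg_right (le_add_of_nonneg_left (sq_nonneg _)) (sq_nonneg _)

lemma integral_recoil_eq (u : avSpace V e₀) : ∫ z, recoilEnergy z.2 * ‖u.1 z‖ ^ 2 ∂μₚ =
      ∑ j, ‖momLp j u‖ ^ 2 + ∫ z, photonEnergy z.2 * ‖u.1 z‖ ^ 2 ∂μₚ := by
  have h : ∀ j, ‖momLp j u‖ ^ 2 =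
      ∫ z : E3 × Photon, z.2.1 j ^ 2 * ‖u.1 z‖ ^ 2 ∂μₚ := fun j => by
    rw [norm_sq_eq_integral]
    refine integral_congr_ae ?_
    filter_upwards [coeFn_momLp j u] with z hz
    rw [hz, norm_smul, norm_real, mul_pow, norm_eq_abs, sq_abs]
  simp only [h]
  rw [← integral_finsetSum _ fun j _ => integrable_coord_sq u j,
    ← integral_add (integrable_finsetSum _ fun j _ => integrable_coord_sq u j)
      (integrable_photonEnergy_sq u)]
  refine integral_congr_ae (of_forall fun z => ?_)
  simp only [recoilEnergy, photonEnergy, ← sum_mul, sum_coord_sq, add_mul]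

/-- The electron gradient of the one-photon component, shifted by the photon momentum. -/
def shiftGrad
    (η : Fin 2 → avSpace V e₀) (j : Fin 3) (i : Fin 2) : L2pair :=
  avVal V e₀ (η i) (some j) + (-I) • momLp j (η i)

lemma trial_grad (s : Fin 2)
    (f : schrSpace V) (η : Fin 2 → avSpace V e₀) (j : Fin 3) :
    (trial s f fun i => η i, trial s (schrVal V f (some j)) (shiftGrad η j)) ∈
      gradGraphParam Spin configMeasure j := by
  refine trial_mem_gradGraph s (schrVal_mem f j) (fun i => paramVal_mem (η i) j) fun i => ?_
  filter_upwards [coeFn_add (avVal V e₀ (η i) (some j)) ((-I) • momLp j (η i)),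
    coeFn_smul (-I) (momLp j (η i)), coeFn_momLp j (η i)] with z a b c
  rw [shiftGrad, a, Pi.add_apply, b, Pi.smul_apply, c, smul_eq_mul, smul_eq_mul, mul_assoc]

lemma integrable_V_trial (f : schrSpace V) :
    Integrable (fun x => V x * ‖f.1 x‖ ^ 2) volume := by
  obtain ⟨C, hC, hb⟩ := negFormBound_schrodinger (V := V) one_pos
  exact integrable_of_mem_opDomain isClosedOp_gradGraph hV.meas.aemeasurable hb f

lemma trial_V (s : Fin 2)
    (f : schrSpace V) (η : Fin 2 → avSpace V e₀) :
    Integrable (fun z => V z.1 * ‖trial s f (fun i => η i) z‖ ^ 2) μₛ ∧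
    ∫ z, V z.1 * ‖trial s f (fun i => η i) z‖ ^ 2 ∂μₛ =
      (∫ x, V x * ‖f.1 x‖ ^ 2) + ∑ i, ∫ z, V z.1 * ‖(η i).1 z‖ ^ 2 ∂μₚ :=
  integral_trial s f (fun i => η i) (W := fun z => V z.1) (hV.meas.comp measurable_fst)
    (integrable_V_trial f) fun i =>
      integrable_V_sq (η i).2

lemma trial_energy (s : Fin 2)
    (f : schrSpace V) (η : Fin 2 → avSpace V e₀) :
    Integrable (fun z => fieldEnergy z.2 * ‖trial s f (fun i => η i) z‖ ^ 2) μₛ ∧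
    ∫ z, fieldEnergy z.2 * ‖trial s f (fun i => η i) z‖ ^ 2 ∂μₛ =
      ∑ i, ∫ z, photonEnergy z.2 * ‖(η i).1 z‖ ^ 2 ∂μₚ := by
  have e0 : ∀ x, fieldEnergy (vac x).2 = 0 := fun x => Finset.sum_empty
  have e1 : ∀ z, fieldEnergy (one z).2 = photonEnergy z.2 := fun z => Finset.sum_singleton _ _
  have h := integral_trial s f (fun i => η i) (W := fun z => fieldEnergy z.2) measurable_fieldEnergy
    (by simp only [e0, zero_mul]; exact integrable_zero _ _ _) fun i => by
      simp only [e1]; exact integrable_photonEnergy_sq (η i)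
  simpa only [e0, e1, zero_mul, integral_zero, zero_add] using h

lemma lintegral_ne_top_of_integrable {W : E3 × Config → ℝ} {u : 𝓗}
    (h : Integrable (fun z => W z * ‖u z‖ ^ 2) μₛ) :
    ∫⁻ z, ofReal (W z) * ‖u z‖ₑ ^ 2 ∂μₛ ≠ ⊤ := by
  have h1 := h.lintegral_lt_top.ne
  simp only [ENNReal.ofReal_mul' (sq_nonneg _), ofReal_pow (norm_nonneg _), ofReal_norm] at h1
  exact h1

/-- The trial state as an element of the form domain. -/
def trialState (s : Fin 2)
    (f : schrSpace V) (η : Fin 2 → avSpace V e₀) : pfSpace V :=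
  ⟨⟨_, trial_mem s f fun i => η i⟩, mem_pfSpace.2
    ⟨fun j => ⟨_, trial_grad s f η j⟩,
      lintegral_ne_top_of_integrable (trial_energy s f η).1,
      lintegral_ne_top_of_integrable (trial_V s f η).1⟩⟩

lemma pfVal_trialState (s : Fin 2)
    (f : schrSpace V) (η : Fin 2 → avSpace V e₀) (j : Fin 3) :
    pfVal V (trialState s f η) (some j) =
      trial s (schrVal V f (some j)) (shiftGrad η j) :=
  Lp.ext ((partialParam_ae_eq (pfVal_mem _ j)).symm.trans
    (partialParam_ae_eq (trial_grad s f η j)))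

/-- The matrix entries of a coupling. -/
def entry (t : couplings L) (i s : Fin 2) (k : Photon) : ℂ := t.1 k (single s 1) i

lemma measurable_entry (t : couplings L) (i s : Fin 2) : Measurable (entry t i s) :=
  (proj (𝕜 := ℂ) i : Spin →L[ℂ] ℂ).measurable.comp (t.2.1 _)

lemma exists_norm_entry_le (t : couplings L) (i s : Fin 2) :
    ∃ K : ℝ, ∀ k, ‖entry t i s k‖ ≤ K * cutoffBound L k := by
  obtain ⟨K, -, hK⟩ := t.2.2
  refine ⟨K, fun k => (norm_apply_le (t.1 k (single s 1) : Spin) i).trans ?_⟩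
  refine ((t.1 k).le_opNorm _).trans ?_
  rw [norm_single, norm_one, mul_one]
  exact hK k

lemma memLp_entry (hL : 0 < L) (t : couplings L) (i s : Fin 2) : MemLp (entry t i s) 2 μₖ :=
  memLp_of_le_cutoffBound hL (measurable_entry t i s).aestronglyMeasurable
    (exists_norm_entry_le t i s).choose_spec

lemma inner_annih_couplA {Ψ : fockDom} {s : Fin 2} {f : L2x} {η : Fin 2 → L2pair}
    {ζ : Fin 3 → Fin 2 → L2pair} (hΨ : Ψ.1 = trial s f η) :
    ∑ j, ⟪annih (couplA L hε j) Ψ, (-I) • trial s (hφ.grad j) (ζ j)⟫ =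
      ⟪η s, dStarLp hL hε hφ⟫ := by
  rw [dStarLp, inner_sum]
  refine sum_congr rfl fun j _ => ?_
  rw [inner_annih_trial (couplA L hε j) hΨ ((coeFn_smul (-I) _).trans
    ((coeFn_trial s _ (ζ j)).const_smul _)), L2.inner_def]
  refine integral_congr_ae ?_
  filter_upwards [coeFn_tensLp (memLp_couplingG hL hε j) ((-I) • hφ.grad j),
    quasiMeasurePreserving_fst.ae
      (coeFn_smul (-I) (hφ.grad j))] with z a b
  rw [a, b]
  change ∑ i, ⟪η i z, (couplingG L ε j z.2 • (-I) • (hφ.grad j z.1 • (single s 1 : Spin))) i⟫ = _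
  rw [Finset.sum_eq_single s (fun i _ hi => by simp [hi]) (by simp)]
  simp

lemma inner_annih_eq_entry (t : couplings L) {Ψ : fockDom} {s : Fin 2} {f : L2x}
    {η : Fin 2 → L2pair} (hΨ : Ψ.1 = trial s f η) :
    ⟪annih t Ψ, Ψ.1⟫ = ∑ i, ⟪η i, tensLp _ (memLp_entry hL t i s) f⟫ := by
  rw [inner_annih_trial t hΨ (hΨ ▸ coeFn_trial s f η)]
  simp only [L2.inner_def]
  rw [← integral_finsetSum _ fun i _ => L2.integrable_inner _ _]
  refine integral_congr_ae ?_
  filter_upwards [ae_all_iff.2 fun i => coeFn_tensLp (memLp_entry hL t i s) f] with z a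
  refine sum_congr rfl fun i _ => ?_
  rw [a]
  change ⟪η i z, t.1 z.2 (f z.1 • (single s 1 : Spin)) i⟫ = _
  rw [map_smul, mul_comm]
  rfl

/-- The field fluctuations in states with at most one photon. -/
lemma norm_fieldA_trial_le (j : Fin 3) : ∃ C : ℝ, 0 ≤ C ∧
    ∀ (Ψ : fockDom) (s : Fin 2) (f : L2x) (η : Fin 2 → L2pair), Ψ.1 = trial s f η →
      ‖fieldA L hε j Ψ‖ ^ 2 ≤ fieldVar L ε j * ‖Ψ.1‖ ^ 2 + C * ‖pullP Ψ‖ ^ 2 := by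
  obtain ⟨D, hD, h⟩ := norm_creat_sq (couplA L hε j)
  obtain ⟨A, hA⟩ : ∃ A, A = ‖source isWeight_invSqrt L (couplA L hε j)‖ := ⟨_, rfl⟩
  refine ⟨D + A ^ 2, by positivity, fun Ψ s f η hΨ => ?_⟩
  have h1 := (abs_le.1 (h Ψ)).2
  have h2 := pow_le_pow_left₀ (norm_nonneg _) (norm_annih_le (couplA L hε j) Ψ) 2
  rw [norm_source_couplA] at h1
  rw [← hA, mul_pow] at h2
  have h3 : ⟪annih (couplA L hε j) Ψ, creat (couplA L hε j) Ψ⟫ = 0 := by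
    rw [inner_annih_trial _ hΨ (coeFn_creat (couplA L hε j) Ψ)]
    refine (integral_congr_ae (of_forall fun z => ?_)).trans (integral_zero _ _)
    change ∑ i, ⟪η i z, (couplA L hε j).1 z.2 (0 : Spin) i⟫ = 0
    simp only [map_zero, PiLp.zero_apply, inner_zero_right, Finset.sum_const_zero]
  have h4 : ‖fieldA L hε j Ψ‖ ^ 2 = ‖annih (couplA L hε j) Ψ‖ ^ 2 +
      2 * ⟪annih (couplA L hε j) Ψ, creat (couplA L hε j) Ψ⟫.re +
      ‖creat (couplA L hε j) Ψ‖ ^ 2 := norm_add_sq (𝕜 := ℂ) _ _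
  rw [h3, zero_re] at h4
  linarith

/-- The recoil of the electron against the photon, averaged to zero over the directions. -/
def recoilForm (v u : avSpace V e₀) : ℂ :=
  ∑ j, ⟪avVal V e₀ v (some j), (-I) • momLp j u⟫

lemma IsGroundState.energy_eq :
    ∑ j, ‖hφ.grad j‖ ^ 2 + ∫ x, V x * ‖φ x‖ ^ 2 = -e₀ := by
  have h1 := congrArg Complex.re (hφ.form_eq ⟨φ, hφ.mem⟩)
  rw [schrodingerForm_eq' ⟨φ, hφ.mem⟩ ⟨φ, hφ.mem⟩, add_re, re_sum] at h1
  rw [integral_mul_inner_self] at h1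
  simp only [inner_self_re, ofReal_re, hφ.1] at h1
  rw [h1]; simp

set_option maxHeartbeats 800000 in
/-- The energy of the trial state. -/
lemma form_trialState_le :
    ∃ C : ℝ, 0 ≤ C ∧ ∀ (α : ℝ) (s : Fin 2) (η : Fin 2 → avSpace V e₀), 0 ≤ α →
      (pauliFierzForm L ε V α (trialState s ⟨φ, hφ.mem⟩ η).1
        (trialState s ⟨φ, hφ.mem⟩ η).1).re +
          e₀ * ‖trialState s ⟨φ, hφ.mem⟩ η‖ ^ 2 ≤
      ∑ i, ((1 + α * C) * (avForm V e₀ (η i) (η i)).re + 2 * (recoilForm (η i) (η i)).re) +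
      4 * √α * ⟪(η s).1, dStarLp hL hε hφ⟫.re +
      2 * √α * ∑ i, ⟪(η i).1, tensLp _ (memLp_entry hL (couplB L hε) i s) φ⟫.re +
      α * (∑ j, fieldVar L ε j) * (1 + ∑ i, ‖(η i).1‖ ^ 2) := by
  choose C hC h using fun j => norm_fieldA_trial_le (L := L) hε j
  refine ⟨∑ j, C j, sum_nonneg fun j _ => hC j, fun α s η hα => ?_⟩
  obtain ⟨Θ, hΘ⟩ : ∃ Θ, Θ = trialState s ⟨φ, hφ.mem⟩ η := ⟨_, rfl⟩
  have hΘ1 : Θ.1.1 = trial s φ fun i => η i := by rw [hΘ]; rfl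
  have e := re_pauliFierzForm (L := L) hε hα Θ
  obtain ⟨Ψ, hΨ⟩ : ∃ Ψ, Ψ = toFock Θ := ⟨_, rfl⟩
  have hΨ1 : Ψ.1 = trial s φ fun i => η i := by rw [hΨ, ← hΘ1]; rfl
  have hn : ‖Θ‖ ^ 2 = 1 + ∑ i, ‖(η i).1‖ ^ 2 := by
    have h1 : ‖Θ‖ = ‖Θ.1.1‖ := rfl
    rw [h1, hΘ1, norm_trial_sq, hφ.1, one_pow]
  have hg : ∀ j, pfVal V Θ (some j) =
    trial s (hφ.grad j) (shiftGrad η j) := fun j => by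
    rw [hΘ]; exact pfVal_trialState s _ η j
  have hA := congrArg Complex.re (inner_annih_couplA (ζ := shiftGrad η) hL hε hφ hΨ1)
  have hB := congrArg Complex.re (inner_annih_eq_entry hL (couplB L hε) hΨ1)
  have hP : ‖pullP Ψ‖ ^ 2 = ∑ i, ∫ z, photonEnergy z.2 * ‖(η i).1 z‖ ^ 2 ∂μₚ := by
    rw [← integral_fieldEnergy, hΨ1]; exact (trial_energy s ⟨φ, hφ.mem⟩ η).2
  have hW := (trial_V s ⟨φ, hφ.mem⟩ η).2
  have hK : ∀ j, ‖pfVal V Θ (some j)‖ ^ 2 = ‖hφ.grad j‖ ^ 2 + ∑ i,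
      (‖avVal V e₀ (η i) (some j)‖ ^ 2 + 2 * ⟪avVal V e₀ (η i) (some j), (-I) • momLp j (η i)⟫.re + ‖momLp j (η i)‖ ^ 2) := fun j => by
    rw [hg, norm_trial_sq]
    congr 1
    refine sum_congr rfl fun i _ => ?_
    rw [shiftGrad, norm_add_sq (𝕜 := ℂ), norm_smul, norm_neg, norm_I, one_mul]
    rfl
  have hav : ∀ i, (avForm V e₀ (η i) (η i)).re = ∑ j, ‖avVal V e₀ (η i) (some j)‖ ^ 2 +
      ∫ z, V z.1 * ‖(η i).1 z‖ ^ 2 ∂μₚ + e₀ * ‖(η i).1‖ ^ 2 +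
      (∑ j, ‖momLp j (η i)‖ ^ 2 +
        ∫ z, photonEnergy z.2 * ‖(η i).1 z‖ ^ 2 ∂μₚ) := fun i => by
    rw [avForm_eq, add_re, re_electronForm_self, re_integral_recoil,
      integral_recoil_eq]
  have hge : ‖pullP Ψ‖ ^ 2 ≤ ∑ i, (avForm V e₀ (η i) (η i)).re := by
    rw [hP]
    refine sum_le_sum fun i _ => ?_
    refine le_trans ?_ (avForm_ge hφ (η i))
    rw [integral_recoil_eq]
    exact le_add_of_nonneg_left (sum_nonneg fun j _ => sq_nonneg _)
  have hgs := hφ.energy_eq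
  have hF : ∀ j, α * ‖fieldA L hε j Ψ‖ ^ 2 ≤ α * (fieldVar L ε j * ‖Θ‖ ^ 2 +
      C j * ∑ i, (avForm V e₀ (η i) (η i)).re) := fun j => by
    have h1 : ‖Θ‖ = ‖Ψ.1‖ := by rw [hΨ]; rfl
    refine mul_le_mul_of_nonneg_left ((h j Ψ s φ _ hΨ1).trans ?_) hα
    rw [h1]
    exact add_le_add le_rfl (mul_le_mul_of_nonneg_left hge (hC j))
  have f0 := hF 0
  have f1 := hF 1
  have f2 := hF 2
  simp only [← hg] at hA
  rw [hΨ1, ← hΘ1] at hB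
  rw [← hΨ, hB, hΘ1, hW, hP] at e
  simp only [hK] at e
  rw [← hΘ, e, hn]
  rw [hn] at f0 f1 f2
  have a0 := hav 0
  have a1 := hav 1
  simp only [recoilForm, Fin.sum_univ_two, Fin.sum_univ_three, add_re] at hA hgs f0 f1 f2 a0 a1 ⊢
  linear_combination f0 + f1 + f2 + hgs - a0 - a1 + 4 * √α * hA

end TrialEnergy

/-! ### The trial states and the upper bound -/

section UpperBound

variable {L : ℝ} {ε : Fin 2 → E3 → E3} {V : E3 → ℝ} [hV : RegularPotential V] {e₀ α : ℝ} [he₀ : Fact (0 < e₀)] {φ : L2x}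
  (hL : 0 < L) (hε : IsPolarization ε) (hφ : IsGroundState V φ e₀)

lemma couplingH_reflect (hε : IsPolarization ε) (j : Fin 3) (k : Photon) :
    couplingH L ε j (reflect k) = -(paritySign ε k.2 * couplingH L ε j k) := by
  by_cases hk : k.1 = 0
  · simp [couplingH, reflect, hk, cutoffFactor_zero]
  · simp only [couplingH, reflect, cutoffFactor_neg, hε.neg_eq k.2 hk, WithLp.ofLp_neg, WithLp.ofLp_smul,
      map_neg, map_smul, LinearMap.neg_apply, Pi.neg_apply, Pi.smul_apply, smul_eq_mul]
    push_cast; ring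

lemma entry_dress (i s : Fin 2) (k : Photon) :
    entry (dress L hε) i s k = ∑ j, dressFun L ε j k * pauli j i s := by
  have h : ∀ j, (pauliOp j (single s 1)) i = pauli j i s := fun j => by
    rw [← pauliAct_eq]
    simp [pauliAct]
  rw [entry, coe_dress]
  simp only [sum_apply, smul_apply, WithLp.ofLp_sum, Finset.sum_apply, PiLp.smul_apply, h, smul_eq_mul]

lemma norm_entry_dress_reflect (i s : Fin 2) (k : Photon) :
    ‖entry (dress L hε) i s (reflect k)‖ = ‖entry (dress L hε) i s k‖ := by
  have h : entry (dress L hε) i s (reflect k) = -(paritySign ε k.2 : ℂ) * entry (dress L hε) i s k := by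
    simp only [entry_dress, dressFun, recoilEnergy_reflect, couplingH_reflect hε, mul_sum]
    exact sum_congr rfl fun j _ => by ring
  rw [h, norm_mul, norm_neg, norm_real, norm_eq_abs, abs_paritySign, one_mul]

lemma entry_dress_trace (k : Photon) :
    entry (dress L hε) 0 0 k + entry (dress L hε) 1 1 k = 0 := by
  simp [entry_dress, Fin.sum_univ_three, pauli]

lemma sum_norm_entry_dress (s : Fin 2) (k : Photon) :
    ∑ i, ‖entry (dress L hε) i s k‖ ^ 2 = dressNorm L ε k ^ 2 := by
  have h := norm_dress (L := L) hε k (single s 1)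
  rw [norm_single, norm_one, mul_one] at h
  rw [← h, norm_sq_eq]
  rfl

lemma entry_couplB (i s : Fin 2) (k : Photon) :
    entry (couplB L hε) i s k = recoilEnergy k * entry (dress L hε) i s k := by
  rw [entry, coe_couplB]; rfl

lemma integrable_recoil_entry (hL : 0 < L) (hε : IsPolarization ε) (i s : Fin 2) :
    Integrable (fun k => recoilEnergy k * ‖entry (dress L hε) i s k‖ ^ 2) μₖ := by
  have m := measurable_entry (dress L hε) i s
  refine integrable_weight_sq measurable_recoilEnergy.aemeasurable m.aestronglyMeasurable ?_ ?_
  · have h := lintegral_recoil_coupling (e₀ := 0) hL m.aestronglyMeasurable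
      (exists_norm_entry_le (dress L hε) i s).choose_spec
    simpa only [add_zero] using h
  · simp [ofReal_of_nonpos (neg_nonpos.2 (recoilEnergy_nonneg _))]

lemma dress_energy (hL : 0 < L) (hε : IsPolarization ε) (s : Fin 2) :
    ∑ i, ∫ k, recoilEnergy k * ‖entry (dress L hε) i s k‖ ^ 2 ∂μₖ =
      dressField L ε + ∑ j, dressRecoil L ε j := by
  have e : (fun k => ∑ i, recoilEnergy k * ‖entry (dress L hε) i s k‖ ^ 2) =
      fun k => recoilEnergy k * dressNorm L ε k ^ 2 := funext fun k => by
    rw [← mul_sum, sum_norm_entry_dress]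
  have i0 : Integrable (fun k => recoilEnergy k * dressNorm L ε k ^ 2) μₖ := by
    rw [← e]; exact integrable_finsetSum _ fun i _ => integrable_recoil_entry hL hε i s
  have m : Measurable fun k => dressNorm L ε k ^ 2 := by
    simp only [← sum_norm_entry_dress hε s]
    exact Finset.measurable_fun_sum _ fun i _ => (measurable_entry _ i s).norm.pow_const 2
  have e1 : ∀ k, (invSqrt k * (photonEnergy k * dressNorm L ε k)) ^ 2 =
      photonEnergy k * dressNorm L ε k ^ 2 := fun k => by
    rw [mul_pow, invSqrt_sq, mul_pow]
    rcases eq_or_ne (photonEnergy k) 0 with h | h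
    · simp [h]
    · field_simp
  have e2 : ∀ j (k : Photon), (1 * (|k.1 j| * dressNorm L ε k)) ^ 2 = k.1 j ^ 2 * dressNorm L ε k ^ 2 :=
    fun j k => by rw [one_mul, mul_pow, sq_abs]
  have i1 : Integrable (fun k => photonEnergy k * dressNorm L ε k ^ 2) μₖ := by
    refine i0.mono' (measurable_photonEnergy.mul m).aestronglyMeasurable (of_forall fun k => ?_)
    rw [norm_of_nonneg (mul_nonneg (photonEnergy_nonneg k) (sq_nonneg _))]
    exact mul_le_mul_of_nonneg_right (le_add_of_nonneg_left (sq_nonneg _)) (sq_nonneg _)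
  have i2 : ∀ j, Integrable (fun k : Photon => k.1 j ^ 2 * dressNorm L ε k ^ 2) μₖ := fun j => by
    have mj : Measurable fun k : Photon => k.1 j :=
      (proj (𝕜 := ℝ) j : E3 →L[ℝ] ℝ).measurable.comp measurable_fst
    refine i0.mono' ((mj.pow_const 2).mul m).aestronglyMeasurable (of_forall fun k => ?_)
    rw [norm_of_nonneg (by positivity)]
    refine mul_le_mul_of_nonneg_right ?_ (sq_nonneg _)
    rw [recoilEnergy, ← sum_coord_sq]
    exact (single_le_sum (f := fun j => k.1 j ^ 2) (fun i _ => sq_nonneg _)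
      (mem_univ j)).trans (le_add_of_nonneg_right (norm_nonneg _))
  rw [← integral_finsetSum _ fun i _ => integrable_recoil_entry hL hε i s, e, dressField]
  simp only [dressRecoil, e1, e2]
  rw [← integral_finsetSum _ fun j _ => i2 j, ← integral_add i1 (integrable_finsetSum _ fun j _ => i2 j)]
  refine integral_congr_ae (of_forall fun k => ?_)
  simp only [recoilEnergy, photonEnergy, ← sum_mul, sum_coord_sq]
  ring

lemma lintegral_recoil_entry (hL : 0 < L) (t : couplings L) (i s : Fin 2) :
    ∫⁻ k, ofReal (recoilEnergy k + e₀) * ‖entry t i s k‖ₑ ^ 2 ∂μₖ ≠ ⊤ :=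
  lintegral_recoil_coupling hL (measurable_entry _ i s).aestronglyMeasurable
    (exists_norm_entry_le t i s).choose_spec

/-- The dressing photons attached to the electron ground state. -/
def dressPhoton (i s : Fin 2) : avSpace V e₀ :=
  ⟨tensLp _ (memLp_entry hL (dress L hε) i s) φ,
    tensLp_mem _ (lintegral_recoil_entry hL (dress L hε) i s) ⟨φ, hφ.mem⟩⟩

lemma coeFn_dressPhoton (i s : Fin 2) :
    (dressPhoton hL hε hφ i s : L2pair) =ᵐ[μₚ]
      fun z => entry (dress L hε) i s z.2 * φ z.1 :=
  coeFn_tensLp (memLp_entry hL (dress L hε) i s) φ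

lemma avVal_dressPhoton (i s : Fin 2) (j : Fin 3) :
    avVal V e₀ (dressPhoton hL hε hφ i s) (some j) =
      tensLp _ (memLp_entry hL (dress L hε) i s) (hφ.grad j) :=
  paramVal_tensLp (memLp_entry hL (dress L hε) i s) ⟨φ, hφ.mem⟩ _ j

lemma dressPhoton_trace :
    dressPhoton hL hε hφ 1 1 = -dressPhoton hL hε hφ 0 0 := by
  refine Subtype.ext (Lp.ext ?_)
  filter_upwards [coeFn_dressPhoton hL hε hφ 1 1, coeFn_dressPhoton hL hε hφ 0 0,
    Lp.coeFn_neg (dressPhoton hL hε hφ 0 0 : L2pair)] with z a b c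
  rw [a, Submodule.coe_neg, c, Pi.neg_apply, b]
  linear_combination (φ z.1) * entry_dress_trace hε z.2

lemma avForm_dressPhoton (v : avSpace V e₀) (i s : Fin 2) :
    avForm V e₀ v (dressPhoton hL hε hφ i s) =
      ⟪v.1, tensLp _ (memLp_entry hL (couplB L hε) i s) φ⟫ := by
  have h0 : tensLp (entry (dress L hε) i s) (memLp_entry hL (dress L hε) i s) (0 : L2x) = 0 := by
    refine Lp.ext ?_
    filter_upwards [coeFn_tensLp (memLp_entry hL (dress L hε) i s) (0 : L2x), coeFn_zero ℂ 2 μₚ,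
      quasiMeasurePreserving_fst.ae (coeFn_zero ℂ 2 (volume : Measure E3))] with z a b c
    rw [a, b, c]; simp
  have h1 : electronForm V e₀ v (dressPhoton hL hε hφ i s) = 0 :=
    (electronForm_tensLp (memLp_entry hL (dress L hε) i s)
      (lintegral_recoil_entry hL _ i s) (ψ := ⟨φ, hφ.mem⟩) (η := 0)
      (fun v => by rw [hφ.form_eq]; simp) v).trans (by rw [h0, inner_zero_right])
  rw [avForm_eq, h1, zero_add, L2.inner_def]
  refine integral_congr_ae ?_
  filter_upwards [coeFn_dressPhoton hL hε hφ i s,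
    coeFn_tensLp (memLp_entry hL (couplB L hε) i s) φ] with z a b
  rw [a, b, entry_couplB, RCLike.inner_apply, RCLike.inner_apply]
  ring

lemma inner_dressPhoton (i s : Fin 2) :
    ⟪(dressPhoton hL hε hφ i s : L2pair), tensLp _ (memLp_entry hL (couplB L hε) i s) φ⟫ =
      ((∫ k, recoilEnergy k * ‖entry (dress L hε) i s k‖ ^ 2 ∂μₖ : ℝ) : ℂ) := by
  have h1 : ∫ x, ‖φ x‖ ^ 2 = 1 := by rw [← norm_sq_eq_integral, hφ.1, one_pow]
  rw [← one_mul (∫ k, _ ∂μₖ), ← h1, ← integral_prod_mul, ← integral_complex_ofReal, L2.inner_def]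
  refine integral_congr_ae ?_
  filter_upwards [coeFn_dressPhoton hL hε hφ i s,
    coeFn_tensLp (memLp_entry hL (couplB L hε) i s) φ] with z a b
  rw [a, b, entry_couplB, mul_assoc, ← smul_eq_mul (recoilEnergy z.2 : ℂ), inner_smul_right, inner_self_re,
    norm_mul]
  push_cast; ring

lemma recoilForm_dressPhoton (i s : Fin 2) : recoilForm
    (dressPhoton hL hε hφ i s) (dressPhoton hL hε hφ i s) = 0 := by
  refine Finset.sum_eq_zero fun j _ => ?_
  rw [inner_smul_right, L2.inner_def]
  refine mul_eq_zero_of_right _ ?_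
  have h0 : ∫ k : Photon, (k.1 j : ℂ) * (‖entry (dress L hε) i s k‖ ^ 2 : ℝ) ∂μₖ = 0 := by
    refine self_eq_neg.1 ?_
    conv_lhs => rw [← measurePreserving_reflect.integral_comp' (f := ⟨⟨reflect, reflect, reflect_reflect,
      reflect_reflect⟩, measurable_reflect, measurable_reflect⟩)]
    rw [← integral_neg]
    refine integral_congr_ae (of_forall fun k => ?_)
    change (((-k.1 : E3) j : ℝ) : ℂ) * (‖entry (dress L hε) i s (reflect k)‖ ^ 2 : ℝ) = _
    rw [norm_entry_dress_reflect]; simp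
  have h2 := integral_prod_mul (μ := (volume : Measure E3)) (ν := μₖ)
    (fun x => ⟪hφ.grad j x, φ x⟫)
    (fun k => (k.1 j : ℂ) * (‖entry (dress L hε) i s k‖ ^ 2 : ℝ))
  rw [h0, mul_zero] at h2
  rw [← h2, avVal_dressPhoton]
  refine integral_congr_ae ?_
  filter_upwards [coeFn_momLp j (dressPhoton hL hε hφ i s),
    coeFn_dressPhoton hL hε hφ i s,
    coeFn_tensLp (memLp_entry hL (dress L hε) i s) (hφ.grad j)] with z a b c
  rw [a, b, c, inner_smul_right, ← smul_eq_mul (entry (dress L hε) i s z.2),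
    ← smul_eq_mul (entry (dress L hε) i s z.2), inner_smul_left, inner_smul_right, ← Complex.normSq_eq_norm_sq,
    ← Complex.mul_conj]
  ring

lemma recoilForm_solution {χ : avSpace V e₀}
    (hχ : FormOp (avSpace V e₀ : Set L2pair) (avForm V e₀) χ (dStarLp hL hε hφ)) :
    recoilForm χ χ = 0 := by
  have h := reflLp_solution hL hε hφ hχ
  refine Finset.sum_eq_zero fun j _ => ?_
  rw [inner_smul_right, L2.inner_def]
  refine mul_eq_zero_of_right _ ?_
  rw [← integral_momentum_inner (reflLp_avVal χ h j) h j]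
  refine integral_congr_ae ?_
  filter_upwards [coeFn_momLp j χ] with z a
  rw [a, inner_smul_right]

lemma recoilForm_add_add_sub (v u : avSpace V e₀) :
    recoilForm (v + u) (v + u) + recoilForm (v - u) (v - u) =
      2 * (recoilForm v v + recoilForm u u) := by
  simp only [recoilForm, map_add, map_sub, Pi.add_apply, Pi.sub_apply, smul_add, smul_sub, inner_add_left,
    inner_add_right, inner_sub_left, inner_sub_right, sum_add_distrib, sum_sub_distrib]
  ring

lemma recoilForm_smul (r : ℝ) (v : avSpace V e₀) :
    recoilForm ((r : ℂ) • v) ((r : ℂ) • v) = (r ^ 2 : ℝ) * recoilForm v v := by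
  simp only [recoilForm, map_smul, Pi.smul_apply, inner_smul_left, inner_smul_right, mul_sum,
    conj_ofReal]
  refine sum_congr rfl fun j _ => ?_
  push_cast; ring

/-- The one-photon component of the trial state, up to the factor `-√α`. -/
def photonPart (χ : avSpace V e₀) (s i : Fin 2) : avSpace V e₀ :=
  (if i = s then (2 : ℂ) else 0) • χ + dressPhoton hL hε hφ i s

lemma recoilForm_photonPart {χ : avSpace V e₀}
    (hχ : FormOp (avSpace V e₀ : Set L2pair) (avForm V e₀) χ (dStarLp hL hε hφ)) :
    ∑ s, ∑ i, recoilForm (photonPart hL hε hφ χ s i)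
      (photonPart hL hε hφ χ s i) = 0 := by
  have h := recoilForm_add_add_sub ((2 : ℂ) • χ) (dressPhoton hL hε hφ 0 0)
  have h2 := recoilForm_smul 2 χ
  rw [recoilForm_solution hL hε hφ hχ, mul_zero] at h2
  push_cast at h2
  rw [h2, recoilForm_dressPhoton hL hε hφ] at h
  simp only [Fin.sum_univ_two, photonPart, dressPhoton_trace hL hε hφ, zero_ne_one, one_ne_zero,
    if_true, if_false, zero_smul, zero_add, recoilForm_dressPhoton hL hε hφ,
    ← sub_eq_add_neg, add_zero]
  simpa using h

lemma avForm_photonPart {χ : avSpace V e₀}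
    (hχ : FormOp (avSpace V e₀ : Set L2pair) (avForm V e₀) χ (dStarLp hL hε hφ)) (v : avSpace V e₀)
    (s i : Fin 2) : avForm V e₀ v (photonPart hL hε hφ χ s i) =
      (if i = s then (2 : ℂ) else 0) * ⟪v.1, dStarLp hL hε hφ⟫ +
        ⟪v.1, tensLp _ (memLp_entry hL (couplB L hε) i s) φ⟫ := by
  have h := closedForm_av (V := V) (e₀ := e₀)
  rw [photonPart, coe_add, coe_smul, h.add_right v v.2 _ (Submodule.smul_mem _ _ χ.2) _
    (Subtype.prop _), h.smul_right v v.2 _ χ.2, hχ.2 v v.2, avForm_dressPhoton]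

lemma sum_inner_dStar (χ : avSpace V e₀) :
    ∑ s, ⟪(photonPart hL hε hφ χ s s : L2pair), dStarLp hL hε hφ⟫ =
      4 * ⟪χ.1, dStarLp hL hε hφ⟫ := by
  simp only [Fin.sum_univ_two, photonPart, dressPhoton_trace hL hε hφ, if_true,
    coe_add, coe_smul, Submodule.coe_neg, inner_add_left, inner_neg_left,
    inner_smul_left, map_ofNat]
  ring

lemma sum_inner_couplB (χ : avSpace V e₀) :
    ∑ s, ∑ i, ⟪(photonPart hL hε hφ χ s i : L2pair), tensLp _ (memLp_entry hL (couplB L hε) i s) φ⟫ =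
      2 * ((dressField L ε + ∑ j, dressRecoil L ε j : ℝ) : ℂ) := by
  have h0 := congrArg (fun r : ℝ => (r : ℂ)) (dress_energy hL hε 0)
  have h1 := congrArg (fun r : ℝ => (r : ℂ)) (dress_energy hL hε 1)
  have h2 : ⟪χ.1, tensLp _ (memLp_entry hL (couplB L hε) 0 0) φ⟫ +
      ⟪χ.1, tensLp _ (memLp_entry hL (couplB L hε) 1 1) φ⟫ = 0 := by
    have h := closedForm_av (V := V) (e₀ := e₀)
    rw [← avForm_dressPhoton hL hε hφ, ← avForm_dressPhoton hL hε hφ,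
      dressPhoton_trace, ← neg_one_smul ℂ, coe_smul, h.smul_right χ χ.2 _ (Subtype.prop _)]
    ring
  simp only [Fin.sum_univ_two, Complex.ofReal_add] at h0 h1
  simp only [Fin.sum_univ_two, photonPart, zero_ne_one, one_ne_zero, if_true, if_false, map_zero,
    coe_add, coe_smul, inner_add_left, inner_smul_left, map_ofNat,
    inner_dressPhoton hL hε hφ]
  push_cast at h0 h1 ⊢
  linear_combination h0 + h1 + 2 * h2

lemma upper_aux {E N₀ N₁ α b c d n₀ n₁ K e : ℝ} (h0 : 0 ≤ α) (hN₀ : N₀ = 1 + α * n₀) (hN₁ : N₁ = 1 + α * n₁)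
    (hn₀ : 0 ≤ n₀) (hn₁ : 0 ≤ n₁) (h : (E + e) * (N₀ + N₁) ≤ 2 * α * b + α ^ 2 * K) (hb : b = c - d) :
    E ≤ -e + α * (c - d) + (|K| + |b| * (n₀ + n₁)) * α ^ 2 := by
  rw [← hb]
  by_contra hc
  rw [not_le] at hc
  have h1 : 0 ≤ (|K| + |b| * (n₀ + n₁)) * α ^ 2 := by positivity
  have h2 : α * b + (|K| + |b| * (n₀ + n₁)) * α ^ 2 < E + e := by linarith
  have h3 : 2 ≤ N₀ + N₁ := by rw [hN₀, hN₁]; nlinarith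
  have h4 : (α * b + (|K| + |b| * (n₀ + n₁)) * α ^ 2) * (N₀ + N₁) < 2 * α * b + α ^ 2 * K :=
    (mul_lt_mul_of_pos_right h2 (by linarith)).trans_le h
  have h5 : 2 * ((|K| + |b| * (n₀ + n₁)) * α ^ 2) ≤ (|K| + |b| * (n₀ + n₁)) * α ^ 2 * (N₀ + N₁) := by
    nlinarith
  have h6 : α * b * (N₀ + N₁) = 2 * α * b + α ^ 2 * (b * (n₀ + n₁)) := by rw [hN₀, hN₁]; ring
  have h7 : -(|b| * (n₀ + n₁)) ≤ b * (n₀ + n₁) := by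
    rw [← neg_mul]; exact mul_le_mul_of_nonneg_right (neg_abs_le b) (by positivity)
  have h8 := mul_le_mul_of_nonneg_left h7 (sq_nonneg α)
  have h9 := mul_le_mul_of_nonneg_left (le_abs_self K) (sq_nonneg α)
  have h10 := mul_nonneg (sq_nonneg α) (abs_nonneg K)
  have h11 : 0 ≤ α ^ 2 * (|b| * (n₀ + n₁)) := by positivity
  nlinarith

end UpperBound

section Conclusion

variable {L : ℝ} {ε : Fin 2 → E3 → E3} {V : E3 → ℝ} [hV : RegularPotential V] {e₀ : ℝ} [he₀ : Fact (0 < e₀)] {φ : L2x}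
  (hL : 0 < L) (hε : IsPolarization ε) (hφ : IsGroundState V φ e₀)

lemma avForm_real_smul (r : ℝ)
    (v : avSpace V e₀) : (avForm V e₀ ((r : ℂ) • v.1) ((r : ℂ) • v.1)).re =
      r ^ 2 * (avForm V e₀ v v).re := by
  have h := closedForm_av (V := V) (e₀ := e₀)
  have hm := Submodule.smul_mem _ (r : ℂ) v.2
  rw [h.smul_right _ hm _ v.2, h.smul_left v.2 v.2, conj_ofReal, ← mul_assoc,
    ← Complex.ofReal_mul, re_ofReal_mul, sq]

lemma norm_trialState_sq (s : Fin 2) (η : Fin 2 → avSpace V e₀) :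
    ‖trialState s ⟨φ, hφ.mem⟩ η‖ ^ 2 = 1 + ∑ i, ‖(η i).1‖ ^ 2 := by
  have h : ‖trialState s ⟨φ, hφ.mem⟩ η‖ = ‖trial s φ fun i => η i‖ := rfl
  rw [h, norm_trial_sq, hφ.1, one_pow]

/-- Averaged over the spin, the trial states have the asserted energy up to `O(α²)`. -/
lemma sum_form_le {χ : avSpace V e₀}
    (hχ : FormOp (avSpace V e₀ : Set L2pair) (avForm V e₀) χ (dStarLp hL hε hφ)) :
    ∃ n : Fin 2 → ℝ, ∃ K : ℝ, (∀ s, 0 ≤ n s) ∧ ∀ α, 0 ≤ α → ∃ u : Fin 2 → pfSpace V,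
      (∀ s, ‖u s‖ ^ 2 = 1 + α * n s) ∧
      ∑ s, ((pauliFierzForm L ε V α (u s).1 (u s).1).re + e₀ * ‖u s‖ ^ 2) ≤
        2 * α * (selfEnergyCoeff L ε - 4 * ⟪χ.1, dStarLp hL hε hφ⟫.re) +
          α ^ 2 * K := by
  obtain ⟨C, hC, h⟩ := form_trialState_le hL hε hφ
  obtain ⟨ζ, hζ⟩ : ∃ ζ, ζ = photonPart hL hε hφ χ := ⟨_, rfl⟩
  have hr := congrArg Complex.re (recoilForm_photonPart hL hε hφ hχ)
  have hF := congrArg Complex.re (sum_inner_dStar hL hε hφ χ)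
  have hB := congrArg Complex.re (sum_inner_couplB hL hε hφ χ)
  have ha : ∀ s i, (avForm V e₀ (ζ s i) (ζ s i)).re =
      (if i = s then 2 else 0) * ⟪(ζ s i).1, dStarLp hL hε hφ⟫.re +
        ⟪(ζ s i).1, tensLp _ (memLp_entry hL (couplB L hε) i s) φ⟫.re := fun s i => by
    have h1 := congrArg Complex.re (avForm_photonPart hL hε hφ hχ (ζ s i) s i)
    rw [← hζ] at h1
    rw [h1]
    split_ifs <;> simp
  rw [← hζ] at hr hF hB
  refine ⟨fun s => ∑ i, ‖(ζ s i).1‖ ^ 2, ∑ s, ∑ i, (C * (avForm V e₀ (ζ s i) (ζ s i)).re +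
    (∑ j, fieldVar L ε j) * ‖(ζ s i).1‖ ^ 2), fun s => sum_nonneg fun i _ => sq_nonneg _,
    fun α hα => ⟨fun s => trialState s ⟨φ, hφ.mem⟩ fun i =>
      ((-√α : ℝ) : ℂ) • ζ s i, fun s => ?_, ?_⟩⟩
  · rw [norm_trialState_sq hφ, mul_sum]
    congr 1
    refine sum_congr rfl fun i _ => ?_
    rw [coe_smul, norm_smul, norm_real, mul_pow, norm_eq_abs, sq_abs, neg_sq,
      sq_sqrt hα]
  · have hs := fun s => h α s (fun i => ((-√α : ℝ) : ℂ) • ζ s i) hα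
    simp only [coe_smul, avForm_real_smul, recoilForm_smul, neg_sq, sq_sqrt hα,
      inner_smul_left, conj_ofReal, re_ofReal_mul, norm_smul, norm_real, mul_pow,
      norm_eq_abs, sq_abs, ha] at hs
    have e1 : ∀ x, √α * (√α * x) = α * x := fun x => by
      rw [← mul_assoc, mul_self_sqrt hα]
    have h0 := hs 0
    have h1 := hs 1
    have e2 : (4 * ⟪χ.1, dStarLp hL hε hφ⟫ : ℂ).re =
      4 * ⟪χ.1, dStarLp hL hε hφ⟫.re := by simp
    rw [← Complex.ofReal_ofNat, re_ofReal_mul, ofReal_re] at hB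
    rw [selfEnergyCoeff, sum_sub_distrib]
    simp only [Fin.sum_univ_two, add_re, zero_re, e2, neg_mul, mul_neg, mul_add, mul_assoc, e1, ha,
      zero_ne_one, one_ne_zero, if_true, if_false] at h0 h1 hr hF hB ⊢
    linear_combination h0 + h1 + 2 * α * hr - 2 * α * hF - α * hB

lemma inner_tensLp {Y : Type*} [MeasurableSpace Y] {ν : Measure Y} [SFinite ν] {g h : Y → ℂ}
    (hg : MemLp g 2 ν) (hh : MemLp h 2 ν) (ψ η : L2x) :
    ⟪tensLp g hg ψ, tensLp h hh η⟫ = (∫ y, ⟪g y, h y⟫ ∂ν) * ⟪ψ, η⟫ := by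
  rw [L2.inner_def, L2.inner_def, mul_comm, ← integral_prod_mul]
  refine integral_congr_ae ?_
  filter_upwards [coeFn_tensLp hg ψ, coeFn_tensLp hh η] with z a b
  simp only [a, b, RCLike.inner_apply, map_mul]
  ring

/-- The energy `4⟨F, χ⟩` is positive. -/
lemma re_inner_dStar_pos (hVd : Dense (schrodingerDomain V))
    (hV2 : Tendsto (fun x => max (-(V x)) 0) (cocompact E3) (𝓝 0))
    (hφ : IsGroundState V φ e₀) {χ : avSpace V e₀}
    (hχ : FormOp (avSpace V e₀ : Set L2pair) (avForm V e₀) χ (dStarLp hL hε hφ)) :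
    0 < ⟪χ.1, dStarLp hL hε hφ⟫.re := by
  rw [← hχ.2 χ χ.2]
  refine lt_of_le_of_ne (avForm_nonneg hφ χ χ.2) fun h0 => ?_
  have hz := eq_zero_of_avForm hφ χ h0.symm
  have hv : ∀ v : avSpace V e₀, ⟪v.1, dStarLp hL hε hφ⟫ = 0 := fun v => by
    have h1 := closedForm_av.smul_right v v.2 χ χ.2 0
    rw [← hχ.2 v v.2, hz]
    rwa [hz, smul_zero, zero_mul] at h1
  refine grad_ne_zero hV2 hφ 0 (hVd.eq_zero_of_inner_right (𝕜 := ℂ) fun ψ hψ => ?_)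
  rw [← coe_opDomain_schrodinger] at hψ
  obtain ⟨c, hc⟩ : ∃ c : Fin 3 → ℂ, ∀ j, c j =
    ⟪ψ, (-I) • hφ.grad j⟫ := ⟨_, fun _ => rfl⟩
  have hg : MemLp (fun k => ∑ j, couplingG L ε j k * c j) 2 μₖ :=
    memLp_finsetSum _ fun j _ => (memLp_couplingG hL hε j).mul_const (c j)
  have hm := tensLp_mem (m := fun k => recoilEnergy k + e₀) hg
    (lintegral_recoil_coupling hL hg.1 (K := ∑ j, ‖c j‖) fun k => by
      rw [sum_mul]
      refine (norm_sum_le _ _).trans (sum_le_sum fun j _ => ?_)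
      rw [norm_mul, mul_comm]
      exact mul_le_mul_of_nonneg_left (norm_couplingG_le hε j k) (norm_nonneg _)) ⟨ψ, hψ⟩
  have h1 := hv ⟨_, hm⟩
  have hint : ∀ j, Integrable (fun k => ⟪(∑ j, couplingG L ε j k * c j), couplingG L ε j k * c j⟫ :
      Photon → ℂ) μₖ := fun j =>
    integrable_inner_of_memLp hg ((memLp_couplingG hL hε j).mul_const (c j))
  simp only [dStarLp, inner_sum, inner_tensLp, ← hc, ← integral_mul_const] at h1
  have e : ∀ j k, ⟪(∑ j, couplingG L ε j k * c j), couplingG L ε j k⟫ * c j =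
      ⟪(∑ j, couplingG L ε j k * c j), couplingG L ε j k * c j⟫ := fun j k => by
    simp only [RCLike.inner_apply]; ring
  simp only [e] at h1
  rw [← integral_finsetSum _ fun j _ => hint j] at h1
  simp only [← inner_sum] at h1
  have h2 : (MemLp.toLp _ hg) = 0 := by
    rw [← inner_self_eq_zero (𝕜 := ℂ), L2.inner_def, ← h1]
    refine integral_congr_ae ?_
    filter_upwards [hg.coeFn_toLp] with k hk
    rw [hk]
  have h3 := congrFun (eq_zero_of_ae_couplingG hL hε (a := c) ?_) 0
  · rw [hc, inner_smul_right] at h3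
    exact (mul_eq_zero.1 h3).resolve_left (by simp)
  · have h4 := hg.coeFn_toLp
    rw [h2] at h4
    filter_upwards [h4, coeFn_zero ℂ 2 μₖ] with k a b
    rw [← a, b]; rfl

lemma final_aux {E S c d A B α e : ℝ} (hE : E ≤ -e + α * (c - d) + A * α ^ 2)
    (hS : α * c - B * α ^ 2 ≤ S) : E - S ≤ -e - α * d + (A + B) * α ^ 2 := by linarith

lemma energy_bounds {χ : avSpace V e₀}
    (hχ : FormOp (avSpace V e₀ : Set L2pair) (avForm V e₀) χ (dStarLp hL hε hφ)) :
    ∃ C α₀ : ℝ, 0 < α₀ ∧ ∀ α : ℝ, 0 < α → α ≤ α₀ → groundEnergy L ε V α - selfEnergy L ε α ≤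
      -e₀ - α * (4 * ⟪χ.1, dStarLp hL hε hφ⟫.re) + C * α ^ 2 := by
  obtain ⟨n, K, hn, h⟩ := sum_form_le hL hε hφ hχ
  obtain ⟨u₀, hu₀, -⟩ := h 0 le_rfl
  have hne : ((u₀ 0).1 : stateSpace) ≠ 0 := fun h0 => by
    have h1 := hu₀ 0
    have h2 : ‖u₀ 0‖ = ‖(u₀ 0).1‖ := rfl
    rw [h2, h0, norm_zero] at h1
    norm_num at h1
  have hm : (u₀ 0).1 ∈ pfSpace 0 := by
    have h1 := mem_pfSpace.1 (u₀ 0).2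
    exact mem_pfSpace.2 ⟨h1.1, h1.2.1, by simp⟩
  obtain ⟨α₁, h1, h1', hs1⟩ := groundEnergy_spec L hε ⟨_, (u₀ 0).2, hne⟩
  obtain ⟨α₂, h2, h2', hs2⟩ := groundEnergy_spec L hε ⟨_, hm, hne⟩
  obtain ⟨C, hC, hlow⟩ := form_ge (L := L) hε
  refine ⟨(|K| + |selfEnergyCoeff L ε - 4 * ⟪χ.1, dStarLp hL hε hφ⟫.re| *
    (n 0 + n 1)) + C * (C + 1), min (min α₁ α₂) (1 / (4 * (C + 1))), by positivity, fun α hα hle => ?_⟩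
  rw [le_min_iff, le_min_iff] at hle
  have hαC : α * C ≤ 1 / 4 := by
    have h3 := hle.2
    rw [le_div_iff₀ (by positivity)] at h3
    linarith
  obtain ⟨u, hu, hsum⟩ := h α hα.le
  have hup := upper_aux (E := groundEnergy L ε V α) (K := K) (e := e₀)
    (c := selfEnergyCoeff L ε) (d := 4 * ⟪χ.1, dStarLp hL hε hφ⟫.re) hα.le (hu 0) (hu 1) (hn 0) (hn 1) (by
    have b0 := (hs1 α hα hle.1.1).1 (u 0)
    have b1 := (hs1 α hα hle.1.1).1 (u 1)
    rw [Fin.sum_univ_two] at hsum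
    rw [mul_add, add_mul, add_mul]
    linarith) rfl
  exact final_aux hup ((hs2 α hα hle.1.2).2 _ (hlow α hα (hle.1.1.trans h1') hαC))

end Conclusion

end PauliFierz

end

theorem theorem2
    (L : ℝ) (hL : 0 < L)
    (ε : Fin 2 → E3 → E3) (hε : IsPolarization ε)
    (V : E3 → ℝ) (hVmeas : Measurable V)
    (hVdense : Dense (schrodingerDomain V))
    (hV1 : NegPartFormBounded V)
    (hV2 : Filter.Tendsto (fun x => max (-(V x)) 0) (Filter.cocompact E3) (nhds 0))
    (φ : L2x) (e₀ : ℝ) (he₀ : 0 < e₀) (hφ : IsGroundState V φ e₀) :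
    ∃ (F χ : L2pair) (E : ℝ),
      F =ᵐ[pairMeasure] dStarP L ε φ ∧
      (∀ u : L2pair, FormOp (avDomain V) (avForm V e₀) u F ↔ u = χ) ∧
      (E : ℂ) = 4 * inner ℂ F χ ∧
      0 < E ∧
      (∃ C α₀ : ℝ, 0 < α₀ ∧ ∀ α : ℝ, 0 < α → α ≤ α₀ →
        groundEnergy L ε V α - selfEnergy L ε α ≤ -e₀ - α * E + C * α ^ 2) ∧
      (∃ ρ : ℝ, 0 < ρ ∧ ∀ α : ℝ, 0 < α → α ≤ ρ →
        groundEnergy L ε V α - selfEnergy L ε α < -e₀) := by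
  have : RegularPotential V := ⟨hVmeas, hV1⟩
  have : Fact (0 < e₀) := ⟨he₀⟩
  obtain ⟨χ, hχ⟩ := exists_formOp_dStar hL hε hV2 hφ
  have hpos := re_inner_dStar_pos hL hε hVdense hV2 hφ (χ := ⟨χ, hχ.1⟩) hχ
  obtain ⟨C, α₀, hα₀, h⟩ := energy_bounds hL hε hφ (χ := ⟨χ, hχ.1⟩) hχ
  refine ⟨dStarLp hL hε hφ, χ, 4 * (inner ℂ χ (dStarLp hL hε hφ) : ℂ).re,
    dStarLp_ae_eq hL hε hφ, fun u => ?_, ?_, by linarith, ⟨C, α₀, hα₀, h⟩, ?_⟩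
  · rw [← coe_avSpace (e₀ := e₀)]
    exact ⟨fun hu => formOp_av_unique hφ hu hχ, fun hu => hu ▸ hχ⟩
  · have h1 := (closedForm_av (e₀ := e₀)).symm χ hχ.1 χ hχ.1
    rw [hχ.2 χ hχ.1, inner_conj_symm] at h1
    have h2 := (inner_conj_symm (dStarLp hL hε hφ) χ).trans h1
    rw [h1, Complex.ofReal_mul, Complex.conj_eq_iff_re.1 h2, Complex.ofReal_ofNat]
  · obtain ⟨E, hE⟩ : ∃ E, E = 4 * (inner ℂ χ (dStarLp hL hε hφ) : ℂ).re := ⟨_, rfl⟩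
    have hE0 : 0 < E := by linarith
    refine ⟨min α₀ (E / (2 * (|C| + 1))), by positivity, fun α hα hle => ?_⟩
    have h1 := h α hα (hle.trans (min_le_left _ _))
    have h2 := hle.trans (min_le_right _ _)
    rw [le_div_iff₀ (by positivity)] at h2
    have h3 : C * α ^ 2 ≤ α * (α * |C|) := by
      rw [sq, mul_comm C, mul_assoc]
      gcongr
      exact le_abs_self C
    have h4 : α * (α * |C|) < α * E := by
      gcongr
      nlinarith [mul_nonneg hα.le (abs_nonneg C)]
    change _ ≤ -e₀ - α * (4 * (inner ℂ χ (dStarLp hL hε hφ) : ℂ).re) + C * α ^ 2 at h1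
    rw [← hE] at h1
    linarith
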